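/- **Conventions.** $\mathrm{PGL}_2(\mathbb Q)$ acts on $\hat{\mathbb C}=\mathbb C\cup\{\infty\}$ by Möbius transformations, $h$ is the absolute logarithmic Weil height on $\mathbb P^1(\overline{\mathbb Q})$ (so $h(\infty)=h(0)=0$), and for a finite group $G\le \mathrm{PGL}_2(\mathbb Q)$ we put $h_G(\alpha)=\sum_{\tau\in G}h(\tau\alpha)$. Let $\mathcal O$ be the set of $G$-orbits in $\hat{\mathbb C}$ all of whose non-zero elements lie on the unit circle. For an orbit $O\in\mathcal O$ of algebraic numbers let $f$ be the minimal polynomial over $\mathbb Q$ of an element of $O$ and $\phi_O(z)=\frac1E\prod_{\tau\in G}f(\tau z)$, where the constant $E$ is such that $\phi_O$ is a quotient of two coprime primitive integer polynomials. Write $\omega_{s,t}=\frac s2+\frac t2 i\sqrt3$ for $s,t\in\{1,-1\}$, $\log^+x=\log\max(x,1)$. A maximal root of a polynomial is a root of maximal absolute value with non-negative imaginary part. For $G=\langle\sigma\rangle$, orbits $O_1,\dots,O_k$ and reals $B_1,\dots,B_k$, let $\mathrm{Ineq}(O_j;B_j;D)$ be the statement $$\sum_{i=0}^{\mathrm{ord}\,\sigma-1}\log^+|\sigma^i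 z|-\sum_{j}B_j\log|\phi_{O_j}(z)|\ \ge\ D$$ for all $z\in\mathbb C$ whose $G$-orbit does not contain $\infty$ and with $\phi_{O_j}(z)\ne0$ for all $j$. Call a positive $D$ *optimal* for $\sigma$ if it is the largest positive real number such that $h_G(\alpha)=0$ or $h_G(\alpha)\ge D$ for all $\alpha\in\overline{\mathbb Q}$. **Theorem.** Let $s\in\{1,-1\}$, and let $p,q$ be coprime integers with $q>0$. In each of the cases below (in which $\det\sigma\ne0$ is assumed) $\sigma$ has the stated order, $\mathcal O$ is finite and contains the listed orbits, and, for the stated $B$'s and $D$, $\mathrm{Ineq}$ holds. In all cases except (9), $h_G(\alpha)=0$ or $h_G(\alpha)\ge D$ for all $\alpha\in\overline{\mathbb Q}$, and for the stated $\alpha$ (under the stated condition) one has $h_G(\alpha)=D$; so if in addition $D>0$, then $D$ is optimal for $\sigma$. 1. $\sigma=\begin{pmatrix}1&0\\p/q&-1\end{pmatrix}$, $p\ne0$: order $2$, orbit $\{0\}$, $B=1$, $e^D=\max(||p|-q|,|q|)$, $\alpha=1$ if $p>0$, $\alpha=-1$ if $p<0$. 2. $\sigma=\begin{pmatrix}1&s\\p/q&-1\end{pmatrix}$: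 order $2$, orbit $\{0,-s\}$, $B=1$, $e^D=\max(|p-sq|/2,|q|)$, $\alpha=s$ if $2\mid p-sq$. 3. $\sigma=\begin{pmatrix}1&p/q\\p/q+2s&-1\end{pmatrix}$: order $2$, orbit $\{s\}$, $B=1$, $e^D=\max(|p+3sq|/4,|p-sq|/4)$, $\alpha=-s$ if $4\mid p-sq$. 4. $\sigma=\begin{pmatrix}1&-1\\3&1\end{pmatrix}$: order $3$, orbit $\{0,-1,1\}$, $B=1$, $e^D=5$, $\alpha=i$. 5. $\sigma=\begin{pmatrix}1&p/q\\p/q&-1\end{pmatrix}$, $p\ne0$: order $2$, orbit $\{i,-i\}$, $B=\frac12$, $e^D=||p|+q|/2$, both $\alpha=1$ and $\alpha=-1$ if $2\mid p+q$. 6. $\sigma=\begin{pmatrix}1&1\\-1&1\end{pmatrix}$: order $4$, orbits $\{i\}$, $\{-i\}$ ($\mathrm{Ineq}$ for each orbit separately), some $B\in[0.19408,0.19409)$, $e^D=|\alpha|>1$ with $\alpha$ the unique maximal root of $(z^2+1)^4+z^2(z^2-1)^2$. 7. $\sigma=\begin{pmatrix}1&p/q\\p/q+s&-1\end{pmatrix}$,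 $p/q\ne-s/2$: order $2$, orbit $\{\omega_{s,1},\omega_{s,-1}\}$, $B=\frac12$, $e^D=\max(|p+2sq|/3,|p-sq|/3)$, $\alpha=-s$ if $3\mid p-sq$. 8. $\sigma=\begin{pmatrix}0&1\\-1&s\end{pmatrix}$: order $3$, orbits $\{\omega_{s,1}\}$, $\{\omega_{s,-1}\}$ ($\mathrm{Ineq}$ for each separately), some $B\in[0.11724,0.11725)$, $e^D=|\alpha|>1$ with $\alpha$ the unique maximal root of $(z^2-sz+1)^3-(z^2-sz)^2$. 9. $\sigma=\begin{pmatrix}2&-s\\s&1\end{pmatrix}$: order $6$, orbits $\{\omega_{s,1}\}$, $\{\omega_{s,-1}\}$ ($\mathrm{Ineq}$ for each separately), some $B\in[0.30503,0.30504)$, $e^D=\left|\frac{\alpha(2\alpha-s)}{\alpha+s}\right|$ with $\alpha$ the unique maximal root of $(z^2-sz+1)^6+z^2(2z^2-5sz+2)^2(z^2-1)^2$. Here $D>\log4$; $h_G(\beta)=0$ or $h_G(\beta)\ge D$ for all $\beta\in\overline{\mathbb Q}$ whose orbit does not contain $\infty$, with equality $h_G(\alpha)=D$, so that $D$ is the largest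 constant with this property. Every point of the orbit $\{\infty,2s,s,s/2,0,-s\}$ of $\infty$ has $h_G=\log4$, so that the optimal constant for all of $\overline{\mathbb Q}$ is $\log 4$. The following groups of order $2$ have two listed orbits; here $\mathrm{Ineq}$ is the inequality with both orbits and $(B_1,B_2)$, and $D>0$. 10. $\sigma=\begin{pmatrix}1&0\\s&-1\end{pmatrix}$: orbits $\{0\}$, $\{\omega_{s,1},\omega_{s,-1}\}$, $B_1=\frac12$, $B_2=\frac1{4\sqrt5}$, $e^D=\sqrt{\frac{1+\sqrt5}2}$, $\alpha=-s\,e^{2\pi i/5}$. 11. $\sigma=\begin{pmatrix}1&0\\2s&-1\end{pmatrix}$: orbits $\{0\}$, $\{s\}$, $B_1=\frac23$, $B_2=\frac13$, $e^D=\sqrt3$, $\alpha=\omega_{s,1}$. 12. $\sigma=\begin{pmatrix}1&-s\\0&-1\end{pmatrix}$: orbits $\{0,s\}$, $\{\omega_{s,1},\omega_{s,-1}\}$, $B_1=\frac{\sqrt5-1}{2\sqrt5}$, $B_2=\frac1{4\sqrt5}$, $e^D=\sqrt{\frac{1+\sqrt5}2}$, $\alpha=s\,e^{\pi i/5}$.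 -/

import Mathlib

open scoped MatrixGroups OnePoint

noncomputable section

namespace OrbitHeight

/-- The Möbius action of `PGL(2, ℂ)` on the Riemann sphere `ℂ ∪ {∞}`. -/
instance actionComplex : MulAction PGL(2, ℂ) (OnePoint ℂ) :=
  Matrix.ProjGenLinGroup.mulActionOfGL fun u a => by
    have hu : (u : ℂ) ≠ 0 := u.ne_zero
    cases a with
    | infty => simp [OnePoint.smul_infty_eq_ite, Matrix.scalar_apply]
    | coe z => simp [OnePoint.smul_some_eq_ite, Matrix.scalar_apply, hu]

/-- The Möbius action of `PGL(2, ℚ)` on the Riemann sphere. -/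
instance actionRat : MulAction PGL(2, ℚ) (OnePoint ℂ) :=
  MulAction.compHom (OnePoint ℂ)
    (Matrix.ProjGenLinGroup.map (n := Fin 2) (algebraMap ℚ ℂ))

/-- The class in `PGL(2, ℚ)` of the matrix with rows `(a, b)` and `(c, d)`. -/
def moebius (a b c d : ℚ) (h : a * d - b * c ≠ 0) : PGL(2, ℚ) :=
  Matrix.ProjGenLinGroup.mk
    (Matrix.GeneralLinearGroup.mkOfDetNeZero !![a, b; c, d]
      (by rwa [Matrix.det_fin_two_of]))

/-- Sanity check: `moebius a b c d` is the map `z ↦ (a z + b) / (c z + d)`. -/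
theorem moebius_smul_coe (a b c d : ℚ) (h : a * d - b * c ≠ 0) (z : ℂ) :
    moebius a b c d h • (z : OnePoint ℂ) =
      if (c : ℂ) * z + d = 0 then ∞ else (((a * z + b) / (c * z + d) : ℂ) : OnePoint ℂ) := by
  change (Matrix.GeneralLinearGroup.map (algebraMap ℚ ℂ)
    (Matrix.GeneralLinearGroup.mkOfDetNeZero !![a, b; c, d] _)) • (z : OnePoint ℂ) = _
  rw [OnePoint.smul_some_eq_ite]
  simp [Matrix.GeneralLinearGroup.mkOfDetNeZero]

/-- The complex number underlying a finite point of the sphere (`∞` gets the unused value `0`). -/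
def affine (x : OnePoint ℂ) : ℂ := x.elim 0 id

/-- The absolute logarithmic Weil height on `ℙ¹` of the algebraic numbers:
`h([z : 1]) = h(z)` and `h(∞) = h([1 : 0]) = 0`. -/
def weilHeight (x : OnePoint ℂ) : ℝ := x.elim 0 NumberField.absLogHeight₁

/-- The `G`-orbit height, for a finite subgroup `G` of `PGL(2, ℚ)`. -/
def orbitHeight (G : Subgroup PGL(2, ℚ)) (x : OnePoint ℂ) : ℝ :=
  ∑ᶠ σ : G, weilHeight (σ • x)

/-- The set of all `G`-orbits on the sphere all of whose non-zero elements lie on the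
unit circle. -/
def unitOrbits (G : Subgroup PGL(2, ℚ)) : Set (Set (OnePoint ℂ)) :=
  {O | (∃ x : OnePoint ℂ, O = MulAction.orbit G x) ∧
    ∀ x ∈ O, ∃ z : ℂ, x = (z : OnePoint ℂ) ∧ (z = 0 ∨ ‖z‖ = 1)}

/-- `φ = N / M` is the normalised rational function attached to the orbit `O`: the fraction
`N / M` of primitive coprime integer polynomials is in lowest terms and
`N / M = E⁻¹ ∏_{σ ∈ G} f(σ z)` for a non-zero constant `E`, where `f` is the minimal polynomial
of an element of `O` (whichever element is used). This determines `N / M` up to sign. -/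
def IsOrbitFunction (G : Subgroup PGL(2, ℚ)) (O : Set (OnePoint ℂ))
    (N M : Polynomial ℤ) : Prop :=
  N.IsPrimitive ∧ M.IsPrimitive ∧ IsRelPrime N M ∧
    ∀ a : ℂ, (a : OnePoint ℂ) ∈ O → ∃ E : ℚ, E ≠ 0 ∧
      ∀ z : ℂ, (∀ σ ∈ G, σ • (z : OnePoint ℂ) ≠ ∞) →
        (E : ℂ) * Polynomial.aeval z N =
          Polynomial.aeval z M *
            ∏ᶠ σ : G, Polynomial.aeval (affine (σ • (z : OnePoint ℂ))) (minpoly ℚ a)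

/-- A set of complex numbers, viewed in the sphere. -/
def points (S : Set ℂ) : Set (OnePoint ℂ) := (fun z : ℂ => (z : OnePoint ℂ)) '' S

/-- `∑_{i < ord σ} log⁺ |σ^i z| - ∑_j B_j log |φ_j(z)| ≥ D`, where `φ_j` is the function attached
to the orbit `O_j` of `⟨σ⟩`; it is required at all `z` at which every term is defined and
finite. -/
def OrbitInequality (σ : PGL(2, ℚ)) {k : ℕ} (O : Fin k → Set ℂ) (B : Fin k → ℝ) (D : ℝ) : Prop :=
  ∃ N M : Fin k → Polynomial ℤ,
    (∀ j, IsOrbitFunction (Subgroup.zpowers σ) (points (O j)) (N j) (M j)) ∧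
    ∀ z : ℂ, (∀ τ ∈ Subgroup.zpowers σ, τ • (z : OnePoint ℂ) ≠ ∞) →
      (∀ j, Polynomial.aeval z (N j) ≠ 0) →
      D ≤ ∑ i ∈ Finset.range (orderOf σ),
            Real.posLog ‖affine (σ ^ i • (z : OnePoint ℂ))‖
          - ∑ j, B j * Real.log ‖Polynomial.aeval z (N j) / Polynomial.aeval z (M j)‖

/-- The group `⟨σ⟩` has order `n`, it has finitely many orbits of the kind `unitOrbits`, and the
sets `O_j` are among them. -/
def HasOrbits (σ : PGL(2, ℚ)) (n : ℕ) {k : ℕ} (O : Fin k → Set ℂ) : Prop :=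
  orderOf σ = n ∧ (unitOrbits (Subgroup.zpowers σ)).Finite ∧
    ∀ j, points (O j) ∈ unitOrbits (Subgroup.zpowers σ)

/-- The algebraic numbers. -/
def algNumbers : Set ℂ := {α | IsAlgebraic ℚ α}

/-- The algebraic numbers whose orbit does not contain `∞`. -/
def algNumbersOffInfty (σ : PGL(2, ℚ)) : Set ℂ :=
  {α | IsAlgebraic ℚ α ∧ ∀ τ ∈ Subgroup.zpowers σ, τ • (α : OnePoint ℂ) ≠ ∞}

/-- `h_G(α) = 0` or `h_G(α) ≥ D` for all `α ∈ S`, where `G = ⟨σ⟩`. -/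
def IsHeightBound (σ : PGL(2, ℚ)) (S : Set ℂ) (D : ℝ) : Prop :=
  ∀ α ∈ S, orbitHeight (Subgroup.zpowers σ) (α : OnePoint ℂ) = 0 ∨
    D ≤ orbitHeight (Subgroup.zpowers σ) (α : OnePoint ℂ)

/-- `D` is the largest positive constant with `IsHeightBound σ S D`. -/
def IsOptimalConstant (σ : PGL(2, ℚ)) (S : Set ℂ) (D : ℝ) : Prop :=
  IsGreatest {D' : ℝ | 0 < D' ∧ IsHeightBound σ S D'} D

/-- `α ∈ S` satisfies `h_G(α) = D`; and if `D` is positive, then it is the optimal constant. -/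
def AttainsBound (σ : PGL(2, ℚ)) (S : Set ℂ) (D : ℝ) (α : ℂ) : Prop :=
  α ∈ S ∧ orbitHeight (Subgroup.zpowers σ) (α : OnePoint ℂ) = D ∧
    (0 < D → IsOptimalConstant σ S D)

/-- `ω_{s t} = s / 2 + t i √3 / 2` for signs `s`, `t`. -/
def omega (s t : ℤ) : ℂ := (s : ℂ) / 2 + (t : ℂ) / 2 * (Complex.I * (Real.sqrt 3 : ℂ))

/-- A maximal root: one of maximal absolute value, with non-negative imaginary part. -/
def IsMaximalRoot (P : Polynomial ℤ) (α : ℂ) : Prop :=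
  Polynomial.aeval α P = 0 ∧ 0 ≤ α.im ∧
    ∀ β : ℂ, Polynomial.aeval β P = 0 → ‖β‖ ≤ ‖α‖

/-- `(z² + 1)⁴ + z² (z² - 1)²`. -/
def polyFour : Polynomial ℤ :=
  (.X ^ 2 + 1) ^ 4 + .X ^ 2 * (.X ^ 2 - 1) ^ 2

/-- `(z² - s z + 1)³ - (z² - s z)²`. -/
def polyThree (s : ℤ) : Polynomial ℤ :=
  (.X ^ 2 - .C s * .X + 1) ^ 3 - (.X ^ 2 - .C s * .X) ^ 2

/-- `(z² - s z + 1)⁶ + z² (2 z² - 5 s z + 2)² (z² - 1)²`. -/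
def polySix (s : ℤ) : Polynomial ℤ :=
  (.X ^ 2 - .C s * .X + 1) ^ 6 +
    .X ^ 2 * (2 * .X ^ 2 - .C (5 * s) * .X + 2) ^ 2 * (.X ^ 2 - 1) ^ 2

end OrbitHeight

end

/-! ### Powers of an element of PGL₂(ℚ) as integral matrices. -/

namespace OrbitHeight
open Matrix

/-! Let d be the degree of α. Each height in the orbit is a sum of log⁺ over the places of ℚ(α).
Subtracting B_j times the product formula for φ_j(α) turns d·h_G(α) into a sum of local terms Σ_i
log⁺|σ^i α|_v − Σ_j B_j log|φ_j(α)|_v (`exists_place_formula`). At a finite place |φ_j| ≤ ∏_i max(1,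
|σ^i α|)^{C_j}, and Σ_j B_j C_j ≤ 1, so the local term is non-negative. At an archimedean place it
is at least D by the inequality on ℂ. Hence h_G(α) ≥ D (`le_orbitHeight`). Two kinds of points
escape: zeros of some φ_j, whose orbits consist of 0 and roots of unity and have height 0, and the
orbit of ∞, whose height is computed by hand.

The inequality on ℂ is a minimum principle. Its left-hand side (`defect`) is G-invariant, tends to
+∞ at the zeros of the φ_j, and is harmonic off the circles |σ^i z| = 1. By `le_defect` only the
unit circle and a neighbourhood of ∞ remain, since the other poles of the σ^i are moved to ∞ by the
group. On the circle one real variable is left. For the parametrised involutions all squared norms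
are polynomials in Re z. For the groups with two orbits everything depends on |z − s|². For the
fixed points of the groups of order 3, 4 and 6 there is one critical parameter T: B is chosen to
make T critical, and T is chosen so that |φ| = 1 there, which makes B disappear from the minimum.

Sharpness requires equality at every place. For α = ±1 in an involution, σα is rational and its
height is explicit. For the other α, every conjugate has the minimal archimedean term, and the
finite places contribute nothing (`orbitHeight_eq_of_places`). In the fixed-point groups α solves φ
= ±1; this equation is G-invariant and monic, so the whole orbit consists of algebraic integers
(`orbitHeight_eq_of_integral`). -/

theorem moebius_mul (a b c d a' b' c' d' : ℚ) (h : a * d - b * c ≠ 0)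
    (h' : a' * d' - b' * c' ≠ 0) :
    ∃ h'', moebius a b c d h * moebius a' b' c' d' h' =
      moebius (a * a' + b * c') (a * b' + b * d') (c * a' + d * c') (c * b' + d * d') h'' := by
  refine ⟨?_, ?_⟩
  · convert mul_ne_zero h h' using 1; ring
  · rw [moebius, moebius, ← map_mul, moebius]
    congr 1
    ext i j
    fin_cases i <;> fin_cases j <;>
      simp [Matrix.GeneralLinearGroup.mkOfDetNeZero, Matrix.mul_apply, Fin.sum_univ_two]

theorem moebius_eq_of_smul (k a b c d a' b' c' d' : ℚ) (h : a * d - b * c ≠ 0) (hk : k ≠ 0)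
    (ha : a' = k * a) (hb : b' = k * b) (hc : c' = k * c) (hd : d' = k * d) :
    ∃ h', moebius a b c d h = moebius a' b' c' d' h' := by
  subst ha hb hc hd
  refine ⟨?_, ?_⟩
  · have := mul_ne_zero (mul_ne_zero hk hk) h
    intro h0
    apply this
    linear_combination h0
  · rw [moebius, moebius, Matrix.ProjGenLinGroup.mk_eq_mk_iff]
    refine ⟨Units.mk0 k hk, ?_⟩
    ext i j
    fin_cases i <;> fin_cases j <;>
      simp [Matrix.GeneralLinearGroup.mkOfDetNeZero, Matrix.mul_apply, Fin.sum_univ_two,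
        mul_comm]

theorem moebius_scalar (k : ℚ) (h : k * k - 0 * 0 ≠ 0) : moebius k 0 0 k h = 1 := by
  have hk : k ≠ 0 := by rintro rfl; simp at h
  rw [moebius, ← Matrix.ProjGenLinGroup.mk_scalar (Units.mk0 k hk)]
  congr 1
  ext i j
  fin_cases i <;> fin_cases j <;>
      simp [Matrix.GeneralLinearGroup.mkOfDetNeZero]

/-- Integral matrices `(a i, b i; c i, d i)` for the powers of an element of order `n`. -/
structure MatrixSeq (n : ℕ) where
  a : Fin n → ℤ
  b : Fin n → ℤ
  c : Fin n → ℤ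
  d : Fin n → ℤ

namespace MatrixSeq

variable {n : ℕ} (m : MatrixSeq n) {K : Type*} [Field K]

def num (i : Fin n) (x : K) : K := (m.a i : K) * x + m.b i
def den (i : Fin n) (x : K) : K := (m.c i : K) * x + m.d i
-- Division by zero gives 0, so this is the action of σ^i only where `den` does not vanish.
def ev (i : Fin n) (x : K) : K := m.num i x / m.den i x

/-- `m` lists the powers `σ ^ 0, …, σ ^ (n - 1)`, where `n` is the order of `σ`. -/
structure Represents (σ : PGL(2, ℚ)) : Prop where
  pos : 0 < n
  order : orderOf σ = n
  pow : ∀ i : Fin n, ∃ h, σ ^ (i : ℕ) = moebius (m.a i) (m.b i) (m.c i) (m.d i) h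

end MatrixSeq

namespace MatrixSeq.Represents

variable {n : ℕ} {m : MatrixSeq n} {σ : PGL(2, ℚ)}

theorem smul_coe (h : m.Represents σ) (i : Fin n) (z : ℂ) :
    σ ^ (i : ℕ) • (z : OnePoint ℂ) = if m.den i z = 0 then ∞ else ((m.ev i z : ℂ) : OnePoint ℂ) := by
  obtain ⟨h', e⟩ := h.pow i
  rw [e, moebius_smul_coe]
  simp only [ev, num, den, Rat.cast_intCast]
  congr

theorem smul_coe_of_ne (h : m.Represents σ) {i : Fin n} {z : ℂ} (hz : m.den i z ≠ 0) :
    σ ^ (i : ℕ) • (z : OnePoint ℂ) = ((m.ev i z : ℂ) : OnePoint ℂ) := by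
  rw [h.smul_coe, if_neg hz]

theorem mem_zpowers_iff (h : m.Represents σ) (τ : PGL(2, ℚ)) :
    τ ∈ Subgroup.zpowers σ ↔ ∃ i : Fin n, τ = σ ^ (i : ℕ) := by
  classical
  have hfin : IsOfFinOrder σ := orderOf_pos_iff.mp (h.order ▸ h.pos)
  rw [← hfin.mem_powers_iff_mem_zpowers, hfin.mem_powers_iff_mem_range_orderOf, h.order]
  simp only [Finset.mem_image, Finset.mem_range]
  exact ⟨fun ⟨k, hk, e⟩ => ⟨⟨k, hk⟩, e.symm⟩, fun ⟨i, e⟩ => ⟨i, i.2, e.symm⟩⟩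

theorem off_infty_iff (h : m.Represents σ) (z : ℂ) :
    (∀ τ ∈ Subgroup.zpowers σ, τ • (z : OnePoint ℂ) ≠ ∞) ↔ ∀ i, m.den i z ≠ 0 := by
  constructor
  · intro H i hi
    apply H (σ ^ (i : ℕ)) ((h.mem_zpowers_iff _).2 ⟨i, rfl⟩)
    rw [h.smul_coe, if_pos hi]
  · intro H τ hτ
    obtain ⟨i, rfl⟩ := (h.mem_zpowers_iff _).1 hτ
    rw [h.smul_coe_of_ne (H i)]
    exact OnePoint.coe_ne_infty _

/-- The indexing of `⟨σ⟩` by exponents. -/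
noncomputable def equiv (h : m.Represents σ) : Fin n ≃ Subgroup.zpowers σ :=
  Equiv.ofBijective (fun i => ⟨σ ^ (i : ℕ), (h.mem_zpowers_iff _).2 ⟨i, rfl⟩⟩) (by
    constructor
    · intro i j e
      have e' : σ ^ (i : ℕ) = σ ^ (j : ℕ) := congrArg Subtype.val e
      rw [pow_inj_mod, h.order, Nat.mod_eq_of_lt i.2, Nat.mod_eq_of_lt j.2] at e'
      exact Fin.ext e'
    · rintro ⟨τ, hτ⟩
      obtain ⟨i, rfl⟩ := (h.mem_zpowers_iff _).1 hτ
      exact ⟨i, rfl⟩)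

theorem equiv_apply (h : m.Represents σ) (i : Fin n) : (h.equiv i : PGL(2, ℚ)) = σ ^ (i : ℕ) := rfl

theorem finsum_eq (h : m.Represents σ) {A : Type*} [AddCommMonoid A] (f : PGL(2, ℚ) → A) :
    ∑ᶠ τ : Subgroup.zpowers σ, f τ = ∑ i : Fin n, f (σ ^ (i : ℕ)) := by
  rw [← finsum_comp_equiv h.equiv, finsum_eq_sum_of_fintype]
  rfl

theorem finprod_eq (h : m.Represents σ) {A : Type*} [CommMonoid A] (f : PGL(2, ℚ) → A) :
    ∏ᶠ τ : Subgroup.zpowers σ, f τ = ∏ i : Fin n, f (σ ^ (i : ℕ)) := by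
  rw [← finprod_comp_equiv h.equiv, finprod_eq_prod_of_fintype]
  rfl

theorem orbit_eq (h : m.Represents σ) (x : OnePoint ℂ) :
    MulAction.orbit (Subgroup.zpowers σ) x = Set.range fun i : Fin n => σ ^ (i : ℕ) • x := by
  ext y
  constructor
  · rintro ⟨⟨τ, hτ⟩, rfl⟩
    obtain ⟨i, rfl⟩ := (h.mem_zpowers_iff _).1 hτ
    exact ⟨i, rfl⟩
  · rintro ⟨i, rfl⟩
    exact ⟨h.equiv i, rfl⟩

/-- Right multiplication by σ^j permutes ⟨σ⟩, so passing from z to σ^j z only permutes the orbit.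
The invariance of `defect` and of the orbit functions rests on this permutation. -/
theorem ev_ev (h : m.Represents σ) {z : ℂ} (hz : ∀ i, m.den i z ≠ 0) (j : Fin n) :
    (∀ i, m.den i (m.ev j z) ≠ 0) ∧ ∃ e : Fin n ≃ Fin n, ∀ i, m.ev i (m.ev j z) = m.ev (e i) z := by
  have hj := h.smul_coe_of_ne (hz j)
  have h1 : ∀ i, m.den i (m.ev j z) ≠ 0 := by
    rw [← h.off_infty_iff] at hz ⊢
    intro τ hτ
    rw [← hj, smul_smul]
    exact hz _ (mul_mem hτ ((h.mem_zpowers_iff _).2 ⟨j, rfl⟩))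
  refine ⟨h1, (h.equiv.trans (Equiv.mulRight (h.equiv j))).trans h.equiv.symm, fun i => ?_⟩
  rw [← OnePoint.coe_eq_coe, ← h.smul_coe_of_ne (h1 i), ← hj, smul_smul, ← h.smul_coe_of_ne (hz _)]
  congr 1
  have := h.equiv_apply (h.equiv.symm (h.equiv i * h.equiv j))
  rw [Equiv.apply_symm_apply] at this
  exact this

theorem orbitHeight_eq (h : m.Represents σ) (x : OnePoint ℂ) :
    orbitHeight (Subgroup.zpowers σ) x = ∑ i : Fin n, weilHeight (σ ^ (i : ℕ) • x) :=
  h.finsum_eq fun τ => weilHeight (τ • x)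

theorem affine_smul (h : m.Represents σ) {i : Fin n} {z : ℂ} (hz : m.den i z ≠ 0) :
    affine (σ ^ (i : ℕ) • (z : OnePoint ℂ)) = m.ev i z := by
  rw [h.smul_coe_of_ne hz]; rfl

end MatrixSeq.Represents

theorem orbitHeight_smul {σ : PGL(2, ℚ)} (τ : PGL(2, ℚ)) (hτ : τ ∈ Subgroup.zpowers σ)
    (x : OnePoint ℂ) :
    orbitHeight (Subgroup.zpowers σ) (τ • x) = orbitHeight (Subgroup.zpowers σ) x := by
  unfold orbitHeight
  rw [← finsum_comp_equiv (Equiv.mulRight (⟨τ, hτ⟩ : Subgroup.zpowers σ))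
    (f := fun τ' : Subgroup.zpowers σ => weilHeight (τ' • x))]
  congr 1
  ext τ'
  rw [Equiv.coe_mulRight, mul_smul]
  rfl

end OrbitHeight

/-! ### Absolute heights as sums over places, and the product formula. -/

namespace OrbitHeight
open NumberField Polynomial IntermediateField Real

/-- The absolute height of β is computed in the field that β itself generates. All points of an
orbit generate one field, but only up to a proved equality; hence the field is a variable here. -/
theorem absLogHeight_eq_of_adjoin_eq (β : ℂ) (F : IntermediateField ℚ ℂ) [NumberField F]
    (hF : F = ℚ⟮β⟯) (hβ : β ∈ F) :
    absLogHeight₁ β = (Module.finrank ℚ F : ℝ)⁻¹ * Height.logHeight₁ (⟨β, hβ⟩ : F) := by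
  subst hF
  have hint : IsIntegral ℚ β := by
    have h := Algebra.IsIntegral.isIntegral (R := ℚ) (⟨β, hβ⟩ : ℚ⟮β⟯)
    exact h.map (ℚ⟮β⟯.val)
  rw [absLogHeight₁, absMulHeight₁, dif_pos hint, Real.log_rpow (Height.mulHeight₁_pos _)]
  rfl

section places
variable {F : Type} [Field F] [NumberField F]

theorem finite_support_log (y : F) : (Function.support fun v : FinitePlace F => log (v y)).Finite := by
  by_cases hy : y = 0
  · simp [hy]
  · refine (FinitePlace.hasFiniteMulSupport hy).subset fun v hv hv' => hv ?_
    simp only at hv'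
    simp [hv']

theorem finite_support_posLog (y : F) :
    (Function.support fun v : FinitePlace F => log⁺ (v y)).Finite := by
  refine (finite_support_log y).subset fun v hv hv' => hv ?_
  simp only at hv' ⊢
  rw [posLog, hv', max_self]

theorem sum_log_places_eq_zero {y : F} (hy : y ≠ 0) :
    (∑ w : InfinitePlace F, w.mult * log (w y)) + ∑ᶠ v : FinitePlace F, log (v y) = 0 := by
  have hpos : ∀ v : FinitePlace F, 0 < v y := fun v => FinitePlace.pos_iff.2 hy
  have h := congrArg Real.log (prod_abs_eq_one hy)
  rw [Real.log_mul, Real.log_one, Real.log_prod, Real.log_finprod hpos] at h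
  · simpa using h
  · intro w _
    exact pow_ne_zero _ (by simpa using hy)
  · rw [Finset.prod_ne_zero_iff]
    intro w _
    exact pow_ne_zero _ (by simpa using hy)
  · exact right_ne_zero_of_mul (prod_abs_eq_one hy ▸ one_ne_zero)

/-- The sum of the heights of the `b i`, rewritten with the product formula for the `y j`. -/
theorem sum_logHeight_eq {n k : ℕ} (b : Fin n → F) (y : Fin k → F) (hy : ∀ j, y j ≠ 0)
    (B : Fin k → ℝ) :
    ∑ i, Height.logHeight₁ (b i) =
      ∑ w : InfinitePlace F, w.mult * (∑ i, log⁺ (w (b i)) - ∑ j, B j * log (w (y j))) +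
      ∑ᶠ v : FinitePlace F, (∑ i, log⁺ (v (b i)) - ∑ j, B j * log (v (y j))) := by
  classical
  -- A finite set of places outside which every local term is trivial. It turns all sums over finite
  -- places into finite sums, which may be exchanged.
  set s : Finset (FinitePlace F) :=
    (Finset.univ.biUnion fun i => (finite_support_posLog (b i)).toFinset) ∪
    (Finset.univ.biUnion fun j => (finite_support_log (y j)).toFinset) with hs
  have h1 : ∀ i, ∑ᶠ v : FinitePlace F, log⁺ (v (b i)) = ∑ v ∈ s, log⁺ (v (b i)) := fun i => by
    apply finsum_eq_sum_of_support_subset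
    intro v hv
    simp only [hs, Finset.coe_union, Finset.coe_biUnion, Set.mem_union, Set.mem_iUnion]
    exact Or.inl ⟨i, by simp, by simpa using hv⟩
  have h2 : ∀ j, ∑ᶠ v : FinitePlace F, log (v (y j)) = ∑ v ∈ s, log (v (y j)) := fun j => by
    apply finsum_eq_sum_of_support_subset
    intro v hv
    simp only [hs, Finset.coe_union, Finset.coe_biUnion, Set.mem_union, Set.mem_iUnion]
    exact Or.inr ⟨j, by simp, by simpa using hv⟩
  have h3 : ∑ᶠ v : FinitePlace F, (∑ i, log⁺ (v (b i)) - ∑ j, B j * log (v (y j))) =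
      ∑ v ∈ s, (∑ i, log⁺ (v (b i)) - ∑ j, B j * log (v (y j))) := by
    apply finsum_eq_sum_of_support_subset
    intro v hv
    by_contra hvs
    apply hv
    simp only [hs, Finset.coe_union, Finset.coe_biUnion, Set.mem_union, Set.mem_iUnion, not_or,
      not_exists] at hvs
    have e1 : ∀ i, log⁺ (v (b i)) = 0 := fun i => by simpa using hvs.1 i
    have e2 : ∀ j, log (v (y j)) = 0 := fun j => by
      have := hvs.2 j
      by_contra h0
      exact this (by simp) (by simpa using h0)
    simp [e1, e2]
  have h4 : ∀ j, (∑ w : InfinitePlace F, w.mult * log (w (y j))) + ∑ v ∈ s, log (v (y j)) = 0 :=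
    fun j => by rw [← h2, sum_log_places_eq_zero (hy j)]
  have h5 : ∑ j, B j * ((∑ w : InfinitePlace F, w.mult * log (w (y j))) +
      ∑ v ∈ s, log (v (y j))) = 0 := by simp [h4]
  simp_rw [NumberField.logHeight₁_eq, h1, h3]
  rw [Finset.sum_add_distrib, Finset.sum_comm, Finset.sum_comm (t := s)]
  simp_rw [mul_add, Finset.sum_add_distrib, Finset.mul_sum] at h5
  rw [Finset.sum_comm, Finset.sum_comm (t := s)] at h5
  simp_rw [Finset.sum_sub_distrib, mul_sub, Finset.sum_sub_distrib, Finset.mul_sum]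
  have h6 : ∑ w : InfinitePlace F, ∑ j, (w.mult : ℝ) * (B j * log (w (y j))) =
      ∑ w : InfinitePlace F, ∑ j, B j * (w.mult * log (w (y j))) :=
    Finset.sum_congr rfl fun w _ => Finset.sum_congr rfl fun j _ => by ring
  rw [h6]
  linarith

theorem sum_mult_eq : ∑ w : InfinitePlace F, (w.mult : ℝ) = Module.finrank ℚ F := by
  exact_mod_cast InfinitePlace.sum_mult_eq (K := F)

theorem finitePlace_intCast_le_one (v : FinitePlace F) (a : ℤ) : v (a : F) ≤ 1 := by
  obtain ⟨P, rfl⟩ : ∃ P, v = FinitePlace.mk P := ⟨_, (FinitePlace.mk_maximalIdeal v).symm⟩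
  have := FinitePlace.norm_le_one (K := F) P (a : 𝓞 F)
  rw [FinitePlace.mk_apply]
  simpa using this

end places

/-- The product formula for B clears the denominator: each archimedean term becomes log max(|A|,
|B|), and each finite term becomes log max(|A|_v, |B|_v) = 0 because A and B are coprime. -/
theorem absLogHeight_ratio {A B : ℤ} (hB : B ≠ 0) (h : IsCoprime A B) :
    absLogHeight₁ ((A : ℂ) / B) = log (max |(A : ℝ)| |(B : ℝ)|) := by
  set β : ℂ := (A : ℂ) / B with hβ
  have hint : IsIntegral ℚ β := by
    have : β = algebraMap ℚ ℂ ((A : ℚ) / B) := by simp [hβ]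
    rw [this]; exact isIntegral_algebraMap
  have : FiniteDimensional ℚ ℚ⟮β⟯ := adjoin.finiteDimensional hint
  have : NumberField ℚ⟮β⟯ := {}
  rw [absLogHeight_eq_of_adjoin_eq β ℚ⟮β⟯ rfl (mem_adjoin_simple_self ℚ β)]
  have hB' : (B : ℚ⟮β⟯) ≠ 0 := by exact_mod_cast hB
  have hb : (⟨β, mem_adjoin_simple_self ℚ β⟩ : ℚ⟮β⟯) = (A : ℚ⟮β⟯) / B := by
    apply Subtype.ext
    push_cast
    rfl
  rw [hb]
  -- The weight −1 adds log|B|_v at every place.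
  have key := sum_logHeight_eq (F := ℚ⟮β⟯) ![(A : ℚ⟮β⟯) / B] ![(B : ℚ⟮β⟯)] (by simpa using hB) ![-1]
  simp only [Finset.univ_unique, Fin.default_eq_zero, Matrix.cons_val_fin_one,
    Finset.sum_singleton] at key
  rw [key]
  have hBr : (0 : ℝ) < |(B : ℝ)| := by simpa using hB
  have h1 : ∀ w : InfinitePlace ℚ⟮β⟯, log⁺ (w ((A : ℚ⟮β⟯) / B)) - -1 * log (w (B : ℚ⟮β⟯)) =
      log (max |(A : ℝ)| |(B : ℝ)|) := fun w => by
    have e : ∀ n : ℤ, w (n : ℚ⟮β⟯) = |(n : ℝ)| := fun n => by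
      rw [← InfinitePlace.norm_embedding_eq, map_intCast, Complex.norm_intCast]
    rw [map_div₀, e, e, posLog_eq_log_max_one (by positivity), neg_one_mul, sub_neg_eq_add]
    rw [← Real.log_mul (by positivity) hBr.ne', max_mul_of_nonneg _ _ hBr.le,
      div_mul_cancel₀ _ hBr.ne', one_mul, max_comm]
  have h2 : ∀ v : FinitePlace ℚ⟮β⟯, log⁺ (v ((A : ℚ⟮β⟯) / B)) - -1 * log (v (B : ℚ⟮β⟯)) = 0 :=
    fun v => by
    have hvB : 0 < v (B : ℚ⟮β⟯) := FinitePlace.pos_iff.2 hB'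
    have hmax : max (v (B : ℚ⟮β⟯)) (v (A : ℚ⟮β⟯)) = 1 := by
      apply le_antisymm (max_le (finitePlace_intCast_le_one v B) (finitePlace_intCast_le_one v A))
      obtain ⟨r, s, hrs⟩ := h
      have : (1 : ℚ⟮β⟯) = r * A + s * B := by exact_mod_cast hrs.symm
      calc (1 : ℝ) = v 1 := by simp
        _ = v (r * A + s * B) := by rw [this]
        _ ≤ max (v (r * A)) (v (s * B)) := FinitePlace.add_le v _ _
        _ ≤ _ := by
          rw [map_mul, map_mul, max_comm]
          exact max_le_max
            (mul_le_of_le_one_left (apply_nonneg _ _) (finitePlace_intCast_le_one v s))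
            (mul_le_of_le_one_left (apply_nonneg _ _) (finitePlace_intCast_le_one v r))
    rw [map_div₀, posLog_eq_log_max_one (by positivity), neg_one_mul, sub_neg_eq_add]
    rw [← Real.log_mul (by positivity) hvB.ne', max_mul_of_nonneg _ _ hvB.le,
      div_mul_cancel₀ _ hvB.ne', one_mul, hmax, Real.log_one]
  simp_rw [h1, h2, finsum_zero, ← Finset.sum_mul, sum_mult_eq, add_zero]
  have : (Module.finrank ℚ ℚ⟮β⟯ : ℝ) ≠ 0 := by exact_mod_cast Module.finrank_pos.ne'
  field_simp

/-- Every absolute value of such a z is 0 or 1, so each log⁺ vanishes. -/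
theorem absLogHeight_eq_zero {z : ℂ} {k : ℕ} (hk : k ≠ 0) (h : z = 0 ∨ z ^ k = 1) :
    absLogHeight₁ z = 0 := by
  have hint : IsIntegral ℚ z := by
    rcases h with rfl | h
    · exact isIntegral_zero
    · exact IsIntegral.of_pow (Nat.pos_of_ne_zero hk) (h ▸ isIntegral_one)
  have : FiniteDimensional ℚ ℚ⟮z⟯ := adjoin.finiteDimensional hint
  have : NumberField ℚ⟮z⟯ := {}
  rw [absLogHeight_eq_of_adjoin_eq z ℚ⟮z⟯ rfl (mem_adjoin_simple_self ℚ z)]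
  set b : ℚ⟮z⟯ := ⟨z, mem_adjoin_simple_self ℚ z⟩
  have hb : b = 0 ∨ b ^ k = 1 := by
    rcases h with h | h
    · exact Or.inl (Subtype.ext h)
    · exact Or.inr (Subtype.ext h)
  have h1 : ∀ r : ℝ, 0 ≤ r → (r = 0 ∨ r ^ k = 1) → log⁺ r = 0 := by
    rintro r hr (rfl | h)
    · simp
    · rw [(pow_eq_one_iff_of_nonneg hr hk).1 h]; simp
  have h2 : ∀ w : InfinitePlace ℚ⟮z⟯, log⁺ (w b) = 0 := fun w =>
    h1 _ (apply_nonneg _ _) (hb.imp (fun e => by rw [e, map_zero])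
      (fun e => by rw [← map_pow, e, map_one]))
  have h3 : ∀ v : FinitePlace ℚ⟮z⟯, log⁺ (v b) = 0 := fun w =>
    h1 _ (apply_nonneg _ _) (hb.imp (fun e => by rw [e, map_zero])
      (fun e => by rw [← map_pow, e, map_one]))
  simp [NumberField.logHeight₁_eq, h2, h3]

end OrbitHeight

/-! ### The orbit height as a sum of local terms: lower bound and equality. -/

namespace OrbitHeight
open NumberField Polynomial IntermediateField Real

namespace MatrixSeq

variable {n k : ℕ} (m : MatrixSeq n)

/-- `∑_i log⁺ |σ^i z| - ∑_j B_j log |N_j(z) / M_j(z)|`. -/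
noncomputable def defect (B : Fin k → ℝ) (N M : Fin k → ℤ[X]) (z : ℂ) : ℝ :=
  ∑ i, log⁺ ‖m.ev i z‖ - ∑ j, B j * log ‖aeval z (N j) / aeval z (M j)‖

/-- The non-archimedean bound `|N(x) / M(x)| ≤ ∏_i max(1, |σ^i x|)^C`. -/
def NonarchBound (N M : ℤ[X]) (C : ℕ) : Prop :=
  ∀ (F : Type) [Field F] (v : AbsoluteValue F ℝ), IsNonarchimedean v → (∀ t : ℤ, v t ≤ 1) →
    ∀ x : F, v (aeval x N) * ∏ i, v (m.den i x) ^ C ≤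
      v (aeval x M) * ∏ i, max (v (m.den i x)) (v (m.num i x)) ^ C

variable {m}

theorem map_num {F K : Type*} [Field F] [Field K] (φ : F →+* K) (i : Fin n) (x : F) :
    φ (m.num i x) = m.num i (φ x) := by simp [num]

theorem map_den {F K : Type*} [Field F] [Field K] (φ : F →+* K) (i : Fin n) (x : F) :
    φ (m.den i x) = m.den i (φ x) := by simp [den]

theorem map_ev {F K : Type*} [Field F] [Field K] (φ : F →+* K) (i : Fin n) (x : F) :
    φ (m.ev i x) = m.ev i (φ x) := by simp [ev, map_num, map_den]

theorem map_aeval_int {F K : Type*} [Field F] [Field K] (φ : F →+* K) (p : ℤ[X]) (x : F) :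
    φ (aeval x p) = aeval (φ x) p :=
  (Polynomial.aeval_algHom_apply φ.toIntAlgHom x p).symm

/-- `NonarchBound` is free of denominators, so that it can be checked for every x by polynomial
identities. Logarithms enter only here, where nothing vanishes. -/
theorem NonarchBound.log_le {N M : ℤ[X]} {C : ℕ} (h : m.NonarchBound N M C)
    {F : Type} [Field F] (v : AbsoluteValue F ℝ) (hv : IsNonarchimedean v) (hv' : ∀ t : ℤ, v t ≤ 1)
    {x : F} (hx : ∀ i, m.den i x ≠ 0) (hN : aeval x N ≠ 0) (hM : aeval x M ≠ 0) :
    log (v (aeval x N / aeval x M)) ≤ C * ∑ i, log⁺ (v (m.ev i x)) := by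
  have h1 := h F v hv hv' x
  have hd : ∀ i, 0 < v (m.den i x) := fun i => v.pos (hx i)
  have h2 : ∀ i, log⁺ (v (m.ev i x)) = log (max (v (m.den i x)) (v (m.num i x))) -
      log (v (m.den i x)) := fun i => by
    rw [ev, map_div₀, posLog_eq_log_max_one (by positivity),
      ← Real.log_div (lt_max_of_lt_left (hd i)).ne' (hd i).ne', ← max_div_div_right (hd i).le,
      div_self (hd i).ne']
  have h3 := Real.log_le_log (mul_pos (v.pos hN) (Finset.prod_pos fun i _ => pow_pos (hd i) C)) h1
  have hmx : ∀ i, 0 < max (v (m.den i x)) (v (m.num i x)) := fun i => lt_max_of_lt_left (hd i)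
  rw [Real.log_mul (v.pos hN).ne' (Finset.prod_pos fun i _ => pow_pos (hd i) C).ne',
    Real.log_mul (v.pos hM).ne' (Finset.prod_pos fun i _ => pow_pos (hmx i) C).ne',
    Real.log_prod (fun i _ => (pow_pos (hd i) C).ne'),
    Real.log_prod (fun i _ => (pow_pos (hmx i) C).ne')] at h3
  simp_rw [Real.log_pow, ← Finset.mul_sum] at h3
  rw [map_div₀, Real.log_div (v.pos hN).ne' (v.pos hM).ne']
  simp_rw [h2, Finset.sum_sub_distrib]
  linarith

namespace Represents

variable {σ : PGL(2, ℚ)}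

theorem exists_ev_ev_eq (h : m.Represents σ) {z : ℂ} (hz : ∀ i, m.den i z ≠ 0) (j : Fin n) :
    ∃ i, m.ev i (m.ev j z) = z := by
  obtain ⟨-, e, he⟩ := h.ev_ev hz j
  refine ⟨e.symm ⟨0, h.pos⟩, ?_⟩
  rw [he, Equiv.apply_symm_apply, ← OnePoint.coe_eq_coe, ← h.smul_coe_of_ne (hz _)]
  simp

/-- The powers of σ have rational coefficients, and each is undone by another power. -/
theorem adjoin_ev (h : m.Represents σ) {z : ℂ} (hz : ∀ i, m.den i z ≠ 0) (j : Fin n) :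
    ℚ⟮z⟯ = ℚ⟮m.ev j z⟯ := by
  have key : ∀ (i : Fin n) (x : ℂ), m.ev i x ∈ ℚ⟮x⟯ := fun i x => by
    have hx := mem_adjoin_simple_self ℚ x
    have hi : ∀ t : ℤ, (t : ℂ) ∈ ℚ⟮x⟯ := fun t => intCast_mem _ t
    exact div_mem (add_mem (mul_mem (hi _) hx) (hi _)) (add_mem (mul_mem (hi _) hx) (hi _))
  apply le_antisymm
  · obtain ⟨i, hi⟩ := h.exists_ev_ev_eq hz j
    rw [adjoin_simple_le_iff]
    have := key i (m.ev j z)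
    rwa [hi] at this
  · rw [adjoin_simple_le_iff]
    exact key _ _

/-- The orbit height as a sum over the places of `ℚ(α)`. -/
theorem exists_place_formula (h : m.Represents σ) {α : ℂ} (hα : IsAlgebraic ℚ α)
    (hz : ∀ i, m.den i α ≠ 0) (B : Fin k → ℝ) (N M : Fin k → ℤ[X])
    (hN : ∀ j, aeval α (N j) ≠ 0) (hM : ∀ j, aeval α (M j) ≠ 0) :
    ∃ (F : IntermediateField ℚ ℂ) (_ : NumberField F) (x : F), (x : ℂ) = α ∧
      Module.finrank ℚ F * orbitHeight (Subgroup.zpowers σ) (α : OnePoint ℂ) =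
      ∑ w : InfinitePlace F, w.mult * m.defect B N M (w.embedding x) +
      ∑ᶠ v : FinitePlace F, (∑ i, log⁺ (v (m.ev i x)) -
        ∑ j, B j * log (v (aeval x (N j) / aeval x (M j)))) := by
  have hint : IsIntegral ℚ α := hα.isIntegral
  have : FiniteDimensional ℚ ℚ⟮α⟯ := adjoin.finiteDimensional hint
  have hF : NumberField ℚ⟮α⟯ := {}
  refine ⟨ℚ⟮α⟯, hF, ⟨α, mem_adjoin_simple_self ℚ α⟩, rfl, ?_⟩
  set x : ℚ⟮α⟯ := ⟨α, mem_adjoin_simple_self ℚ α⟩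
  have hN' : ∀ j, aeval x (N j) ≠ 0 := fun j e => hN j (by
    have := congrArg (algebraMap ℚ⟮α⟯ ℂ) e
    rwa [map_aeval_int, map_zero] at this)
  have hM' : ∀ j, aeval x (M j) ≠ 0 := fun j e => hM j (by
    have := congrArg (algebraMap ℚ⟮α⟯ ℂ) e
    rwa [map_aeval_int, map_zero] at this)
  have h1 := sum_logHeight_eq (fun i => m.ev i x) (fun j => aeval x (N j) / aeval x (M j))
    (fun j => div_ne_zero (hN' j) (hM' j)) B
  have h2 : Module.finrank ℚ ℚ⟮α⟯ * orbitHeight (Subgroup.zpowers σ) (α : OnePoint ℂ) =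
      ∑ i, Height.logHeight₁ (m.ev i x) := by
    rw [h.orbitHeight_eq, Finset.mul_sum]
    refine Finset.sum_congr rfl fun i _ => ?_
    rw [h.smul_coe_of_ne (hz i)]
    have e : m.ev i α = ((m.ev i x : ℚ⟮α⟯) : ℂ) := (map_ev (algebraMap ℚ⟮α⟯ ℂ) i x).symm
    have hmem : m.ev i α ∈ ℚ⟮α⟯ := by rw [e]; exact SetLike.coe_mem _
    change _ * absLogHeight₁ (m.ev i α) = _
    rw [absLogHeight_eq_of_adjoin_eq (m.ev i α) ℚ⟮α⟯ (h.adjoin_ev hz i) hmem]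
    have hne : (Module.finrank ℚ ℚ⟮α⟯ : ℝ) ≠ 0 := by exact_mod_cast Module.finrank_pos.ne'
    rw [mul_inv_cancel_left₀ hne]
    congr 1
  rw [h2, h1]
  congr 1
  refine Finset.sum_congr rfl fun w _ => ?_
  rw [defect]
  simp_rw [← InfinitePlace.norm_embedding_eq, map_ev, map_div₀, map_aeval_int]

/-- Each archimedean term is at least D, and the multiplicities add up to the degree. Each finite
term is at least (1 − Σ_j B_j C_j) Σ_i log⁺|σ^i α|_v ≥ 0. -/
theorem le_orbitHeight (h : m.Represents σ) {α : ℂ} (hα : IsAlgebraic ℚ α)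
    (hz : ∀ i, m.den i α ≠ 0) {B : Fin k → ℝ} {N M : Fin k → ℤ[X]} {D : ℝ}
    (hN : ∀ j, aeval α (N j) ≠ 0) (hM : ∀ j, aeval α (M j) ≠ 0)
    (hineq : ∀ z : ℂ, (∀ i, m.den i z ≠ 0) → (∀ j, aeval z (N j) ≠ 0) → D ≤ m.defect B N M z)
    (hB : ∀ j, 0 ≤ B j) (C : Fin k → ℕ) (hC : ∀ j, m.NonarchBound (N j) (M j) (C j))
    (hBC : ∑ j, B j * C j ≤ 1) :
    D ≤ orbitHeight (Subgroup.zpowers σ) (α : OnePoint ℂ) := by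
  obtain ⟨F, _, x, hx, e⟩ := h.exists_place_formula hα hz B N M hN hM
  have hN' : ∀ j, aeval x (N j) ≠ 0 := fun j e => hN j (by
    have := congrArg (algebraMap F ℂ) e
    rw [map_aeval_int, map_zero] at this
    rwa [← hx])
  have hM' : ∀ j, aeval x (M j) ≠ 0 := fun j e => hM j (by
    have := congrArg (algebraMap F ℂ) e
    rw [map_aeval_int, map_zero] at this
    rwa [← hx])
  have hz' : ∀ i, m.den i x ≠ 0 := fun i e => hz i (by
    have := congrArg (algebraMap F ℂ) e
    rw [map_den, map_zero] at this
    rwa [← hx])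
  have h1 : ∑ w : InfinitePlace F, w.mult * D ≤
      ∑ w : InfinitePlace F, w.mult * m.defect B N M (w.embedding x) := by
    gcongr with w
    apply hineq
    · intro i
      rw [← map_den]
      exact (_root_.map_ne_zero _).2 (hz' i)
    · intro j
      rw [← map_aeval_int]
      exact (_root_.map_ne_zero _).2 (hN' j)
  have h2 : 0 ≤ ∑ᶠ v : FinitePlace F, (∑ i, log⁺ (v (m.ev i x)) -
        ∑ j, B j * log (v (aeval x (N j) / aeval x (M j)))) := by
    apply finsum_nonneg
    intro v
    have hS : 0 ≤ ∑ i, log⁺ (v (m.ev i x)) := Finset.sum_nonneg fun i _ => posLog_nonneg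
    rw [sub_nonneg]
    calc ∑ j, B j * log (v (aeval x (N j) / aeval x (M j)))
        ≤ ∑ j, B j * (C j * ∑ i, log⁺ (v (m.ev i x))) := by
          gcongr with j
          · exact hB j
          · exact (hC j).log_le v.1 (fun a b => FinitePlace.add_le v a b)
              (finitePlace_intCast_le_one v) hz' (hN' j) (hM' j)
      _ = (∑ j, B j * C j) * ∑ i, log⁺ (v (m.ev i x)) := by
          rw [Finset.sum_mul]
          exact Finset.sum_congr rfl fun j _ => by ring
      _ ≤ _ := mul_le_of_le_one_left hS hBC
  rw [← Finset.sum_mul, sum_mult_eq] at h1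
  have hpos : (0 : ℝ) < Module.finrank ℚ F := by exact_mod_cast Module.finrank_pos
  refine le_of_mul_le_mul_left ?_ hpos
  linarith

/-- The criterion for equality. The embeddings of ℚ(α) send α to its conjugates, which are further
roots of P; therefore the archimedean condition is imposed at all roots of P, and the finite one at
roots of P in any field with a non-archimedean absolute value. -/
theorem orbitHeight_eq_of_places (h : m.Represents σ) {α : ℂ} {P : ℤ[X]} (hP : P ≠ 0)
    (hα : aeval α P = 0)
    (hz : ∀ i, m.den i α ≠ 0) {B : Fin k → ℝ} {N M : Fin k → ℤ[X]} {D : ℝ}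
    (hN : ∀ j, aeval α (N j) ≠ 0) (hM : ∀ j, aeval α (M j) ≠ 0)
    (harch : ∀ z : ℂ, aeval z P = 0 → (∀ i, m.den i z ≠ 0) → (∀ j, aeval z (N j) ≠ 0) →
      (∀ j, aeval z (M j) ≠ 0) → m.defect B N M z = D)
    (hnon : ∀ (F : Type) [Field F] [CharZero F] (v : AbsoluteValue F ℝ), IsNonarchimedean v →
      (∀ t : ℤ, v t ≤ 1) → ∀ x : F, aeval x P = 0 → (∀ i, m.den i x ≠ 0) →
      (∀ j, aeval x (N j) ≠ 0) → (∀ j, aeval x (M j) ≠ 0) →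
      ∑ i, log⁺ (v (m.ev i x)) = ∑ j, B j * log (v (aeval x (N j) / aeval x (M j)))) :
    orbitHeight (Subgroup.zpowers σ) (α : OnePoint ℂ) = D := by
  have halg : IsAlgebraic ℚ α :=
    (IsFractionRing.isAlgebraic_iff ℤ ℚ ℂ).1 ⟨P, hP, hα⟩
  obtain ⟨F, _, x, hx, e⟩ := h.exists_place_formula halg hz B N M hN hM
  have hN' : ∀ j, aeval x (N j) ≠ 0 := fun j e => hN j (by
    have := congrArg (algebraMap F ℂ) e
    rw [map_aeval_int, map_zero] at this
    rwa [← hx])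
  have hM' : ∀ j, aeval x (M j) ≠ 0 := fun j e => hM j (by
    have := congrArg (algebraMap F ℂ) e
    rw [map_aeval_int, map_zero] at this
    rwa [← hx])
  have hz' : ∀ i, m.den i x ≠ 0 := fun i e => hz i (by
    have := congrArg (algebraMap F ℂ) e
    rw [map_den, map_zero] at this
    rwa [← hx])
  have hP' : aeval x P = 0 := by
    apply (algebraMap F ℂ).injective
    rw [map_aeval_int, map_zero]
    rwa [← hx] at hα
  have h1 : ∀ w : InfinitePlace F, m.defect B N M (w.embedding x) = D := fun w => by
    apply harch
    · rw [← map_aeval_int, hP', map_zero]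
    · intro i
      rw [← map_den]
      exact (_root_.map_ne_zero _).2 (hz' i)
    · intro j
      rw [← map_aeval_int]
      exact (_root_.map_ne_zero _).2 (hN' j)
    · intro j
      rw [← map_aeval_int]
      exact (_root_.map_ne_zero _).2 (hM' j)
  have h2 : ∀ v : FinitePlace F, ∑ i, log⁺ (v (m.ev i x)) -
        ∑ j, B j * log (v (aeval x (N j) / aeval x (M j))) = 0 := fun v => by
    rw [sub_eq_zero]
    exact hnon F v.1 (fun a b => FinitePlace.add_le v a b) (finitePlace_intCast_le_one v) x hP'
      hz' hN' hM'
  simp_rw [h1, h2, finsum_zero, ← Finset.sum_mul, sum_mult_eq, add_zero] at e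
  have hne : (Module.finrank ℚ F : ℝ) ≠ 0 := by exact_mod_cast Module.finrank_pos.ne'
  exact mul_left_cancel₀ hne e

end Represents
end MatrixSeq

theorem attainsBound_of_eq {σ : PGL(2, ℚ)} {S : Set ℂ} {D : ℝ} {α : ℂ} (hα : α ∈ S)
    (h : orbitHeight (Subgroup.zpowers σ) (α : OnePoint ℂ) = D) (hb : IsHeightBound σ S D) :
    AttainsBound σ S D α := by
  refine ⟨hα, h, fun hD => ⟨⟨hD, hb⟩, fun D' hD' => ?_⟩⟩
  rcases hD'.2 α hα with h0 | h0
  · exact absurd (h.symm.trans h0) hD.ne'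
  · rwa [h] at h0

end OrbitHeight

/-! ### Reduction to the unit circle by the minimum principle. -/

namespace OrbitHeight
open Polynomial Real Filter Topology InnerProductSpace

theorem harmonicAt_finset_sum {ι : Type*} (s : Finset ι) (f : ι → ℂ → ℝ) {z : ℂ}
    (h : ∀ i ∈ s, HarmonicAt (f i) z) : HarmonicAt (fun y => ∑ i ∈ s, f i y) z := by
  classical
  induction s using Finset.induction_on with
  | empty => simp
  | insert a s ha ih =>
    simp_rw [Finset.sum_insert ha]
    exact (h a (by simp)).add (ih fun i hi => h i (by simp [hi]))

/-- Near z, f is the real part of a holomorphic F, and |exp(−F)| = exp(−f) has a local maximum; the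
maximum modulus principle applies. -/
theorem eventually_eq_of_harmonicAt_of_isLocalMin {f : ℂ → ℝ} {z : ℂ} (hf : HarmonicAt f z)
    (hmin : ∀ᶠ y in 𝓝 z, f z ≤ f y) : ∀ᶠ y in 𝓝 z, f y = f z := by
  obtain ⟨r, hr, hball⟩ := Metric.eventually_nhds_iff_ball.1 hf.eventually
  obtain ⟨F, hF, hFre⟩ := HarmonicOnNhd.exists_analyticOnNhd_ball_re_eq (fun x hx => hball x hx)
  have hmem : Metric.ball z r ∈ 𝓝 z := Metric.ball_mem_nhds z hr
  have hre : ∀ y ∈ Metric.ball z r, ‖Complex.exp (-F y)‖ = Real.exp (-f y) := fun y hy => by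
    rw [Complex.norm_exp, Complex.neg_re]
    congr 2
    exact hFre hy
  have h1 := Complex.norm_eventually_eq_of_isLocalMax (f := fun y => Complex.exp (-F y)) (c := z)
    (by
      filter_upwards [hmem] with y hy
      exact ((hF y hy).differentiableAt.neg).cexp)
    (by
      filter_upwards [hmem, hmin] with y hy hy'
      simp only [Function.comp]
      rw [hre y hy, hre z (mem_of_mem_nhds hmem)]
      exact Real.exp_le_exp.2 (neg_le_neg hy'))
  filter_upwards [h1, hmem] with y hy hy'
  rw [hre y hy', hre z (mem_of_mem_nhds hmem), Real.exp_eq_exp] at hy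
  linarith

namespace MatrixSeq

variable {n k : ℕ} {m : MatrixSeq n} {σ : PGL(2, ℚ)} {B : Fin k → ℝ} {N M : Fin k → ℤ[X]} {D : ℝ}

theorem continuous_den (i : Fin n) : Continuous fun z : ℂ => m.den i z := by
  unfold den; fun_prop

theorem continuous_num (i : Fin n) : Continuous fun z : ℂ => m.num i z := by
  unfold num; fun_prop

theorem analyticAt_ev {i : Fin n} {z : ℂ} (hz : m.den i z ≠ 0) :
    AnalyticAt ℂ (fun y => m.ev i y) z := by
  refine AnalyticAt.div ?_ ?_ hz
  · unfold num; fun_prop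
  · unfold den; fun_prop

variable (m N) in
/-- The points at which all terms of `defect` are finite. -/
def regular : Set ℂ := {z | (∀ i, m.den i z ≠ 0) ∧ ∀ j, aeval z (N j) ≠ 0}

theorem isOpen_regular : IsOpen (regular m N) := by
  have : regular m N = (⋂ i, {z | m.den i z ≠ 0}) ∩ ⋂ j, {z : ℂ | aeval z (N j) ≠ 0} := by
    ext z; simp [regular]
  rw [this]
  refine IsOpen.inter (isOpen_iInter_of_finite fun i => ?_) (isOpen_iInter_of_finite fun j => ?_)
  · exact isOpen_ne_fun (continuous_den i) continuous_const
  · exact isOpen_ne_fun (N j).continuous_aeval continuous_const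

theorem analyticAt_quot {z : ℂ} {j : Fin k} (hM : aeval z (M j) ≠ 0) :
    AnalyticAt ℂ (fun y : ℂ => aeval y (N j) / aeval y (M j)) z := by
  refine AnalyticAt.div ?_ ?_ hM
  · exact AnalyticAt.aeval_polynomial analyticAt_id _
  · exact AnalyticAt.aeval_polynomial analyticAt_id _

theorem continuousAt_defect {z : ℂ} (hz : z ∈ regular m N) (hM : ∀ j, aeval z (M j) ≠ 0) :
    ContinuousAt (m.defect B N M) z := by
  refine ContinuousAt.sub (tendsto_finsetSum _ fun i _ => ?_) (tendsto_finsetSum _ fun j _ => ?_)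
  · exact Real.continuous_posLog.continuousAt.comp (analyticAt_ev (hz.1 i)).continuousAt.norm
  · refine tendsto_const_nhds.mul (ContinuousAt.log (analyticAt_quot (hM j)).continuousAt.norm ?_)
    exact norm_ne_zero_iff.2 (div_ne_zero (hz.2 j) (hM j))

/-- Where |g| ≠ 1, log⁺|g| is locally either 0 or log|g|. -/
theorem harmonicAt_defect {z : ℂ} (hz : z ∈ regular m N) (hM : ∀ j, aeval z (M j) ≠ 0)
    (hcirc : ∀ i, ‖m.ev i z‖ ≠ 1) : HarmonicAt (m.defect B N M) z := by
  refine HarmonicAt.sub (harmonicAt_finset_sum _ _ fun i _ => ?_)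
    (harmonicAt_finset_sum _ _ fun j _ => ?_)
  · have hc := (analyticAt_ev (hz.1 i)).continuousAt.norm
    rcases lt_or_gt_of_ne (hcirc i) with h | h
    · refine (harmonicAt_congr_nhds (f₂ := fun _ => (0 : ℝ)) ?_).2 (harmonicAt_const _)
      filter_upwards [hc.eventually_lt continuousAt_const h] with y hy
      exact posLog_eq_zero_iff _ |>.2 (by rw [abs_norm]; exact hy.le)
    · refine (harmonicAt_congr_nhds (f₂ := fun y => log ‖m.ev i y‖) ?_).2
        ((analyticAt_ev (hz.1 i)).harmonicAt_log_norm fun h0 => ?_)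
      · filter_upwards [continuousAt_const.eventually_lt hc h] with y hy
        exact posLog_eq_log (by rw [abs_norm]; exact hy.le)
      · rw [h0, norm_zero] at h
        linarith
  · exact ((analyticAt_quot (hM j)).harmonicAt_log_norm
      (div_ne_zero (hz.2 j) (hM j))).const_smul (c := B j)

namespace Represents

theorem det_ne (h : m.Represents σ) (i : Fin n) : m.a i * m.d i - m.b i * m.c i ≠ 0 := by
  obtain ⟨h', -⟩ := h.pow i
  exact_mod_cast h'

/-- A common zero of numerator and denominator would annihilate the determinant. -/
theorem num_ne (h : m.Represents σ) {i : Fin n} {z : ℂ} (hz : m.den i z = 0) : m.num i z ≠ 0 := by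
  intro h0
  apply h.det_ne i
  have e1 : ((m.a i * m.d i - m.b i * m.c i : ℤ) : ℂ) =
      m.a i * m.den i z - m.c i * m.num i z := by
    simp only [den, num]; push_cast; ring
  rw [hz, h0] at e1
  simp only [mul_zero, sub_zero] at e1
  exact_mod_cast e1

/-- The sum of log⁺ is permuted by σ^i, and each N/M takes the same value at σ^i z. -/
theorem defect_ev (h : m.Represents σ)
    (hinv : ∀ z : ℂ, (∀ i, m.den i z ≠ 0) → ∀ i j, aeval (m.ev i z) (N j) * aeval z (M j) =
      aeval z (N j) * aeval (m.ev i z) (M j))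
    (hM : ∀ z : ℂ, (∀ i, m.den i z ≠ 0) → ∀ j, aeval z (M j) ≠ 0) {z : ℂ}
    (hz : ∀ i, m.den i z ≠ 0) (i : Fin n) :
    m.defect B N M (m.ev i z) = m.defect B N M z := by
  obtain ⟨h1, e, he⟩ := h.ev_ev hz i
  simp_rw [defect, he]
  congr 1
  · exact Equiv.sum_comp e fun i => log⁺ ‖m.ev i z‖
  · refine Finset.sum_congr rfl fun j _ => ?_
    rw [(div_eq_div_iff (hM _ h1 j) (hM _ hz j)).2 (hinv z hz i j)]

theorem mem_regular_ev (h : m.Represents σ)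
    (hinv : ∀ z : ℂ, (∀ i, m.den i z ≠ 0) → ∀ i j, aeval (m.ev i z) (N j) * aeval z (M j) =
      aeval z (N j) * aeval (m.ev i z) (M j))
    (hM : ∀ z : ℂ, (∀ i, m.den i z ≠ 0) → ∀ j, aeval z (M j) ≠ 0) {z : ℂ}
    (hz : z ∈ regular m N) (i : Fin n) : m.ev i z ∈ regular m N := by
  have h1 := (h.ev_ev hz.1 i).1
  refine ⟨h1, fun j h0 => ?_⟩
  have := hinv z hz.1 i j
  rw [h0, zero_mul] at this
  exact mul_ne_zero (hz.2 j) (hM _ h1 j) this.symm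

theorem tendsto_norm_ev (h : m.Represents σ) {i : Fin n} {z : ℂ} (hz : m.den i z = 0) (R : ℝ) :
    ∀ᶠ y in 𝓝 z, m.den i y ≠ 0 → R < ‖m.ev i y‖ := by
  have h0 : 0 < ‖m.num i z‖ := norm_pos_iff.2 (h.num_ne hz)
  have h1 : ∀ᶠ y in 𝓝 z, ‖m.num i z‖ / 2 < ‖m.num i y‖ :=
    (continuous_num i).norm.continuousAt.eventually (lt_mem_nhds (by linarith))
  have h2 : ∀ᶠ y in 𝓝 z, ‖m.den i y‖ < ‖m.num i z‖ / 2 / (|R| + 1) :=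
    (continuous_den i).norm.continuousAt.eventually (gt_mem_nhds (by
      simp only [hz, norm_zero]; positivity))
  filter_upwards [h1, h2] with y hy1 hy2 hy
  have hpos : 0 < ‖m.den i y‖ := norm_pos_iff.2 hy
  rw [ev, norm_div, lt_div_iff₀ hpos]
  rw [lt_div_iff₀ (by positivity)] at hy2
  nlinarith [le_abs_self R]

/-- At a zero of φ_{j₀} the term −B_{j₀} log|φ_{j₀}| tends to +∞. The other terms stay bounded
below, since |φ_j| ≤ |φ_j(z)| + 1 nearby and the sum of log⁺ is non-negative. -/
theorem eventually_lt_defect (hB : ∀ j, 0 < B j) {z : ℂ} (hM : ∀ j, aeval z (M j) ≠ 0) {j₀ : Fin k}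
    (hj : aeval z (N j₀) = 0) (t : ℝ) :
    ∀ᶠ y in 𝓝 z, y ∈ regular m N → t < m.defect B N M y := by
  set φ : Fin k → ℂ → ℂ := fun j y => aeval y (N j) / aeval y (M j) with hφ
  set c : ℝ := ∑ j, B j * log (‖φ j z‖ + 1)
  have hcont : ∀ j, ContinuousAt (fun y => ‖φ j y‖) z := fun j =>
    (analyticAt_quot (hM j)).continuousAt.norm
  have h1 : ∀ᶠ y in 𝓝 z, ∀ j, ‖φ j y‖ < ‖φ j z‖ + 1 :=
    eventually_all.2 fun j => (hcont j).eventually (gt_mem_nhds (by linarith))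
  -- With this bound B_{j₀} log|φ_{j₀}| ≤ −(t + 1 + c), where c dominates the contributions of all
  -- the φ_j.
  have h2 : ∀ᶠ y in 𝓝 z, ‖φ j₀ y‖ < Real.exp (-(t + 1 + c) / B j₀) :=
    (hcont j₀).eventually (gt_mem_nhds (by simp [hφ, hj, Real.exp_pos]))
  have hMe : ∀ᶠ y in 𝓝 z, ∀ j, aeval y (M j) ≠ 0 :=
    eventually_all.2 fun j => (M j).continuous_aeval.continuousAt.eventually_ne (hM j)
  filter_upwards [h1, h2, hMe] with y hy1 hy2 hy3 hy
  have hpos : ∀ j, 0 < ‖φ j y‖ := fun j => norm_pos_iff.2 (div_ne_zero (hy.2 j) (hy3 j))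
  have hS : 0 ≤ ∑ i, log⁺ ‖m.ev i y‖ := Finset.sum_nonneg fun i _ => posLog_nonneg
  have hlog : log ‖φ j₀ y‖ ≤ -(t + 1 + c) / B j₀ := by
    rw [Real.log_le_iff_le_exp (hpos j₀)]; exact hy2.le
  have h3 : ∑ j, B j * log ‖φ j y‖ ≤ -(t + 1 + c) + c := by
    classical
    calc ∑ j, B j * log ‖φ j y‖ ≤
        ∑ j, ((if j = j₀ then -(t + 1 + c) else 0) + B j * log (‖φ j z‖ + 1)) := by
          refine Finset.sum_le_sum fun j _ => ?_
          split_ifs with hjj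
          · subst hjj
            have e1 := mul_le_mul_of_nonneg_left hlog (hB j).le
            rw [mul_div_cancel₀ _ (hB j).ne'] at e1
            have e2 : 0 ≤ log (‖φ j z‖ + 1) := Real.log_nonneg (by linarith [norm_nonneg (φ j z)])
            nlinarith [hB j]
          · rw [zero_add]
            exact mul_le_mul_of_nonneg_left (Real.log_le_log (hpos j) (hy1 j).le) (hB j).le
      _ = _ := by simp [Finset.sum_add_distrib, c]
  rw [defect]
  change t < _ - ∑ j, B j * log ‖φ j y‖
  linarith

/-- It suffices to prove a lower bound for `defect` on the unit circle and near `∞`: away from the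
circles `|σ^i z| = 1` the function is harmonic. -/
theorem le_defect (h : m.Represents σ) (hB : ∀ j, 0 < B j)
    (hinv : ∀ z : ℂ, (∀ i, m.den i z ≠ 0) → ∀ i j, aeval (m.ev i z) (N j) * aeval z (M j) =
      aeval z (N j) * aeval (m.ev i z) (M j))
    (hM : ∀ z : ℂ, (∀ i, m.den i z ≠ 0) → ∀ j, aeval z (M j) ≠ 0)
    (hcirc : ∀ z : ℂ, ‖z‖ = 1 → z ∈ regular m N → D ≤ m.defect B N M z)
    (hinf : ∀ D' < D, ∃ R : ℝ, ∀ z : ℂ, R < ‖z‖ → z ∈ regular m N → D' ≤ m.defect B N M z)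
    {z : ℂ} (hz : z ∈ regular m N) : D ≤ m.defect B N M z := by
  by_contra! hlt
  -- Two levels are inserted: the value at z is below t, and t < D' < D. The gap between t and D'
  -- keeps the sublevel set of t away from ∞ and from the poles of the σ^i.
  obtain ⟨t, ht1, ht2⟩ := exists_between hlt
  obtain ⟨D', hD1, hD2⟩ := exists_between ht2
  obtain ⟨R, hR⟩ := hinf D' hD2
  -- This sublevel set is compact. Near a pole of some σ^i the value equals that at σ^i x, which is
  -- near ∞, hence is at least D' > t. Near a zero of some N_j the function exceeds t. Beyond the
  -- radius R it is at least D'.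
  set S := {y | y ∈ regular m N ∧ m.defect B N M y ≤ t} with hS
  have hclosed : IsClosed S := by
    rw [← isOpen_compl_iff, isOpen_iff_mem_nhds]
    intro y hy
    suffices ∀ᶠ x in 𝓝 y, x ∈ regular m N → t < m.defect B N M x by
      filter_upwards [this] with x hx hxS
      exact absurd hxS.2 (not_le.2 (hx hxS.1))
    by_cases h1 : ∃ i, m.den i y = 0
    · obtain ⟨i, hi⟩ := h1
      filter_upwards [h.tendsto_norm_ev hi R] with x hx hxr
      rw [← h.defect_ev hinv hM hxr.1 i]
      exact hD1.trans_le (hR _ (hx (hxr.1 i)) (h.mem_regular_ev hinv hM hxr i))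
    · push Not at h1
      by_cases h2 : ∃ j, aeval y (N j) = 0
      · obtain ⟨j, hj⟩ := h2
        exact eventually_lt_defect hB (hM y h1) hj t
      · push Not at h2
        have hyr : y ∈ regular m N := ⟨h1, h2⟩
        have : t < m.defect B N M y := by
          by_contra! hle
          exact hy ⟨hyr, hle⟩
        filter_upwards [(continuousAt_defect hyr (hM y h1)).eventually (lt_mem_nhds this)] with x hx _
        exact hx
  have hcompact : IsCompact S := by
    refine Metric.isCompact_of_isClosed_isBounded hclosed
      ((Metric.isBounded_closedBall (x := (0 : ℂ)) (r := R)).subset fun y hy => ?_)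
    rw [mem_closedBall_zero_iff]
    by_contra! hy'
    linarith [hR y hy' hy.1, hy.2]
  have hcont : ContinuousOn (m.defect B N M) S := fun y hy =>
    (continuousAt_defect hy.1 (hM y hy.1.1)).continuousWithinAt
  obtain ⟨z₁, hz₁, hmin⟩ := hcompact.exists_isMinOn ⟨z, hz, ht1.le⟩ hcont
  have hmin' : ∀ y ∈ regular m N, m.defect B N M z₁ ≤ m.defect B N M y := fun y hy => by
    by_cases hyS : m.defect B N M y ≤ t
    · exact hmin ⟨hy, hyS⟩
    · exact hz₁.2.trans (not_le.1 hyS).le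
  -- The set of minimisers is closed. No σ^i maps a minimiser to the unit circle, because the value
  -- there would be at least D > t; so the function is harmonic at each minimiser, and Z is open. By
  -- connectedness Z = ℂ, which is not compact.
  set Z := {y | y ∈ S ∧ m.defect B N M y = m.defect B N M z₁} with hZ
  have hZc : IsClosed Z := hcont.preimage_isClosed_of_isClosed hclosed
    (isClosed_singleton (x := m.defect B N M z₁))
  have hZo : IsOpen Z := by
    rw [isOpen_iff_mem_nhds]
    intro y hy
    have hyr := hy.1.1
    have hne : ∀ i, ‖m.ev i y‖ ≠ 1 := fun i hi => by
      have e1 := hcirc _ hi (h.mem_regular_ev hinv hM hyr i)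
      rw [h.defect_ev hinv hM hyr.1 i] at e1
      linarith [hy.1.2]
    have e2 : ∀ᶠ x in 𝓝 y, x ∈ regular m N := isOpen_regular.mem_nhds hyr
    have e3 := eventually_eq_of_harmonicAt_of_isLocalMin
      (harmonicAt_defect (B := B) hyr (hM y hyr.1) hne) (by
        filter_upwards [e2] with x hx
        rw [hy.2]
        exact hmin' x hx)
    filter_upwards [e2, e3] with x hx hx'
    exact ⟨⟨hx, by rw [hx']; exact hy.1.2⟩, by rw [hx', hy.2]⟩
  have hZu : Z = Set.univ := IsClopen.eq_univ ⟨hZc, hZo⟩ ⟨z₁, hz₁, rfl⟩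
  have : IsCompact Z := hcompact.of_isClosed_subset hZc fun y hy => hy.1
  rw [hZu] at this
  exact noncompact_univ ℂ this

end Represents
end MatrixSeq
end OrbitHeight

/-! ### Normalised orbit functions and the finiteness of the set of orbits. -/

namespace OrbitHeight
open Polynomial Real

/-- A common divisor is primitive, so it is a unit unless it has positive degree, and then it has a
complex root. -/
theorem isRelPrime_of_forall_aeval_ne {N M : ℤ[X]} (hN : N.IsPrimitive)
    (h : ∀ z : ℂ, aeval z N = 0 → aeval z M ≠ 0) : IsRelPrime N M := by
  intro d hdN hdM
  have hd := isPrimitive_of_dvd hN hdN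
  have hdeg : d.natDegree = 0 := by
    by_contra hne
    obtain ⟨z, hz⟩ := IsAlgClosed.exists_aeval_eq_zero ℂ d (fun h0 => hne
      (natDegree_eq_zero_iff_degree_le_zero.2 h0.le))
    exact h z (by simpa [hz] using (map_dvd (aeval z) hdN))
      (by simpa [hz] using (map_dvd (aeval z) hdM))
  rw [natDegree_eq_zero] at hdeg
  obtain ⟨c, rfl⟩ := hdeg
  exact (hd c dvd_rfl).map C

theorem minpoly_intCast (t : ℤ) :
    minpoly ℚ (t : ℂ) = (X - C t : ℤ[X]).map (Int.castRingHom ℚ) := by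
  have := minpoly.eq_X_sub_C ℂ (t : ℚ)
  simpa using this

/-- The discriminant k² − 4 is negative, so there is no rational root. -/
theorem minpoly_of_quadratic {k : ℤ} (hk : k ^ 2 < 4) {a : ℂ} (ha : a ^ 2 - k * a + 1 = 0) :
    minpoly ℚ a = (X ^ 2 - C k * X + 1 : ℤ[X]).map (Int.castRingHom ℚ) := by
  symm
  have hmon : (X ^ 2 - C k * X + 1 : ℤ[X]).Monic := by monicity!
  have hdeg : (X ^ 2 - C k * X + 1 : ℤ[X]).natDegree = 2 := by compute_degree!
  refine minpoly.eq_of_irreducible_of_monic ?_ ?_ (hmon.map _)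
  · refine irreducible_of_degree_le_three_of_not_isRoot ?_ fun x hx => ?_
    · rw [hmon.natDegree_map, hdeg]; simp
    · simp only [Polynomial.map_add, Polynomial.map_sub, Polynomial.map_mul, Polynomial.map_pow,
        map_X, Polynomial.map_one, IsRoot.def, eval_add, eval_sub, eval_mul, eval_pow,
        eval_X, eval_one, eq_intCast, Polynomial.map_intCast, eval_intCast] at hx
      have hk' : (k : ℚ) ^ 2 < 4 := by exact_mod_cast hk
      nlinarith [sq_nonneg (2 * x - k)]
  · simpa using ha

/-- On the unit circle both squared norms are affine in Re z, and their slopes 2ab and 2cd differ.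
So Re z is determined, and z up to conjugation. -/
theorem finite_circle_inter {a b c d : ℤ} (h : a * b ≠ c * d) :
    {z : ℂ | ‖z‖ = 1 ∧ ‖(a : ℂ) * z + b‖ = ‖(c : ℂ) * z + d‖}.Finite := by
  have hne : (a * b - c * d : ℝ) ≠ 0 := by
    rw [sub_ne_zero]; exact_mod_cast h
  set r : ℝ := (c ^ 2 + d ^ 2 - a ^ 2 - b ^ 2) / (2 * (a * b - c * d)) with hr
  refine (Set.toFinite {(⟨r, √(1 - r ^ 2)⟩ : ℂ), ⟨r, -√(1 - r ^ 2)⟩}).subset ?_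
  rintro z ⟨h1, h2⟩
  have e1 : z.re ^ 2 + z.im ^ 2 = 1 := by
    have := Complex.sq_norm z
    rw [h1, Complex.normSq_apply] at this
    linarith
  have e2 : (a * z.re + b) ^ 2 + (a * z.im) ^ 2 = (c * z.re + d : ℝ) ^ 2 + (c * z.im) ^ 2 := by
    have := congrArg (· ^ 2) h2
    simp only [Complex.sq_norm, Complex.normSq_apply] at this
    simp only [Complex.add_re, Complex.mul_re, Complex.intCast_re, Complex.intCast_im,
      Complex.add_im, Complex.mul_im, zero_mul, sub_zero, add_zero] at this
    linarith
  have e3 : z.re = r := by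
    rw [hr, eq_div_iff (mul_ne_zero two_ne_zero hne)]
    linear_combination e2 + (c ^ 2 - a ^ 2) * e1
  have e4 : z.im ^ 2 = √(1 - r ^ 2) ^ 2 := by
    rw [Real.sq_sqrt (by rw [← e3]; nlinarith [sq_nonneg z.im]), ← e3]; linarith
  rcases sq_eq_sq_iff_eq_or_eq_neg.1 e4 with h | h
  · left; exact Complex.ext e3 h
  · right; exact Complex.ext e3 h

namespace MatrixSeq

variable {n k : ℕ} {m : MatrixSeq n} {σ : PGL(2, ℚ)}

variable (m) in
/-- `N / M` is the normalised orbit function of `O`, in terms of the matrices `m`. -/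
structure Quot (O : Set ℂ) (N M : ℤ[X]) : Prop where
  prim_num : N.IsPrimitive
  prim_den : M.IsPrimitive
  disjoint : ∀ z : ℂ, aeval z N = 0 → aeval z M ≠ 0
  den_ne : ∀ z : ℂ, (∀ i, m.den i z ≠ 0) → aeval z M ≠ 0
  nonempty : O.Nonempty
  formula : ∀ a ∈ O, ∃ f : ℤ[X], minpoly ℚ a = f.map (Int.castRingHom ℚ) ∧ ∃ E : ℤ, E ≠ 0 ∧
    ∀ z : ℂ, (∀ i, m.den i z ≠ 0) → E * aeval z N = aeval z M * ∏ i, aeval (m.ev i z) f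

namespace Quot

variable {O : Set ℂ} {N M : ℤ[X]}

theorem isOrbitFunction (hQ : m.Quot O N M) (h : m.Represents σ) :
    IsOrbitFunction (Subgroup.zpowers σ) (points O) N M := by
  refine ⟨hQ.prim_num, hQ.prim_den, isRelPrime_of_forall_aeval_ne hQ.prim_num hQ.disjoint,
    fun a ha => ?_⟩
  have ha' : a ∈ O := by
    obtain ⟨b, hb, e⟩ := ha
    rwa [← OnePoint.coe_injective e]
  obtain ⟨f, hf, E, hE, hz⟩ := hQ.formula a ha'
  refine ⟨E, by exact_mod_cast hE, fun z hoff => ?_⟩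
  rw [h.off_infty_iff] at hoff
  rw [show ∏ᶠ τ : Subgroup.zpowers σ, aeval (affine (τ • (z : OnePoint ℂ))) (minpoly ℚ a) = _ from
    h.finprod_eq fun τ => aeval (affine (τ • (z : OnePoint ℂ))) (minpoly ℚ a), hf]
  have := hz z hoff
  simp_rw [h.affine_smul (hoff _)]
  simp only [aeval_def, eval₂_map, Rat.cast_intCast] at this ⊢
  rw [this]
  congr 1

/-- The product of f over the orbit does not change when the orbit is permuted. -/
theorem inv (hQ : m.Quot O N M) (h : m.Represents σ) (z : ℂ) (hz : ∀ i, m.den i z ≠ 0)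
    (i : Fin n) : aeval (m.ev i z) N * aeval z M = aeval z N * aeval (m.ev i z) M := by
  obtain ⟨a, ha⟩ := hQ.nonempty
  obtain ⟨f, -, E, hE, hf⟩ := hQ.formula a ha
  obtain ⟨h1, e, he⟩ := h.ev_ev hz i
  have e1 := hf z hz
  have e2 := hf _ h1
  simp_rw [he] at e2
  rw [Equiv.prod_comp e fun i => aeval (m.ev i z) f] at e2
  have hE' : (E : ℂ) ≠ 0 := by exact_mod_cast hE
  apply mul_left_cancel₀ hE'
  linear_combination aeval z M * e2 - aeval (m.ev i z) M * e1

end Quot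

namespace Represents

variable {O : Fin k → Set ℂ} {B : Fin k → ℝ} {N M : Fin k → ℤ[X]} {D : ℝ}

theorem orbitInequality (h : m.Represents σ) (hQ : ∀ j, m.Quot (O j) (N j) (M j))
    (hD : ∀ z ∈ regular m N, D ≤ m.defect B N M z) : OrbitInequality σ O B D := by
  refine ⟨N, M, fun j => (hQ j).isOrbitFunction h, fun z hz hN => ?_⟩
  rw [h.off_infty_iff] at hz
  refine (hD z ⟨hz, hN⟩).trans (le_of_eq ?_)
  rw [defect, h.order, Finset.sum_range]
  simp_rw [h.affine_smul (hz _)]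

theorem weilHeight_coe (z : ℂ) : weilHeight (z : OnePoint ℂ) = NumberField.absLogHeight₁ z := rfl

theorem weilHeight_infty : weilHeight ∞ = 0 := rfl

/-- Both lower bounds, from the inequality on the unit circle, near `∞`, and at the
non-archimedean places. -/
theorem bounds (h : m.Represents σ) (hQ : ∀ j, m.Quot (O j) (N j) (M j)) (hB : ∀ j, 0 < B j)
    (hcirc : ∀ z : ℂ, ‖z‖ = 1 → z ∈ regular m N → D ≤ m.defect B N M z)
    (hinf : ∀ D' < D, ∃ R : ℝ, ∀ z : ℂ, R < ‖z‖ → z ∈ regular m N → D' ≤ m.defect B N M z)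
    (C : Fin k → ℕ) (hC : ∀ j, m.NonarchBound (N j) (M j) (C j)) (hBC : ∑ j, B j * C j ≤ 1)
    (hroots : ∀ j, ∀ z : ℂ, aeval z (N j) = 0 → z = 0 ∨ z ^ 12 = 1) :
    OrbitInequality σ O B D ∧ IsHeightBound σ (algNumbersOffInfty σ) D := by
  have hM : ∀ z : ℂ, (∀ i, m.den i z ≠ 0) → ∀ j, aeval z (M j) ≠ 0 :=
    fun z hz j => (hQ j).den_ne z hz
  have hineq : ∀ z ∈ regular m N, D ≤ m.defect B N M z := fun z hz =>
    h.le_defect hB (fun z hz i j => (hQ j).inv h z hz i) hM hcirc hinf hz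
  refine ⟨h.orbitInequality hQ hineq, fun α hα => ?_⟩
  obtain ⟨halg, hoff⟩ := hα
  rw [h.off_infty_iff] at hoff
  -- By invariance the whole orbit of a zero of N_j consists of zeros of N_j, each of them 0 or a
  -- root of unity. The exponent 12 covers every order that occurs below: 1, 2, 3, 4 and 6.
  by_cases h0 : ∃ j, aeval α (N j) = 0
  · left
    obtain ⟨j, hj⟩ := h0
    rw [h.orbitHeight_eq]
    refine Finset.sum_eq_zero fun i _ => ?_
    rw [h.smul_coe_of_ne (hoff i), weilHeight_coe]
    refine absLogHeight_eq_zero (k := 12) (by norm_num) (hroots j _ ?_)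
    have := (hQ j).inv h α hoff i
    rw [hj, zero_mul] at this
    exact (mul_eq_zero.1 this).resolve_right (hM α hoff j)
  · right
    push Not at h0
    exact h.le_orbitHeight halg hoff h0 (hM α hoff) (fun z hz hN => hineq z ⟨hz, hN⟩)
      (fun j => (hB j).le) C hC hBC

theorem isHeightBound_algNumbers (h : m.Represents σ)
    (hb : IsHeightBound σ (algNumbersOffInfty σ) D)
    (hinf : ∀ α : ℂ, (∃ i, m.den i α = 0) →
      orbitHeight (Subgroup.zpowers σ) (α : OnePoint ℂ) = 0 ∨
      D ≤ orbitHeight (Subgroup.zpowers σ) (α : OnePoint ℂ)) : IsHeightBound σ algNumbers D := by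
  intro α hα
  by_cases h0 : ∃ i, m.den i α = 0
  · exact hinf α h0
  · push Not at h0
    exact hb α ⟨hα, (h.off_infty_iff α).2 h0⟩

/-- An orbit of this kind contains some finite z with σ^i z finite too. Then z = 0, or σ^i z = 0, or
both points lie on the unit circle, and the hypothesis on the matrix leaves finitely many z of the
last kind. -/
theorem finite_unitOrbits (h : m.Represents σ) (i : Fin n)
    (hi : m.a i * m.b i ≠ m.c i * m.d i) : (unitOrbits (Subgroup.zpowers σ)).Finite := by
  set T : Set ℂ := {0} ∪ {z | m.num i z = 0} ∪
    {z : ℂ | ‖z‖ = 1 ∧ ‖(m.a i : ℂ) * z + m.b i‖ = ‖(m.c i : ℂ) * z + m.d i‖} with hT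
  have hTfin : T.Finite := by
    refine ((Set.finite_singleton _).union (Set.Subsingleton.finite ?_)).union
      (finite_circle_inter hi)
    intro z hz w hw
    simp only [Set.mem_ofPred_eq, num] at hz hw
    have ha : (m.a i : ℂ) ≠ 0 := by
      intro h0
      rw [h0, zero_mul, zero_add] at hz
      apply h.det_ne i
      have h1 : m.a i = 0 := by exact_mod_cast h0
      have h2 : m.b i = 0 := by exact_mod_cast hz
      rw [h1, h2]; ring
    apply mul_left_cancel₀ ha
    linear_combination hz - hw
  refine (hTfin.image fun z : ℂ => MulAction.orbit (Subgroup.zpowers σ) (z : OnePoint ℂ)).subset ?_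
  rintro O ⟨⟨x, rfl⟩, hO⟩
  obtain ⟨z, rfl, hz⟩ := hO x (MulAction.mem_orbit_self x)
  refine ⟨z, ?_, rfl⟩
  obtain ⟨w, hw, hw'⟩ := hO (σ ^ (i : ℕ) • (z : OnePoint ℂ)) (by rw [h.orbit_eq]; exact ⟨i, rfl⟩)
  have hd : m.den i z ≠ 0 := by
    intro h0
    rw [h.smul_coe, if_pos h0] at hw
    exact OnePoint.infty_ne_coe _ hw
  rw [h.smul_coe_of_ne hd, OnePoint.coe_eq_coe] at hw
  subst hw
  rcases hz with hz | hz
  · left; left; exact hz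
  · rcases hw' with hw | hw
    · left; right
      exact (div_eq_zero_iff.1 hw).resolve_right hd
    · right
      refine ⟨hz, ?_⟩
      rw [ev, norm_div, div_eq_one_iff_eq (norm_ne_zero_iff.2 hd)] at hw
      exact hw

theorem hasOrbits (h : m.Represents σ) (hi : ∃ i, m.a i * m.b i ≠ m.c i * m.d i)
    (hO : ∀ j, (∀ z ∈ O j, z = 0 ∨ ‖z‖ = 1) ∧ ∃ x : ℂ, (∀ i, m.den i x ≠ 0) ∧
      O j = Set.range fun i => m.ev i x) : HasOrbits σ n O := by
  obtain ⟨i, hi⟩ := hi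
  refine ⟨h.order, h.finite_unitOrbits i hi, fun j => ?_⟩
  obtain ⟨h1, x, hx, e⟩ := hO j
  refine ⟨⟨x, ?_⟩, ?_⟩
  · rw [h.orbit_eq]
    simp_rw [h.smul_coe_of_ne (hx _)]
    rw [points, e, ← Set.range_comp]
    rfl
  · rintro _ ⟨z, hz, rfl⟩
    exact ⟨z, rfl, h1 z hz⟩

end Represents
end MatrixSeq
end OrbitHeight

/-! ### Computing powers of Möbius maps; involutions; estimates near ∞ and at finite places. -/

namespace OrbitHeight
open Polynomial Real Matrix

theorem eq_of_moebius_eq_one {a b c d : ℚ} {h : a * d - b * c ≠ 0} (h1 : moebius a b c d h = 1) :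
    b = 0 ∧ c = 0 ∧ a = d := by
  rw [moebius, ← map_one Matrix.ProjGenLinGroup.mk, eq_comm,
    Matrix.ProjGenLinGroup.mk_eq_mk_iff] at h1
  obtain ⟨u, hu⟩ := h1
  have e : ∀ i j, (Matrix.GeneralLinearGroup.scalar (Fin 2) u : Matrix (Fin 2) (Fin 2) ℚ) i j =
      !![a, b; c, d] i j := fun i j => by
    rw [one_mul] at hu
    rw [hu]; rfl
  have e00 := e 0 0
  have e01 := e 0 1
  have e10 := e 1 0
  have e11 := e 1 1
  simp at e00 e01 e10 e11
  exact ⟨e01.symm, e10.symm, e00.symm.trans e11⟩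

/-- In PGL₂ a common factor k of the product matrix may be cancelled, which keeps the listed
matrices small. -/
theorem exists_pow_succ_eq_moebius {σ : PGL(2, ℚ)} {i : ℕ} {a b c d a' b' c' d' : ℤ}
    (hi : ∃ h, σ ^ i = moebius a b c d h) (h1 : ∃ h, σ = moebius a' b' c' d' h)
    (k A B C D : ℤ) (hk : k ≠ 0) (hA : a * a' + b * c' = k * A) (hB : a * b' + b * d' = k * B)
    (hC : c * a' + d * c' = k * C) (hD : c * b' + d * d' = k * D) :
    ∃ h, σ ^ (i + 1) = moebius A B C D h := by
  obtain ⟨h, e⟩ := hi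
  obtain ⟨h', e'⟩ := h1
  obtain ⟨h'', e''⟩ := moebius_mul _ _ _ _ _ _ _ _ h h'
  have hk' : (k : ℚ) ≠ 0 := by exact_mod_cast hk
  have eA : (a * a' + b * c' : ℚ) = k * A := by exact_mod_cast hA
  have eB : (a * b' + b * d' : ℚ) = k * B := by exact_mod_cast hB
  have eC : (c * a' + d * c' : ℚ) = k * C := by exact_mod_cast hC
  have eD : (c * b' + d * d' : ℚ) = k * D := by exact_mod_cast hD
  obtain ⟨h3, e3⟩ := moebius_eq_of_smul (k : ℚ)⁻¹ _ _ _ _ A B C D h'' (inv_ne_zero hk')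
    (by rw [eA, inv_mul_cancel_left₀ hk']) (by rw [eB, inv_mul_cancel_left₀ hk'])
    (by rw [eC, inv_mul_cancel_left₀ hk']) (by rw [eD, inv_mul_cancel_left₀ hk'])
  refine ⟨h3, ?_⟩
  rw [pow_succ, e]
  conv_lhs => rw [e']
  rw [e'', e3]

theorem MatrixSeq.Represents.of_pow {n : ℕ} {m : MatrixSeq n} {σ : PGL(2, ℚ)} (hn : 0 < n)
    (hpow : ∀ i : Fin n, ∃ h, σ ^ (i : ℕ) = moebius (m.a i) (m.b i) (m.c i) (m.d i) h)
    (t : ℤ) (hlast : ∃ h, σ ^ n = moebius t (0 : ℤ) (0 : ℤ) t h)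
    (hne : ∀ i : Fin n, 0 < (i : ℕ) → ¬ (m.b i = 0 ∧ m.c i = 0 ∧ m.a i = m.d i)) :
    m.Represents σ := by
  refine ⟨hn, (orderOf_eq_iff hn).2 ⟨?_, fun j hj hj0 h1 => ?_⟩, hpow⟩
  · obtain ⟨h, e⟩ := hlast
    rw [e]
    have := moebius_scalar (t : ℚ) (by simpa using h)
    simpa using this
  · obtain ⟨h, e⟩ := hpow ⟨j, hj⟩
    rw [h1] at e
    have := eq_of_moebius_eq_one e.symm
    exact hne ⟨j, hj⟩ hj0 (by exact_mod_cast this)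

theorem exists_pow_zero_eq_moebius (σ : PGL(2, ℚ)) :
    ∃ h, σ ^ 0 = moebius (1 : ℤ) (0 : ℤ) (0 : ℤ) (1 : ℤ) h := by
  refine ⟨by norm_num, ?_⟩
  have := moebius_scalar 1 (by norm_num)
  simpa using this.symm

/-- The matrices of the group generated by the involution `(q, b; c, -q)`. -/
def involution (q b c : ℤ) : MatrixSeq 2 := ⟨![1, q], ![0, b], ![0, c], ![1, -q]⟩

section involution
variable {q b c : ℤ} {K : Type*} [Field K]

@[simp] theorem involution_num_zero (x : K) : (involution q b c).num 0 x = x := by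
  simp [involution, MatrixSeq.num]
@[simp] theorem involution_den_zero (x : K) : (involution q b c).den 0 x = 1 := by
  simp [involution, MatrixSeq.den]
@[simp] theorem involution_num_one (x : K) : (involution q b c).num 1 x = q * x + b := by
  simp [involution, MatrixSeq.num]
@[simp] theorem involution_den_one (x : K) : (involution q b c).den 1 x = c * x - q := by
  simp [involution, MatrixSeq.den, sub_eq_add_neg]
@[simp] theorem involution_ev_zero (x : K) : (involution q b c).ev 0 x = x := by
  simp [MatrixSeq.ev]
@[simp] theorem involution_ev_one (x : K) :
    (involution q b c).ev 1 x = (q * x + b) / (c * x - q) := by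
  simp [MatrixSeq.ev]

/-- A matrix of trace zero squares to a scalar, here q² + bc. -/
theorem involution_represents {σ : PGL(2, ℚ)} (hq : q ≠ 0)
    (h : ∃ h, σ = moebius q b c (-q : ℤ) h) : (involution q b c).Represents σ := by
  have h1 : ∃ h, σ ^ 1 = moebius q b c (-q : ℤ) h := by simpa using h
  refine .of_pow (by norm_num) ?_ (q * q + b * c) ?_ ?_
  · intro i
    fin_cases i
    · exact exists_pow_zero_eq_moebius σ
    · exact h1
  · exact exists_pow_succ_eq_moebius h1 h 1 _ _ _ _ one_ne_zero (by ring) (by ring) (by ring)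
      (by ring)
  · intro i hi
    fin_cases i
    · simp at hi
    · rintro ⟨-, -, h3⟩
      simp only [involution, Fin.mk_one, Matrix.cons_val_one, Matrix.cons_val_fin_one] at h3
      omega

theorem exists_eq_moebius_of_div {σ : PGL(2, ℚ)} {b' c' : ℚ} {hdet} (hq : q ≠ 0)
    (hσ : σ = moebius 1 b' c' (-1) hdet) (hb : q * b' = b) (hc : q * c' = c) :
    ∃ h, σ = moebius q b c (-q : ℤ) h := by
  rw [hσ]
  exact moebius_eq_of_smul q _ _ _ _ _ _ _ _ hdet (by exact_mod_cast hq) (by ring) hb.symm hc.symm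
    (by push_cast; ring)

theorem involution_off_iff {x : K} :
    (∀ i, (involution q b c).den i x ≠ 0) ↔ (c : K) * x - q ≠ 0 := by
  simp [Fin.forall_fin_two]

end involution

/-- For `‖z‖` large the `defect` is large, if it grows at least like `δ log ‖z‖`. -/
theorem exists_radius_of_growth {f : ℂ → ℝ} {S : Set ℂ} {δ c R₀ : ℝ} (hδ : 0 < δ)
    (h : ∀ z ∈ S, R₀ < ‖z‖ → δ * log ‖z‖ - c ≤ f z) (D' : ℝ) :
    ∃ R : ℝ, ∀ z : ℂ, R < ‖z‖ → z ∈ S → D' ≤ f z := by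
  refine ⟨max R₀ (Real.exp ((D' + c) / δ)), fun z hz hzS => ?_⟩
  have h1 := h z hzS ((le_max_left _ _).trans_lt hz)
  have h2 : (D' + c) / δ ≤ log ‖z‖ := by
    rw [Real.le_log_iff_exp_le ((Real.exp_pos _).trans ((le_max_right _ _).trans_lt hz))]
    exact ((le_max_right _ _).trans_lt hz).le
  rw [div_le_iff₀ hδ] at h2
  linarith

theorem posLog_div_add_log {x y : ℝ} (hx : 0 ≤ x) (hy : 0 < y) :
    log⁺ (x / y) + log y = log (max x y) := by
  rw [posLog_eq_log_max_one (by positivity), ← Real.log_mul (by positivity) hy.ne',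
    max_mul_of_nonneg _ _ hy.le, div_mul_cancel₀ _ hy.ne', one_mul, max_comm]

theorem IsPrimitive.linear {q c : ℤ} (h : IsCoprime q c) : (C c * X - C q : ℤ[X]).IsPrimitive := by
  intro r hr
  rw [C_dvd_iff_dvd_coeff] at hr
  have h0 := hr 0
  have h1 := hr 1
  simp only [coeff_sub, coeff_C_mul, coeff_X_zero, mul_zero, coeff_C_zero, zero_sub, dvd_neg,
    coeff_X_one, mul_one, coeff_C_succ, sub_zero] at h0 h1
  exact h.isUnit_of_dvd' h0 h1

theorem IsPrimitive.pow {p : ℤ[X]} (hp : p.IsPrimitive) (e : ℕ) : (p ^ e).IsPrimitive := by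
  induction e with
  | zero => simp
  | succ e ih => rw [pow_succ]; exact ih.mul hp

theorem nonarch_add_le {F : Type*} [Field F] {v : AbsoluteValue F ℝ} (hv : IsNonarchimedean v)
    {x y : F} {r : ℝ} (hx : v x ≤ r) (hy : v y ≤ r) : v (x + y) ≤ r :=
  (hv x y).trans (max_le hx hy)

theorem nonarch_sub_le {F : Type*} [Field F] {v : AbsoluteValue F ℝ} (hv : IsNonarchimedean v)
    {x y : F} {r : ℝ} (hx : v x ≤ r) (hy : v y ≤ r) : v (x - y) ≤ r := by
  rw [sub_eq_add_neg]
  exact nonarch_add_le hv hx (by rwa [v.map_neg])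

theorem nonarch_int_mul_le {F : Type*} [Field F] {v : AbsoluteValue F ℝ} (hv' : ∀ t : ℤ, v t ≤ 1)
    (t : ℤ) {x : F} {r : ℝ} (hx : v x ≤ r) : v (t * x) ≤ r := by
  rw [map_mul]
  exact (mul_le_of_le_one_left (v.nonneg _) (hv' t)).trans hx

end OrbitHeight

/-! ### Involutions whose orbit function is a power of a quadratic over a linear polynomial. -/

namespace OrbitHeight
open Polynomial Real Matrix

section family

variable {q b c u w : ℤ}

/-- The quadratic polynomial `X² + u X + w`. -/
noncomputable def quad (u w : ℤ) : ℤ[X] := X ^ 2 + C u * X + C w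

theorem quad_monic (u w : ℤ) : (quad u w).Monic := by
  unfold quad; monicity!

theorem aeval_quad {K : Type*} [Field K] (x : K) : aeval x (quad u w) = x ^ 2 + u * x + w := by
  simp [quad]

theorem aeval_linear {K : Type*} [Field K] (x : K) :
    aeval x (C c * X - C q : ℤ[X]) = c * x - q := by
  simp

-- This relation says that the involution interchanges the two roots r, r' of X² + uX + w: the
-- equation r'(cr − q) = qr + b reads c·rr' − q(r + r') = b, where rr' = w and r + r' = −u.
variable (hb : b = q * u + w * c)
include hb

theorem quad_mul_fst {K : Type*} [Field K] (x : K) :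
    (q : K) * (x ^ 2 + u * x + w) = x * (q * x + b) - w * (c * x - q) := by
  rw [hb]; push_cast; ring

theorem quad_mul_snd {K : Type*} [Field K] (x : K) :
    (c : K) * (x ^ 2 + u * x + w) = x * (c * x - q) + u * (c * x - q) + (q * x + b) := by
  rw [hb]; push_cast; ring

/-- Both q and c times the quadratic are integral combinations of products of {1, x} with the
numerator and denominator of σx. As q and c are coprime, a Bézout relation recovers the quadratic
itself without loss at a finite place. -/
theorem quad_nonarch_le (hcop : IsCoprime q c) {F : Type*} [Field F] {v : AbsoluteValue F ℝ}
    (hv : IsNonarchimedean v) (hv' : ∀ t : ℤ, v t ≤ 1) (x : F) :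
    v (x ^ 2 + u * x + w) ≤ max 1 (v x) * max (v (c * x - q)) (v (q * x + b)) := by
  set r := max 1 (v x) * max (v (c * x - q)) (v (q * x + b)) with hr
  have h1 : ∀ y : F, (v y ≤ max (v (c * x - q)) (v (q * x + b))) → v y ≤ r ∧ v (x * y) ≤ r :=
    fun y hy => ⟨hy.trans (le_mul_of_one_le_left ((v.nonneg _).trans hy) (le_max_left _ _)), by
      rw [map_mul]
      exact mul_le_mul (le_max_right _ _) hy (v.nonneg _) (by positivity)⟩
  obtain ⟨hL1, hxL1⟩ := h1 (q * x + b) (le_max_right _ _)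
  obtain ⟨hL2, hxL2⟩ := h1 (c * x - q) (le_max_left _ _)
  have hqQ : v ((q : F) * (x ^ 2 + u * x + w)) ≤ r := by
    rw [quad_mul_fst hb]
    exact nonarch_sub_le hv hxL1 (nonarch_int_mul_le hv' _ hL2)
  have hcQ : v ((c : F) * (x ^ 2 + u * x + w)) ≤ r := by
    rw [quad_mul_snd hb]
    exact nonarch_add_le hv (nonarch_add_le hv hxL2 (nonarch_int_mul_le hv' _ hL2)) hL1
  obtain ⟨s, t, hst⟩ := hcop
  have hst' : (s : F) * q + t * c = 1 := by exact_mod_cast congrArg (Int.cast (R := F)) hst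
  have : x ^ 2 + (u : F) * x + w =
      s * (q * (x ^ 2 + u * x + w)) + t * (c * (x ^ 2 + u * x + w)) := by
    linear_combination -(x ^ 2 + (u : F) * x + w) * hst'
  rw [this]
  exact nonarch_add_le hv (nonarch_int_mul_le hv' _ hqQ) (nonarch_int_mul_le hv' _ hcQ)

omit hb in
-- The weight 1/e cancels the exponent e, and log|cz − q| from the denominator of φ turns log⁺|σz|
-- into a maximum.
theorem involution_defect {e : ℕ} (he : e ≠ 0) {z : ℂ} (hz : (c : ℂ) * z - q ≠ 0)
    (hQ : z ^ 2 + u * z + w ≠ 0) :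
    (involution q b c).defect ![1 / (e : ℝ)] ![quad u w ^ e] ![(C c * X - C q) ^ e] z =
      log⁺ ‖z‖ + log (max ‖(q : ℂ) * z + b‖ ‖(c : ℂ) * z - q‖) - log ‖z ^ 2 + u * z + w‖ := by
  have h1 : 0 < ‖(c : ℂ) * z - q‖ := norm_pos_iff.2 hz
  have he' : (e : ℝ) ≠ 0 := by exact_mod_cast he
  simp only [MatrixSeq.defect, Fin.sum_univ_two, involution_ev_zero, involution_ev_one,
    Finset.univ_unique, Fin.default_eq_zero, Matrix.cons_val_fin_one, Finset.sum_singleton,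
    map_pow, aeval_quad, aeval_linear]
  rw [← div_pow, norm_pow, Real.log_pow, norm_div, norm_div,
    Real.log_div (norm_ne_zero_iff.2 hQ) h1.ne', ← posLog_div_add_log (norm_nonneg _) h1]
  field_simp
  ring

/-- The parametrised involutions, for which the orbit function is `((X² + uX + w) / (cX - q))^e`
or a root of it. -/
theorem involution_bounds {σ : PGL(2, ℚ)} {O : Set ℂ} {e : ℕ} {R : ℝ} (hq : 0 < q)
    (hcop : IsCoprime q c) (hσ : ∃ h, σ = moebius q b c (-q : ℤ) h) (he : e ≠ 0)
    (hne : O.Nonempty)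
    (hO : ∀ a ∈ O, ∃ f : ℤ[X], minpoly ℚ a = f.map (Int.castRingHom ℚ) ∧ ∃ E : ℤ, E ≠ 0 ∧
      ∀ z : ℂ, (c : ℂ) * z - q ≠ 0 → E * (z ^ 2 + u * z + w) ^ e =
        (c * z - q) ^ e * (aeval z f * aeval ((q * z + b) / (c * z - q)) f))
    (hroots : ∀ z : ℂ, z ^ 2 + u * z + w = 0 → z = 0 ∨ z ^ 12 = 1)
    (hR : 0 < R) (hRc : R ≤ max (q : ℝ) |(c : ℝ)|)
    (hcirc : ∀ z : ℂ, ‖z‖ = 1 → R * ‖z ^ 2 + u * z + w‖ ≤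
      max ‖(q : ℂ) * z + b‖ ‖(c : ℂ) * z - q‖) :
    OrbitInequality σ ![O] ![1 / (e : ℝ)] (log R) ∧ IsHeightBound σ algNumbers (log R) := by
  have hrep := involution_represents hq.ne' hσ
  have hmax : ∀ z : ℂ, (c : ℂ) * z - q ≠ 0 → 0 < max ‖(q : ℂ) * z + b‖ ‖(c : ℂ) * z - q‖ :=
    fun z hz => lt_max_of_lt_right (norm_pos_iff.2 hz)
  have hreg : ∀ z ∈ MatrixSeq.regular (involution q b c) ![quad u w ^ e],
      (c : ℂ) * z - q ≠ 0 ∧ z ^ 2 + u * z + w ≠ 0 := fun z hz => by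
    refine ⟨involution_off_iff.1 hz.1, fun h0 => hz.2 0 ?_⟩
    simp [aeval_quad, h0, he]
  have hQ : (involution q b c).Quot O (quad u w ^ e) ((C c * X - C q) ^ e) := by
    refine ⟨IsPrimitive.pow (quad_monic u w).isPrimitive e,
      IsPrimitive.pow (IsPrimitive.linear hcop) e, fun z h1 h2 => ?_, fun z hz => ?_, hne, ?_⟩
    · rw [map_pow, pow_eq_zero_iff he, aeval_quad] at h1
      rw [map_pow, pow_eq_zero_iff he, aeval_linear] at h2
      have h3 := quad_mul_snd hb z
      rw [h1, h2] at h3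
      refine hrep.num_ne (i := 1) (z := z) (by simpa using h2) ?_
      rw [involution_num_one]
      linear_combination -h3
    · rw [map_pow, aeval_linear]
      exact pow_ne_zero _ (involution_off_iff.1 hz)
    · intro a ha
      obtain ⟨f, hf, E, hE, h⟩ := hO a ha
      refine ⟨f, hf, E, hE, fun z hz => ?_⟩
      have := h z (involution_off_iff.1 hz)
      simpa only [map_pow, aeval_quad, aeval_linear, Fin.prod_univ_two, involution_ev_zero,
        involution_ev_one] using this
  have hb1 := hrep.bounds (O := ![O]) (N := ![quad u w ^ e]) (M := ![(C c * X - C q) ^ e])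
    (B := ![1 / (e : ℝ)]) (D := log R)
    (fun j => by fin_cases j; exact hQ)
    (fun j => by
      fin_cases j
      have : (0 : ℝ) < e := by exact_mod_cast Nat.pos_of_ne_zero he
      simpa using this)
    (fun z hz hzr => by
      obtain ⟨h1, h2⟩ := hreg z hzr
      have hn := norm_pos_iff.2 h2
      rw [involution_defect he h1 h2, hz, posLog_one, zero_add,
        ← Real.log_div (hmax z h1).ne' hn.ne']
      exact Real.log_le_log hR ((le_div_iff₀ hn).2 (hcirc z hz)))
    (fun D' hD' => by
      have hlt : Real.exp D' < max (q : ℝ) |(c : ℝ)| :=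
        ((Real.lt_log_iff_exp_lt hR).1 hD').trans_le hRc
      -- In the coordinate y = 1/z the exponential of the defect extends continuously to y = 0, with
      -- value max(q, |c|) ≥ R > exp D'.
      set G : ℂ → ℝ := fun y => max ‖(q : ℂ) + b * y‖ ‖(c : ℂ) - q * y‖ /
        ‖1 + u * y + w * y ^ 2‖ with hG
      have hG0 : G 0 = max (q : ℝ) |(c : ℝ)| := by
        have : |(q : ℝ)| = q := abs_of_pos (by exact_mod_cast hq)
        simp [hG, this]
      have hGc : ContinuousAt G 0 := by
        refine ContinuousAt.div (by fun_prop) (by fun_prop) (by simp)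
      obtain ⟨δ, hδ, hball⟩ := Metric.eventually_nhds_iff.1
        (hGc.eventually (lt_mem_nhds (hG0 ▸ hlt)))
      refine ⟨max 1 δ⁻¹, fun z hz hzr => ?_⟩
      obtain ⟨h1, h2⟩ := hreg z hzr
      have hz1 : 1 < ‖z‖ := (le_max_left _ _).trans_lt hz
      have hz0 : z ≠ 0 := by rintro rfl; simp at hz1; linarith
      have h3 := hball (y := z⁻¹) (by
        rw [dist_zero_right, norm_inv]
        exact inv_lt_of_inv_lt₀ hδ ((le_max_right _ _).trans_lt hz))
      have hn := norm_pos_iff.2 h2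
      have e1 : G z⁻¹ = ‖z‖ * max ‖(q : ℂ) * z + b‖ ‖(c : ℂ) * z - q‖ / ‖z ^ 2 + u * z + w‖ := by
        have a1 : (q : ℂ) + b * z⁻¹ = (q * z + b) / z := by field_simp
        have a2 : (c : ℂ) - q * z⁻¹ = (c * z - q) / z := by field_simp
        have a3 : 1 + (u : ℂ) * z⁻¹ + w * z⁻¹ ^ 2 = (z ^ 2 + u * z + w) / z ^ 2 := by field_simp
        have hzp : 0 < ‖z‖ := by linarith
        simp only [hG, a1, a2, a3, norm_div, norm_pow]
        rw [max_div_div_right hzp.le]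
        field_simp
      rw [e1] at h3
      rw [involution_defect he h1 h2, posLog_eq_log (by rw [abs_norm]; exact hz1.le),
        ← Real.log_mul (by linarith) (hmax z h1).ne',
        ← Real.log_div (mul_pos (by linarith) (hmax z h1)).ne' hn.ne',
        Real.le_log_iff_exp_le (div_pos (mul_pos (by linarith) (hmax z h1)) hn)]
      exact h3.le)
    ![e]
    (fun j => by
      fin_cases j
      intro F _ v hv hv' x
      simp only [Fin.zero_eta, Matrix.cons_val_zero, map_pow, aeval_quad, aeval_linear,
        Fin.prod_univ_two, involution_den_zero, involution_den_one, involution_num_zero,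
        involution_num_one, map_one, one_pow, one_mul]
      rw [mul_comm]
      gcongr
      rw [← mul_pow]
      exact pow_le_pow_left₀ (v.nonneg _) (quad_nonarch_le hb hcop hv hv' x) e)
    (by
      have : (e : ℝ) ≠ 0 := by exact_mod_cast he
      simp [this])
    (fun j z hj => by
      fin_cases j
      apply hroots
      simpa [aeval_quad, he] using hj)
  -- The finite point that can share an orbit with ∞ is q/c, in lowest terms. Its orbit height is
  -- log max(q, |c|), so the hypothesis needed near ∞ also settles this orbit.
  refine ⟨hb1.1, hrep.isHeightBound_algNumbers hb1.2 fun α hα => Or.inr ?_⟩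
  obtain ⟨i, hi⟩ := hα
  fin_cases i
  · simp at hi
  · simp only [Fin.mk_one, involution_den_one] at hi
    have hc : c ≠ 0 := by
      rintro rfl
      simp at hi
      omega
    have hα : α = (q : ℂ) / c := by
      rw [eq_div_iff (by exact_mod_cast hc)]; linear_combination hi
    rw [hrep.orbitHeight_eq, Fin.sum_univ_two, hrep.smul_coe, hrep.smul_coe, if_neg (by simp),
      if_pos (by simpa using hi), involution_ev_zero, MatrixSeq.Represents.weilHeight_coe,
      MatrixSeq.Represents.weilHeight_infty, add_zero, hα, absLogHeight_ratio hc hcop]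
    refine Real.log_le_log hR (hRc.trans (le_of_eq ?_))
    rw [abs_of_pos (show (0 : ℝ) < q by exact_mod_cast hq)]

omit hb in
-- The point ±1 has height 0, so only σ(±1) = A/B counts, after cancelling the common factor t. The
-- case B = 0 is included: then A = ±1 and both sides are 0.
theorem involution_orbitHeight_sign {σ : PGL(2, ℚ)} (hq : q ≠ 0)
    (hσ : ∃ h, σ = moebius q b c (-q : ℤ) h) {ε t A B : ℤ} (hε : ε = 1 ∨ ε = -1) (ht : t ≠ 0)
    (hA : q * ε + b = t * A) (hB : c * ε - q = t * B) (hAB : IsCoprime A B) :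
    orbitHeight (Subgroup.zpowers σ) ((ε : ℂ) : OnePoint ℂ) = log (max |(A : ℝ)| |(B : ℝ)|) := by
  have hrep := involution_represents hq hσ
  have h0 : NumberField.absLogHeight₁ (ε : ℂ) = 0 :=
    absLogHeight_eq_zero (k := 2) two_ne_zero (Or.inr (by rcases hε with rfl | rfl <;> norm_num))
  have hA' : (q : ℂ) * ε + b = t * A := by exact_mod_cast hA
  have hB' : (c : ℂ) * ε - q = t * B := by exact_mod_cast hB
  have ht' : (t : ℂ) ≠ 0 := by exact_mod_cast ht
  rw [hrep.orbitHeight_eq, Fin.sum_univ_two, hrep.smul_coe, hrep.smul_coe, if_neg (by simp),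
    involution_ev_zero, MatrixSeq.Represents.weilHeight_coe, h0, zero_add, involution_den_one,
    involution_ev_one, hA', hB']
  split_ifs with hd
  · have hB0 : B = 0 := by
      rcases mul_eq_zero.1 hd with h | h
      · exact absurd h ht'
      · exact_mod_cast h
    subst hB0
    have hA1 : |(A : ℝ)| = 1 := by
      have := Int.isUnit_iff_abs_eq.1 (isCoprime_zero_right.1 hAB)
      exact_mod_cast this
    rw [MatrixSeq.Represents.weilHeight_infty, hA1]
    simp
  · have hB0 : B ≠ 0 := by
      rintro rfl
      simp at hd
    rw [mul_div_mul_left _ _ ht', MatrixSeq.Represents.weilHeight_coe, absLogHeight_ratio hB0 hAB]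

omit hb in
theorem involution_hasOrbits {σ : PGL(2, ℚ)} (hq : q ≠ 0)
    (hσ : ∃ h, σ = moebius q b c (-q : ℤ) h) (hbc : b + c ≠ 0) {k : ℕ} {O : Fin k → Set ℂ}
    (hO : ∀ j, (∀ z ∈ O j, z = 0 ∨ ‖z‖ = 1) ∧ ∃ x : ℂ, (c : ℂ) * x - q ≠ 0 ∧
      O j = {x, (q * x + b) / (c * x - q)}) : HasOrbits σ 2 O := by
  refine (involution_represents hq hσ).hasOrbits ⟨1, ?_⟩ fun j => ⟨(hO j).1, ?_⟩
  · simp only [involution, Matrix.cons_val_one, Matrix.cons_val_fin_one]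
    intro h
    apply hbc
    have : q * (b + c) = 0 := by linear_combination h
    exact (mul_eq_zero.1 this).resolve_left hq
  · obtain ⟨x, hx, e⟩ := (hO j).2
    refine ⟨x, involution_off_iff.2 hx, ?_⟩
    rw [e]
    ext y
    simp [Fin.exists_fin_two, eq_comm]

end family

end OrbitHeight

/-! ### The orbits {0} and {0, −s}. -/

namespace OrbitHeight
open Polynomial Real Matrix

theorem norm_sq_linear {z : ℂ} (hz : ‖z‖ = 1) (a b : ℝ) :
    ‖(a : ℂ) * z + b‖ ^ 2 = a ^ 2 + b ^ 2 + 2 * a * b * z.re := by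
  have h1 : z.re ^ 2 + z.im ^ 2 = 1 := by
    have := Complex.sq_norm z
    rw [hz, Complex.normSq_apply] at this
    linarith
  rw [Complex.sq_norm, Complex.normSq_apply]
  simp
  linear_combination a ^ 2 * h1

/-- On the circle 1 = z·z̄, so a palindromic quadratic is z times a real number. -/
theorem norm_quad_palindromic {z : ℂ} (hz : ‖z‖ = 1) (u : ℝ) :
    ‖z ^ 2 + u * z + 1‖ = |2 * z.re + u| := by
  have h0 : z ≠ 0 := by rintro rfl; simp at hz
  have h1 : z * (starRingEnd ℂ) z = 1 := by
    rw [Complex.mul_conj, Complex.normSq_eq_norm_sq, hz]; simp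
  have h2 : z ^ 2 + u * z + 1 = z * ((2 * z.re + u : ℝ) : ℂ) := by
    have := Complex.add_conj z
    push_cast at this ⊢
    linear_combination (-1 : ℂ) * h1 + z * this
  rw [h2, norm_mul, hz, one_mul, Complex.norm_real, Real.norm_eq_abs]

theorem re_mem_of_norm_one {z : ℂ} (hz : ‖z‖ = 1) : -1 ≤ z.re ∧ z.re ≤ 1 :=
  abs_le.1 (hz ▸ Complex.abs_re_le_norm z)

theorem mul_norm_le_of_sq {R x y : ℝ} (hy : 0 ≤ y) (h : R ^ 2 * x ^ 2 ≤ y ^ 2) : R * x ≤ y :=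
  le_of_sq_le_sq (by rw [mul_pow]; exact h) hy

theorem max_mul_norm_le {a b x y₁ y₂ : ℝ} (hx : 0 ≤ x) (ha : a * x ≤ max y₁ y₂)
    (hb : b * x ≤ max y₁ y₂) : max a b * x ≤ max y₁ y₂ := by
  rw [max_mul_of_nonneg _ _ hx]
  exact max_le ha hb


theorem minpoly_zero : minpoly ℚ (0 : ℂ) = (X - C 0 : ℤ[X]).map (Int.castRingHom ℚ) := by
  rw [← minpoly_intCast, Int.cast_zero]

theorem mem_algNumbers_sign {ε : ℤ} : (ε : ℂ) ∈ algNumbers := by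
  have := isAlgebraic_algebraMap (R := ℚ) (A := ℂ) (ε : ℚ)
  simpa [algNumbers] using this

theorem sign_pow_twelve {s : ℤ} (hs : s = 1 ∨ s = -1) : (s : ℂ) ^ 12 = 1 := by
  rcases hs with rfl | rfl <;> norm_num

theorem norm_sign {s : ℤ} (hs : s = 1 ∨ s = -1) : ‖(s : ℂ)‖ = 1 := by
  rcases hs with rfl | rfl <;> simp

theorem sign_mul_self {s : ℤ} (hs : s = 1 ∨ s = -1) : s * s = 1 := by
  rcases hs with rfl | rfl <;> norm_num

/-- Here the quadratic is z², of norm 1 on the circle. The numerator of σz has norm q, and the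
reverse triangle inequality bounds the denominator; that inequality is sharp at z = sign p. -/
theorem parametrised_zero {p q : ℤ} (hq : 0 < q) (hpq : IsCoprime p q) (hp : p ≠ 0)
    (hdet : (1 : ℚ) * (-1) - 0 * ((p : ℚ) / q) ≠ 0) (σ : PGL(2, ℚ)) (D : ℝ)
    (hσ : σ = moebius 1 0 ((p : ℚ) / q) (-1) hdet)
    (hD : D = Real.log (max |(|(p : ℝ)| - q)| |(q : ℝ)|)) :
    HasOrbits σ 2 ![{0}] ∧ OrbitInequality σ ![{0}] ![1] D ∧ IsHeightBound σ algNumbers D ∧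
      (0 < p → AttainsBound σ algNumbers D 1) ∧ (p < 0 → AttainsBound σ algNumbers D (-1)) := by
  have hq0 : (q : ℚ) ≠ 0 := by exact_mod_cast hq.ne'
  have hqc : (q : ℂ) ≠ 0 := by exact_mod_cast hq.ne'
  have hqr : (0 : ℝ) < q := by exact_mod_cast hq
  have hσ' : ∃ h, σ = moebius q (0 : ℤ) p (-q : ℤ) h :=
    exists_eq_moebius_of_div hq.ne' hσ (by simp) (by field_simp)
  have h1p : (1 : ℝ) ≤ |(p : ℝ)| := by exact_mod_cast Int.one_le_abs hp
  have hbd := involution_bounds (u := 0) (w := 0) (e := 1) (R := max |(|(p : ℝ)| - q)| |(q : ℝ)|)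
    (O := {0}) (by ring) hq hpq.symm hσ' one_ne_zero ⟨0, rfl⟩
    (by
      rintro a rfl
      refine ⟨X - C 0, minpoly_zero, q, hq.ne', fun z hz => ?_⟩
      generalize (p : ℂ) * z - q = d at hz ⊢
      simp
      field_simp)
    (fun z hz => Or.inl (by simpa using hz))
    (lt_max_of_lt_right (abs_pos.2 hqr.ne'))
    (by
      refine max_le (abs_le.2 ⟨?_, ?_⟩) (le_max_of_le_left (abs_of_pos hqr).le)
      · linarith [le_max_left (q : ℝ) |(p : ℝ)|]
      · linarith [le_max_right (q : ℝ) |(p : ℝ)|])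
    (fun z hz => by
      have e1 : ‖z ^ 2 + ((0 : ℤ) : ℂ) * z + ((0 : ℤ) : ℂ)‖ = 1 := by simp [hz]
      have e2 : ‖(q : ℂ) * z + ((0 : ℤ) : ℂ)‖ = |(q : ℝ)| := by simp [hz]
      have e3 : |(|(p : ℝ)| - q)| ≤ ‖(p : ℂ) * z - q‖ := by
        have := abs_norm_sub_norm_le ((p : ℂ) * z) q
        simpa [hz, abs_of_pos hqr] using this
      rw [e1, e2, mul_one]
      exact max_le (le_max_of_le_right e3) (le_max_left _ _))
  rw [← hD] at hbd
  refine ⟨involution_hasOrbits hq.ne' hσ' (by simpa using hp) fun j => ?_, by simpa using hbd.1,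
    hbd.2, fun hp0 => ?_, fun hp0 => ?_⟩
  · fin_cases j
    refine ⟨fun z hz => Or.inl (by simpa using hz), 0, by simpa using hqc, by simp⟩
  · have h := involution_orbitHeight_sign (ε := 1) (t := 1) (A := q) (B := p - q) hq.ne' hσ'
      (Or.inl rfl) one_ne_zero (by ring) (by ring)
      (by simpa [sub_eq_add_neg] using hpq.symm.add_mul_left_right (-1))
    have hpr : (0 : ℝ) < p := by exact_mod_cast hp0
    refine attainsBound_of_eq (by simpa using mem_algNumbers_sign (ε := 1)) ?_ hbd.2
    rw [hD, abs_of_pos hpr, max_comm]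
    simpa using h
  · have h := involution_orbitHeight_sign (ε := -1) (t := -1) (A := q) (B := p + q) hq.ne' hσ'
      (Or.inr rfl) (by norm_num) (by ring) (by ring)
      (by simpa using hpq.symm.add_mul_left_right 1)
    have hpr : (p : ℝ) < 0 := by exact_mod_cast hp0
    refine attainsBound_of_eq (by simpa using mem_algNumbers_sign (ε := -1)) ?_ hbd.2
    rw [hD, abs_of_neg hpr, max_comm, ← abs_neg (-(p : ℝ) - q)]
    have e : -(-(p : ℝ) - q) = p + q := by ring
    rw [e]
    simpa using h

theorem parametrised_zero_neg {p q s : ℤ} (hq : 0 < q) (hpq : IsCoprime p q) (hs : s = 1 ∨ s = -1)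
    (hdet : (1 : ℚ) * (-1) - (s : ℚ) * ((p : ℚ) / q) ≠ 0) (σ : PGL(2, ℚ)) (D : ℝ)
    (hσ : σ = moebius 1 s ((p : ℚ) / q) (-1) hdet)
    (hD : D = Real.log (max (|(p : ℝ) - s * q| / 2) |(q : ℝ)|)) :
    HasOrbits σ 2 ![{0, -(s : ℂ)}] ∧ OrbitInequality σ ![{0, -(s : ℂ)}] ![1] D ∧
      IsHeightBound σ algNumbers D ∧ (2 ∣ p - s * q → AttainsBound σ algNumbers D s) := by
  have hq0 : (q : ℚ) ≠ 0 := by exact_mod_cast hq.ne'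
  have hqc : (q : ℂ) ≠ 0 := by exact_mod_cast hq.ne'
  have hqr : (0 : ℝ) < q := by exact_mod_cast hq
  have hss := sign_mul_self hs
  have hssr : (s : ℝ) * s = 1 := by exact_mod_cast hss
  have hssc : (s : ℂ) * s = 1 := by exact_mod_cast hss
  have hs0 : (s : ℂ) ≠ 0 := left_ne_zero_of_mul (hssc ▸ one_ne_zero)
  have hσ' : ∃ h, σ = moebius q (q * s : ℤ) p (-q : ℤ) h :=
    exists_eq_moebius_of_div hq.ne' hσ (by push_cast; ring) (by field_simp)
  have hne : q + s * p ≠ 0 := by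
    intro h0
    apply hdet
    have : (q : ℚ) + s * p = 0 := by exact_mod_cast h0
    field_simp
    linarith
  have hbd := involution_bounds (u := s) (w := 0) (e := 1)
    (R := max (|(p : ℝ) - s * q| / 2) |(q : ℝ)|) (O := {0, -(s : ℂ)}) (by ring) hq hpq.symm hσ'
    one_ne_zero ⟨0, by simp⟩
    (by
      rintro a (rfl | rfl)
      · refine ⟨X - C 0, minpoly_zero, q, hq.ne', fun z hz => ?_⟩
        generalize (p : ℂ) * z - q = d at hz ⊢
        simp
        field_simp
      · refine ⟨X - C (-s), by simpa using minpoly_intCast (-s), q + s * p, hne, fun z hz => ?_⟩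
        obtain ⟨d, hd⟩ : ∃ d, d = (p : ℂ) * z - q := ⟨_, rfl⟩
        rw [← hd] at hz ⊢
        simp
        field_simp
        rw [hd]
        rcases hs with rfl | rfl <;> push_cast <;> ring)
    (fun z hz => by
      have : z * (z + s) = 0 := by simpa [mul_add, sq, mul_comm] using hz
      rcases mul_eq_zero.1 this with h | h
      · exact Or.inl h
      · right
        rw [eq_neg_of_add_eq_zero_left h, neg_pow, sign_pow_twelve hs]; norm_num)
    (lt_max_of_lt_right (abs_pos.2 hqr.ne'))
    (by
      refine max_le ?_ (le_max_of_le_left (abs_of_pos hqr).le)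
      have h1 : |(s : ℝ) * q| = q := by
        rw [abs_mul, abs_of_pos hqr]
        rcases hs with rfl | rfl <;> simp
      have := abs_sub (p : ℝ) (s * q)
      linarith [le_max_left (q : ℝ) |(p : ℝ)|, le_max_right (q : ℝ) |(p : ℝ)|])
    (fun z hz => by
      obtain ⟨hx1, hx2⟩ := re_mem_of_norm_one hz
      have e1 : ‖z ^ 2 + (s : ℂ) * z + ((0 : ℤ) : ℂ)‖ = ‖z + s‖ := by
        rw [show z ^ 2 + (s : ℂ) * z + ((0 : ℤ) : ℂ) = z * (z + s) by push_cast; ring, norm_mul, hz,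
          one_mul]
      have e2 : ‖(q : ℂ) * z + ((q * s : ℤ) : ℂ)‖ = |(q : ℝ)| * ‖z + s‖ := by
        rw [show (q : ℂ) * z + ((q * s : ℤ) : ℂ) = q * (z + s) by push_cast; ring, norm_mul,
          Complex.norm_intCast]
      have e3 : ‖z + s‖ ^ 2 = 2 + 2 * s * z.re := by
        have := norm_sq_linear hz 1 s
        push_cast at this
        rw [one_mul] at this
        rw [this]; linear_combination hssr
      have e4 : ‖(p : ℂ) * z - q‖ ^ 2 = p ^ 2 + q ^ 2 - 2 * p * q * z.re := by
        have := norm_sq_linear hz p (-q)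
        push_cast at this
        rw [← sub_eq_add_neg] at this
        rw [this]; ring
      rw [e1, e2]
      refine max_mul_norm_le (norm_nonneg _) (le_max_of_le_right ?_) (le_max_left _ _)
      refine mul_norm_le_of_sq (norm_nonneg _) ?_
      rw [e3, e4, div_pow, sq_abs]
      have hsx : 0 ≤ 1 - s * z.re := by
        rcases hs with rfl | rfl <;> push_cast <;> linarith
      -- The difference of the two squared sides is a square times 1 − s Re z, hence non-negative,
      -- and it vanishes at z = s.
      have : (p : ℝ) ^ 2 + q ^ 2 - 2 * p * q * z.re -
          ((p : ℝ) - s * q) ^ 2 / 2 ^ 2 * (2 + 2 * s * z.re) =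
          (1 - s * z.re) * (p + s * q) ^ 2 / 2 := by
        rcases hs with rfl | rfl <;> push_cast <;> ring
      have h3 : 0 ≤ (1 - s * z.re) * ((p : ℝ) + s * q) ^ 2 / 2 := by positivity
      linarith)
  rw [← hD] at hbd
  refine ⟨involution_hasOrbits hq.ne' hσ' (fun h0 => hne ?_) fun j => ?_, by simpa using hbd.1,
    hbd.2, fun hp0 => ?_⟩
  · linear_combination s * h0 - q * hss
  · fin_cases j
    refine ⟨?_, 0, by simpa using hqc, ?_⟩
    · rintro z (rfl | rfl)
      · exact Or.inl rfl
      · exact Or.inr (by rw [norm_neg, norm_sign hs])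
    · have : ((q : ℂ) * 0 + ((q * s : ℤ) : ℂ)) / (p * 0 - q) = -s := by
        rw [mul_zero, mul_zero, zero_add, zero_sub, div_neg, Int.cast_mul,
          mul_div_cancel_left₀ _ hqc]
      rw [this]; rfl
  · obtain ⟨r, hr⟩ := hp0
    have hcop : IsCoprime q r := by
      obtain ⟨x, y, h⟩ := hpq
      exact ⟨x * s + y, 2 * x, by linear_combination h - x * hr⟩
    have h := involution_orbitHeight_sign (ε := s) (t := 2 * s) (A := q) (B := r) hq.ne' hσ'
      hs (by rcases hs with rfl | rfl <;> norm_num) (by ring) (by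
        linear_combination s * hr + q * hss) hcop
    refine attainsBound_of_eq mem_algNumbers_sign ?_ hbd.2
    have hr' : (p : ℝ) - s * q = 2 * r := by exact_mod_cast hr
    rw [hD, hr', abs_mul, abs_two, mul_div_cancel_left₀ _ two_ne_zero, max_comm]
    exact h

end OrbitHeight

/-! ### The orbits {s} and {i, −i}. -/

namespace OrbitHeight
open Polynomial Real Matrix

theorem sq_norm_fst {z : ℂ} (hz : ‖z‖ = 1) (q b : ℤ) :
    ‖(q : ℂ) * z + b‖ ^ 2 = q ^ 2 + b ^ 2 + 2 * q * b * z.re := by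
  have := norm_sq_linear hz q b
  push_cast at this
  exact this

theorem sq_norm_snd {z : ℂ} (hz : ‖z‖ = 1) (q c : ℤ) :
    ‖(c : ℂ) * z - q‖ ^ 2 = c ^ 2 + q ^ 2 - 2 * q * c * z.re := by
  have := norm_sq_linear hz c (-q)
  push_cast at this
  rw [← sub_eq_add_neg] at this
  rw [this]; ring

theorem norm_quad_one {z : ℂ} (hz : ‖z‖ = 1) (u : ℤ) :
    ‖z ^ 2 + (u : ℂ) * z + ((1 : ℤ) : ℂ)‖ = |2 * z.re + u| := by
  have := norm_quad_palindromic hz u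
  push_cast at this ⊢
  exact this

theorem exists_sign_reduction {s : ℤ} (hs : s = 1 ∨ s = -1) {z : ℂ} (hz : ‖z‖ = 1) :
    -1 ≤ s * z.re ∧ s * z.re ≤ 1 := by
  obtain ⟨h1, h2⟩ := re_mem_of_norm_one hz
  rcases hs with rfl | rfl <;> push_cast <;> constructor <;> linarith

/-- Since s is a fixed point, the quadratic is (z − s)², of norm 2(1 − s Re z) on the circle. The
denominator of σz yields the first constant and the numerator the second: each difference of squares
is a combination of 1 + s Re z and (1 − s Re z)(1 + s Re z) with squares as coefficients, and it
vanishes at z = −s. -/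
theorem parametrised_fixed {p q s : ℤ} (hq : 0 < q) (hpq : IsCoprime p q) (hs : s = 1 ∨ s = -1)
    (hdet : (1 : ℚ) * (-1) - ((p : ℚ) / q) * ((p : ℚ) / q + 2 * s) ≠ 0) (σ : PGL(2, ℚ)) (D : ℝ)
    (hσ : σ = moebius 1 ((p : ℚ) / q) ((p : ℚ) / q + 2 * s) (-1) hdet)
    (hD : D = Real.log (max (|(p : ℝ) + 3 * s * q| / 4) (|(p : ℝ) - s * q| / 4))) :
    HasOrbits σ 2 ![{(s : ℂ)}] ∧ OrbitInequality σ ![{(s : ℂ)}] ![1] D ∧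
      IsHeightBound σ algNumbers D ∧ (4 ∣ p - s * q → AttainsBound σ algNumbers D (-s)) := by
  have hq0 : (q : ℚ) ≠ 0 := by exact_mod_cast hq.ne'
  have hqr : (0 : ℝ) < q := by exact_mod_cast hq
  have hss := sign_mul_self hs
  have hσ' : ∃ h, σ = moebius q p (p + 2 * s * q : ℤ) (-q : ℤ) h :=
    exists_eq_moebius_of_div hq.ne' hσ (by field_simp) (by push_cast; field_simp)
  have hne : s * p + q ≠ 0 := by
    intro h0
    apply hdet
    have h1 : (p : ℚ) = - (s * q) := by
      have : p = -(s * q) := by linear_combination s * h0 - p * hss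
      exact_mod_cast this
    have h2 : (s : ℚ) * s = 1 := by exact_mod_cast hss
    rw [h1]
    field_simp
    linear_combination h2
  have habs : |(s : ℝ) * q| = q := by
    rw [abs_mul, abs_of_pos hqr]
    rcases hs with rfl | rfl <;> simp
  have hbd := involution_bounds (u := -2 * s) (w := 1) (e := 1) (c := p + 2 * s * q) (b := p)
    (R := max (|(p : ℝ) + 3 * s * q| / 4) (|(p : ℝ) - s * q| / 4)) (O := {(s : ℂ)}) (by ring) hq
    (by simpa [mul_comm, mul_left_comm, mul_assoc] using hpq.symm.add_mul_left_right (2 * s)) hσ'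
    one_ne_zero ⟨s, rfl⟩
    (by
      rintro a rfl
      refine ⟨X - C s, minpoly_intCast s, -(s * p + q), neg_ne_zero.2 hne, fun z hz => ?_⟩
      obtain ⟨d, hd⟩ : ∃ d, d = ((p + 2 * s * q : ℤ) : ℂ) * z - q := ⟨_, rfl⟩
      rw [← hd] at hz ⊢
      simp
      field_simp
      rw [hd]
      rcases hs with rfl | rfl <;> push_cast <;> ring)
    (fun z hz => by
      right
      have h1 : (z - s) ^ 2 = 0 := by
        rcases hs with rfl | rfl <;> push_cast at hz ⊢ <;> linear_combination hz
      rw [sub_eq_zero.1 (pow_eq_zero_iff two_ne_zero |>.1 h1), sign_pow_twelve hs])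
    (by
      rw [lt_max_iff]
      by_contra! h
      have h1 : (p : ℝ) + 3 * s * q = 0 := abs_nonpos_iff.1 (by linarith [h.1])
      have h2 : (p : ℝ) - s * q = 0 := abs_nonpos_iff.1 (by linarith [h.2])
      have h3 : (s : ℝ) * q = 0 := by linarith
      rw [h3, abs_zero] at habs
      linarith)
    (by
      push_cast
      set y : ℝ := p + 2 * s * q with hy
      have h1 : |(p : ℝ) + 3 * s * q| ≤ |y| + q := by
        have h3 := abs_add_le y (s * q : ℝ)
        rwa [habs, show y + s * q = (p : ℝ) + 3 * s * q by rw [hy]; ring] at h3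
      have h2 : |(p : ℝ) - s * q| ≤ |y| + 3 * q := by
        rw [show (p : ℝ) - s * q = y - 3 * (s * q) by rw [hy]; ring]
        refine (abs_sub _ _).trans ?_
        rw [abs_mul, habs]; norm_num
      refine max_le ?_ ?_ <;> linarith [le_max_left (q : ℝ) |y|, le_max_right (q : ℝ) |y|])
    (fun z hz => by
      obtain ⟨h1, h2⟩ := exists_sign_reduction hs hz
      rw [norm_quad_one hz]
      have hm : 0 ≤ (1 - s * z.re) * (1 + s * z.re) := mul_nonneg (by linarith) (by linarith)
      refine max_mul_norm_le (abs_nonneg _) (le_max_of_le_right (mul_norm_le_of_sq (norm_nonneg _) ?_))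
        (le_max_of_le_left (mul_norm_le_of_sq (norm_nonneg _) ?_))
      · rw [div_pow, sq_abs, sq_abs, sq_norm_snd hz]
        have h3 : 0 ≤ (1 + s * z.re) / 2 * ((p : ℝ) + s * q) ^ 2 +
          (1 - s * z.re) * (1 + s * z.re) / 4 * (p + 3 * s * q) ^ 2 := by
          have : 0 ≤ 1 + s * z.re := by linarith
          positivity
        rw [← sub_nonneg]
        convert h3 using 1
        rcases hs with rfl | rfl <;> push_cast <;> ring
      · rw [div_pow, sq_abs, sq_abs, sq_norm_fst hz]
        have h3 : 0 ≤ (1 + s * z.re) / 2 * ((p : ℝ) + s * q) ^ 2 +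
          (1 - s * z.re) * (1 + s * z.re) / 4 * (p - s * q) ^ 2 := by
          have : 0 ≤ 1 + s * z.re := by linarith
          positivity
        rw [← sub_nonneg]
        convert h3 using 1
        rcases hs with rfl | rfl <;> push_cast <;> ring)
  rw [← hD] at hbd
  refine ⟨involution_hasOrbits hq.ne' hσ' (fun h0 => hne ?_) fun j => ?_, by simpa using hbd.1,
    hbd.2, fun hp0 => ?_⟩
  · have : 2 * (s * p + q) = 0 := by linear_combination s * h0 - 2 * q * hss
    omega
  · fin_cases j
    have hnec : (s : ℂ) * p + q ≠ 0 := by exact_mod_cast hne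
    have e1 : ((p + 2 * s * q : ℤ) : ℂ) * s - q = s * p + q := by
      rcases hs with rfl | rfl <;> push_cast <;> ring
    have e2 : (q : ℂ) * s + p = s * (s * p + q) := by
      rcases hs with rfl | rfl <;> push_cast <;> ring
    refine ⟨fun z hz => Or.inr ?_, s, by rwa [e1], ?_⟩
    · rw [show z = s from hz, norm_sign hs]
    · rw [e1, e2, mul_div_cancel_right₀ _ hnec, Set.pair_eq_singleton]
      rfl
  · obtain ⟨r, hr⟩ := hp0
    have hcop : IsCoprime r (-s * (r + s * q)) := by
      obtain ⟨x, y, h⟩ := hpq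
      exact ⟨4 * x - (x * s + y) * s, -(x * s + y), by
        linear_combination h - x * hr + (x * s + y) * q * hss⟩
    have h := involution_orbitHeight_sign (ε := -s) (t := 4) (A := r) (B := -s * (r + s * q))
      hq.ne' hσ' (by rcases hs with rfl | rfl <;> norm_num) (by norm_num)
      (by linear_combination hr) (by linear_combination -s * hr + 1 * q * hss) hcop
    refine attainsBound_of_eq (by simpa using mem_algNumbers_sign (ε := -s)) ?_ hbd.2
    have hr' : (p : ℝ) = 4 * r + s * q := by
      have : p = 4 * r + s * q := by linarith
      exact_mod_cast this
    rw [hD, max_comm, hr', show 4 * (r : ℝ) + s * q - s * q = 4 * r by ring,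
      show 4 * (r : ℝ) + s * q + 3 * s * q = 4 * (r + s * q) by ring, abs_mul, abs_mul,
      show |(4 : ℝ)| = 4 by norm_num, mul_div_cancel_left₀ _ four_ne_zero,
      mul_div_cancel_left₀ _ four_ne_zero]
    push_cast at h
    rw [h, abs_mul, abs_neg]
    rcases hs with rfl | rfl <;> simp

theorem parametrised_I {p q : ℤ} (hq : 0 < q) (hpq : IsCoprime p q) (hp : p ≠ 0)
    (hdet : (1 : ℚ) * (-1) - ((p : ℚ) / q) * ((p : ℚ) / q) ≠ 0) (σ : PGL(2, ℚ)) (D : ℝ)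
    (hσ : σ = moebius 1 ((p : ℚ) / q) ((p : ℚ) / q) (-1) hdet)
    (hD : D = Real.log (|(|(p : ℝ)| + q)| / 2)) :
    HasOrbits σ 2 ![{Complex.I, -Complex.I}] ∧
      OrbitInequality σ ![{Complex.I, -Complex.I}] ![1 / 2] D ∧ IsHeightBound σ algNumbers D ∧
      (2 ∣ p + q → AttainsBound σ algNumbers D 1 ∧ AttainsBound σ algNumbers D (-1)) := by
  have hq0 : (q : ℚ) ≠ 0 := by exact_mod_cast hq.ne'
  have hqr : (0 : ℝ) < q := by exact_mod_cast hq
  have hσ' : ∃ h, σ = moebius q p p (-q : ℤ) h :=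
    exists_eq_moebius_of_div hq.ne' hσ (by field_simp) (by field_simp)
  have hp0 : 0 < |(p : ℝ)| := abs_pos.2 (by exact_mod_cast hp)
  rw [abs_of_pos (add_pos hp0 hqr)] at hD
  have hne : q ^ 2 + p ^ 2 ≠ 0 := by positivity
  have hbd := involution_bounds (u := 0) (w := 1) (e := 2) (c := p) (b := p)
    (R := (|(p : ℝ)| + q) / 2) (O := {Complex.I, -Complex.I}) (by ring) hq hpq.symm hσ'
    two_ne_zero ⟨Complex.I, by simp⟩
    (by
      intro a ha
      have ha' : a ^ 2 - ((0 : ℤ) : ℂ) * a + 1 = 0 := by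
        rcases ha with rfl | rfl <;> simp
      refine ⟨_, minpoly_of_quadratic (by norm_num) ha', q ^ 2 + p ^ 2, hne, fun z hz => ?_⟩
      obtain ⟨d, hd⟩ : ∃ d, d = (p : ℂ) * z - q := ⟨_, rfl⟩
      rw [← hd] at hz ⊢
      simp
      field_simp
      rw [hd]
      ring)
    (fun z hz => by
      right
      have h1 : z ^ 2 = -1 := by simpa [add_eq_zero_iff_eq_neg] using hz
      rw [show z ^ 12 = (z ^ 2) ^ 6 by ring, h1]; norm_num)
    (by positivity)
    (by linarith [le_max_left (q : ℝ) |(p : ℝ)|, le_max_right (q : ℝ) |(p : ℝ)|])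
    (fun z hz => by
      obtain ⟨h1, h2⟩ := re_mem_of_norm_one hz
      rw [norm_quad_one hz]
      have hm : 0 ≤ (1 - z.re) * (1 + z.re) := mul_nonneg (by linarith) (by linarith)
      have h3 : 0 ≤ (1 - z.re) * (1 + z.re) * ((p : ℝ) ^ 2 + q ^ 2) := by positivity
      have h4 : ((|(p : ℝ)| + q) / 2) ^ 2 * |2 * z.re + ((0 : ℤ) : ℝ)| ^ 2 =
          (p ^ 2 + q ^ 2 + 2 * |(p : ℝ)| * q) * z.re ^ 2 := by
        rw [sq_abs, ← sq_abs (p : ℝ)]; push_cast; ring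
      have h5 : 2 * |(p : ℝ)| * q * z.re ^ 2 ≤ 2 * |(p : ℝ)| * q * |z.re| := by
        have : z.re ^ 2 ≤ |z.re| := by
          rw [← sq_abs]
          have := abs_le.2 ⟨h1, h2⟩
          nlinarith [abs_nonneg z.re]
        gcongr
      -- The squared norms are p² + q² ± 2pq Re z; the sign of p Re z selects the larger one.
      rcases le_total 0 (p * z.re) with h | h
      · refine le_max_of_le_left (mul_norm_le_of_sq (norm_nonneg _) ?_)
        have h6 : |(p : ℝ)| * |z.re| = p * z.re := by rw [← abs_mul, abs_of_nonneg h]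
        rw [h4, sq_norm_fst hz]
        nlinarith
      · refine le_max_of_le_right (mul_norm_le_of_sq (norm_nonneg _) ?_)
        have h6 : |(p : ℝ)| * |z.re| = -(p * z.re) := by rw [← abs_mul, abs_of_nonpos h]
        rw [h4, sq_norm_snd hz]
        nlinarith)
  rw [← hD] at hbd
  refine ⟨involution_hasOrbits hq.ne' hσ' (by omega) fun j => ?_, by simpa using hbd.1,
    hbd.2, fun hdvd => ?_⟩
  · fin_cases j
    have hd : (p : ℂ) * Complex.I - q ≠ 0 := fun h0 => by
      have := congrArg Complex.re h0
      simp at this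
      omega
    refine ⟨fun z hz => Or.inr ?_, Complex.I, hd, ?_⟩
    · rcases hz with rfl | rfl <;> simp
    · have : ((q : ℂ) * Complex.I + p) / (p * Complex.I - q) = -Complex.I := by
        rw [div_eq_iff hd]
        linear_combination p * Complex.I_sq
      rw [this]; rfl
  · obtain ⟨r, hr⟩ := hdvd
    have hr' : (p : ℝ) + q = 2 * r := by exact_mod_cast hr
    -- The numbers r and r − q are (p + q)/2 and (p − q)/2, and the larger of their absolute values
    -- is (|p| + q)/2.
    have hD' : D = log (max |(r : ℝ)| |(r : ℝ) - q|) := by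
      rw [hD]
      congr 1
      rw [show (r : ℝ) = (p + q) / 2 by linarith]
      rw [show ((p : ℝ) + q) / 2 - q = (p - q) / 2 by ring]
      rcases le_total 0 (p : ℝ) with h | h
      · rw [abs_of_nonneg h, abs_of_pos (by positivity), max_eq_left]
        rw [abs_le]; constructor <;> linarith
      · rw [abs_of_nonpos h, abs_of_neg (show ((p : ℝ) - q) / 2 < 0 by linarith), max_eq_right]
        · ring
        · rw [abs_le]; constructor <;> linarith
    obtain ⟨x, y, h⟩ := hpq
    constructor
    · have h := involution_orbitHeight_sign (ε := 1) (t := 2) (A := r) (B := r - q) hq.ne' hσ'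
        (Or.inl rfl) two_ne_zero (by linarith) (by linarith)
        ⟨x + y, x - y, by linear_combination h - x * hr⟩
      refine attainsBound_of_eq (by simpa using mem_algNumbers_sign (ε := 1)) ?_ hbd.2
      rw [hD']
      push_cast at h
      exact h
    · have h := involution_orbitHeight_sign (ε := -1) (t := 2) (A := r - q) (B := -r) hq.ne' hσ'
        (Or.inr rfl) two_ne_zero (by linarith) (by linarith)
        ⟨x - y, -(x + y), by linear_combination h - x * hr⟩
      refine attainsBound_of_eq (by simpa using mem_algNumbers_sign (ε := -1)) ?_ hbd.2
      rw [hD', max_comm]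
      push_cast at h
      rw [abs_neg] at h
      exact h

theorem omega_quadratic {s t : ℤ} (hs : s * s = 1) (ht : t * t = 1) :
    omega s t ^ 2 - s * omega s t + 1 = 0 := by
  have h3 : ((Real.sqrt 3 : ℝ) : ℂ) ^ 2 = 3 := by
    rw [← Complex.ofReal_pow, Real.sq_sqrt (by norm_num)]; norm_num
  have hs' : (s : ℂ) * s = 1 := by exact_mod_cast hs
  have ht' : (t : ℂ) * t = 1 := by exact_mod_cast ht
  rw [omega]
  linear_combination (t : ℂ) ^ 2 / 4 * Complex.I ^ 2 * h3 + 3 / 4 * (t : ℂ) ^ 2 * Complex.I_sq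
    - 1 / 4 * hs' - 3 / 4 * ht'

theorem omega_neg_one (s : ℤ) : omega s (-1) = s - omega s 1 := by
  rw [omega, omega]; push_cast; ring

theorem pow_twelve_of_quadratic {s : ℤ} (hs : s = 1 ∨ s = -1) {z : ℂ}
    (hz : z ^ 2 - s * z + 1 = 0) : z ^ 12 = 1 := by
  have h3 : z ^ 3 = -s := by
    rcases hs with rfl | rfl <;> push_cast at hz ⊢
    · linear_combination (z + 1) * hz
    · linear_combination (z - 1) * hz
  rw [show z ^ 12 = (z ^ 3) ^ 4 by ring, h3]
  rcases hs with rfl | rfl <;> norm_num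

theorem norm_of_quadratic {s : ℤ} (hs : s = 1 ∨ s = -1) {z : ℂ}
    (hz : z ^ 2 - s * z + 1 = 0) : ‖z‖ = 1 :=
  (pow_eq_one_iff_of_nonneg (norm_nonneg _) (by norm_num : 12 ≠ 0)).1 (by
    rw [← norm_pow, pow_twelve_of_quadratic hs hz, norm_one])

end OrbitHeight

/-! ### The orbit formed by both roots of z² − sz + 1. -/

namespace OrbitHeight
open Polynomial Real Matrix

/-- In the application P = sp, the quadratic has norm 3|ν| with ν = (1 − 2s Re z)/3, and x, y are
the norms of the numerator and the denominator of σz. For ν ≥ 0 one norm suffices for each constant,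
and ν = 1 (that is, z = −s) is the case of equality. For ν ≤ 0 neither is used alone: |P + q|·3|ν| ≤
x and |P|·3|ν| ≤ y are combined by the triangle inequality. -/
theorem mul_abs_max_le {P q ν x y : ℝ} (h0 : -1 ≤ 3 * ν) (h1 : ν ≤ 1) (hx0 : 0 ≤ x) (hy0 : 0 ≤ y)
    (hx : x ^ 2 = P ^ 2 + P * q + q ^ 2 - 3 * ν * P * q)
    (hy : y ^ 2 = P ^ 2 + P * q + q ^ 2 + 3 * ν * q * (P + q)) :
    |P + 2 * q| / 3 * |3 * ν| ≤ max x y ∧ |P - q| / 3 * |3 * ν| ≤ max x y := by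
  have hT : 0 ≤ P ^ 2 + P * q + q ^ 2 := by nlinarith [sq_nonneg (P + q), sq_nonneg P, sq_nonneg q]
  rcases le_total 0 ν with hν | hν
  · rw [abs_of_nonneg (by linarith : 0 ≤ 3 * ν)]
    have h2 : 0 ≤ (1 - ν) * (P ^ 2 + P * q + q ^ 2) := mul_nonneg (by linarith) hT
    have h3 : 0 ≤ ν * (1 - ν) := mul_nonneg hν (by linarith)
    constructor
    · refine le_max_of_le_right (le_of_sq_le_sq ?_ hy0)
      rw [hy, mul_pow, div_pow, sq_abs]
      nlinarith [mul_nonneg h3 (sq_nonneg (P + 2 * q))]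
    · refine le_max_of_le_left (le_of_sq_le_sq ?_ hx0)
      rw [hx, mul_pow, div_pow, sq_abs]
      nlinarith [mul_nonneg h3 (sq_nonneg (P - q))]
  · rw [abs_of_nonpos (by linarith : 3 * ν ≤ 0)]
    have h2 : 0 ≤ (1 + 3 * ν) * (P ^ 2 + P * q + q ^ 2) := mul_nonneg (by linarith) hT
    have h3 : 0 ≤ -(3 * ν) * (1 + 3 * ν) := mul_nonneg (by linarith) (by linarith)
    have h4 : |P + q| * -(3 * ν) ≤ x := by
      refine le_of_sq_le_sq ?_ hx0
      rw [hx, mul_pow, sq_abs]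
      nlinarith [mul_nonneg h3 (sq_nonneg (P + q))]
    have h5 : |P| * -(3 * ν) ≤ y := by
      refine le_of_sq_le_sq ?_ hy0
      rw [hy, mul_pow, sq_abs]
      nlinarith [mul_nonneg h3 (sq_nonneg P)]
    have h6 : |P + 2 * q| ≤ 2 * |P + q| + |P| := by
      have := abs_sub (2 * (P + q)) P
      rwa [abs_mul, abs_two, show 2 * (P + q) - P = P + 2 * q by ring] at this
    have h7 : |P - q| ≤ 2 * |P| + |P + q| := by
      have := abs_sub (2 * P) (P + q)
      rwa [abs_mul, abs_two, show 2 * P - (P + q) = P - q by ring] at this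
    have h8 : 0 ≤ -(3 * ν) := by linarith
    constructor
    · have := mul_le_mul_of_nonneg_right h6 h8
      linarith [le_max_left x y, le_max_right x y]
    · have := mul_le_mul_of_nonneg_right h7 h8
      linarith [le_max_left x y, le_max_right x y]

theorem parametrised_omega {p q s : ℤ} (hq : 0 < q) (hpq : IsCoprime p q) (hs : s = 1 ∨ s = -1)
    (hps : (p : ℚ) / q ≠ -s / 2)
    (hdet : (1 : ℚ) * (-1) - ((p : ℚ) / q) * ((p : ℚ) / q + s) ≠ 0) (σ : PGL(2, ℚ)) (D : ℝ)
    (hσ : σ = moebius 1 ((p : ℚ) / q) ((p : ℚ) / q + s) (-1) hdet)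
    (hD : D = Real.log (max (|(p : ℝ) + 2 * s * q| / 3) (|(p : ℝ) - s * q| / 3))) :
    HasOrbits σ 2 ![{omega s 1, omega s (-1)}] ∧
      OrbitInequality σ ![{omega s 1, omega s (-1)}] ![1 / 2] D ∧
      IsHeightBound σ algNumbers D ∧ (3 ∣ p - s * q → AttainsBound σ algNumbers D (-s)) := by
  have hq0 : (q : ℚ) ≠ 0 := by exact_mod_cast hq.ne'
  have hqr : (0 : ℝ) < q := by exact_mod_cast hq
  have hss := sign_mul_self hs
  have hssc : (s : ℂ) * s = 1 := by exact_mod_cast hss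
  have hσ' : ∃ h, σ = moebius q p (p + s * q : ℤ) (-q : ℤ) h :=
    exists_eq_moebius_of_div hq.ne' hσ (by field_simp) (by push_cast; field_simp)
  have hne : p ^ 2 + s * p * q + q ^ 2 ≠ 0 := by
    rcases hs with rfl | rfl
    · nlinarith [sq_nonneg (2 * p + q), mul_pos hq hq]
    · nlinarith [sq_nonneg (2 * p - q), mul_pos hq hq]
  have habs : |(s : ℝ)| = 1 := by rcases hs with rfl | rfl <;> simp
  have hbd := involution_bounds (u := -s) (w := 1) (e := 2) (c := p + s * q) (b := p)
    (R := max (|(p : ℝ) + 2 * s * q| / 3) (|(p : ℝ) - s * q| / 3))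
    (O := {omega s 1, omega s (-1)}) (by ring) hq
    (by simpa [mul_comm, mul_left_comm, mul_assoc] using hpq.symm.add_mul_left_right s) hσ'
    two_ne_zero ⟨omega s 1, by simp⟩
    (by
      intro a ha
      have ha' : a ^ 2 - (s : ℂ) * a + 1 = 0 := by
        rcases ha with rfl | rfl <;> exact omega_quadratic hss (by norm_num)
      refine ⟨_, minpoly_of_quadratic (by nlinarith) ha', _, hne, fun z hz => ?_⟩
      obtain ⟨d, hd⟩ : ∃ d, d = ((p + s * q : ℤ) : ℂ) * z - q := ⟨_, rfl⟩
      rw [← hd] at hz ⊢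
      simp
      field_simp
      rw [hd]
      rcases hs with rfl | rfl <;> push_cast <;> ring)
    (fun z hz => by
      right
      refine pow_twelve_of_quadratic hs (z := z) ?_
      push_cast at hz
      linear_combination hz)
    (by
      rw [lt_max_iff]
      by_contra! h
      have h1 : (p : ℝ) + 2 * s * q = 0 := abs_nonpos_iff.1 (by linarith [h.1])
      have h2 : (p : ℝ) - s * q = 0 := abs_nonpos_iff.1 (by linarith [h.2])
      have h3 : (s : ℝ) * q = 0 := by linarith
      have h4 : |(s : ℝ) * q| = 0 := by rw [h3, abs_zero]
      rw [abs_mul, habs, one_mul, abs_of_pos hqr] at h4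
      linarith)
    (by
      push_cast
      set y : ℝ := p + s * q with hy
      have hsq : |(s : ℝ) * q| = q := by rw [abs_mul, habs, one_mul, abs_of_pos hqr]
      have h1 : |(p : ℝ) + 2 * s * q| ≤ |y| + q := by
        have h3 := abs_add_le y (s * q : ℝ)
        rwa [hsq, show y + s * q = (p : ℝ) + 2 * s * q by rw [hy]; ring] at h3
      have h2 : |(p : ℝ) - s * q| ≤ |y| + 2 * q := by
        rw [show (p : ℝ) - s * q = y - 2 * (s * q) by rw [hy]; ring]
        refine (abs_sub _ _).trans ?_
        rw [abs_mul, hsq]; norm_num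
      refine max_le ?_ ?_ <;> linarith [le_max_left (q : ℝ) |y|, le_max_right (q : ℝ) |y|])
    (fun z hz => by
      obtain ⟨h1, h2⟩ := exists_sign_reduction hs hz
      have hssr : (s : ℝ) * s = 1 := by exact_mod_cast hss
      have hmul : ∀ x : ℝ, |(s : ℝ) * x| = |x| := fun x => by rw [abs_mul, habs, one_mul]
      rw [norm_quad_one hz]
      have e1 : |2 * z.re + ((-s : ℤ) : ℝ)| = |3 * ((1 - 2 * (s * z.re)) / 3)| := by
        rw [← hmul, ← abs_neg]
        congr 1; push_cast; linear_combination hssr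
      have e2 : |(p : ℝ) + 2 * s * q| = |(s : ℝ) * p + 2 * q| := by
        rw [← hmul]
        congr 1; linear_combination 2 * q * hssr
      have e3 : |(p : ℝ) - s * q| = |(s : ℝ) * p - q| := by
        rw [← hmul]
        congr 1; linear_combination -q * hssr
      rw [e1, e2, e3]
      obtain ⟨h3, h4⟩ := mul_abs_max_le (P := s * p) (q := q) (ν := (1 - 2 * (s * z.re)) / 3)
        (x := ‖(q : ℂ) * z + p‖) (y := ‖((p + s * q : ℤ) : ℂ) * z - q‖)
        (by linarith) (by linarith) (norm_nonneg _) (norm_nonneg _)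
        (by
          rw [sq_norm_fst hz]
          rcases hs with rfl | rfl <;> push_cast <;> ring)
        (by
          rw [sq_norm_snd hz]
          rcases hs with rfl | rfl <;> push_cast <;> ring)
      exact max_mul_norm_le (abs_nonneg _) h3 h4)
  rw [← hD] at hbd
  refine ⟨involution_hasOrbits hq.ne' hσ' (fun h0 => hps ?_) fun j => ?_, by simpa using hbd.1,
    hbd.2, fun hp0 => ?_⟩
  · rw [div_eq_div_iff hq0 two_ne_zero]
    have : 2 * p = - s * q := by linear_combination h0
    rw [mul_comm]
    exact_mod_cast this
  · fin_cases j
    have hω := omega_quadratic hss (t := 1) (by norm_num)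
    have hd : ((p + s * q : ℤ) : ℂ) * omega s 1 - q ≠ 0 := fun h0 => by
      refine hne ?_
      -- This integer is the product of the denominators of σ at the two roots ω and s − ω.
      have h1 : ((p ^ 2 + s * p * q + q ^ 2 : ℤ) : ℂ) = 0 := by
        push_cast at h0 ⊢
        linear_combination (((p + s * q) : ℂ) * (s - omega s 1) - q) * h0 +
          ((p + s * q) : ℂ) ^ 2 * hω
      exact_mod_cast h1
    refine ⟨fun z hz => Or.inr ?_, omega s 1, hd, ?_⟩
    · rcases hz with rfl | rfl <;>
        exact norm_of_quadratic hs (omega_quadratic hss (by norm_num))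
    · have : ((q : ℂ) * omega s 1 + p) / (((p + s * q : ℤ) : ℂ) * omega s 1 - q) =
          omega s (-1) := by
        rw [div_eq_iff hd, omega_neg_one]
        push_cast
        linear_combination ((p : ℂ) + s * q) * hω
      rw [this]; rfl
  · obtain ⟨r, hr⟩ := hp0
    have hcop : IsCoprime r (-s * (r + s * q)) := by
      obtain ⟨x, y, h⟩ := hpq
      exact ⟨3 * x - (x * s + y) * s, -(x * s + y), by
        linear_combination h - x * hr + (x * s + y) * q * hss⟩
    have h := involution_orbitHeight_sign (ε := -s) (t := 3) (A := r) (B := -s * (r + s * q))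
      hq.ne' hσ' (by rcases hs with rfl | rfl <;> norm_num) (by norm_num)
      (by linear_combination hr) (by linear_combination -s * hr + q * hss) hcop
    refine attainsBound_of_eq (by simpa using mem_algNumbers_sign (ε := -s)) ?_ hbd.2
    have hr' : (p : ℝ) = 3 * r + s * q := by
      have : p = 3 * r + s * q := by linarith
      exact_mod_cast this
    rw [hD, max_comm, hr', show 3 * (r : ℝ) + s * q - s * q = 3 * r by ring,
      show 3 * (r : ℝ) + s * q + 2 * s * q = 3 * (r + s * q) by ring, abs_mul, abs_mul,
      show |(3 : ℝ)| = 3 by norm_num, mul_div_cancel_left₀ _ three_ne_zero,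
      mul_div_cancel_left₀ _ three_ne_zero]
    push_cast at h
    rw [h, abs_mul, abs_neg]
    rcases hs with rfl | rfl <;> simp

end OrbitHeight

/-! ### Order three with the orbit {0, −1, 1}. -/

namespace OrbitHeight
open Polynomial Real Matrix

theorem MatrixSeq.posLog_ev {n : ℕ} {m : MatrixSeq n} {i : Fin n} {z : ℂ} (hz : m.den i z ≠ 0) :
    log⁺ ‖m.ev i z‖ = log (max ‖m.num i z‖ ‖m.den i z‖) - log ‖m.den i z‖ := by
  rw [MatrixSeq.ev, norm_div,
    ← posLog_div_add_log (norm_nonneg (m.num i z)) (norm_pos_iff.2 hz), add_sub_cancel_right]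

namespace OrderThree

/-- The powers of `z ↦ (z - 1) / (3 z + 1)`. -/
def mats : MatrixSeq 3 := ⟨![1, 1, -1], ![0, -1, -1], ![0, 3, 3], ![1, 1, -1]⟩

section
variable {K : Type*} [Field K] (x : K)

@[simp] theorem num_zero : mats.num 0 x = x := by simp [mats, MatrixSeq.num]
@[simp] theorem den_zero : mats.den 0 x = 1 := by simp [mats, MatrixSeq.den]
@[simp] theorem num_one : mats.num 1 x = x - 1 := by simp [mats, MatrixSeq.num]; ring
@[simp] theorem den_one : mats.den 1 x = 3 * x + 1 := by simp [mats, MatrixSeq.den]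
@[simp] theorem num_two : mats.num 2 x = -x - 1 := by simp [mats, MatrixSeq.num]; ring
@[simp] theorem den_two : mats.den 2 x = 3 * x - 1 := by simp [mats, MatrixSeq.den]; ring
@[simp] theorem ev_zero : mats.ev 0 x = x := by simp [MatrixSeq.ev]
@[simp] theorem ev_one : mats.ev 1 x = (x - 1) / (3 * x + 1) := by simp [MatrixSeq.ev]
@[simp] theorem ev_two : mats.ev 2 x = (-x - 1) / (3 * x - 1) := by simp [MatrixSeq.ev]

theorem off_iff : (∀ i, mats.den i x ≠ 0) ↔ 3 * x + 1 ≠ 0 ∧ 3 * x - 1 ≠ 0 := by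
  simp [Fin.forall_fin_succ]

end

theorem represents {σ : PGL(2, ℚ)} {hdet} (hσ : σ = moebius 1 (-1) 3 1 hdet) :
    mats.Represents σ := by
  have h1 : ∃ h, σ = moebius (1 : ℤ) (-1 : ℤ) (3 : ℤ) (1 : ℤ) h := by
    refine ⟨by norm_num, ?_⟩; rw [hσ]; norm_num
  have h1' : ∃ h, σ ^ 1 = moebius (1 : ℤ) (-1 : ℤ) (3 : ℤ) (1 : ℤ) h := by rwa [pow_one]
  have h2 := exists_pow_succ_eq_moebius h1' h1 2 (-1) (-1) 3 (-1)
    (by norm_num) (by norm_num) (by norm_num) (by norm_num) (by norm_num)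
  have h3 := exists_pow_succ_eq_moebius h2 h1 1 (-4) 0 0 (-4)
    (by norm_num) (by norm_num) (by norm_num) (by norm_num) (by norm_num)
  refine .of_pow (by norm_num) (fun i => ?_) _ h3 (fun i hi => ?_)
  · fin_cases i
    · exact exists_pow_zero_eq_moebius σ
    · exact h1'
    · exact h2
  · fin_cases i <;> simp [mats] at hi ⊢

/-- The numerator and denominator of the orbit function `(X³ - X) / (9 X² - 1)`. -/
noncomputable def N : ℤ[X] := X ^ 3 - X
noncomputable def M : ℤ[X] := 9 * X ^ 2 - 1

theorem aeval_N {K : Type*} [Field K] (x : K) : aeval x N = x ^ 3 - x := by simp [N]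
theorem aeval_M {K : Type*} [Field K] (x : K) : aeval x M = 9 * x ^ 2 - 1 := by simp [M, show (aeval x) (9 : ℤ[X]) = 9 from map_ofNat (aeval x) 9]

theorem quot : mats.Quot {0, -1, 1} N M := by
  refine ⟨?_, ?_, fun z h1 h2 => ?_, fun z hz => ?_, ⟨0, by simp⟩, ?_⟩
  · refine Monic.isPrimitive ?_
    unfold N; monicity!
  · have h : (M.coeff 0) = -1 := by simp [M]
    intro r hr
    exact isUnit_of_dvd_unit ((C_dvd_iff_dvd_coeff _ _).1 hr 0) (by rw [h]; norm_num)
  · rw [aeval_N] at h1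
    rw [aeval_M] at h2
    have : (8 : ℂ) * z = 0 := by linear_combination z * h2 - 9 * h1
    have hz : z = 0 := by simpa using this
    simp [hz] at h2
  · obtain ⟨h1, h2⟩ := (off_iff z).1 hz
    rw [aeval_M, show 9 * z ^ 2 - 1 = (3 * z + 1) * (3 * z - 1) by ring]
    exact mul_ne_zero h1 h2
  · intro a ha
    obtain ⟨t, rfl, ht⟩ : ∃ t : ℤ, a = t ∧ t * (t ^ 2 - 1) = 0 := by
      rcases ha with rfl | rfl | rfl
      · exact ⟨0, by simp, by norm_num⟩
      · exact ⟨-1, by simp, by norm_num⟩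
      · exact ⟨1, by simp, by norm_num⟩
    refine ⟨X - C t, minpoly_intCast t, 9 * t ^ 2 - 1, ?_, fun z hz => ?_⟩
    · omega
    · obtain ⟨h1, h2⟩ := (off_iff z).1 hz
      have ht' : (t : ℂ) * (t ^ 2 - 1) = 0 := by exact_mod_cast ht
      rw [aeval_N, aeval_M, show 9 * z ^ 2 - 1 = (3 * z + 1) * (3 * z - 1) by ring]
      obtain ⟨d, hd⟩ : ∃ d, d = 3 * z + 1 := ⟨_, rfl⟩
      obtain ⟨e, he⟩ : ∃ e, e = 3 * z - 1 := ⟨_, rfl⟩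
      simp only [Fin.prod_univ_three, ev_zero, ev_one, ev_two, map_sub, aeval_X, aeval_C]
      rw [← hd] at h1 ⊢
      rw [← he] at h2 ⊢
      simp
      field_simp
      rw [hd, he]
      linear_combination (9 * z ^ 2 - 1) * ht'

theorem defect_eq {z : ℂ} (hz : z ∈ MatrixSeq.regular mats ![N]) (h1 : 1 ≤ ‖z‖) :
    mats.defect ![1] ![N] ![M] z = log (max ‖z - 1‖ ‖3 * z + 1‖) +
      log (max ‖-z - 1‖ ‖3 * z - 1‖) - log ‖z ^ 2 - 1‖ := by
  obtain ⟨hz1, hz2⟩ := (off_iff z).1 hz.1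
  have hN : z ^ 3 - z ≠ 0 := by simpa [aeval_N] using hz.2 0
  have hN' : z ^ 2 - 1 ≠ 0 := fun h => hN (by linear_combination z * h)
  have hz0 : z ≠ 0 := by rintro rfl; norm_num at h1
  have e1 := MatrixSeq.posLog_ev (hz.1 1)
  have e2 := MatrixSeq.posLog_ev (hz.1 2)
  simp only [num_one, den_one, num_two, den_two] at e1 e2
  simp only [MatrixSeq.defect, Fin.sum_univ_three, ev_zero, e1, e2, Finset.univ_unique,
    Fin.default_eq_zero, Matrix.cons_val_fin_one, Finset.sum_singleton, aeval_N, aeval_M, one_mul]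
  rw [posLog_eq_log (by rwa [abs_norm]), show z ^ 3 - z = z * (z ^ 2 - 1) by ring,
    show 9 * z ^ 2 - 1 = (3 * z + 1) * (3 * z - 1) by ring, norm_div, norm_mul, norm_mul,
    log_div (mul_ne_zero (norm_ne_zero_iff.2 hz0) (norm_ne_zero_iff.2 hN'))
      (mul_ne_zero (norm_ne_zero_iff.2 hz1) (norm_ne_zero_iff.2 hz2)),
    log_mul (norm_ne_zero_iff.2 hz0) (norm_ne_zero_iff.2 hN'),
    log_mul (norm_ne_zero_iff.2 hz1) (norm_ne_zero_iff.2 hz2)]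
  ring

/-- Replacing both maxima by the denominators already gives the sharp constant. The argument needs
only |z| ≥ 1, so it serves on the circle and near ∞ alike. -/
theorem le_defect_of_norm_le {z : ℂ} (hz : z ∈ MatrixSeq.regular mats ![N]) (h1 : 1 ≤ ‖z‖)
    (h : 5 * ‖z ^ 2 - 1‖ ≤ ‖3 * z + 1‖ * ‖3 * z - 1‖) :
    log 5 ≤ mats.defect ![1] ![N] ![M] z := by
  obtain ⟨hz1, hz2⟩ := (off_iff z).1 hz.1
  have hN : z ^ 3 - z ≠ 0 := by simpa [aeval_N] using hz.2 0
  have hN' : z ^ 2 - 1 ≠ 0 := fun h => hN (by linear_combination z * h)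
  have p1 := norm_pos_iff.2 hz1
  have p2 := norm_pos_iff.2 hz2
  have h2 := log_le_log (mul_pos (by norm_num) (norm_pos_iff.2 hN')) h
  rw [log_mul (by norm_num) (norm_ne_zero_iff.2 hN'), log_mul p1.ne' p2.ne'] at h2
  rw [defect_eq hz h1]
  linarith [log_le_log p1 (le_max_right ‖z - 1‖ ‖3 * z + 1‖),
    log_le_log p2 (le_max_right ‖-z - 1‖ ‖3 * z - 1‖)]

/-- With x = Re z the squares are 100 − 100x² on the left and 100 − 36x² on the right, equal exactly
at z = ±i. -/
theorem circle_le {z : ℂ} (hz : ‖z‖ = 1) : 5 * ‖z ^ 2 - 1‖ ≤ ‖3 * z + 1‖ * ‖3 * z - 1‖ := by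
  have e1 := norm_sq_linear hz 3 1
  have e2 := norm_sq_linear hz 3 (-1)
  have e3 := norm_sq_linear hz 1 1
  have e4 := norm_sq_linear hz 1 (-1)
  push_cast at e1 e2 e3 e4
  rw [← sub_eq_add_neg] at e2 e4
  rw [one_mul] at e3 e4
  rw [show z ^ 2 - 1 = (z + 1) * (z - 1) by ring, norm_mul]
  refine le_of_sq_le_sq ?_ (by positivity)
  rw [mul_pow, mul_pow, mul_pow, e1, e2, e3, e4]
  nlinarith [sq_nonneg z.re]

theorem nonarchBound : mats.NonarchBound N M 1 := by
  intro F _ v hv hv' x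
  simp only [Fin.prod_univ_three, num_zero, num_one, num_two, den_zero, den_one, den_two,
    aeval_N, aeval_M, pow_one, map_one, one_mul]
  rw [show 9 * x ^ 2 - 1 = (3 * x + 1) * (3 * x - 1) by ring,
    show x ^ 3 - x = x * (x - 1) * (x + 1) by ring, map_mul, map_mul, map_mul,
    show -x - 1 = -(x + 1) by ring, v.map_neg, mul_comm]
  gcongr
  · exact le_max_right _ _
  · exact le_max_right _ _
  · exact le_max_right _ _

theorem bounds {σ : PGL(2, ℚ)} {hdet} (hσ : σ = moebius 1 (-1) 3 1 hdet) :
    OrbitInequality σ ![{0, -1, 1}] ![1] (Real.log 5) ∧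
      IsHeightBound σ (algNumbersOffInfty σ) (Real.log 5) := by
  refine (represents hσ).bounds (N := ![N]) (M := ![M]) (fun j => ?_) (fun j => ?_)
    (fun z hz hr => le_defect_of_norm_le hr hz.ge (circle_le hz))
    (fun D' hD' => ⟨2, fun z hz hr => hD'.le.trans (le_defect_of_norm_le hr (by linarith) ?_)⟩)
    ![1] (fun j => ?_) (by simp) (fun j z hj => ?_)
  · fin_cases j; exact quot
  · fin_cases j; simp
  · rw [← norm_mul, show (3 * z + 1) * (3 * z - 1) = 9 * z ^ 2 - 1 by ring]
    have h1 : ‖(9 : ℂ) * z ^ 2‖ - ‖(1 : ℂ)‖ ≤ ‖9 * z ^ 2 - 1‖ := norm_sub_norm_le _ _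
    have h2 : ‖z ^ 2 - 1‖ ≤ ‖z ^ 2‖ + ‖(1 : ℂ)‖ := norm_sub_le _ _
    rw [norm_mul] at h1
    norm_num at h1 h2
    nlinarith
  · fin_cases j; exact nonarchBound
  · fin_cases j
    have h1 : z ^ 3 - z = 0 := by simpa [aeval_N] using hj
    rcases mul_eq_zero.1 (show z * (z ^ 2 - 1) = 0 by linear_combination h1) with h | h
    · exact Or.inl h
    · right
      rw [show z ^ 12 = (z ^ 2) ^ 6 by ring, sub_eq_zero.1 h]; norm_num

/-- The orbit of ∞ is {∞, 1/3, −1/3}, of height 2 log 3 > log 5. -/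
theorem isHeightBound {σ : PGL(2, ℚ)} {hdet} (hσ : σ = moebius 1 (-1) 3 1 hdet) :
    IsHeightBound σ algNumbers (Real.log 5) := by
  have h3 : ∀ t : ℤ, t = 1 ∨ t = -1 → weilHeight (((t : ℂ) / (3 : ℤ) : ℂ) : OnePoint ℂ) = log 3 :=
    fun t ht => by
      rw [MatrixSeq.Represents.weilHeight_coe, absLogHeight_ratio (by norm_num)]
      · rcases ht with rfl | rfl <;> norm_num
      · rcases ht with rfl | rfl
        · exact isCoprime_one_left
        · exact isCoprime_one_left.neg_left
  have h5 : log 5 ≤ log 3 + log 3 := by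
    rw [← log_mul (by norm_num) (by norm_num)]
    exact log_le_log (by norm_num) (by norm_num)
  have e1 : (((1 : ℤ) : ℂ) / (3 : ℤ) : ℂ) = 1 / 3 := by norm_num
  have e2 : (((-1 : ℤ) : ℂ) / (3 : ℤ) : ℂ) = -1 / 3 := by norm_num
  have w1 := h3 1 (Or.inl rfl)
  have w2 := h3 (-1) (Or.inr rfl)
  rw [e1] at w1
  rw [e2] at w2
  have hrep := represents hσ
  refine hrep.isHeightBound_algNumbers (bounds hσ).2 fun α hα => Or.inr ?_
  rw [hrep.orbitHeight_eq, Fin.sum_univ_three, hrep.smul_coe, hrep.smul_coe, hrep.smul_coe]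
  obtain ⟨i, hi⟩ := hα
  fin_cases i
  · simp at hi
  · have hα : α = -1 / 3 := by
      rw [Fin.mk_one, den_one] at hi
      linear_combination hi / 3
    subst hα
    norm_num
    rw [neg_div] at w2
    norm_num at w1 w2
    rw [w1, w2, MatrixSeq.Represents.weilHeight_infty]
    linarith
  · have hα : α = 1 / 3 := by
      have hi' : 3 * α - 1 = 0 := by simpa using hi
      linear_combination hi' / 3
    subst hα
    norm_num
    rw [neg_div] at w2
    norm_num at w1 w2
    rw [w1, w2, MatrixSeq.Represents.weilHeight_infty]
    linarith

theorem defect_I {z : ℂ} (h : z ^ 2 = -1) (hr : z ∈ MatrixSeq.regular mats ![N]) :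
    mats.defect ![1] ![N] ![M] z = log 5 := by
  obtain ⟨hz1, hz2⟩ := (off_iff z).1 hr.1
  have hz : ‖z‖ = 1 := Complex.norm_eq_one_of_pow_eq_one (n := 4)
    (by rw [show z ^ 4 = (z ^ 2) ^ 2 by ring, h]; norm_num) (by norm_num)
  have hre : z.re = 0 := by
    have h1 := congrArg Complex.re h
    have h2 := Complex.sq_norm z
    rw [hz, Complex.normSq_apply] at h2
    simp [pow_two] at h1
    nlinarith
  have e1 := norm_sq_linear hz 3 1
  have e2 := norm_sq_linear hz 3 (-1)
  have e3 := norm_sq_linear hz (-1) (-1)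
  have e4 := norm_sq_linear hz 1 (-1)
  push_cast at e1 e2 e3 e4
  rw [← sub_eq_add_neg] at e2 e4 e3
  rw [one_mul] at e4
  rw [neg_one_mul] at e3
  rw [hre] at e1 e2 e3 e4
  rw [defect_eq hr hz.ge, max_eq_right (le_of_sq_le_sq (by rw [e1, e4]; norm_num) (norm_nonneg _)),
    max_eq_right (le_of_sq_le_sq (by rw [e2, e3]; norm_num) (norm_nonneg _)),
    ← log_mul (norm_ne_zero_iff.2 hz1) (norm_ne_zero_iff.2 hz2), ← norm_mul,
    show (3 * z + 1) * (3 * z - 1) = 9 * z ^ 2 - 1 by ring, h]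
  norm_num
  rw [← log_div (by norm_num) (by norm_num)]
  norm_num

/-- Modulo x² = −1 the two other orbit points are x/(2 + x) and x/(2 − x), and φ(x) = x/5 with 5 =
(2 + x)(2 − x). Their denominators have absolute value at most 1, so both sides are −log|2 + x| −
log|2 − x|. The places above 5, where the orbit is not integral, are thus balanced by φ. -/
theorem posLog_sum_I {F : Type} [Field F] [CharZero F] {v : AbsoluteValue F ℝ}
    (hv : IsNonarchimedean v) (hv' : ∀ t : ℤ, v t ≤ 1) {x : F} (h : x ^ 2 = -1)
    (h1 : 3 * x + 1 ≠ 0) (h2 : 3 * x - 1 ≠ 0) :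
    log⁺ (v x) + log⁺ (v ((x - 1) / (3 * x + 1))) + log⁺ (v ((-x - 1) / (3 * x - 1))) =
      log (v ((x ^ 3 - x) / (9 * x ^ 2 - 1))) := by
  have hvx : v x = 1 := by
    have := congrArg v h
    rw [map_pow, v.map_neg, map_one] at this
    exact (pow_eq_one_iff_of_nonneg (v.nonneg _) two_ne_zero).1 this
  have h5 : (2 + x) * (2 - x) = 5 := by linear_combination -h
  have hne : (2 + x) * (2 - x) ≠ 0 := by rw [h5]; norm_num
  obtain ⟨hp, hm⟩ := mul_ne_zero_iff.1 hne
  have e1 : (x - 1) / (3 * x + 1) = x / (2 + x) := by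
    rw [div_eq_div_iff h1 hp]; linear_combination -2 * h
  have e2 : (-x - 1) / (3 * x - 1) = x / (2 - x) := by
    rw [div_eq_div_iff h2 hm]; linear_combination -2 * h
  have e3 : (x ^ 3 - x) / (9 * x ^ 2 - 1) = x / ((2 + x) * (2 - x)) := by
    rw [div_eq_div_iff (by rw [h]; norm_num) hne]
    linear_combination -x * (x ^ 2 + 3) * h
  have hi : ∀ y : F, v y = 1 → y ≠ -2 → log⁺ (v (x / (2 + y))) = -log (v (2 + y)) := by
    intro y hy hy2
    have hy3 : 2 + y ≠ 0 := fun h => hy2 (by linear_combination h)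
    have : v (2 + y) ≤ 1 := nonarch_add_le hv (by exact_mod_cast hv' 2) hy.le
    rw [map_div₀, hvx, one_div, posLog_eq_log, log_inv]
    rw [abs_of_nonneg (by positivity)]
    exact (one_le_inv₀ (v.pos hy3)).2 this
  rw [e1, e2, e3, hi x hvx (fun h => hp (by rw [h]; ring)), show (2 : F) - x = 2 + -x by ring,
    hi (-x) (by rw [v.map_neg, hvx]) (fun h => hm (by linear_combination h)), hvx, posLog_one,
    ← sub_eq_add_neg, map_div₀, map_mul, hvx, one_div, log_inv,
    ← sub_eq_add_neg, ← sub_eq_add_neg, log_mul (v.ne_zero hp) (v.ne_zero hm)]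
  ring

theorem orbitHeight_I {σ : PGL(2, ℚ)} {hdet} (hσ : σ = moebius 1 (-1) 3 1 hdet) :
    orbitHeight (Subgroup.zpowers σ) (Complex.I : OnePoint ℂ) = log 5 := by
  have hP : (X ^ 2 + 1 : ℤ[X]) ≠ 0 := by
    refine Monic.ne_zero ?_
    monicity!
  have hI : Complex.I ^ 2 = -1 := Complex.I_sq
  have h9 : (3 * Complex.I + 1) * (3 * Complex.I - 1) ≠ 0 := by
    rw [show (3 * Complex.I + 1) * (3 * Complex.I - 1) = 9 * Complex.I ^ 2 - 1 by ring, hI]; norm_num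
  have hP' : ∀ {K : Type} [Field K] (x : K), aeval x (X ^ 2 + 1 : ℤ[X]) = 0 → x ^ 2 = -1 :=
    fun x hx => eq_neg_of_add_eq_zero_left (by simpa using hx)
  refine (represents hσ).orbitHeight_eq_of_places hP (B := ![1]) (N := ![N]) (M := ![M])
    (by simp) ((off_iff _).2 (mul_ne_zero_iff.1 h9)) (fun j => ?_) (fun j => ?_)
    (fun z hz hd hN hM => defect_I (hP' z hz) ⟨hd, hN⟩) (fun F _ _ v hv hv' x hx hd hN hM => ?_)
  · fin_cases j
    simp only [Fin.zero_eta, Matrix.cons_val_zero, aeval_N]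
    rw [pow_succ, hI]
    ring_nf
    simp
  · fin_cases j
    simp only [Fin.zero_eta, Matrix.cons_val_zero, aeval_M]
    rw [hI]; norm_num
  · obtain ⟨h1, h2⟩ := (off_iff x).1 hd
    have := posLog_sum_I hv hv' (hP' x hx) h1 h2
    simpa [Fin.sum_univ_three, aeval_N, aeval_M] using this

end OrderThree

theorem order_three_zero (σ : PGL(2, ℚ)) (hσ : σ = moebius 1 (-1) 3 1 (by norm_num)) :
    HasOrbits σ 3 ![{0, -1, 1}] ∧ OrbitInequality σ ![{0, -1, 1}] ![1] (Real.log 5) ∧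
      IsHeightBound σ algNumbers (Real.log 5) ∧
      AttainsBound σ algNumbers (Real.log 5) Complex.I := by
  have hb := OrderThree.isHeightBound hσ
  refine ⟨(OrderThree.represents hσ).hasOrbits ⟨1, ?_⟩ fun j => ?_, (OrderThree.bounds hσ).1, hb,
    attainsBound_of_eq (Complex.isIntegral_rat_I.isAlgebraic) (OrderThree.orbitHeight_I hσ) hb⟩
  · simp [OrderThree.mats]
  · fin_cases j
    refine ⟨fun z hz => ?_, 0, (OrderThree.off_iff _).2 (by norm_num), ?_⟩
    · rcases hz with rfl | rfl | rfl <;> simp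
    · ext y
      simp [Fin.exists_fin_succ, eq_comm]

end OrbitHeight

/-! ### The golden ratio inequality and the quintic for −s times a primitive fifth root of unity. -/

namespace OrbitHeight
open Polynomial Real Matrix

section golden

theorem log_sqrt_golden : log (√((1 + √5) / 2)) = log ((1 + √5) / 2) / 2 :=
  log_sqrt (by positivity)

theorem log_sqrt_golden_pos : 0 < log (√((1 + √5) / 2)) := by
  have h5 : (1 : ℝ) < √5 := by rw [lt_sqrt] <;> norm_num
  rw [log_sqrt_golden]
  have := log_pos (show 1 < (1 + √5) / 2 by linarith)
  linarith

/-- With the golden ratio φ the minimum is at t = φ⁻², 1 − t = φ⁻¹. The inequality log y ≤ y − 1 is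
applied at y = φ²t and y = φ(1 − t), both equal to 1 there; for these weights the linear terms
cancel. -/
theorem golden_le_of_lt_one {t : ℝ} (h0 : 0 < t) (h1 : t < 1) :
    log ((1 + √5) / 2) / 2 ≤
      -(1 / 4 - 1 / (4 * √5)) * log t - 2 * (1 / (4 * √5)) * log (1 - t) := by
  obtain ⟨r, hr⟩ : ∃ r, r = √5 := ⟨_, rfl⟩
  have hr2 : r ^ 2 = 5 := by rw [hr]; norm_num
  have hr1 : 1 < r := by rw [hr, lt_sqrt] <;> norm_num
  have hr0 : r ≠ 0 := by positivity
  rw [← hr]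
  set φ : ℝ := (1 + r) / 2 with hφ
  have hφ0 : 0 < φ := by positivity
  have hφ2 : φ ^ 2 = φ + 1 := by rw [hφ]; linear_combination hr2 / 4
  have e1 : log (φ ^ 2 * t) ≤ φ ^ 2 * t - 1 := log_le_sub_one_of_pos (by positivity)
  have e2 : log (φ * (1 - t)) ≤ φ * (1 - t) - 1 :=
    log_le_sub_one_of_pos (mul_pos hφ0 (by linarith))
  rw [log_mul (by positivity) h0.ne', log_pow] at e1
  rw [log_mul hφ0.ne' (by linarith)] at e2
  push_cast at e1
  have hB : 0 < 1 / 4 - 1 / (4 * r) := by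
    rw [sub_pos, one_div_lt_one_div (by positivity) (by norm_num)]; linarith
  have hB' : 0 < 2 * (1 / (4 * r)) := by positivity
  have h3 := mul_le_mul_of_nonneg_left e1 hB.le
  have h4 := mul_le_mul_of_nonneg_left e2 hB'.le
  have h5 : (1 / 4 - 1 / (4 * r)) * (φ ^ 2 * t - 1) +
      2 * (1 / (4 * r)) * (φ * (1 - t) - 1) = 0 := by
    rw [hφ2, hφ]
    field_simp
    linear_combination t * hr2
  have h6 : (1 / 4 - 1 / (4 * r)) * 2 + 2 * (1 / (4 * r)) = 1 / 2 := by ring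
  have h7 : ((1 / 4 - 1 / (4 * r)) * 2 + 2 * (1 / (4 * r))) * log φ = 1 / 2 * log φ := by rw [h6]
  linarith

theorem golden_le {x : ℝ} (h0 : 0 < x) (h1 : x ≠ 1) :
    log (√((1 + √5) / 2)) ≤
      |log x| / 4 + 1 / (4 * √5) * log x - 2 * (1 / (4 * √5)) * log |1 - x| := by
  rw [log_sqrt_golden]
  rcases lt_or_gt_of_ne h1 with h | h
  · have := golden_le_of_lt_one h0 h
    rw [abs_of_nonpos (log_nonpos h0.le h.le), abs_of_pos (by linarith)]
    linarith
  -- The right-hand side is invariant under x ↦ 1/x.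
  · have h2 := golden_le_of_lt_one (inv_pos.2 h0) (inv_lt_one_of_one_lt₀ h)
    rw [show 1 - x⁻¹ = (x - 1) / x by field_simp, log_div (by linarith) h0.ne', log_inv] at h2
    rw [abs_of_nonneg (log_nonneg h.le), abs_of_neg (by linarith), neg_sub]
    linarith

/-- The equation says (1 − x)² = x, so the two terms with 1/(4√5) cancel; its roots are φ^{±2} for
the golden ratio φ, so |log x|/4 = (log φ)/2. -/
theorem golden_eq {x : ℝ} (h : x ^ 2 - 3 * x + 1 = 0) :
    |log x| / 4 + 1 / (4 * √5) * log x - 2 * (1 / (4 * √5)) * log |1 - x| =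
      log (√((1 + √5) / 2)) := by
  have h1 : log x = 2 * log |1 - x| := by
    rw [log_abs, ← Nat.cast_two, ← log_pow]
    congr 1; linear_combination -h
  have h5 : √5 ^ 2 = 5 := by norm_num
  have h6 : |log x| = 2 * log ((1 + √5) / 2) := by
    have hφ : (1 : ℝ) ≤ (1 + √5) / 2 := by
      have : (1 : ℝ) < √5 := by rw [lt_sqrt] <;> norm_num
      linarith
    have e : (((1 + √5) / 2) ^ 2 - x) * (((1 + √5) / 2) ^ 2 * x - 1) = 0 := by
      have e1 : ((1 + √5) / 2) ^ 2 = (3 + √5) / 2 := by linear_combination h5 / 4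
      rw [e1]
      linear_combination x / 4 * h5 - (3 + √5) / 2 * h
    rw [show 2 * log ((1 + √5) / 2) = log (((1 + √5) / 2) ^ 2) by rw [log_pow]; norm_num]
    rcases mul_eq_zero.1 e with e | e
    · rw [← sub_eq_zero.1 e, abs_of_nonneg (log_nonneg (one_le_pow₀ hφ))]
    · rw [eq_inv_of_mul_eq_one_right (sub_eq_zero.1 e), log_inv, abs_neg,
        abs_of_nonneg (log_nonneg (one_le_pow₀ hφ))]
  rw [log_sqrt_golden, h6, h1]
  ring

end golden

/-- The polynomial of `-s ξ`, for the primitive fifth roots of unity `ξ`. -/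
noncomputable def quintic (s : ℤ) : ℤ[X] := X ^ 4 - C s * X ^ 3 + X ^ 2 - C s * X + 1

theorem quintic_ne_zero (s : ℤ) : quintic s ≠ 0 := by
  refine Monic.ne_zero ?_
  unfold quintic; monicity!

theorem aeval_quintic {K : Type*} [Field K] (s : ℤ) (x : K) :
    aeval x (quintic s) = x ^ 4 - s * x ^ 3 + x ^ 2 - s * x + 1 := by
  simp [quintic]

section
variable {s : ℤ} (hs : s = 1 ∨ s = -1)
include hs

theorem norm_of_quintic {z : ℂ} (h : z ^ 4 - s * z ^ 3 + z ^ 2 - s * z + 1 = 0) : ‖z‖ = 1 :=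
  Complex.norm_eq_one_of_pow_eq_one (n := 10) (by
    have h5 : z ^ 5 = -s := by
      rcases hs with rfl | rfl <;> push_cast at h ⊢
      · linear_combination (z + 1) * h
      · linear_combination (z - 1) * h
    rw [show z ^ 10 = (z ^ 5) ^ 2 by ring, h5]
    rcases hs with rfl | rfl <;> norm_num) (by norm_num)

theorem sq_norm_sub_sign {z : ℂ} (hz : ‖z‖ = 1) : ‖z - s‖ ^ 2 = 2 - 2 * (s * z.re) := by
  have := norm_sq_linear hz 1 (-s)
  push_cast at this
  rw [one_mul, ← sub_eq_add_neg] at this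
  rw [this]
  rcases hs with rfl | rfl <;> push_cast <;> ring

theorem norm_mul_sub_one (z : ℂ) : ‖(s : ℂ) * z - 1‖ = ‖z - s‖ := by
  rw [← one_mul ‖z - s‖, ← norm_sign hs, ← norm_mul]
  congr 1
  rcases hs with rfl | rfl <;> push_cast <;> ring

/-- This makes |z − s|² the only variable on the circle. -/
theorem norm_quad_eq {z : ℂ} (hz : ‖z‖ = 1) : ‖z ^ 2 - s * z + 1‖ = |1 - ‖z - s‖ ^ 2| := by
  have := norm_quad_palindromic hz (-s)
  push_cast at this
  rw [neg_mul, ← sub_eq_add_neg] at this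
  rw [this, sq_norm_sub_sign hs hz]
  rcases hs with rfl | rfl
  · congr 1; push_cast; ring
  · rw [← abs_neg]; congr 1; push_cast; ring

/-- Modulo the quintic, (z² − sz + 1)² = −sz(z − s)². Taking norms with x = |z − s|² gives (1 − x)²
= x. -/
theorem golden_of_quintic {z : ℂ} (h : z ^ 4 - s * z ^ 3 + z ^ 2 - s * z + 1 = 0) :
    (‖z - s‖ ^ 2) ^ 2 - 3 * ‖z - s‖ ^ 2 + 1 = 0 := by
  have hz := norm_of_quintic hs h
  have h2 : (z ^ 2 - s * z + 1) ^ 2 = -s * z * (z - s) ^ 2 := by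
    rcases hs with rfl | rfl <;> push_cast at h ⊢ <;> linear_combination h
  have h3 := congrArg norm h2
  rw [norm_pow, norm_mul, norm_mul, norm_neg, norm_sign hs, hz, norm_pow, norm_quad_eq hs hz,
    sq_abs] at h3
  linear_combination h3

/-- Such an x is a root of unity, and (x − s)·(−x(x² + 1)) = 1 shows that x − s is a unit. All
finite local terms therefore vanish. -/
theorem nonarch_of_quintic {F : Type} [Field F] {v : AbsoluteValue F ℝ}
    (hv : IsNonarchimedean v) {x : F}
    (h : x ^ 4 - s * x ^ 3 + x ^ 2 - s * x + 1 = 0) :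
    v x = 1 ∧ v (s * x - 1) = 1 ∧ v (x - s) = 1 ∧ v (x ^ 2 - s * x + 1) = 1 := by
  have hss : (s : F) * s = 1 := by exact_mod_cast congrArg (Int.cast (R := F)) (sign_mul_self hs)
  have hvs : v s = 1 := by
    rcases hs with rfl | rfl
    · simp
    · push_cast; rw [v.map_neg, map_one]
  have hx : v x = 1 := by
    have h5 : x ^ 5 = -s := by
      rcases hs with rfl | rfl <;> push_cast at h ⊢
      · linear_combination (x + 1) * h
      · linear_combination (x - 1) * h
    have := congrArg v h5
    rw [map_pow, v.map_neg, hvs] at this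
    exact (pow_eq_one_iff_of_nonneg (v.nonneg _) (by norm_num)).1 this
  have h1 : v (x - s) = 1 := by
    have e : (x - s) * (-(x * (x ^ 2 + 1))) = 1 := by linear_combination -h
    have e' := congrArg v e
    rw [map_mul, map_one, v.map_neg, map_mul, hx, one_mul] at e'
    have a1 : v (x - s) ≤ 1 := nonarch_sub_le hv hx.le hvs.le
    have a2 : v (x ^ 2 + 1) ≤ 1 :=
      nonarch_add_le hv (by rw [map_pow, hx, one_pow]) (by rw [map_one])
    nlinarith [v.nonneg (x - s), v.nonneg (x ^ 2 + 1)]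
  have h2 : v (s * x - 1) = 1 := by
    rw [show (s : F) * x - 1 = s * (x - s) by linear_combination hss, map_mul, hvs, h1, one_mul]
  have h3 : (x ^ 2 - s * x + 1) ^ 2 = -s * x * (x - s) ^ 2 := by
    rcases hs with rfl | rfl <;> push_cast at h ⊢ <;> linear_combination h
  have h4 := congrArg v h3
  rw [map_pow, map_mul, map_mul, v.map_neg, hvs, hx, map_pow, h1] at h4
  exact ⟨hx, h2, h1, (pow_eq_one_iff_of_nonneg (v.nonneg _) two_ne_zero).1 (by rw [h4]; norm_num)⟩

theorem norm_quad_le {z : ℂ} (hz : 1 ≤ ‖z‖) : ‖z ^ 2 - s * z + 1‖ ≤ 3 * ‖z‖ ^ 2 := by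
  have h1 : ‖z ^ 2 - s * z + 1‖ ≤ ‖z‖ ^ 2 + ‖z‖ + 1 := by
    refine (norm_add_le _ _).trans ?_
    rw [norm_one]
    gcongr
    refine (norm_sub_le _ _).trans ?_
    rw [norm_pow, norm_mul, norm_sign hs, one_mul]
  nlinarith

theorem half_norm_le {z : ℂ} (hz : 2 ≤ ‖z‖) : ‖z‖ / 2 ≤ ‖z - s‖ := by
  have := norm_sub_norm_le z s
  rw [norm_sign hs] at this
  linarith

end

end OrbitHeight

/-! ### The involution with the orbits {0} and {ω, ω̄}. -/

namespace OrbitHeight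
open Polynomial Real Matrix

theorem aeval_quintic_of_pow_eq {s : ℤ} (hs : s = 1 ∨ s = -1) {η : ℂ} (h5 : η ^ 5 = -1)
    (h1 : η ≠ -1) : aeval (s * η) (quintic s) = 0 := by
  rw [aeval_quintic]
  have h2 : η + 1 ≠ 0 := fun h => h1 (eq_neg_of_add_eq_zero_left h)
  apply mul_left_cancel₀ h2
  rcases hs with rfl | rfl <;> push_cast <;> linear_combination h5

theorem aeval_quintic_neg_exp {s : ℤ} (hs : s = 1 ∨ s = -1) :
    aeval (-s * Complex.exp (2 * Real.pi * Complex.I / 5)) (quintic s) = 0 := by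
  have hξ := Complex.isPrimitiveRoot_exp 5 (by norm_num)
  push_cast at hξ
  rw [show -(s : ℂ) * Complex.exp (2 * Real.pi * Complex.I / 5) =
    s * -Complex.exp (2 * Real.pi * Complex.I / 5) by ring]
  refine aeval_quintic_of_pow_eq hs ?_ fun h => ?_
  · rw [Odd.neg_pow (by decide), hξ.pow_eq_one]
  · exact hξ.ne_one (by norm_num) (neg_injective h)

theorem aeval_quintic_exp {s : ℤ} (hs : s = 1 ∨ s = -1) :
    aeval (s * Complex.exp (Real.pi * Complex.I / 5)) (quintic s) = 0 := by
  have hξ := Complex.isPrimitiveRoot_exp 5 (by norm_num)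
  push_cast at hξ
  refine aeval_quintic_of_pow_eq hs ?_ fun h => ?_
  · rw [← Complex.exp_nat_mul, ← Complex.exp_pi_mul_I]
    congr 1; push_cast; ring
  · refine hξ.ne_one (by norm_num) ?_
    rw [show 2 * (Real.pi : ℂ) * Complex.I / 5 = (2 : ℕ) * (Real.pi * Complex.I / 5) by
      push_cast; ring, Complex.exp_nat_mul, h]
    norm_num

theorem isAlgebraic_of_aeval_intPoly {P : ℤ[X]} (hP : P ≠ 0) {α : ℂ} (h : aeval α P = 0) :
    IsAlgebraic ℚ α :=
  (show IsAlgebraic ℤ α from ⟨P, hP, h⟩).extendScalars (Int.cast_injective (α := ℚ))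

theorem quad_palindromic_minpoly {s : ℤ} (hs : s = 1 ∨ s = -1) {a : ℂ}
    (ha : a ∈ ({omega s 1, omega s (-1)} : Set ℂ)) :
    minpoly ℚ a = (X ^ 2 - C s * X + 1 : ℤ[X]).map (Int.castRingHom ℚ) := by
  have hss := sign_mul_self hs
  refine minpoly_of_quadratic (by nlinarith) ?_
  rcases ha with rfl | rfl <;> exact omega_quadratic hss (by norm_num)

theorem quot_zero (c : ℤ) : (involution 1 0 c).Quot {0} (X ^ 2) (C c * X - C 1) := by
  refine ⟨(monic_X_pow 2).isPrimitive, IsPrimitive.linear isCoprime_one_left, fun z h1 h2 => ?_,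
    fun z hz => ?_, ⟨0, rfl⟩, ?_⟩
  · have : z = 0 := by simpa using h1
    simp [this] at h2
  · rw [aeval_linear]; exact involution_off_iff.1 hz
  · rintro a rfl
    refine ⟨_, minpoly_zero, 1, one_ne_zero, fun z hz => ?_⟩
    have h1 := involution_off_iff.1 hz
    rw [Fin.prod_univ_two, involution_ev_zero, involution_ev_one, aeval_linear]
    obtain ⟨d, hd⟩ : ∃ d, d = (c : ℂ) * z - (1 : ℤ) := ⟨_, rfl⟩
    rw [← hd] at h1 ⊢
    simp
    field_simp

theorem aeval_linear_one {K : Type*} [Field K] (c : ℤ) (x : K) :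
    aeval x (C c * X - 1 : ℤ[X]) = c * x - 1 := by
  simp

theorem off_iff_of_one {b c : ℤ} {K : Type*} [Field K] {x : K} :
    (∀ i, (involution 1 b c).den i x ≠ 0) ↔ (c : K) * x - 1 ≠ 0 := by
  rw [involution_off_iff, Int.cast_one]

theorem ne_of_quintic {s : ℤ} (hs : s = 1 ∨ s = -1) {z : ℂ}
    (h : z ^ 4 - s * z ^ 3 + z ^ 2 - s * z + 1 = 0) :
    z ≠ 0 ∧ (s : ℂ) * z - 1 ≠ 0 ∧ z - s ≠ 0 ∧ z ^ 2 - s * z + 1 ≠ 0 := by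
  have hss : (s : ℂ) * s = 1 := by exact_mod_cast sign_mul_self hs
  have h0 : z ≠ 0 := by rintro rfl; simp at h
  have h1 : (s : ℂ) * z - 1 ≠ 0 := fun h1 =>
    pow_ne_zero 4 h0 (by linear_combination h + (z ^ 2 + 1) * h1)
  have h2 : z - s ≠ 0 := fun h2 => h1 (by linear_combination s * h2 + hss)
  refine ⟨h0, h1, h2, fun h3 => ?_⟩
  have h4 : (s : ℂ) * (z * (z - s) ^ 2) = 0 := by
    linear_combination h - (z ^ 2 - s * z + 1) * h3 + (-z ^ 2 + s * z) * hss
  have h5 : (s : ℂ) ≠ 0 := left_ne_zero_of_mul_eq_one hss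
  exact mul_ne_zero h5 (mul_ne_zero h0 (pow_ne_zero 2 h2)) h4

namespace ZeroOmega

variable {s : ℤ} (hs : s = 1 ∨ s = -1)
include hs

theorem quot_omega : (involution 1 0 s).Quot {omega s 1, omega s (-1)}
    ((X ^ 2 - C s * X + 1) ^ 2) ((C s * X - C 1) ^ 2) := by
  have hm : (X ^ 2 - C s * X + 1 : ℤ[X]).Monic := by monicity!
  refine ⟨(hm.pow 2).isPrimitive, IsPrimitive.pow (IsPrimitive.linear isCoprime_one_left) 2,
    fun z h1 h2 => ?_, fun z hz => ?_, ⟨_, Or.inl rfl⟩, ?_⟩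
  · have h1' : z ^ 2 - s * z + 1 = 0 := by simpa using h1
    have h2' : (s : ℂ) * z - 1 = 0 := by simpa using h2
    have h3 : z ^ 2 = 0 := by linear_combination h1' + h2'
    simp [pow_eq_zero_iff] at h3
    simp [h3] at h2'
  · rw [map_pow, aeval_linear]; exact pow_ne_zero _ (involution_off_iff.1 hz)
  · intro a ha
    refine ⟨_, quad_palindromic_minpoly hs ha, 1, one_ne_zero, fun z hz => ?_⟩
    have h1 := off_iff_of_one.1 hz
    rw [Fin.prod_univ_two, involution_ev_zero, involution_ev_one]
    obtain ⟨d, hd⟩ : ∃ d, d = (s : ℂ) * z - 1 := ⟨_, rfl⟩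
    simp
    rw [← hd] at h1 ⊢
    field_simp
    rw [hd]
    ring

theorem defect_eq {z : ℂ} (h1 : (s : ℂ) * z - 1 ≠ 0) (h0 : z ≠ 0) (hQ : z ^ 2 - s * z + 1 ≠ 0)
    (B : ℝ) :
    (involution 1 0 s).defect ![1 / 2, B] ![X ^ 2, (X ^ 2 - C s * X + 1) ^ 2]
      ![C s * X - C 1, (C s * X - C 1) ^ 2] z =
      log⁺ ‖z‖ + log⁺ (‖z‖ / ‖z - s‖) - (log ‖z‖ - log ‖z - s‖ / 2) -
        2 * B * (log ‖z ^ 2 - s * z + 1‖ - log ‖z - s‖) := by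
  have e : ‖(s : ℂ) * z - 1‖ ≠ 0 := norm_ne_zero_iff.2 h1
  simp only [MatrixSeq.defect, Fin.sum_univ_two, involution_ev_zero, involution_ev_one, map_pow,
    Matrix.cons_val_zero, Matrix.cons_val_one, Matrix.cons_val_fin_one, aeval_X,
    map_add, map_sub, map_mul, map_one, eq_intCast, map_intCast, Int.cast_one,
    Int.cast_zero, one_mul, add_zero]
  simp only [norm_div, norm_pow]
  rw [log_div (by simpa using h0) e, log_div (by simpa using hQ) (pow_ne_zero _ e),
    log_pow, log_pow, log_pow, norm_mul_sub_one hs]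
  push_cast
  ring

/-- Let r = |z − s| = |sz − 1|. The weight 1/2 is the one that symmetrises: log⁺(1/r) + (log r)/2 =
|log r|/2. -/
theorem defect_of_norm_eq_one {z : ℂ} (hz : ‖z‖ = 1) (h1 : (s : ℂ) * z - 1 ≠ 0)
    (hQ : z ^ 2 - s * z + 1 ≠ 0) (B : ℝ) :
    (involution 1 0 s).defect ![1 / 2, B] ![X ^ 2, (X ^ 2 - C s * X + 1) ^ 2]
      ![C s * X - C 1, (C s * X - C 1) ^ 2] z =
      |log (‖z - s‖ ^ 2)| / 4 + B * log (‖z - s‖ ^ 2) - 2 * B * log |1 - ‖z - s‖ ^ 2| := by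
  have h0 : z ≠ 0 := by rintro rfl; simp at hz
  rw [defect_eq hs h1 h0 hQ, hz, posLog_one, log_one, ← half_mul_log_add_log_abs, one_div, log_inv,
    abs_neg, norm_quad_eq hs hz, log_pow, abs_mul]
  norm_num
  ring

omit hs in
theorem mem_regular {z : ℂ} (hr : z ∈ MatrixSeq.regular (involution 1 0 s)
      ![X ^ 2, (X ^ 2 - C s * X + 1) ^ 2]) :
    (s : ℂ) * z - 1 ≠ 0 ∧ z ≠ 0 ∧ z ^ 2 - s * z + 1 ≠ 0 :=
  ⟨off_iff_of_one.1 hr.1, by simpa using hr.2 0, by simpa using hr.2 1⟩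

omit hs in
theorem nonarchBound_omega :
    (involution 1 0 s).NonarchBound ((X ^ 2 - C s * X + 1) ^ 2) ((C s * X - C 1) ^ 2) 2 := by
  intro F _ v hv hv' x
  simp only [map_pow, aeval_linear_one, Fin.prod_univ_two, involution_den_zero, involution_den_one,
    involution_num_zero, involution_num_one, map_one, one_pow, one_mul, Int.cast_one, Int.cast_zero,
    add_zero]
  rw [mul_comm]
  gcongr
  rw [← mul_pow]
  refine pow_le_pow_left₀ (v.nonneg _) ?_ 2
  simp only [map_add, map_sub, map_mul, map_pow, aeval_X, map_one, eq_intCast,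
    map_intCast]
  rw [show x ^ 2 - s * x + 1 = x * x - (s * x - 1) by ring]
  refine nonarch_sub_le hv ?_ ?_
  · rw [map_mul]
    exact mul_le_mul (le_max_right _ _) (le_max_right _ _) (v.nonneg _) (by positivity)
  · exact (le_max_left _ _).trans
      (le_mul_of_one_le_left (le_max_of_le_left (v.nonneg _)) (le_max_left _ _))

theorem bounds {σ : PGL(2, ℚ)} (hrep : (involution 1 0 s).Represents σ) :
    OrbitInequality σ ![{0}, {omega s 1, omega s (-1)}] ![1 / 2, 1 / (4 * √5)]
        (log (√((1 + √5) / 2))) ∧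
      IsHeightBound σ (algNumbersOffInfty σ) (log (√((1 + √5) / 2))) := by
  have h5 : (2 : ℝ) < √5 := by rw [lt_sqrt] <;> norm_num
  have hB : 0 < 1 / (4 * √5) := by positivity
  have hB2 : 1 / (4 * √5) < 1 / 8 := one_div_lt_one_div_of_lt (by norm_num) (by linarith)
  refine hrep.bounds (N := ![X ^ 2, (X ^ 2 - C s * X + 1) ^ 2])
    (M := ![C s * X - C 1, (C s * X - C 1) ^ 2]) (fun j => ?_) (fun j => ?_)
    (fun z hz hr => ?_) (fun D' hD' => ?_) ![1, 2] (fun j => ?_) ?_ (fun j z hj => ?_)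
  · fin_cases j
    · exact quot_zero s
    · exact quot_omega hs
  · fin_cases j
    · norm_num
    · exact hB
  · obtain ⟨h1, h0, hQ⟩ := mem_regular hr
    rw [defect_of_norm_eq_one hs hz h1 hQ]
    have hw : 0 < ‖z - s‖ := by rw [← norm_mul_sub_one hs]; exact norm_pos_iff.2 h1
    refine golden_le (by positivity) fun h => ?_
    have := norm_quad_eq hs hz
    rw [h, sub_self, abs_zero] at this
    exact hQ (norm_eq_zero.1 this)
  -- Since |z − s| and |z| are comparable near ∞, the defect grows at least like (1/2 − 2B) log|z|
  -- with B = 1/(4√5) < 1/8.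
  · refine exists_radius_of_growth (δ := 1 / 2 - 2 * (1 / (4 * √5)))
      (c := log 2 / 2 + 2 * (1 / (4 * √5)) * log 6) (R₀ := 2) (by linarith)
      (fun z hr hz => ?_) D'
    obtain ⟨h1, h0, hQ⟩ := mem_regular hr
    have hz0 : 0 < ‖z‖ := by linarith
    have e1 : log ‖z‖ - log 2 ≤ log ‖z - s‖ := by
      rw [← log_div hz0.ne' two_ne_zero]
      exact log_le_log (by positivity) (half_norm_le hs hz.le)
    have e2 : log ‖z ^ 2 - s * z + 1‖ ≤ log 3 + 2 * log ‖z‖ := by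
      refine (log_le_log (norm_pos_iff.2 hQ) (norm_quad_le hs (by linarith))).trans ?_
      rw [log_mul (by norm_num) (by positivity), log_pow]; norm_num
    have e3 : log 6 = log 2 + log 3 := by rw [← log_mul] <;> norm_num
    rw [defect_eq hs h1 h0 hQ, posLog_eq_log (by rw [abs_norm]; linarith)]
    have e4 : 0 ≤ log⁺ (‖z‖ / ‖z - s‖) := posLog_nonneg
    have e5 := mul_le_mul_of_nonneg_left (sub_le_sub e2 e1)
      (show 0 ≤ 2 * (1 / (4 * √5)) by positivity)
    rw [e3]
    linarith
  · fin_cases j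
    · intro F _ v hv hv' x
      simp only [Fin.zero_eta, Matrix.cons_val_zero, map_pow, aeval_linear_one, Fin.prod_univ_two,
        involution_den_zero, involution_den_one, involution_num_zero, involution_num_one, map_one,
        pow_one, one_mul, aeval_X, Int.cast_one, Int.cast_zero, add_zero]
      rw [mul_comm]
      gcongr
      rw [sq]
      exact mul_le_mul (le_max_right _ _) (le_max_right _ _) (v.nonneg _) (by positivity)
    · exact nonarchBound_omega
  · simp
    have : (√5)⁻¹ < 1 / 2 := by rw [← one_div]; exact one_div_lt_one_div_of_lt (by norm_num) h5
    linarith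
  · fin_cases j
    · left; simpa using hj
    · right
      exact pow_twelve_of_quadratic hs (by simpa using hj)

theorem orbitHeight_eq {σ : PGL(2, ℚ)} (hrep : (involution 1 0 s).Represents σ) {α : ℂ}
    (hα : aeval α (quintic s) = 0) :
    orbitHeight (Subgroup.zpowers σ) (α : OnePoint ℂ) = log (√((1 + √5) / 2)) := by
  have hreg : ∀ z : ℂ, aeval z (quintic s) = 0 → (s : ℂ) * z - 1 ≠ 0 ∧ z ≠ 0 ∧
      z ^ 2 - s * z + 1 ≠ 0 := fun z hz => by
    obtain ⟨h1, h2, -, h4⟩ := ne_of_quintic hs (by rwa [aeval_quintic] at hz)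
    exact ⟨h2, h1, h4⟩
  obtain ⟨h1, h0, hQ⟩ := hreg α hα
  refine hrep.orbitHeight_eq_of_places (quintic_ne_zero s) hα (off_iff_of_one.2 h1)
    (B := ![1 / 2, 1 / (4 * √5)]) (N := ![X ^ 2, (X ^ 2 - C s * X + 1) ^ 2])
    (M := ![C s * X - C 1, (C s * X - C 1) ^ 2]) ?_ ?_ (fun z hz hd hN hM => ?_)
    (fun F _ _ v hv hv' x hx hd hN hM => ?_)
  · simpa [Fin.forall_fin_two] using ⟨h0, hQ⟩
  · simpa [Fin.forall_fin_two] using h1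
  · obtain ⟨h1, h0, hQ⟩ := hreg z hz
    rw [aeval_quintic] at hz
    rw [defect_of_norm_eq_one hs (norm_of_quintic hs hz) h1 hQ,
      golden_eq (golden_of_quintic hs hz)]
  · rw [aeval_quintic] at hx
    obtain ⟨e1, e2, e3, e4⟩ := nonarch_of_quintic hs hv hx
    simp [e1, e2, e4]

end ZeroOmega

theorem order_two_zero_omega {s : ℤ} (hs : s = 1 ∨ s = -1) (σ : PGL(2, ℚ)) {hdet}
    (hσ : σ = moebius 1 0 s (-1) hdet) (D : ℝ) (hD : D = Real.log (√((1 + √5) / 2))) :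
    HasOrbits σ 2 ![{0}, {omega s 1, omega s (-1)}] ∧
      OrbitInequality σ ![{0}, {omega s 1, omega s (-1)}] ![1 / 2, 1 / (4 * √5)] D ∧
      0 < D ∧ IsHeightBound σ algNumbers D ∧
      AttainsBound σ algNumbers D (-s * Complex.exp (2 * Real.pi * Complex.I / 5)) := by
  have hss : (s : ℂ) * s = 1 := by exact_mod_cast sign_mul_self hs
  have hσ' : ∃ h, σ = moebius (1 : ℤ) (0 : ℤ) s (-1 : ℤ) h := by
    refine ⟨by norm_num, ?_⟩; rw [hσ]; norm_num
  have hrep := involution_represents one_ne_zero hσ'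
  have hb := ZeroOmega.bounds hs hrep
  rw [← hD] at hb
  have hb' : IsHeightBound σ algNumbers D := by
    -- The orbit of ∞ is {∞, s}, of height 0.
    refine hrep.isHeightBound_algNumbers hb.2 fun α hα => Or.inl ?_
    obtain ⟨i, hi⟩ := hα
    fin_cases i
    · simp at hi
    · have hi' : (s : ℂ) * α - 1 = 0 := by simpa using hi
      have hα : α = s := by linear_combination s * hi' - α * hss
      subst hα
      rw [hrep.orbitHeight_eq, Fin.sum_univ_two, hrep.smul_coe, hrep.smul_coe, if_neg (by simp),
        if_pos (by simpa using hi'), involution_ev_zero, MatrixSeq.Represents.weilHeight_coe,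
        MatrixSeq.Represents.weilHeight_infty, add_zero,
        absLogHeight_eq_zero (k := 12) (by norm_num) (Or.inr (sign_pow_twelve hs))]
  refine ⟨involution_hasOrbits one_ne_zero hσ' (by omega) fun j => ?_, hb.1,
    hD ▸ log_sqrt_golden_pos, hb', attainsBound_of_eq ?_
    (by rw [hD]; exact ZeroOmega.orbitHeight_eq hs hrep (aeval_quintic_neg_exp hs)) hb'⟩
  · fin_cases j
    · exact ⟨fun z hz => Or.inl hz, 0, by simp, by simp⟩
    · have hω := omega_quadratic (sign_mul_self hs) (t := 1) (by norm_num)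
      have hd : (s : ℂ) * omega s 1 - 1 ≠ 0 := fun h0 => by
        have h1 : omega s 1 ^ 2 = 0 := by linear_combination hω + h0
        have h2 : omega s 1 = 0 := by simpa using h1
        simp [h2] at h0
      refine ⟨fun z hz => Or.inr ?_, omega s 1, by simpa using hd, ?_⟩
      · rcases hz with rfl | rfl <;>
          exact norm_of_quadratic hs (omega_quadratic (sign_mul_self hs) (by norm_num))
      · have : omega s 1 / (s * omega s 1 - 1) = omega s (-1) := by
          rw [div_eq_iff hd, omega_neg_one]
          linear_combination s * hω
        simp [this]
  · exact isAlgebraic_of_aeval_intPoly (quintic_ne_zero s) (aeval_quintic_neg_exp hs)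

end OrbitHeight

/-! ### The reflection z ↦ s − z with the orbits {0, s} and {ω, ω̄}. -/

namespace OrbitHeight
open Polynomial Real Matrix

namespace ReflectionOmega

variable {s : ℤ}

section
variable {K : Type*} [Field K] (x : K)

theorem num_one : (involution 1 (-s) 0).num 1 x = x - s := by simp [sub_eq_add_neg]
theorem den_one : (involution 1 (-s) 0).den 1 x = -1 := by simp
theorem ev_one : (involution 1 (-s) 0).ev 1 x = s - x := by
  rw [MatrixSeq.ev, num_one, den_one]; ring

/-- The map is affine, so ∞ is fixed and no finite orbit meets it. -/
theorem off : ∀ i, (involution 1 (-s) 0).den i x ≠ 0 := off_iff_of_one.2 (by simp)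

end

variable (hs : s = 1 ∨ s = -1)

theorem quot_zero : (involution 1 (-s) 0).Quot {0, (s : ℂ)} (X ^ 2 - C s * X) 1 := by
  have hm : (X ^ 2 - C s * X : ℤ[X]).Monic := by monicity!
  refine ⟨hm.isPrimitive, monic_one.isPrimitive, fun z h1 => by simp, fun z hz => by simp,
    ⟨_, Or.inl rfl⟩, ?_⟩
  intro a ha
  obtain ⟨t, rfl, ht⟩ : ∃ t : ℤ, a = t ∧ (t = 0 ∨ t = s) := by
    rcases ha with rfl | rfl
    · exact ⟨0, by simp, Or.inl rfl⟩
    · exact ⟨s, rfl, Or.inr rfl⟩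
  refine ⟨_, minpoly_intCast t, -1, by norm_num, fun z hz => ?_⟩
  rw [Fin.prod_univ_two, involution_ev_zero, ev_one]
  rcases ht with rfl | rfl <;> simp <;> ring

include hs in
theorem quot_omega : (involution 1 (-s) 0).Quot {omega s 1, omega s (-1)}
    ((X ^ 2 - C s * X + 1) ^ 2) 1 := by
  have hm : (X ^ 2 - C s * X + 1 : ℤ[X]).Monic := by monicity!
  refine ⟨(hm.pow 2).isPrimitive, monic_one.isPrimitive, fun z h1 => by simp,
    fun z hz => by simp, ⟨_, Or.inl rfl⟩, ?_⟩
  intro a ha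
  refine ⟨_, quad_palindromic_minpoly hs ha, 1, one_ne_zero, fun z hz => ?_⟩
  rw [Fin.prod_univ_two, involution_ev_zero, ev_one]
  simp
  ring

theorem defect_eq {z : ℂ} (h0 : z ≠ 0) (h1 : z - s ≠ 0) (B₁ B₂ : ℝ) :
    (involution 1 (-s) 0).defect ![B₁, B₂] ![X ^ 2 - C s * X, (X ^ 2 - C s * X + 1) ^ 2]
      ![1, 1] z = log⁺ ‖z‖ + log⁺ ‖z - s‖ - B₁ * (log ‖z‖ + log ‖z - s‖) -
        2 * B₂ * log ‖z ^ 2 - s * z + 1‖ := by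
  simp only [MatrixSeq.defect, Fin.sum_univ_two, involution_ev_zero, ev_one, map_pow,
    Matrix.cons_val_zero, Matrix.cons_val_one, Matrix.cons_val_fin_one, aeval_X,
    map_add, map_sub, map_mul, map_one, eq_intCast, map_intCast, div_one]
  rw [show z ^ 2 - s * z = z * (z - s) by ring, norm_mul, norm_pow,
    log_mul (norm_ne_zero_iff.2 h0) (norm_ne_zero_iff.2 h1), log_pow, norm_sub_rev]
  push_cast
  ring

include hs in
-- Write B = 1/(4√5) and r = |z − s|. The first weight is 1/2 − 2B, and log⁺ r − (1/2 − 2B) log r =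
-- |log r|/2 + 2B log r, so the function of |z − s|² is the one already minimised by `golden_le`.
theorem defect_of_norm_eq_one {z : ℂ} (hz : ‖z‖ = 1) (h1 : z - s ≠ 0) :
    (involution 1 (-s) 0).defect ![(√5 - 1) / (2 * √5), 1 / (4 * √5)]
      ![X ^ 2 - C s * X, (X ^ 2 - C s * X + 1) ^ 2] ![1, 1] z =
      |log (‖z - s‖ ^ 2)| / 4 + 1 / (4 * √5) * log (‖z - s‖ ^ 2) -
        2 * (1 / (4 * √5)) * log |1 - ‖z - s‖ ^ 2| := by
  have h0 : z ≠ 0 := by rintro rfl; simp at hz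
  have h5 : √5 ≠ 0 := by positivity
  rw [defect_eq h0 h1, hz, posLog_one, log_one, ← half_mul_log_add_log_abs,
    norm_quad_eq hs hz, log_pow, abs_mul]
  norm_num
  field_simp
  ring

theorem mem_regular {z : ℂ} (hr : z ∈ MatrixSeq.regular (involution 1 (-s) 0)
      ![X ^ 2 - C s * X, (X ^ 2 - C s * X + 1) ^ 2]) :
    z ≠ 0 ∧ z - s ≠ 0 ∧ z ^ 2 - s * z + 1 ≠ 0 := by
  have h1 : z ^ 2 - s * z ≠ 0 := by simpa using hr.2 0
  rw [show z ^ 2 - s * z = z * (z - s) by ring, mul_ne_zero_iff] at h1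
  exact ⟨h1.1, h1.2, by simpa using hr.2 1⟩

include hs in
theorem bounds {σ : PGL(2, ℚ)} (hrep : (involution 1 (-s) 0).Represents σ) :
    OrbitInequality σ ![{0, (s : ℂ)}, {omega s 1, omega s (-1)}]
        ![(√5 - 1) / (2 * √5), 1 / (4 * √5)] (log (√((1 + √5) / 2))) ∧
      IsHeightBound σ (algNumbersOffInfty σ) (log (√((1 + √5) / 2))) := by
  have h5 : (2 : ℝ) < √5 := by rw [lt_sqrt] <;> norm_num
  have h50 : √5 ≠ 0 := by positivity
  have hB : 0 < 1 / (4 * √5) := by positivity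
  have hB1 : (√5 - 1) / (2 * √5) = 1 / 2 - 2 * (1 / (4 * √5)) := by field_simp; ring
  have hB2 : 1 / (4 * √5) < 1 / 8 := one_div_lt_one_div_of_lt (by norm_num) (by linarith)
  refine hrep.bounds (N := ![X ^ 2 - C s * X, (X ^ 2 - C s * X + 1) ^ 2])
    (M := ![1, 1]) (fun j => ?_) (fun j => ?_)
    (fun z hz hr => ?_) (fun D' hD' => ?_) ![1, 2] (fun j => ?_) ?_ (fun j z hj => ?_)
  · fin_cases j
    · exact quot_zero
    · exact quot_omega hs
  · fin_cases j
    · exact div_pos (by linarith) (by positivity)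
    · exact hB
  · obtain ⟨h0, h1, hQ⟩ := mem_regular hr
    rw [defect_of_norm_eq_one hs hz h1]
    have hw : 0 < ‖z - s‖ := norm_pos_iff.2 h1
    refine golden_le (by positivity) fun h => ?_
    have := norm_quad_eq hs hz
    rw [h, sub_self, abs_zero] at this
    exact hQ (norm_eq_zero.1 this)
  -- The growth rate is 2 − 2(1/2 − 2B) − 4B = 1, with B = 1/(4√5).
  · refine exists_radius_of_growth (δ := 1)
      (c := log 2 + 2 * (1 / (4 * √5)) * log 3) (R₀ := 2) one_pos
      (fun z hr hz => ?_) D'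
    obtain ⟨h0, h1, hQ⟩ := mem_regular hr
    have hz0 : 0 < ‖z‖ := by linarith
    have e1 : log ‖z‖ - log 2 ≤ log ‖z - s‖ := by
      rw [← log_div hz0.ne' two_ne_zero]
      exact log_le_log (by positivity) (half_norm_le hs hz.le)
    have e2 : log ‖z ^ 2 - s * z + 1‖ ≤ log 3 + 2 * log ‖z‖ := by
      refine (log_le_log (norm_pos_iff.2 hQ) (norm_quad_le hs (by linarith))).trans ?_
      rw [log_mul (by norm_num) (by positivity), log_pow]; norm_num
    rw [defect_eq h0 h1, posLog_eq_log (by rw [abs_norm]; linarith), hB1]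
    have e4 : log ‖z - s‖ ≤ log⁺ ‖z - s‖ := le_max_right _ _
    have e5 := mul_le_mul_of_nonneg_left e2 (show 0 ≤ 2 * (1 / (4 * √5)) by positivity)
    have e6 := mul_le_mul_of_nonneg_left e1
      (show 0 ≤ 1 / 2 + 2 * (1 / (4 * √5)) by positivity)
    have e7 : 0 < log 2 := log_pos (by norm_num)
    nlinarith
  · fin_cases j
    · intro F _ v hv hv' x
      simp only [Fin.zero_eta, Matrix.cons_val_zero, Fin.prod_univ_two, involution_den_zero,
        den_one, involution_num_zero, num_one, map_one, v.map_neg, pow_one, one_mul, mul_one,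
        map_sub, map_mul, map_pow, aeval_X, eq_intCast, map_intCast]
      rw [show x ^ 2 - s * x = x * (x - s) by ring, map_mul]
      exact mul_le_mul (le_max_right _ _) (le_max_right _ _) (v.nonneg _) (by positivity)
    · intro F _ v hv hv' x
      simp only [Fin.mk_one, Matrix.cons_val_one, Matrix.cons_val_fin_one, Fin.prod_univ_two,
        involution_den_zero, den_one, involution_num_zero, num_one, map_one, v.map_neg, one_mul,
        mul_one, map_sub, map_add, map_mul, map_pow, aeval_X, eq_intCast, map_intCast, one_pow]
      rw [← mul_pow]
      refine pow_le_pow_left₀ (v.nonneg _) ?_ 2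
      rw [show x ^ 2 - s * x + 1 = x * (x - s) + 1 by ring]
      refine nonarch_add_le hv ?_ ?_
      · rw [map_mul]
        exact mul_le_mul (le_max_right _ _) (le_max_right _ _) (v.nonneg _) (by positivity)
      · rw [map_one]
        exact one_le_mul_of_one_le_of_one_le (le_max_left _ _) (le_max_left _ _)
  · rw [Fin.sum_univ_two]
    simp only [Matrix.cons_val_zero, Matrix.cons_val_one, Matrix.cons_val_fin_one]
    rw [hB1]; norm_num; linarith
  · fin_cases j
    · have h1 : z ^ 2 - s * z = 0 := by simpa using hj
      rw [show z ^ 2 - s * z = z * (z - s) by ring, mul_eq_zero] at h1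
      exact h1.imp id fun h => by rw [sub_eq_zero.1 h, sign_pow_twelve hs]
    · right
      exact pow_twelve_of_quadratic hs (by simpa using hj)

include hs in
theorem orbitHeight_eq {σ : PGL(2, ℚ)} (hrep : (involution 1 (-s) 0).Represents σ) {α : ℂ}
    (hα : aeval α (quintic s) = 0) :
    orbitHeight (Subgroup.zpowers σ) (α : OnePoint ℂ) = log (√((1 + √5) / 2)) := by
  have hreg : ∀ z : ℂ, aeval z (quintic s) = 0 → z ≠ 0 ∧ z - s ≠ 0 ∧
      z ^ 2 - s * z + 1 ≠ 0 := fun z hz => by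
    obtain ⟨h1, -, h3, h4⟩ := ne_of_quintic hs (by rwa [aeval_quintic] at hz)
    exact ⟨h1, h3, h4⟩
  obtain ⟨h0, h1, hQ⟩ := hreg α hα
  refine hrep.orbitHeight_eq_of_places (quintic_ne_zero s) hα (off _)
    (B := ![(√5 - 1) / (2 * √5), 1 / (4 * √5)])
    (N := ![X ^ 2 - C s * X, (X ^ 2 - C s * X + 1) ^ 2]) (M := ![1, 1]) ?_ ?_
    (fun z hz hd hN hM => ?_) (fun F _ _ v hv hv' x hx hd hN hM => ?_)
  · have h2 : α ^ 2 - s * α ≠ 0 := by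
      rw [show α ^ 2 - s * α = α * (α - s) by ring]; exact mul_ne_zero h0 h1
    simpa [Fin.forall_fin_two] using ⟨h2, hQ⟩
  · simp [Fin.forall_fin_two]
  · obtain ⟨h0, h1, hQ⟩ := hreg z hz
    rw [aeval_quintic] at hz
    rw [defect_of_norm_eq_one hs (norm_of_quintic hs hz) h1,
      golden_eq (golden_of_quintic hs hz)]
  · rw [aeval_quintic] at hx
    obtain ⟨e1, e2, e3, e4⟩ := nonarch_of_quintic hs hv hx
    have e5 : v (x ^ 2 - s * x) = 1 := by
      rw [show x ^ 2 - s * x = x * (x - s) by ring, map_mul, e1, e3, one_mul]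
    have e6 : v (s - x) = 1 := by rw [v.map_sub, e3]
    simp only [Fin.sum_univ_two, involution_ev_zero, ev_one, map_pow,
      Matrix.cons_val_zero, Matrix.cons_val_one, Matrix.cons_val_fin_one, aeval_X,
      map_add, map_sub, map_mul, map_one, eq_intCast, map_intCast, div_one]
    rw [e1, e6, e5, e4]
    simp

end ReflectionOmega

theorem order_two_zero_sign_omega {s : ℤ} (hs : s = 1 ∨ s = -1) (σ : PGL(2, ℚ)) {hdet}
    (hσ : σ = moebius 1 (-s) 0 (-1) hdet) (D : ℝ) (hD : D = Real.log (√((1 + √5) / 2))) :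
    HasOrbits σ 2 ![{0, (s : ℂ)}, {omega s 1, omega s (-1)}] ∧
      OrbitInequality σ ![{0, (s : ℂ)}, {omega s 1, omega s (-1)}]
        ![(√5 - 1) / (2 * √5), 1 / (4 * √5)] D ∧
      0 < D ∧ IsHeightBound σ algNumbers D ∧
      AttainsBound σ algNumbers D (s * Complex.exp (Real.pi * Complex.I / 5)) := by
  have hσ' : ∃ h, σ = moebius (1 : ℤ) (-s : ℤ) (0 : ℤ) (-1 : ℤ) h := by
    refine ⟨by norm_num, ?_⟩; rw [hσ]; norm_num
  have hrep := involution_represents one_ne_zero hσ'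
  have hb := ReflectionOmega.bounds hs hrep
  rw [← hD] at hb
  have hb' : IsHeightBound σ algNumbers D :=
    hrep.isHeightBound_algNumbers hb.2 fun α ⟨i, hi⟩ => absurd hi (ReflectionOmega.off α i)
  refine ⟨involution_hasOrbits one_ne_zero hσ' (by omega) fun j => ?_, hb.1,
    hD ▸ log_sqrt_golden_pos, hb', attainsBound_of_eq ?_
    (by rw [hD]; exact ReflectionOmega.orbitHeight_eq hs hrep (aeval_quintic_exp hs)) hb'⟩
  · fin_cases j
    · refine ⟨fun z hz => hz.imp id fun h => ?_, 0, by simp, by simp⟩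
      rw [Set.mem_singleton_iff.1 h, norm_sign hs]
    · refine ⟨fun z hz => Or.inr ?_, omega s 1, by simp, ?_⟩
      · rcases hz with rfl | rfl <;>
          exact norm_of_quadratic hs (omega_quadratic (sign_mul_self hs) (by norm_num))
      · have e : (((1 : ℤ) : ℂ) * omega s 1 + (-s : ℤ)) / ((0 : ℤ) * omega s 1 - (1 : ℤ)) =
            omega s (-1) := by
          rw [omega_neg_one]; push_cast; ring
        rw [e]; rfl
  · exact isAlgebraic_of_aeval_intPoly (quintic_ne_zero s) (aeval_quintic_exp hs)

end OrbitHeight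

/-! ### The involution with the two fixed points 0 and s. -/

namespace OrbitHeight
open Polynomial Real Matrix

namespace ZeroSign

variable {s : ℤ} (hs : s = 1 ∨ s = -1)

section
variable {K : Type*} [Field K] (x : K)

theorem num_one : (involution 1 0 (2 * s)).num 1 x = x := by simp
theorem den_one : (involution 1 0 (2 * s)).den 1 x = 2 * s * x - 1 := by simp
theorem ev_one : (involution 1 0 (2 * s)).ev 1 x = x / (2 * s * x - 1) := by
  rw [MatrixSeq.ev, num_one, den_one]

theorem off_iff : (∀ i, (involution 1 0 (2 * s)).den i x ≠ 0) ↔ 2 * s * x - 1 ≠ 0 := by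
  rw [off_iff_of_one]; push_cast; rfl

theorem aeval_den : aeval x (C (2 * s) * X - C 1 : ℤ[X]) = 2 * s * x - 1 := by
  rw [aeval_linear]; push_cast; ring

end

theorem quot_sign (hs : s = 1 ∨ s = -1) :
    (involution 1 0 (2 * s)).Quot {(s : ℂ)} ((X - C s) ^ 2) (C (2 * s) * X - C 1) := by
  have hss : (s : ℂ) * s = 1 := by exact_mod_cast sign_mul_self hs
  refine ⟨((monic_X_sub_C s).pow 2).isPrimitive, IsPrimitive.linear isCoprime_one_left,
    fun z h1 h2 => ?_, fun z hz => ?_, ⟨_, rfl⟩, ?_⟩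
  · have h1' : z = s := by simpa [sub_eq_zero] using h1
    rw [aeval_den, h1'] at h2
    have : (1 : ℂ) = 0 := by linear_combination h2 - 2 * hss
    norm_num at this
  · rw [aeval_linear]; exact involution_off_iff.1 hz
  · rintro a rfl
    refine ⟨_, minpoly_intCast s, -1, by norm_num, fun z hz => ?_⟩
    have h1 := (off_iff z).1 hz
    rw [Fin.prod_univ_two, involution_ev_zero, ev_one, aeval_den]
    obtain ⟨d, hd⟩ : ∃ d, d = 2 * (s : ℂ) * z - 1 := ⟨_, rfl⟩
    rw [← hd] at h1 ⊢
    simp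
    field_simp
    rw [hd]
    linear_combination 2 * z * (z - s) * hss

theorem defect_eq {z : ℂ} (h1 : 2 * (s : ℂ) * z - 1 ≠ 0) (h0 : z ≠ 0) (h2 : z - s ≠ 0)
    (hz : 1 ≤ ‖z‖) :
    (involution 1 0 (2 * s)).defect ![2 / 3, 1 / 3] ![X ^ 2, (X - C s) ^ 2]
      ![C (2 * s) * X - C 1, C (2 * s) * X - C 1] z =
      log (max ‖z‖ ‖2 * s * z - 1‖) - log ‖z‖ / 3 - 2 / 3 * log ‖z - s‖ := by
  have e : ‖2 * (s : ℂ) * z - 1‖ ≠ 0 := norm_ne_zero_iff.2 h1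
  have e1 := MatrixSeq.posLog_ev (m := involution 1 0 (2 * s)) (i := 1) (z := z)
    (by rwa [den_one])
  rw [num_one, den_one] at e1
  simp only [MatrixSeq.defect, Fin.sum_univ_two, involution_ev_zero, e1,
    Matrix.cons_val_zero, Matrix.cons_val_one, Matrix.cons_val_fin_one, aeval_den]
  rw [map_pow, map_pow, aeval_X, map_sub, aeval_X, aeval_C, eq_intCast, norm_div, norm_div,
    norm_pow, norm_pow, log_div (by simpa using h0) e, log_div (by simpa using h2) e,
    log_pow, log_pow, posLog_eq_log (by rwa [abs_norm])]
  push_cast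
  ring

theorem mem_regular {z : ℂ} (hr : z ∈ MatrixSeq.regular (involution 1 0 (2 * s))
      ![X ^ 2, (X - C s) ^ 2]) :
    2 * (s : ℂ) * z - 1 ≠ 0 ∧ z ≠ 0 ∧ z - s ≠ 0 :=
  ⟨(off_iff z).1 hr.1, by simpa using hr.2 0, by simpa using hr.2 1⟩

include hs in
theorem sq_norm_den {z : ℂ} (hz : ‖z‖ = 1) :
    ‖2 * (s : ℂ) * z - 1‖ ^ 2 = 1 + 2 * ‖z - s‖ ^ 2 := by
  have := norm_sq_linear hz (2 * s) (-1)
  push_cast at this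
  rw [← sub_eq_add_neg] at this
  rw [this, sq_norm_sub_sign hs hz]
  rcases hs with rfl | rfl <;> push_cast <;> ring

include hs in
theorem bounds {σ : PGL(2, ℚ)} (hrep : (involution 1 0 (2 * s)).Represents σ) :
    OrbitInequality σ ![{0}, {(s : ℂ)}] ![2 / 3, 1 / 3] (log √3) ∧
      IsHeightBound σ (algNumbersOffInfty σ) (log √3) := by
  have h3 : √3 ^ 2 = 3 := by norm_num
  have h3' : √3 < 1.8 := by rw [sqrt_lt'] <;> norm_num
  have hl : log √3 = log 3 / 2 := log_sqrt (by norm_num)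
  have hss : (s : ℂ) * s = 1 := by exact_mod_cast sign_mul_self hs
  refine hrep.bounds (N := ![X ^ 2, (X - C s) ^ 2])
    (M := ![C (2 * s) * X - C 1, C (2 * s) * X - C 1]) (fun j => ?_) (fun j => ?_)
    -- Near ∞ the bound uses 2|z| − 1 ≥ √3(|z| + 1), which follows from √3 < 1.8 once |z| ≥ 14.
    (fun z hz hr => ?_) (fun D' hD' => ⟨15, fun z hz hr => hD'.le.trans ?_⟩) ![1, 1]
    (fun j => ?_) (by rw [Fin.sum_univ_two]; norm_num) (fun j z hj => ?_)
  · fin_cases j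
    · exact quot_zero _
    · exact quot_sign hs
  · fin_cases j <;> norm_num
  · obtain ⟨h1, h0, h2⟩ := mem_regular hr
    rw [defect_eq h1 h0 h2 hz.ge, hz, log_one, hl]
    have hw : 0 < ‖2 * (s : ℂ) * z - 1‖ := norm_pos_iff.2 h1
    have hy : 0 < ‖z - s‖ := norm_pos_iff.2 h2
    have e1 := log_le_log hw (le_max_right 1 ‖2 * (s : ℂ) * z - 1‖)
    -- With x = |z − s|² this is the inequality of arithmetic and geometric means for 1, x, x: (1 +
    -- 2x)³ − 27x² = (x − 1)²(8x + 1).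
    have e2 : 27 * (‖z - s‖ ^ 2) ^ 2 ≤ (‖2 * (s : ℂ) * z - 1‖ ^ 2) ^ 3 := by
      rw [sq_norm_den hs hz]
      nlinarith [mul_nonneg (sq_nonneg (‖z - s‖ ^ 2 - 1))
        (show 0 ≤ 8 * ‖z - s‖ ^ 2 + 1 by positivity)]
    have e3 := log_le_log (by positivity) e2
    rw [log_mul (by norm_num) (by positivity), log_pow, log_pow, log_pow, log_pow,
      show (27 : ℝ) = 3 ^ 3 by norm_num, log_pow] at e3
    push_cast at e3
    linarith
  · obtain ⟨h1, h0, h2⟩ := mem_regular hr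
    rw [defect_eq h1 h0 h2 (by linarith)]
    have hz0 : 0 < ‖z‖ := by linarith
    have e1 : 2 * ‖z‖ - 1 ≤ ‖2 * (s : ℂ) * z - 1‖ := by
      have := norm_sub_norm_le (2 * (s : ℂ) * z) 1
      rw [norm_mul, norm_mul, norm_sign hs] at this
      norm_num at this
      linarith
    have e2 : ‖z - s‖ ≤ ‖z‖ + 1 := by
      have := norm_sub_le z s
      rwa [norm_sign hs] at this
    have e3 : √3 * (‖z‖ + 1) ≤ ‖2 * (s : ℂ) * z - 1‖ := by nlinarith
    have e4 := log_le_log (by positivity) e3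
    rw [log_mul (by positivity) (by positivity)] at e4
    have e5 := log_le_log (norm_pos_iff.2 h1) (le_max_right ‖z‖ ‖2 * (s : ℂ) * z - 1‖)
    have e6 := log_le_log (norm_pos_iff.2 h2) e2
    have e7 := log_le_log hz0 (show ‖z‖ ≤ ‖z‖ + 1 by linarith)
    linarith
  · fin_cases j
    · intro F _ v hv hv' x
      simp only [Fin.zero_eta, Matrix.cons_val_zero]
      rw [aeval_den]
      simp only [map_pow, Fin.prod_univ_two,
        involution_den_zero, den_one, involution_num_zero, num_one, map_one, pow_one, one_mul,
        aeval_X]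
      rw [mul_comm]
      gcongr
      rw [sq]
      exact mul_le_mul (le_max_right _ _) (le_max_right _ _) (v.nonneg _) (by positivity)
    · intro F _ v hv hv' x
      have hssF : (s : F) * s = 1 := by
        exact_mod_cast congrArg (Int.cast (R := F)) (sign_mul_self hs)
      simp only [Fin.mk_one, Matrix.cons_val_one, Matrix.cons_val_fin_one]
      rw [aeval_den]
      simp only [map_pow, map_sub, eq_intCast, Fin.prod_univ_two,
        involution_den_zero, den_one, involution_num_zero, num_one, map_one, pow_one, one_mul,
        aeval_X, map_intCast]
      rw [mul_comm]
      gcongr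
      rw [sq]
      refine mul_le_mul ?_ ?_ (v.nonneg _) (by positivity)
      · exact nonarch_sub_le hv (le_max_right _ _) ((hv' s).trans (le_max_left _ _))
      · rw [show x - (s : F) = s * (2 * s * x - 1) - x by linear_combination (-2 * x) * hssF]
        exact nonarch_sub_le hv (nonarch_int_mul_le hv' _ (le_max_left _ _)) (le_max_right _ _)
  · fin_cases j
    · left; simpa using hj
    · right
      have : z = s := by simpa [sub_eq_zero] using hj
      rw [this, sign_pow_twelve hs]

include hs in
-- Since (2sω − 1)² = −3, the point σω fails to be integral at the places above 3. There log⁺|σω| =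
-- −log|2sω − 1|; each of the two orbit functions has absolute value 1/|2sω − 1|, and the weights
-- add up to 1.
theorem orbitHeight_omega {σ : PGL(2, ℚ)} (hrep : (involution 1 0 (2 * s)).Represents σ) :
    orbitHeight (Subgroup.zpowers σ) (omega s 1 : OnePoint ℂ) = log √3 := by
  have hss := sign_mul_self hs
  have h12 : ∀ {K : Type} [Field K] (z : K), z ^ 2 - s * z + 1 = 0 →
      (2 * (s : K) * z - 1) ^ 2 = -3 ∧ z * (s - z) = 1 := fun {K} _ z hz => by
    have hss' : (s : K) * s = 1 := by exact_mod_cast congrArg (Int.cast (R := K)) hss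
    exact ⟨by linear_combination 4 * hz + 4 * z ^ 2 * hss', by linear_combination -hz⟩
  have hreg : ∀ {K : Type} [Field K] [CharZero K] (z : K), z ^ 2 - s * z + 1 = 0 →
      2 * (s : K) * z - 1 ≠ 0 ∧ z ≠ 0 ∧ z - s ≠ 0 := fun {K} _ _ z hz => by
    obtain ⟨h1, h2⟩ := h12 z hz
    refine ⟨fun h => ?_, left_ne_zero_of_mul_eq_one h2, fun h => ?_⟩
    · rw [h] at h1; norm_num at h1
    · rw [← neg_sub, h] at h2; norm_num at h2
  have hP : (X ^ 2 - C s * X + 1 : ℤ[X]) ≠ 0 := by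
    refine Monic.ne_zero ?_
    monicity!
  have hω := omega_quadratic hss (t := 1) (by norm_num)
  obtain ⟨h1, h0, h2⟩ := hreg _ hω
  refine hrep.orbitHeight_eq_of_places hP (by simpa using hω) ((off_iff _).2 h1)
    (B := ![2 / 3, 1 / 3]) (N := ![X ^ 2, (X - C s) ^ 2])
    (M := ![C (2 * s) * X - C 1, C (2 * s) * X - C 1]) ?_ ?_
    (fun z hz hd hN hM => ?_) (fun F _ _ v hv hv' x hx hd hN hM => ?_)
  · simpa [Fin.forall_fin_two] using ⟨h0, h2⟩
  · intro j
    fin_cases j <;> exact (aeval_den (s := s) (omega s 1)).trans_ne h1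
  · have hz' : z ^ 2 - s * z + 1 = 0 := by simpa using hz
    obtain ⟨h1, h0, h2⟩ := hreg z hz'
    obtain ⟨h3, h4⟩ := h12 z hz'
    have hn := norm_of_quadratic hs hz'
    have e1 : ‖z - s‖ = 1 := by
      have := congrArg norm h4
      rwa [norm_mul, hn, one_mul, norm_sub_rev, norm_one] at this
    have e2 : ‖2 * (s : ℂ) * z - 1‖ = √3 := by
      have := sq_norm_den hs hn
      rw [e1] at this
      rw [← sqrt_sq (norm_nonneg (2 * (s : ℂ) * z - 1)), this]; norm_num
    rw [defect_eq h1 h0 h2 hn.ge, hn, e1, e2, max_eq_right (by rw [one_le_sqrt]; norm_num)]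
    simp
  · have hx' : x ^ 2 - s * x + 1 = 0 := by simpa using hx
    obtain ⟨h1, h0, h2⟩ := hreg x hx'
    obtain ⟨h3, h4⟩ := h12 x hx'
    have hvs : v s = 1 := by
      rcases hs with rfl | rfl
      · simp
      · push_cast; rw [v.map_neg, map_one]
    have hvx : v x = 1 := by
      have h5 : x ^ 3 = -s := by
        rcases hs with rfl | rfl <;> push_cast at hx' ⊢
        · linear_combination (x + 1) * hx'
        · linear_combination (x - 1) * hx'
      have := congrArg v h5
      rw [map_pow, v.map_neg, hvs] at this
      exact (pow_eq_one_iff_of_nonneg (v.nonneg _) (by norm_num)).1 this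
    have hvy : v (x - s) = 1 := by
      have := congrArg v h4
      rwa [map_mul, hvx, one_mul, v.map_sub, map_one] at this
    have hvd : v (2 * s * x - 1) ≤ 1 := by
      rw [show 2 * (s : F) * x - 1 = ((2 * s : ℤ) : F) * x - 1 by push_cast; ring]
      exact nonarch_sub_le hv (nonarch_int_mul_le hv' _ hvx.le) (by rw [map_one])
    have hl : log⁺ (v (2 * s * x - 1))⁻¹ = -log (v (2 * s * x - 1)) := by
      rw [posLog_eq_log, log_inv]
      rw [abs_of_nonneg (by positivity)]
      exact (one_le_inv₀ (v.pos h1)).2 hvd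
    simp only [Fin.sum_univ_two, involution_ev_zero, ev_one, aeval_den, Matrix.cons_val_zero,
      Matrix.cons_val_one, Matrix.cons_val_fin_one]
    rw [map_pow, map_pow, aeval_X, map_sub, aeval_X, aeval_C, eq_intCast, map_div₀, map_div₀,
      map_div₀, map_pow, map_pow, hvx, hvy, one_pow, one_div, hl, log_inv, posLog_one]
    ring

end ZeroSign

theorem order_two_zero_sign {s : ℤ} (hs : s = 1 ∨ s = -1) (σ : PGL(2, ℚ)) {hdet}
    (hσ : σ = moebius 1 0 (2 * s) (-1) hdet) (D : ℝ) (hD : D = Real.log √3) :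
    HasOrbits σ 2 ![{0}, {(s : ℂ)}] ∧ OrbitInequality σ ![{0}, {(s : ℂ)}] ![2 / 3, 1 / 3] D ∧
      0 < D ∧ IsHeightBound σ algNumbers D ∧ AttainsBound σ algNumbers D (omega s 1) := by
  have hss : (s : ℂ) * s = 1 := by exact_mod_cast sign_mul_self hs
  have hσ' : ∃ h, σ = moebius (1 : ℤ) (0 : ℤ) (2 * s : ℤ) (-1 : ℤ) h := by
    refine ⟨by norm_num, ?_⟩; rw [hσ]; norm_num
  have hrep := involution_represents one_ne_zero hσ'
  have hb := ZeroSign.bounds hs hrep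
  rw [← hD] at hb
  have hl : log √3 = log 3 / 2 := log_sqrt (by norm_num)
  -- The orbit of ∞ is {∞, s/2}, of height log 2 > log √3.
  have hb' : IsHeightBound σ algNumbers D := by
    refine hrep.isHeightBound_algNumbers hb.2 fun α hα => Or.inr ?_
    obtain ⟨i, hi⟩ := hα
    fin_cases i
    · simp at hi
    · have hi' : 2 * (s : ℂ) * α - 1 = 0 := by simpa using hi
      have hα : α = (s : ℂ) / (2 : ℤ) := by
        push_cast
        linear_combination s / 2 * hi' - α * hss
      have h1 := hrep.orbitHeight_eq α
      rw [Fin.sum_univ_two, hrep.smul_coe, hrep.smul_coe, if_neg (by simp), if_pos (by simpa using hi'),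
        involution_ev_zero, MatrixSeq.Represents.weilHeight_coe,
        MatrixSeq.Represents.weilHeight_infty, add_zero] at h1
      rw [h1, hα, absLogHeight_ratio two_ne_zero
        (by rcases hs with rfl | rfl; exacts [isCoprime_one_left, isCoprime_one_left.neg_left]),
        hD, show max |(s : ℝ)| |((2 : ℤ) : ℝ)| = 2 by rcases hs with rfl | rfl <;> norm_num]
      exact log_le_log (by positivity) (by rw [sqrt_le_left] <;> norm_num)
  refine ⟨involution_hasOrbits one_ne_zero hσ' (by omega) fun j => ?_, hb.1,
    by rw [hD, hl]; have := log_pos (show (1 : ℝ) < 3 by norm_num); linarith, hb',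
    attainsBound_of_eq ?_ (by rw [hD]; exact ZeroSign.orbitHeight_omega hs hrep) hb'⟩
  · fin_cases j
    · exact ⟨fun z hz => Or.inl hz, 0, by simp, by simp⟩
    · have e1 : ((2 * s : ℤ) : ℂ) * s - (1 : ℤ) = 1 := by push_cast; linear_combination 2 * hss
      refine ⟨fun z hz => Or.inr ?_, s, by rw [e1]; norm_num, ?_⟩
      · rw [Set.mem_singleton_iff.1 hz, norm_sign hs]
      · rw [e1]; simp
  · have hω := omega_quadratic (sign_mul_self hs) (t := 1) (by norm_num)
    refine isAlgebraic_of_aeval_intPoly (P := X ^ 2 - C s * X + 1) (Monic.ne_zero ?_)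
      (by simpa using hω)
    monicity!

end OrbitHeight

/-! ### Tools for the fixed points in orders three, four and six. -/

namespace OrbitHeight
open Polynomial Real Matrix

theorem sq_norm_linear (z : ℂ) (a b : ℝ) :
    ‖(a : ℂ) * z + b‖ ^ 2 = a ^ 2 * ‖z‖ ^ 2 + 2 * a * b * z.re + b ^ 2 := by
  rw [Complex.sq_norm, Complex.sq_norm, Complex.normSq_apply, Complex.normSq_apply]
  simp
  ring

theorem re_and_norm_of_quadratic {z : ℂ} {k m : ℝ} (hk : k ^ 2 < 4 * m)
    (hz : z ^ 2 - k * z + m = 0) : z.re = k / 2 ∧ ‖z‖ ^ 2 = m := by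
  have h1 := congrArg Complex.re hz
  have h2 := congrArg Complex.im hz
  simp [pow_two] at h1 h2
  have h3 : z.im * (2 * z.re - k) = 0 := by linear_combination h2
  have h4 : z.re = k / 2 := by
    rcases mul_eq_zero.1 h3 with h | h
    · rw [h] at h1
      nlinarith [sq_nonneg (2 * z.re - k)]
    · linarith
  refine ⟨h4, ?_⟩
  rw [Complex.sq_norm, Complex.normSq_apply]
  rw [h4] at h1 ⊢
  linarith

theorem exists_quadratic_root {k m : ℝ} (hk : k ^ 2 < 4 * m) :
    ∃ z : ℂ, z ^ 2 - k * z + m = 0 ∧ 0 ≤ z.im := by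
  refine ⟨⟨k / 2, √(m - k ^ 2 / 4)⟩, ?_, sqrt_nonneg _⟩
  have h := sq_sqrt (show 0 ≤ m - k ^ 2 / 4 by linarith)
  apply Complex.ext
  · simp [pow_two] at h ⊢
    linarith
  · simp [pow_two]
    ring

/-- The maximal root is the root in the upper half plane of a real quadratic z² − kz + m without
real roots. Its real part k/2, its modulus √m and the sign of its imaginary part determine it. -/
theorem existsUnique_isMaximalRoot {P : ℤ[X]} {k m : ℝ} (hk : k ^ 2 < 4 * m)
    (hroot : ∀ z : ℂ, z ^ 2 - k * z + m = 0 → aeval z P = 0)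
    (hle : ∀ z : ℂ, aeval z P = 0 → ‖z‖ ^ 2 ≤ m)
    (hmax : ∀ z : ℂ, aeval z P = 0 → 0 ≤ z.im → ‖z‖ ^ 2 = m → z.re = k / 2) :
    (∃! α : ℂ, IsMaximalRoot P α) ∧
      ∀ α : ℂ, IsMaximalRoot P α → α.re = k / 2 ∧ ‖α‖ ^ 2 = m := by
  obtain ⟨z₀, hz₀, him⟩ := exists_quadratic_root hk
  obtain ⟨hre, hn⟩ := re_and_norm_of_quadratic hk hz₀
  have key : ∀ α : ℂ, IsMaximalRoot P α → α.re = k / 2 ∧ ‖α‖ ^ 2 = m := fun α hα => by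
    have h1 : ‖α‖ ^ 2 = m := by
      refine le_antisymm (hle α hα.1) ?_
      rw [← hn]
      exact pow_le_pow_left₀ (norm_nonneg _) (hα.2.2 z₀ (hroot z₀ hz₀)) 2
    exact ⟨hmax α hα.1 hα.2.1 h1, h1⟩
  refine ⟨⟨z₀, ⟨hroot z₀ hz₀, him, fun β hβ => le_of_sq_le_sq (by rw [hn]; exact hle β hβ)
    (norm_nonneg _)⟩, fun α hα => ?_⟩, key⟩
  obtain ⟨h1, h2⟩ := key α hα
  have h3 : α.im ^ 2 = z₀.im ^ 2 := by
    rw [Complex.sq_norm, Complex.normSq_apply] at hn h2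
    rw [hre] at hn
    rw [h1] at h2
    linarith
  exact Complex.ext (h1.trans hre.symm) ((pow_left_inj₀ hα.2.1 him two_ne_zero).1 h3)

theorem nonarch_aeval_le {F : Type*} [Field F] {v : AbsoluteValue F ℝ} (hv : IsNonarchimedean v)
    (hv' : ∀ t : ℤ, v t ≤ 1) {x : F} {r : ℝ} (hr : 1 ≤ r) (hx : v x ≤ r) (R : ℤ[X]) :
    v (aeval x R) ≤ r ^ R.natDegree := by
  rw [aeval_eq_sum_range]
  have : ∀ s : Finset ℕ, (∀ i ∈ s, i ≤ R.natDegree) →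
      v (∑ i ∈ s, R.coeff i • x ^ i) ≤ r ^ R.natDegree := fun s => by
    induction s using Finset.induction_on with
    | empty => intro _; rw [Finset.sum_empty, map_zero]; positivity
    | insert a s ha ih =>
      intro h
      rw [Finset.sum_insert ha, zsmul_eq_mul]
      refine nonarch_add_le hv (nonarch_int_mul_le hv' _ ?_)
        (ih fun i hi => h i (Finset.mem_insert_of_mem hi))
      rw [map_pow]
      exact (pow_le_pow_left₀ (v.nonneg _) hx a).trans
        (pow_le_pow_right₀ hr (h a (Finset.mem_insert_self _ _)))
  exact this _ fun i hi => by
    have := Finset.mem_range.1 hi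
    omega

/-- If v(x) > 1, the leading term would dominate all the others. -/
theorem nonarch_le_one_of_monic {F : Type*} [Field F] {v : AbsoluteValue F ℝ}
    (hv : IsNonarchimedean v) (hv' : ∀ t : ℤ, v t ≤ 1) {x : F} {P : ℤ[X]} (hP : P.Monic)
    (hx : aeval x P = 0) : v x ≤ 1 := by
  by_contra! h
  have h1 : aeval x P = x ^ P.natDegree + aeval x P.eraseLead := by
    conv_lhs => rw [← eraseLead_add_C_mul_X_pow P, hP.leadingCoeff]
    simp [add_comm]
  have h2 : v x ^ P.natDegree = v (aeval x P.eraseLead) := by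
    rw [← map_pow, ← v.map_neg]
    congr 1
    linear_combination h1 - hx
  have hdeg : P.natDegree ≠ 0 := fun h0 => by
    rw [hP.natDegree_eq_zero.1 h0] at hx
    simp at hx
  have h3 := nonarch_aeval_le hv hv' h.le le_rfl P.eraseLead
  have h4 : v x ^ P.eraseLead.natDegree ≤ v x ^ (P.natDegree - 1) :=
    pow_le_pow_right₀ h.le (eraseLead_natDegree_le P)
  have h5 : v x ^ (P.natDegree - 1) < v x ^ P.natDegree := pow_lt_pow_right₀ h (by omega)
  linarith

theorem le_of_deriv_sign {f f' : ℝ → ℝ} {a x₀ x : ℝ} (ha : a < x₀) (hx : a < x)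
    (hf : ∀ y, a < y → HasDerivAt f (f' y) y) (h1 : ∀ y, a < y → y ≤ x₀ → f' y ≤ 0)
    (h2 : ∀ y, x₀ ≤ y → 0 ≤ f' y) : f x₀ ≤ f x := by
  rcases le_total x x₀ with h | h
  · refine antitoneOn_of_deriv_nonpos (convex_Icc x x₀)
      (fun y hy => (hf y (hx.trans_le hy.1)).continuousAt.continuousWithinAt)
      (fun y hy => ?_) (fun y hy => ?_) (Set.left_mem_Icc.2 h) (Set.right_mem_Icc.2 h) h
    all_goals rw [interior_Icc] at hy
    · exact (hf y (hx.trans hy.1)).differentiableAt.differentiableWithinAt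
    · rw [(hf y (hx.trans hy.1)).deriv]
      exact h1 y (hx.trans hy.1) hy.2.le
  · refine monotoneOn_of_deriv_nonneg (convex_Icc x₀ x)
      (fun y hy => (hf y (ha.trans_le hy.1)).continuousAt.continuousWithinAt)
      (fun y hy => ?_) (fun y hy => ?_) (Set.left_mem_Icc.2 h) (Set.right_mem_Icc.2 h) h
    all_goals rw [interior_Icc] at hy
    · exact (hf y (ha.trans hy.1)).differentiableAt.differentiableWithinAt
    · rw [(hf y (ha.trans hy.1)).deriv]
      exact h2 y hy.1.le

theorem posLog_of_sq {x y : ℝ} (h : x ^ 2 = y) : log⁺ x = log⁺ y / 2 := by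
  rw [← h, ← half_mul_log_add_log_abs, ← half_mul_log_add_log_abs, log_pow, abs_mul]
  norm_num
  ring

theorem posLog_add_posLog_inv (x : ℝ) : log⁺ x + log⁺ x⁻¹ = |log x| := by
  rw [← half_mul_log_add_log_abs, ← half_mul_log_add_log_abs, log_inv, abs_neg]
  ring

theorem MatrixSeq.Represents.orbitHeight_eq_zero {n : ℕ} {m : MatrixSeq n} {σ : PGL(2, ℚ)}
    (h : m.Represents σ) {α : ℂ}
    (hα : ∀ i, m.den i α = 0 ∨ m.ev i α = 0 ∨ m.ev i α ^ 12 = 1) :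
    orbitHeight (Subgroup.zpowers σ) (α : OnePoint ℂ) = 0 := by
  rw [h.orbitHeight_eq]
  refine Finset.sum_eq_zero fun i _ => ?_
  rw [h.smul_coe]
  split_ifs with hd
  · exact weilHeight_infty
  · rw [weilHeight_coe]
    exact absLogHeight_eq_zero (by norm_num) ((hα i).resolve_left hd)

/-- If the whole orbit of `α` consists of roots of a monic polynomial, then only the archimedean
places contribute to the orbit height. -/
theorem MatrixSeq.Represents.orbitHeight_eq_of_integral {n : ℕ} {m : MatrixSeq n}
    {σ : PGL(2, ℚ)} (h : m.Represents σ) {P : ℤ[X]} {D : ℝ} (hP : P.Monic)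
    (hev : ∀ {K : Type} [Field K] [CharZero K] (x : K), aeval x P = 0 →
      ∀ i, m.den i x ≠ 0 ∧ aeval (m.ev i x) P = 0)
    (harch : ∀ z : ℂ, aeval z P = 0 → ∑ i, log⁺ ‖m.ev i z‖ = D) {α : ℂ} (hα : aeval α P = 0) :
    orbitHeight (Subgroup.zpowers σ) (α : OnePoint ℂ) = D := by
  refine h.orbitHeight_eq_of_places (k := 0) (B := ![]) (N := ![]) (M := ![]) hP.ne_zero hα
    (fun i => (hev α hα i).1) (fun j => j.elim0) (fun j => j.elim0) (fun z hz _ _ _ => ?_)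
    (fun F _ _ v hv hv' x hx _ _ _ => ?_)
  · simp [MatrixSeq.defect, harch z hz]
  · have : ∀ i, log⁺ (v (m.ev i x)) = 0 := fun i => by
      rw [posLog_eq_zero_iff, abs_of_nonneg (v.nonneg _)]
      exact nonarch_le_one_of_monic hv hv' hP (hev x hx i).2
    simp [this]

end OrbitHeight

/-! ### Order four: orbit function, finite places and the polynomial of α. -/

namespace OrbitHeight
open Polynomial Real Matrix

namespace OrderFour

/-- The powers of `z ↦ (z + 1) / (1 - z)`. -/
def mats : MatrixSeq 4 := ⟨![1, 1, 0, 1], ![0, 1, -1, -1], ![0, -1, 1, 1], ![1, 1, 0, 1]⟩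

section
variable {K : Type*} [Field K] (x : K)

@[simp] theorem num_zero : mats.num 0 x = x := by simp [mats, MatrixSeq.num]
@[simp] theorem den_zero : mats.den 0 x = 1 := by simp [mats, MatrixSeq.den]
@[simp] theorem num_one : mats.num 1 x = x + 1 := by simp [mats, MatrixSeq.num]
@[simp] theorem den_one : mats.den 1 x = 1 - x := by simp [mats, MatrixSeq.den]; ring
@[simp] theorem num_two : mats.num 2 x = -1 := by simp [mats, MatrixSeq.num]
@[simp] theorem den_two : mats.den 2 x = x := by simp [mats, MatrixSeq.den]
@[simp] theorem num_three : mats.num 3 x = x - 1 := by simp [mats, MatrixSeq.num]; ring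
@[simp] theorem den_three : mats.den 3 x = x + 1 := by simp [mats, MatrixSeq.den]
@[simp] theorem ev_zero : mats.ev 0 x = x := by simp [MatrixSeq.ev]
@[simp] theorem ev_one : mats.ev 1 x = (x + 1) / (1 - x) := by simp [MatrixSeq.ev]
@[simp] theorem ev_two : mats.ev 2 x = -1 / x := by simp [MatrixSeq.ev]
@[simp] theorem ev_three : mats.ev 3 x = (x - 1) / (x + 1) := by simp [MatrixSeq.ev]

theorem off_iff : (∀ i, mats.den i x ≠ 0) ↔ 1 - x ≠ 0 ∧ x ≠ 0 ∧ x + 1 ≠ 0 := by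
  simp [Fin.forall_fin_succ]

end

theorem represents {σ : PGL(2, ℚ)} {hdet} (hσ : σ = moebius 1 1 (-1) 1 hdet) :
    mats.Represents σ := by
  have h1 : ∃ h, σ = moebius (1 : ℤ) (1 : ℤ) (-1 : ℤ) (1 : ℤ) h := by
    refine ⟨by norm_num, ?_⟩; rw [hσ]; norm_num
  have h1' : ∃ h, σ ^ 1 = moebius (1 : ℤ) (1 : ℤ) (-1 : ℤ) (1 : ℤ) h := by rwa [pow_one]
  have h2 := exists_pow_succ_eq_moebius h1' h1 (-2) 0 (-1) 1 0
    (by norm_num) (by norm_num) (by norm_num) (by norm_num) (by norm_num)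
  have h3 := exists_pow_succ_eq_moebius h2 h1 1 1 (-1) 1 1
    (by norm_num) (by norm_num) (by norm_num) (by norm_num) (by norm_num)
  have h4 := exists_pow_succ_eq_moebius h3 h1 1 2 0 0 2
    (by norm_num) (by norm_num) (by norm_num) (by norm_num) (by norm_num)
  refine .of_pow (by norm_num) (fun i => ?_) _ h4 (fun i hi => ?_)
  · fin_cases i
    · exact exists_pow_zero_eq_moebius σ
    · exact h1'
    · exact h2
    · exact h3
  · fin_cases i <;> simp [mats] at hi ⊢

/-- The numerator and denominator of the orbit function
`(X² + 1)⁴ / (X² (X² - 1)²)`. -/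
noncomputable def N : ℤ[X] := (X ^ 2 + 1) ^ 4
noncomputable def M : ℤ[X] := (X * (X ^ 2 - 1)) ^ 2

theorem aeval_N {K : Type*} [Field K] (x : K) : aeval x N = (x ^ 2 + 1) ^ 4 := by simp [N]
theorem aeval_M {K : Type*} [Field K] (x : K) : aeval x M = (x * (x ^ 2 - 1)) ^ 2 := by simp [M]

theorem quot {a : ℂ} (ha : a ^ 2 = -1) : mats.Quot {a} N M := by
  have h1 : (X ^ 2 + 1 : ℤ[X]).Monic := by monicity!
  have h2 : (X ^ 2 - 1 : ℤ[X]).Monic := by monicity!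
  refine ⟨(h1.pow 4).isPrimitive, ((monic_X.mul h2).pow 2).isPrimitive, fun z h1 h2 => ?_,
    fun z hz => ?_, ⟨a, rfl⟩, ?_⟩
  · rw [aeval_N, pow_eq_zero_iff (by norm_num)] at h1
    rw [aeval_M, pow_eq_zero_iff (by norm_num), mul_eq_zero] at h2
    rcases h2 with rfl | h2
    · norm_num at h1
    · have : (2 : ℂ) = 0 := by linear_combination h1 - h2
      norm_num at this
  · obtain ⟨h1, h2, h3⟩ := (off_iff z).1 hz
    rw [aeval_M, show z * (z ^ 2 - 1) = -(z * (1 - z) * (z + 1)) by ring]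
    exact pow_ne_zero 2 (neg_ne_zero.2 (mul_ne_zero (mul_ne_zero h2 h1) h3))
  · rintro a rfl
    refine ⟨_, minpoly_of_quadratic (k := 0) (by norm_num) (by rw [ha]; norm_num), 4, by norm_num,
      fun z hz => ?_⟩
    obtain ⟨h1, h2, h3⟩ := (off_iff z).1 hz
    rw [aeval_N, aeval_M, Fin.prod_univ_four]
    obtain ⟨d, hd⟩ : ∃ d, d = 1 - z := ⟨_, rfl⟩
    obtain ⟨e, he⟩ : ∃ e, e = z + 1 := ⟨_, rfl⟩
    rw [show z * (z ^ 2 - 1) = -(z * (1 - z) * (z + 1)) by ring]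
    simp only [ev_zero, ev_one, ev_two, ev_three]
    rw [← hd] at h1 ⊢
    rw [← he] at h3 ⊢
    simp
    field_simp
    rw [hd, he]
    ring

theorem defect_eq {z : ℂ} (hz : ∀ i, mats.den i z ≠ 0) (hN : z ^ 2 + 1 ≠ 0) (B : ℝ) :
    mats.defect ![B] ![N] ![M] z = log⁺ ‖z‖ + log⁺ ‖z‖⁻¹ + |log (‖z + 1‖ / ‖z - 1‖)| -
      B * (4 * log ‖z ^ 2 + 1‖ - 2 * (log ‖z‖ + log ‖z ^ 2 - 1‖)) := by
  obtain ⟨h1, h2, h3⟩ := (off_iff z).1 hz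
  have h4 : z ^ 2 - 1 ≠ 0 := by
    rw [show z ^ 2 - 1 = -((1 - z) * (z + 1)) by ring]
    exact neg_ne_zero.2 (mul_ne_zero h1 h3)
  simp only [MatrixSeq.defect, Fin.sum_univ_four, ev_zero, ev_one, ev_two, ev_three,
    Finset.univ_unique,
    Fin.default_eq_zero, Matrix.cons_val_fin_one, Finset.sum_singleton, aeval_N, aeval_M]
  rw [← posLog_add_posLog_inv, inv_div, norm_div, norm_div, norm_div, norm_div, norm_neg, norm_one,
    one_div, norm_sub_rev 1 z, norm_pow, norm_pow, norm_mul,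
    log_div (pow_ne_zero _ (norm_ne_zero_iff.2 hN))
      (pow_ne_zero _ (mul_ne_zero (norm_ne_zero_iff.2 h2) (norm_ne_zero_iff.2 h4))),
    log_pow, log_pow, log_mul (norm_ne_zero_iff.2 h2) (norm_ne_zero_iff.2 h4)]
  push_cast
  ring

/-- Up to sign, x² + 1 is num_i·den_j − den_i·num_j for (i, j) = (0, 1) and (2, 3), reflecting that
the zeros are fixed points. These two estimates together use each exponent once. -/
theorem nonarchBound : mats.NonarchBound N M 2 := by
  intro F _ v hv hv' x
  have key : ∀ y : F, v (y ^ 2 + 1) ≤ max 1 (v y) * max (v (1 - y)) (v (y + 1)) := fun y => by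
    rw [show y ^ 2 + 1 = y * (y + 1) + (1 - y) by ring]
    refine nonarch_add_le hv ?_ ?_
    · rw [map_mul]
      exact mul_le_mul (le_max_right _ _) (le_max_right _ _) (v.nonneg _) (by positivity)
    · exact (le_max_left _ _).trans
        (le_mul_of_one_le_left (le_max_of_le_left (v.nonneg _)) (le_max_left _ _))
  have h1 := key x
  have h2 : v (x ^ 2 + 1) ≤ max (v x) 1 * max (v (x + 1)) (v (x - 1)) := by
    rw [max_comm (v x), v.map_sub x 1, max_comm (v (x + 1))]; exact h1
  simp only [Fin.prod_univ_four, num_zero, num_one, num_two, num_three, den_zero, den_one, den_two,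
    den_three, aeval_N, aeval_M, map_one, one_mul, one_pow, map_pow, map_mul, v.map_neg]
  rw [show x ^ 2 - 1 = -((1 - x) * (x + 1)) by ring, v.map_neg, map_mul]
  have h3 := mul_le_mul h1 h2 (v.nonneg _) (by positivity)
  have h4 := pow_le_pow_left₀ (by positivity) h3 2
  calc _ = (v x * (v (1 - x) * v (x + 1))) ^ 2 * (v (x ^ 2 + 1) * v (x ^ 2 + 1)) ^ 2 := by ring
    _ ≤ _ := mul_le_mul_of_nonneg_left h4 (by positivity)
    _ = _ := by ring

theorem polyFour_monic : polyFour.Monic := by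
  unfold polyFour
  monicity!

theorem aeval_polyFour {K : Type*} [Field K] (x : K) :
    aeval x polyFour = (x ^ 2 + 1) ^ 4 + x ^ 2 * (x ^ 2 - 1) ^ 2 := by
  simp [polyFour]

/-- The polynomial is N + M, so its roots are the solutions of φ = −1, a G-invariant condition. -/
theorem polyFour_ev {K : Type} [Field K] [CharZero K] (x : K) (hx : aeval x polyFour = 0)
    (i : Fin 4) : mats.den i x ≠ 0 ∧ aeval (mats.ev i x) polyFour = 0 := by
  rw [aeval_polyFour] at hx
  have h1 : 1 - x ≠ 0 := fun h => by
    rw [← sub_eq_zero.1 h] at hx; norm_num at hx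
  have h2 : x ≠ 0 := by rintro rfl; norm_num at hx
  have h3 : x + 1 ≠ 0 := fun h => by
    rw [eq_neg_of_add_eq_zero_left h] at hx; norm_num at hx
  refine ⟨(off_iff x).2 ⟨h1, h2, h3⟩ i, ?_⟩
  obtain ⟨d, hd⟩ : ∃ d, d = 1 - x := ⟨_, rfl⟩
  obtain ⟨e, he⟩ : ∃ e, e = x + 1 := ⟨_, rfl⟩
  rw [aeval_polyFour]
  fin_cases i
  · simpa using hx
  · simp only [Fin.mk_one, ev_one]
    rw [← hd] at h1 ⊢
    field_simp
    rw [hd]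
    linear_combination 16 * hx
  · simp only [Fin.reduceFinMk, ev_two]
    field_simp
    linear_combination hx
  · simp only [Fin.reduceFinMk, ev_three]
    rw [← he] at h3 ⊢
    field_simp
    rw [he]
    linear_combination 16 * hx

end OrderFour
end OrbitHeight

/-! ### Order four: the critical parameter and the minimum on the circle. -/

namespace OrbitHeight
open Polynomial Real Matrix

namespace OrderFour

/-- T is |α|² for the maximal root α = i√T; the equation is `polyFour` at z² = −T. -/
theorem exists_parameter : ∃ T : ℝ, 4.3305 < T ∧ T < 4.3307 ∧ (T - 1) ^ 4 = T * (T + 1) ^ 2 := by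
  have hc : ContinuousOn (fun T : ℝ => (T - 1) ^ 4 - T * (T + 1) ^ 2) (Set.Icc 4.3305 4.3307) := by
    fun_prop
  obtain ⟨T, hT, h⟩ := intermediate_value_Ioo (by norm_num) hc
    (show (0 : ℝ) ∈ Set.Ioo _ _ by constructor <;> norm_num)
  exact ⟨T, hT.1, hT.2, by simpa [sub_eq_zero] using h⟩

section
variable {T : ℝ} (hT1 : 4.3305 < T) (hT2 : T < 4.3307) (hT : (T - 1) ^ 4 = T * (T + 1) ^ 2)
include hT1 hT2 hT

omit hT2 in
theorem root_cases {z : ℂ} (hz : aeval z polyFour = 0) :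
    (z.re = 0 ∧ ‖z‖ ^ 2 = T) ∨ (z.re = 0 ∧ ‖z‖ ^ 2 = T⁻¹) ∨
      (‖z‖ = 1 ∧ (z.re = (T - 1) / (T + 1) ∨ z.re = -((T - 1) / (T + 1)))) := by
  rw [aeval_polyFour] at hz
  have hT0 : T ≠ 0 := by linarith
  have hT0' : T + 1 ≠ 0 := by linarith
  have hTc : ((T : ℂ) - 1) ^ 4 = T * (T + 1) ^ 2 := by exact_mod_cast hT
  -- By the equation for T, the polynomial times T(T + 1)² splits into four real quadratics: one for
  -- modulus √T, one for 1/√T, and two with roots on the unit circle.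
  have h0 : (z ^ 2 + T) * (T * z ^ 2 + 1) *
      (((T + 1) * (z ^ 2 + 1) - 2 * (T - 1) * z) * ((T + 1) * (z ^ 2 + 1) + 2 * (T - 1) * z)) = 0 := by
    linear_combination (T : ℂ) * (T + 1) ^ 2 * hz +
      (z ^ 2 * (z ^ 2 + 1) ^ 2 - 4 * z ^ 4) * hTc
  have hr : (2 * (T - 1) / (T + 1)) ^ 2 < 4 * 1 := by
    rw [div_pow, div_lt_iff₀ (by positivity)]
    nlinarith
  have hTc0 : (T : ℂ) ≠ 0 := by exact_mod_cast hT0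
  have hTc1 : (T : ℂ) + 1 ≠ 0 := by exact_mod_cast hT0'
  have hn : ∀ x : ℝ, 0 ≤ x → x ^ 2 = 1 → x = 1 := fun x hx h =>
    (pow_eq_one_iff_of_nonneg hx two_ne_zero).1 h
  rcases mul_eq_zero.1 h0 with h | h <;> rcases mul_eq_zero.1 h with h | h
  · obtain ⟨h1, h2⟩ := re_and_norm_of_quadratic (z := z) (k := 0) (m := T) (by linarith)
      (by push_cast; linear_combination h)
    exact Or.inl ⟨by linarith, h2⟩
  · obtain ⟨h1, h2⟩ := re_and_norm_of_quadratic (z := z) (k := 0) (m := T⁻¹)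
      (by have : 0 < T⁻¹ := inv_pos.2 (by linarith)
          linarith) (by push_cast; field_simp; linear_combination h)
    exact Or.inr (Or.inl ⟨by linarith, h2⟩)
  · obtain ⟨h1, h2⟩ := re_and_norm_of_quadratic (z := z) (k := 2 * (T - 1) / (T + 1)) (m := 1) hr
      (by push_cast; field_simp; linear_combination h)
    exact Or.inr (Or.inr ⟨hn _ (norm_nonneg _) h2, Or.inl (by rw [h1]; ring)⟩)
  · obtain ⟨h1, h2⟩ := re_and_norm_of_quadratic (z := z) (k := -(2 * (T - 1) / (T + 1))) (m := 1)
      (by rwa [neg_sq]) (by push_cast; field_simp; linear_combination h)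
    exact Or.inr (Or.inr ⟨hn _ (norm_nonneg _) h2, Or.inr (by rw [h1]; ring)⟩)

omit hT2 in
theorem maximal : (∃! α : ℂ, IsMaximalRoot polyFour α) ∧
    ∀ α : ℂ, IsMaximalRoot polyFour α → α.re = 0 / 2 ∧ ‖α‖ ^ 2 = T := by
  have hinv : T⁻¹ < 1 := inv_lt_one_of_one_lt₀ (by linarith)
  refine existsUnique_isMaximalRoot (by linarith) (fun z hz => ?_) (fun z hz => ?_)
    fun z hz _ hn => ?_
  · rw [aeval_polyFour]
    have h1 : z ^ 2 + T = 0 := by push_cast at hz; linear_combination hz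
    have hTc : ((T : ℂ) - 1) ^ 4 = T * (T + 1) ^ 2 := by exact_mod_cast hT
    have h2 : z ^ 2 = -T := by linear_combination h1
    rw [show z ^ 2 + 1 = -((T : ℂ) - 1) by linear_combination h2, h2]
    linear_combination hTc
  · rcases root_cases hT1 hT hz with ⟨-, h⟩ | ⟨-, h⟩ | ⟨h, -⟩
    · exact h.le
    · linarith
    · rw [h]; linarith
  · rcases root_cases hT1 hT hz with ⟨h, -⟩ | ⟨h, -⟩ | ⟨h, -⟩
    · rw [h]; norm_num
    · rw [h]; norm_num
    · rw [h] at hn; linarith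

omit hT2 in
theorem sum_posLog_of_root {z : ℂ} (hz : aeval z polyFour = 0) :
    ∑ i, log⁺ ‖mats.ev i z‖ = log T / 2 := by
  have hne : ∀ i, mats.den i z ≠ 0 := fun i => (polyFour_ev z hz i).1
  obtain ⟨h1, h2, h3⟩ := (off_iff z).1 hne
  have e : ∑ i, log⁺ ‖mats.ev i z‖ = |log ‖z‖| + |log (‖z + 1‖ / ‖z - 1‖)| := by
    rw [Fin.sum_univ_four, ← posLog_add_posLog_inv, ← posLog_add_posLog_inv, ev_zero, ev_one,
      ev_two, ev_three, norm_div, norm_div, norm_div, norm_neg, norm_one, one_div, inv_div,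
      norm_sub_rev 1 z]
    ring
  have hlT : 0 < log T := log_pos (by linarith)
  have a1 := sq_norm_linear z 1 1
  have a2 := sq_norm_linear z 1 (-1)
  push_cast at a1 a2
  rw [one_mul] at a1 a2
  rw [← sub_eq_add_neg] at a2
  have hl : ∀ x y : ℝ, x ^ 2 = y → log x = log y / 2 := fun x y h => by
    rw [← h, log_pow]; push_cast; ring
  have hpos : 0 < ‖z - 1‖ := by rw [norm_sub_rev]; exact norm_pos_iff.2 h1
  rw [e]
  have h0 : z.re = 0 → log (‖z + 1‖ / ‖z - 1‖) = 0 := fun h => by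
    have : ‖z + 1‖ = ‖z - 1‖ := by
      rw [← pow_left_inj₀ (norm_nonneg _) (norm_nonneg _) two_ne_zero, a1, a2, h]; ring
    rw [this, div_self hpos.ne', log_one]
  rcases root_cases hT1 hT hz with ⟨h, h'⟩ | ⟨h, h'⟩ | ⟨h, h'⟩
  · rw [h0 h, hl _ _ h', abs_zero, add_zero, abs_of_pos (by linarith)]
  · rw [h0 h, hl _ _ h', log_inv, abs_zero, add_zero, abs_of_neg (by linarith)]; ring
  · rw [h] at a1 a2
    have hT1' : T + 1 ≠ 0 := by linarith
    have hTne : T ≠ 0 := by linarith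
    rw [h, log_one, abs_zero, zero_add]
    rcases h' with h' | h'
    · rw [hl _ T, abs_of_pos (by linarith)]
      rw [div_pow, div_eq_iff (pow_ne_zero 2 hpos.ne'), a1, a2, h']
      field_simp; ring
    · rw [hl _ T⁻¹, log_inv, abs_of_neg (by linarith)]
      · ring
      · rw [div_pow, div_eq_iff (pow_ne_zero 2 hpos.ne'), a1, a2, h']
        field_simp; ring

omit hT2 in
-- B is the value for which the derivative vanishes at T; the derivative is then y − T times a
-- positive function of y > 1. The equation for T makes the bracket after B vanish at t = T, so the
-- minimum is (log T)/2.
theorem min_le {B t : ℝ} (hB : B = (T ^ 2 - 1) / (2 * (T ^ 2 + 6 * T + 1))) (ht : 1 < t) :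
    log T / 2 ≤ log t / 2 - B * (4 * log (t - 1) - 2 * log (t + 1) - log t) := by
  have hG : log T / 2 = log T / 2 - B * (4 * log (T - 1) - 2 * log (T + 1) - log T) := by
    have := congrArg log hT
    rw [log_mul (by linarith) (pow_ne_zero _ (by linarith)), log_pow, log_pow] at this
    push_cast at this
    rw [this]
    ring
  rw [hG]
  refine le_of_deriv_sign
    (f := fun t => log t / 2 - B * (4 * log (t - 1) - 2 * log (t + 1) - log t))
    (f' := fun t => t⁻¹ / 2 - B * (4 * (t - 1)⁻¹ - 2 * (t + 1)⁻¹ - t⁻¹)) (a := 1) (by linarith) ht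
    (fun y hy => ?_) (fun y hy hyT => ?_) (fun y hyT => ?_)
  · have d1 := hasDerivAt_log (show y ≠ 0 by linarith)
    have d2 := ((hasDerivAt_id' y).sub_const 1).log (show y - 1 ≠ 0 by linarith)
    have d3 := ((hasDerivAt_id' y).add_const 1).log (show y + 1 ≠ 0 by linarith)
    exact ((d1.div_const 2).sub ((((d2.const_mul 4).sub (d3.const_mul 2)).sub d1).const_mul
      B)).congr_deriv (by simp)
  all_goals
    have hy1 : 1 < y := by linarith
    have hq : 0 < T ^ 2 + 6 * T + 1 := by nlinarith
    have e : y⁻¹ / 2 - B * (4 * (y - 1)⁻¹ - 2 * (y + 1)⁻¹ - y⁻¹) =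
        (y - T) * ((6 * y * T + 2 * (y + T) + 6) /
          (2 * (T ^ 2 + 6 * T + 1) * (y * (y - 1) * (y + 1)))) := by
      rw [hB]
      have : y - 1 ≠ 0 := by linarith
      have : y + 1 ≠ 0 := by linarith
      have : y ≠ 0 := by linarith
      field_simp
      ring
    have hp : 0 ≤ (6 * y * T + 2 * (y + T) + 6) /
        (2 * (T ^ 2 + 6 * T + 1) * (y * (y - 1) * (y + 1))) := by
      have : 0 < y - 1 := by linarith
      positivity
    simp only [e]
  · exact mul_nonpos_of_nonpos_of_nonneg (by linarith) hp
  · exact mul_nonneg (by linarith) hp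

omit hT2 in
theorem circle_le {B : ℝ} (hB : B = (T ^ 2 - 1) / (2 * (T ^ 2 + 6 * T + 1))) {z : ℂ}
    (hz : ‖z‖ = 1) (hoff : ∀ i, mats.den i z ≠ 0) (hN : z ^ 2 + 1 ≠ 0) :
    log T / 2 ≤ mats.defect ![B] ![N] ![M] z := by
  obtain ⟨h1, h2, h3⟩ := (off_iff z).1 hoff
  rw [defect_eq hoff hN, hz, inv_one, posLog_one, log_one]
  have a1 := sq_norm_linear z 1 1
  have a2 := sq_norm_linear z 1 (-1)
  push_cast at a1 a2
  rw [one_mul, hz] at a1 a2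
  rw [← sub_eq_add_neg] at a2
  have a3 := norm_quad_palindromic hz 0
  push_cast at a3
  rw [zero_mul, add_zero, add_zero] at a3
  set x := ‖z + 1‖ with hx
  set y := ‖z - 1‖ with hy
  have hx0 : 0 < x := norm_pos_iff.2 h3
  have hy0 : 0 < y := by rw [hy, norm_sub_rev]; exact norm_pos_iff.2 h1
  have hQ := norm_pos_iff.2 hN
  have e1 : ‖z ^ 2 - 1‖ = x * y := by
    rw [hx, hy, ← norm_mul]; congr 1; ring
  have e2 : ‖z ^ 2 + 1‖ = |x ^ 2 - y ^ 2| / 2 := by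
    rw [a3, a1, a2, eq_div_iff two_ne_zero, ← abs_two, ← abs_mul, abs_two]
    congr 1; ring
  have e3 : x ^ 2 + y ^ 2 = 4 := by rw [a1, a2]; ring
  rw [e1, e2]
  rw [e2] at hQ
  -- The parameter is t = (b/a)². Since a² + b² = 4, both t − 1 and t + 1 are expressed by a and (b²
  -- − a²)/2. The symmetry z ↦ −z, which exchanges x and y, reduces to a < b.
  have key : ∀ a b : ℝ, 0 < a → a < b → a ^ 2 + b ^ 2 = 4 → log T / 2 ≤ log (b / a) -
      B * (4 * log ((b ^ 2 - a ^ 2) / 2) - 2 * log (b * a)) := fun a b ha hab h4 => by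
    have hb : 0 < b := ha.trans hab
    have ht : 1 < (b / a) ^ 2 := one_lt_pow₀ ((one_lt_div ha).2 hab) two_ne_zero
    have h := min_le hT1 hT hB ht
    have h5 : (b / a) ^ 2 - 1 = (b ^ 2 - a ^ 2) / 2 * (2 / a ^ 2) := by field_simp
    have h6 : (b / a) ^ 2 + 1 = (2 / a) ^ 2 := by
      field_simp
      linear_combination h4
    have h7 : 0 < (b ^ 2 - a ^ 2) / 2 := by nlinarith
    rw [h6, h5, log_mul h7.ne' (by positivity), log_pow, log_pow, log_div hb.ne' ha.ne',
      log_div two_ne_zero ha.ne', log_div two_ne_zero (by positivity), log_pow] at h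
    rw [log_div hb.ne' ha.ne', log_mul hb.ne' ha.ne']
    push_cast at h
    linarith
  rcases lt_trichotomy x y with h | h | h
  · have := key x y hx0 h e3
    rw [abs_of_neg (by nlinarith : x ^ 2 - y ^ 2 < 0), neg_sub,
      abs_of_neg (log_neg (by positivity) ((div_lt_one hy0).2 h)), ← log_inv, inv_div, mul_comm x]
    linarith
  · rw [h] at hQ; norm_num at hQ
  · have := key y x hy0 h (by linarith)
    rw [abs_of_pos (by nlinarith : 0 < x ^ 2 - y ^ 2),
      abs_of_pos (log_pos ((one_lt_div hy0).2 h))]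
    linarith

end

end OrderFour
end OrbitHeight

/-! ### Order four: the bounds and their sharpness. -/

namespace OrbitHeight
open Polynomial Real Matrix

namespace OrderFour

theorem parameter_bounds {T B : ℝ} (hT1 : 4.3305 < T) (hT2 : T < 4.3307)
    (hB : B = (T ^ 2 - 1) / (2 * (T ^ 2 + 6 * T + 1))) : 0.19408 ≤ B ∧ B < 0.19409 := by
  have hq : 0 < T ^ 2 + 6 * T + 1 := by nlinarith
  rw [hB, le_div_iff₀ (by positivity), div_lt_iff₀ (by positivity)]
  constructor <;> nlinarith

theorem growth {B : ℝ} (hB : 0 < B) (hB' : B < 1 / 4) (D' : ℝ) :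
    ∃ R : ℝ, ∀ z : ℂ, R < ‖z‖ → z ∈ MatrixSeq.regular mats ![N] →
      D' ≤ mats.defect ![B] ![N] ![M] z := by
  -- The orbit function has degree 8 − 6 = 2 at ∞, against one factor |z| from log⁺|z|.
  refine exists_radius_of_growth (δ := 1 - 2 * B) (c := 6 * B * log 2) (R₀ := 2) (by linarith)
    (fun z hr hz => ?_) D'
  have hN : z ^ 2 + 1 ≠ 0 := by simpa [aeval_N] using hr.2 0
  have hz0 : 0 < ‖z‖ := by linarith
  rw [defect_eq hr.1 hN, posLog_eq_log (by rw [abs_norm]; linarith)]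
  have e0 : ‖z ^ 2‖ = ‖z‖ ^ 2 := norm_pow z 2
  have e1 : log ‖z ^ 2 + 1‖ ≤ log 2 + 2 * log ‖z‖ := by
    have h1 : ‖z ^ 2 + 1‖ ≤ 2 * ‖z‖ ^ 2 := by
      refine (norm_add_le _ _).trans ?_
      rw [e0, norm_one]
      nlinarith
    refine (log_le_log (norm_pos_iff.2 hN) h1).trans ?_
    rw [log_mul (by norm_num) (by positivity), log_pow]; norm_num
  have e2 : 2 * log ‖z‖ - log 2 ≤ log ‖z ^ 2 - 1‖ := by
    have h1 : ‖z‖ ^ 2 / 2 ≤ ‖z ^ 2 - 1‖ := by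
      refine le_trans ?_ (norm_sub_norm_le _ _)
      rw [e0, norm_one]
      nlinarith
    refine le_trans (le_of_eq ?_) (log_le_log (by positivity) h1)
    rw [log_div (by positivity) (by norm_num), log_pow]; norm_num
  have e3 : 0 ≤ log⁺ ‖z‖⁻¹ := posLog_nonneg
  have e4 := mul_le_mul_of_nonneg_left e1 hB.le
  have e5 := mul_le_mul_of_nonneg_left e2 hB.le
  have e6 := abs_nonneg (log (‖z + 1‖ / ‖z - 1‖))
  linarith

theorem bounds {σ : PGL(2, ℚ)} (hrep : mats.Represents σ) {T B : ℝ} (hT1 : 4.3305 < T)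
    (hT2 : T < 4.3307) (hT : (T - 1) ^ 4 = T * (T + 1) ^ 2)
    (hB : B = (T ^ 2 - 1) / (2 * (T ^ 2 + 6 * T + 1))) {a : ℂ} (ha : a ^ 2 = -1) :
    OrbitInequality σ ![{a}] ![B] (log T / 2) ∧
      IsHeightBound σ (algNumbersOffInfty σ) (log T / 2) := by
  obtain ⟨hB1, hB2⟩ := parameter_bounds hT1 hT2 hB
  refine hrep.bounds (N := ![N]) (M := ![M]) (fun j => ?_) (fun j => ?_)
    (fun z hz hr => circle_le hT1 hT hB hz hr.1 (by simpa [aeval_N] using hr.2 0))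
    (fun D' _ => growth (by linarith) (by linarith) D') ![2] (fun j => ?_)
    (by simp; linarith) (fun j z hj => ?_)
  · fin_cases j; exact quot ha
  · fin_cases j; simp; linarith
  · fin_cases j; exact nonarchBound
  · fin_cases j
    have h1 : z ^ 2 + 1 = 0 := by simpa [aeval_N] using hj
    right
    rw [show z ^ 12 = (z ^ 2) ^ 6 by ring, eq_neg_of_add_eq_zero_left h1]; norm_num

/-- The orbit of ∞ is {∞, −1, 0, 1}, of height 0. -/
theorem orbitHeight_of_not_off {σ : PGL(2, ℚ)} (hrep : mats.Represents σ) {α : ℂ}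
    (hα : ∃ i, mats.den i α = 0) :
    orbitHeight (Subgroup.zpowers σ) (α : OnePoint ℂ) = 0 := by
  have h : α = 1 ∨ α = 0 ∨ α = -1 := by
    by_contra! h
    obtain ⟨i, hi⟩ := hα
    exact (off_iff α).2 ⟨sub_ne_zero.2 h.1.symm, h.2.1, fun h1 =>
      h.2.2 (eq_neg_of_add_eq_zero_left h1)⟩ i hi
  refine hrep.orbitHeight_eq_zero fun i => ?_
  rcases h with rfl | rfl | rfl <;> fin_cases i <;> norm_num [mats, MatrixSeq.ev, MatrixSeq.num, MatrixSeq.den]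

end OrderFour

theorem order_four (σ : PGL(2, ℚ)) {hdet} (hσ : σ = moebius 1 1 (-1) 1 hdet) :
    HasOrbits σ 4 ![{Complex.I}, {-Complex.I}] ∧ (∃! α : ℂ, IsMaximalRoot polyFour α) ∧
      ∀ α : ℂ, IsMaximalRoot polyFour α → ∀ D : ℝ, D = Real.log ‖α‖ →
        0 < D ∧
        (∃ B : ℝ, 0.19408 ≤ B ∧ B < 0.19409 ∧ OrbitInequality σ ![{Complex.I}] ![B] D ∧
          OrbitInequality σ ![{-Complex.I}] ![B] D) ∧
        IsHeightBound σ algNumbers D ∧ AttainsBound σ algNumbers D α := by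
  have hrep := OrderFour.represents hσ
  obtain ⟨T, hT1, hT2, hT⟩ := OrderFour.exists_parameter
  obtain ⟨hu, hm⟩ := OrderFour.maximal hT1 hT
  have hI : Complex.I ^ 2 = -1 := Complex.I_sq
  have hI' : (-Complex.I) ^ 2 = -1 := by rw [neg_sq, hI]
  refine ⟨hrep.hasOrbits ⟨1, ?_⟩ fun j => ?_, hu, fun α hα D hD => ?_⟩
  · simp [OrderFour.mats]
  · have key : ∀ a : ℂ, a ^ 2 = -1 → (∀ z ∈ ({a} : Set ℂ), z = 0 ∨ ‖z‖ = 1) ∧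
        ∃ x : ℂ, (∀ i, OrderFour.mats.den i x ≠ 0) ∧
          ({a} : Set ℂ) = Set.range fun i => OrderFour.mats.ev i x := fun a ha => by
      have h0 : a ≠ 0 := by rintro rfl; norm_num at ha
      have h1 : 1 - a ≠ 0 := fun h => by
        rw [← sub_eq_zero.1 h] at ha; norm_num at ha
      have h2 : a + 1 ≠ 0 := fun h => by
        rw [eq_neg_of_add_eq_zero_left h] at ha; norm_num at ha
      refine ⟨fun z hz => Or.inr ?_, a, (OrderFour.off_iff a).2 ⟨h1, h0, h2⟩, ?_⟩
      · rw [Set.mem_singleton_iff.1 hz]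
        exact Complex.norm_eq_one_of_pow_eq_one (n := 4)
          (by rw [show a ^ 4 = (a ^ 2) ^ 2 by ring, ha]; norm_num) (by norm_num)
      · have e1 : (a + 1) / (1 - a) = a := by rw [div_eq_iff h1]; linear_combination ha
        have e2 : -1 / a = a := by rw [div_eq_iff h0]; linear_combination -ha
        have e3 : (a - 1) / (a + 1) = a := by rw [div_eq_iff h2]; linear_combination -ha
        ext y
        simp only [Set.mem_singleton_iff, Set.mem_range, Fin.exists_fin_succ, OrderFour.ev_zero,
          Fin.succ_zero_eq_one, Fin.succ_one_eq_two, OrderFour.ev_one, OrderFour.ev_two, e1, e2]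
        simp [eq_comm, e3]
    fin_cases j
    · exact key _ hI
    · exact key _ hI'
  · have hD' : D = log T / 2 := by
      rw [hD, ← (hm α hα).2, log_pow]; push_cast; ring
    obtain ⟨hB1, hB2⟩ := OrderFour.parameter_bounds hT1 hT2 rfl
    have hb := OrderFour.bounds hrep hT1 hT2 hT rfl hI
    have hb' := OrderFour.bounds hrep hT1 hT2 hT rfl hI'
    rw [← hD'] at hb hb'
    have hb2 := hrep.isHeightBound_algNumbers hb.2 fun β hβ =>
      Or.inl (OrderFour.orbitHeight_of_not_off hrep hβ)
    refine ⟨?_, ⟨_, hB1, hB2, hb.1, hb'.1⟩, hb2, attainsBound_of_eq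
      (isAlgebraic_of_aeval_intPoly OrderFour.polyFour_monic.ne_zero hα.1) ?_ hb2⟩
    · have := log_pos (show 1 < T by linarith)
      linarith
    · rw [hD']
      exact hrep.orbitHeight_eq_of_integral OrderFour.polyFour_monic OrderFour.polyFour_ev
        (fun z hz => OrderFour.sum_posLog_of_root hT1 hT hz) hα.1

end OrbitHeight

/-! ### Order three with fixed points ω: orbit function, finite places and the polynomial of α. -/

namespace OrbitHeight
open Polynomial Real Matrix

namespace OrderThreeOmega

/-- The powers of `z ↦ 1 / (s - z)`. -/
def mats (s : ℤ) : MatrixSeq 3 := ⟨![1, 0, s], ![0, 1, -1], ![0, -1, 1], ![1, s, 0]⟩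

variable {s : ℤ}

section
variable {K : Type*} [Field K] (x : K)

@[simp] theorem num_zero : (mats s).num 0 x = x := by simp [mats, MatrixSeq.num]
@[simp] theorem den_zero : (mats s).den 0 x = 1 := by simp [mats, MatrixSeq.den]
@[simp] theorem num_one : (mats s).num 1 x = 1 := by simp [mats, MatrixSeq.num]
@[simp] theorem den_one : (mats s).den 1 x = s - x := by simp [mats, MatrixSeq.den]; ring
@[simp] theorem num_two : (mats s).num 2 x = s * x - 1 := by simp [mats, MatrixSeq.num]; ring
@[simp] theorem den_two : (mats s).den 2 x = x := by simp [mats, MatrixSeq.den]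
@[simp] theorem ev_zero : (mats s).ev 0 x = x := by simp [MatrixSeq.ev]
@[simp] theorem ev_one : (mats s).ev 1 x = 1 / (s - x) := by simp [MatrixSeq.ev]
@[simp] theorem ev_two : (mats s).ev 2 x = (s * x - 1) / x := by simp [MatrixSeq.ev]

theorem off_iff : (∀ i, (mats s).den i x ≠ 0) ↔ s - x ≠ 0 ∧ x ≠ 0 := by
  simp [Fin.forall_fin_succ]

end

theorem represents (hs : s = 1 ∨ s = -1) {σ : PGL(2, ℚ)} {hdet}
    (hσ : σ = moebius 0 1 (-1) s hdet) : (mats s).Represents σ := by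
  have hss := sign_mul_self hs
  have h1 : ∃ h, σ = moebius (0 : ℤ) (1 : ℤ) (-1 : ℤ) s h := by
    refine ⟨by norm_num, ?_⟩; rw [hσ]; norm_num
  have h1' : ∃ h, σ ^ 1 = moebius (0 : ℤ) (1 : ℤ) (-1 : ℤ) s h := by rwa [pow_one]
  have h2 := exists_pow_succ_eq_moebius h1' h1 (-1) 1 (-s) s 0
    (by norm_num) (by norm_num) (by norm_num) (by norm_num) (by linarith)
  have h2' : ∃ h, σ ^ 2 = moebius s (-1 : ℤ) (1 : ℤ) (0 : ℤ) h := by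
    obtain ⟨_, h⟩ := h2
    -- Multiplication by the unit s brings the matrix of σ² into the form listed in `mats`.
    obtain ⟨h3, e⟩ := moebius_eq_of_smul s _ _ _ _ s (-1 : ℤ) (1 : ℤ) (0 : ℤ) ‹_›
      (by rcases hs with rfl | rfl <;> norm_num) (by push_cast; ring)
      (by rcases hs with rfl | rfl <;> norm_num) (by rcases hs with rfl | rfl <;> norm_num)
      (by push_cast; ring)
    exact ⟨h3, h.trans e⟩
  have h3 := exists_pow_succ_eq_moebius h2' h1 1 1 0 0 1
    (by norm_num) (by norm_num) (by linarith) (by norm_num) (by norm_num)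
  refine .of_pow (by norm_num) (fun i => ?_) _ h3 (fun i hi => ?_)
  · fin_cases i
    · exact exists_pow_zero_eq_moebius σ
    · exact h1'
    · exact h2'
  · fin_cases i <;> simp [mats] at hi ⊢

/-- The numerator and denominator of the orbit function
`(X² - sX + 1)³ / (X² (X - s)²)`. -/
noncomputable def N (s : ℤ) : ℤ[X] := (X ^ 2 - C s * X + 1) ^ 3
noncomputable def M (s : ℤ) : ℤ[X] := (X * (X - C s)) ^ 2

theorem aeval_N {K : Type*} [Field K] (x : K) : aeval x (N s) = (x ^ 2 - s * x + 1) ^ 3 := by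
  simp [N]
theorem aeval_M {K : Type*} [Field K] (x : K) : aeval x (M s) = (x * (x - s)) ^ 2 := by simp [M]

theorem quot (hs : s = 1 ∨ s = -1) {a : ℂ} (ha : a ^ 2 - s * a + 1 = 0) :
    (mats s).Quot {a} (N s) (M s) := by
  have hssc : (s : ℂ) * s = 1 := by exact_mod_cast sign_mul_self hs
  have h1 : (X ^ 2 - C s * X + 1 : ℤ[X]).Monic := by monicity!
  refine ⟨(h1.pow 3).isPrimitive, ((monic_X.mul (monic_X_sub_C s)).pow 2).isPrimitive,
    fun z h1 h2 => ?_, fun z hz => ?_, ⟨a, rfl⟩, ?_⟩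
  · rw [aeval_N, pow_eq_zero_iff (by norm_num)] at h1
    rw [aeval_M, pow_eq_zero_iff (by norm_num)] at h2
    have : (1 : ℂ) = 0 := by linear_combination h1 - h2
    norm_num at this
  · obtain ⟨h1, h2⟩ := (off_iff z).1 hz
    rw [aeval_M]
    exact pow_ne_zero 2 (mul_ne_zero h2 fun h => h1 (by linear_combination -h))
  · rintro a rfl
    refine ⟨_, minpoly_of_quadratic (k := s) (by have := sign_mul_self hs; nlinarith) ha, 1,
      one_ne_zero, fun z hz => ?_⟩
    obtain ⟨h1, h2⟩ := (off_iff z).1 hz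
    rw [aeval_N, aeval_M, Fin.prod_univ_three, ev_zero, ev_one, ev_two,
      show z * (z - s) = -(z * (s - z)) by ring]
    obtain ⟨d, hd⟩ : ∃ d, d = (s : ℂ) - z := ⟨_, rfl⟩
    rw [← hd] at h1 ⊢
    simp
    field_simp
    rw [hd]
    rcases hs with rfl | rfl <;> push_cast <;> ring

theorem defect_eq (hs : s = 1 ∨ s = -1) {z : ℂ} (hz : ∀ i, (mats s).den i z ≠ 0)
    (hN : z ^ 2 - s * z + 1 ≠ 0) (B : ℝ) :
    (mats s).defect ![B] ![N s] ![M s] z =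
      log⁺ ‖z‖ + log⁺ ‖z - s‖⁻¹ + log⁺ (‖z - s‖ / ‖z‖) -
      B * (3 * log ‖z ^ 2 - s * z + 1‖ - 2 * (log ‖z‖ + log ‖z - s‖)) := by
  obtain ⟨h1, h2⟩ := (off_iff z).1 hz
  have h3 : z - s ≠ 0 := fun h => h1 (by linear_combination -h)
  simp only [MatrixSeq.defect, Fin.sum_univ_three, ev_zero, ev_one, ev_two, Finset.univ_unique,
    Fin.default_eq_zero, Matrix.cons_val_fin_one, Finset.sum_singleton, aeval_N, aeval_M]
  rw [norm_div, norm_div, norm_div, norm_one, one_div, norm_sub_rev (s : ℂ) z, norm_pow, norm_pow,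
    norm_mul, norm_mul_sub_one hs,
    log_div (pow_ne_zero _ (norm_ne_zero_iff.2 hN))
      (pow_ne_zero _ (mul_ne_zero (norm_ne_zero_iff.2 h2) (norm_ne_zero_iff.2 h3))),
    log_pow, log_pow, log_mul (norm_ne_zero_iff.2 h2) (norm_ne_zero_iff.2 h3)]
  push_cast
  ring

/-- Because the zeros of the quadratic Q are fixed by the group, Q is a unit times num_i·den_j −
den_i·num_j for each pair i ≠ j. Multiplying the estimates for all three pairs uses each exponent
twice. -/
theorem nonarchBound (hs : s = 1 ∨ s = -1) : (mats s).NonarchBound (N s) (M s) 2 := by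
  intro F _ v hv hv' x
  have hss : (s : F) * s = 1 := by exact_mod_cast congrArg (Int.cast (R := F)) (sign_mul_self hs)
  have hprod : ∀ {a b m₁ m₂ : ℝ}, 0 ≤ a → 0 ≤ b → a ≤ m₁ → b ≤ m₂ → a * b ≤ m₁ * m₂ :=
    fun ha hb h1 h2 => mul_le_mul h1 h2 hb (ha.trans h1)
  have h1 : v (x ^ 2 - s * x + 1) ≤ max 1 (v x) * max (v (s - x)) 1 := by
    rw [show x ^ 2 - s * x + 1 = 1 - x * (s - x) by ring]
    refine nonarch_sub_le hv ?_ ?_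
    · rw [map_one]; exact one_le_mul_of_one_le_of_one_le (le_max_left _ _) (le_max_right _ _)
    · rw [map_mul]
      exact hprod (v.nonneg _) (v.nonneg _) (le_max_right _ _) (le_max_left _ _)
  have h2 : v (x ^ 2 - s * x + 1) ≤ max 1 (v x) * max (v x) (v (s * x - 1)) := by
    rw [show x ^ 2 - s * x + 1 = x * x - 1 * (s * x - 1) by ring]
    refine nonarch_sub_le hv ?_ ?_ <;> rw [map_mul]
    · exact hprod (v.nonneg _) (v.nonneg _) (le_max_right _ _) (le_max_left _ _)
    · rw [map_one]
      exact hprod zero_le_one (v.nonneg _) (le_max_left _ _) (le_max_right _ _)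
  have h3 : v (x ^ 2 - s * x + 1) ≤ max (v (s - x)) 1 * max (v x) (v (s * x - 1)) := by
    rw [show x ^ 2 - s * x + 1 = s * (1 * x) - s * ((s - x) * (s * x - 1)) by
      linear_combination (s * x - x ^ 2 - 1) * hss]
    refine nonarch_sub_le hv (nonarch_int_mul_le hv' _ ?_) (nonarch_int_mul_le hv' _ ?_) <;>
      rw [map_mul]
    · rw [map_one]
      exact hprod zero_le_one (v.nonneg _) (le_max_right _ _) (le_max_left _ _)
    · exact hprod (v.nonneg _) (v.nonneg _) (le_max_left _ _) (le_max_right _ _)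
  simp only [Fin.prod_univ_three, num_zero, num_one, num_two, den_zero, den_one, den_two,
    aeval_N, aeval_M, map_one, one_mul, one_pow, map_pow, map_mul]
  rw [v.map_sub x s]
  have h4 := mul_le_mul (mul_le_mul h1 h2 (v.nonneg _) (by positivity)) h3 (v.nonneg _)
    (by positivity)
  calc _ = (v x * v (s - x)) ^ 2 *
      (v (x ^ 2 - s * x + 1) * v (x ^ 2 - s * x + 1) * v (x ^ 2 - s * x + 1)) := by ring
    _ ≤ _ := mul_le_mul_of_nonneg_left h4 (by positivity)
    _ = _ := by ring

theorem polyThree_monic : (polyThree s).Monic := by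
  unfold polyThree
  monicity!

theorem aeval_polyThree {K : Type*} [Field K] (x : K) :
    aeval x (polyThree s) = (x ^ 2 - s * x + 1) ^ 3 - (x ^ 2 - s * x) ^ 2 := by
  simp [polyThree]

/-- The polynomial is N − M, so its roots solve the G-invariant equation φ = 1. -/
theorem polyThree_ev (hs : s = 1 ∨ s = -1) {K : Type} [Field K] (x : K)
    (hx : aeval x (polyThree s) = 0) (i : Fin 3) :
    (mats s).den i x ≠ 0 ∧ aeval ((mats s).ev i x) (polyThree s) = 0 := by
  rw [aeval_polyThree] at hx
  have h12 : x * (s - x) ≠ 0 := fun h => by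
    have h' : x ^ 2 - s * x = 0 := by linear_combination -h
    rw [h'] at hx
    norm_num at hx
  obtain ⟨h2, h1⟩ := mul_ne_zero_iff.1 h12
  refine ⟨(off_iff x).2 ⟨h1, h2⟩ i, ?_⟩
  obtain ⟨d, hd⟩ : ∃ d, d = (s : K) - x := ⟨_, rfl⟩
  rw [aeval_polyThree]
  fin_cases i
  · simpa using hx
  · simp only [Fin.mk_one, ev_one]
    rw [← hd] at h1 ⊢
    field_simp
    rw [hd]
    rcases hs with rfl | rfl <;> push_cast at hx ⊢ <;> linear_combination hx
  · simp only [Fin.reduceFinMk, ev_two]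
    field_simp
    rcases hs with rfl | rfl <;> push_cast at hx ⊢ <;> linear_combination hx

end OrderThreeOmega
end OrbitHeight

/-! ### Order three with fixed points ω: the critical parameter, the minimum and the bounds. -/

namespace OrbitHeight
open Polynomial Real Matrix

/-- The roots of `κ² (y + 1)³ = (1 - κ)³ y²`, where `y = z² - s z`. -/
theorem re_and_norm_of_cubic {s : ℤ} (hs : s = 1 ∨ s = -1) {κ : ℝ} (hκ : 1 / 4 < κ) {z : ℂ}
    (hz : (κ : ℂ) ^ 2 * (z ^ 2 - s * z + 1) ^ 3 = (1 - κ) ^ 3 * (z ^ 2 - s * z) ^ 2) :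
    (z.re = s / 2 ∧ ‖z‖ ^ 2 = κ) ∨ (z.re = s / (2 * κ) ∧ ‖z‖ ^ 2 = κ⁻¹) ∨
      (z.re = s * (2 * κ - 1) / (2 * κ) ∧ ‖z‖ ^ 2 = 1) := by
  have hκ0 : 0 < κ := by linarith
  have hκc : (κ : ℂ) ≠ 0 := by exact_mod_cast hκ0.ne'
  have hssr : (s : ℝ) ^ 2 = 1 := by rcases hs with rfl | rfl <;> norm_num
  -- One solution is y = −κ. The root set is invariant under z ↦ 1/(s − z), and the other two
  -- factors are the images of the first. The condition κ > 1/4 makes all three discriminants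
  -- negative.
  have h0 : (z ^ 2 - s * z + κ) * ((κ * z ^ 2 - s * z + 1) *
      (κ * z ^ 2 + s * (1 - 2 * κ) * z + κ)) = 0 := by
    rcases hs with rfl | rfl <;> push_cast at hz ⊢ <;> linear_combination hz
  rcases mul_eq_zero.1 h0 with h | h
  · obtain ⟨h1, h2⟩ := re_and_norm_of_quadratic (z := z) (k := s) (m := κ)
      (by rw [hssr]; linarith) (by push_cast; linear_combination h)
    exact Or.inl ⟨h1, h2⟩
  rcases mul_eq_zero.1 h with h | h
  · obtain ⟨h1, h2⟩ := re_and_norm_of_quadratic (z := z) (k := s / κ) (m := κ⁻¹)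
      (by rw [div_pow, hssr, div_lt_iff₀ (by positivity)]; field_simp; linarith)
      (by push_cast; field_simp; linear_combination h)
    exact Or.inr (Or.inl ⟨by rw [h1]; field_simp, h2⟩)
  · obtain ⟨h1, h2⟩ := re_and_norm_of_quadratic (z := z) (k := s * (2 * κ - 1) / κ) (m := 1)
      (by rw [div_pow, mul_pow, hssr, div_lt_iff₀ (by positivity)]; nlinarith)
      (by push_cast; field_simp; linear_combination h)
    exact Or.inr (Or.inr ⟨by rw [h1]; field_simp, h2⟩)

theorem sq_norm_sub_int (z : ℂ) {s : ℤ} (hs : s = 1 ∨ s = -1) :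
    ‖z - s‖ ^ 2 = ‖z‖ ^ 2 - 2 * s * z.re + 1 := by
  have h := sq_norm_linear z 1 (-s)
  have hssr : (s : ℝ) ^ 2 = 1 := by rcases hs with rfl | rfl <;> norm_num
  push_cast at h
  rw [one_mul, ← sub_eq_add_neg] at h
  rw [h, neg_sq, hssr]
  ring

namespace OrderThreeOmega

/-- With κ = 1/T this equation reads (1 − κ)³ = κ², which turns the polynomial of
`re_and_norm_of_cubic` into a multiple of `polyThree`. T is |α|² for the maximal root α. -/
theorem exists_parameter : ∃ T : ℝ, 2.32465 < T ∧ T < 2.32485 ∧ (T - 1) ^ 3 = T := by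
  have hc : ContinuousOn (fun T : ℝ => (T - 1) ^ 3 - T) (Set.Icc 2.32465 2.32485) := by
    fun_prop
  obtain ⟨T, hT, h⟩ := intermediate_value_Ioo (by norm_num) hc
    (show (0 : ℝ) ∈ Set.Ioo _ _ by constructor <;> norm_num)
  exact ⟨T, hT.1, hT.2, by simpa [sub_eq_zero] using h⟩

section
variable {s : ℤ} {T : ℝ} (hs : s = 1 ∨ s = -1) (hT1 : 2.32465 < T) (hT2 : T < 2.32485)
  (hT : (T - 1) ^ 3 = T)
include hs hT1 hT2 hT

theorem root_cases {z : ℂ} (hz : aeval z (polyThree s) = 0) :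
    (z.re = s / 2 ∧ ‖z‖ ^ 2 = T⁻¹) ∨ (z.re = s * T / 2 ∧ ‖z‖ ^ 2 = T) ∨
      (z.re = s * (2 - T) / 2 ∧ ‖z‖ ^ 2 = 1) := by
  have hT0 : 0 < T := by linarith
  have hTc0 : (T : ℂ) ≠ 0 := by exact_mod_cast hT0.ne'
  have hTc : ((T : ℂ) - 1) ^ 3 = T := by exact_mod_cast hT
  have hκ : 1 / 4 < T⁻¹ := by
    rw [← one_div]; exact one_div_lt_one_div_of_lt hT0 (by linarith)
  rw [aeval_polyThree] at hz
  have := re_and_norm_of_cubic hs hκ (z := z) (by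
    push_cast
    field_simp
    linear_combination T * hz - (z ^ 2 - s * z) ^ 2 * hTc)
  rw [inv_inv] at this
  refine this.imp_right (Or.imp (And.imp_left fun h => ?_) (And.imp_left fun h => ?_))
  · rw [h]; field_simp
  · rw [h]; field_simp

theorem maximal : (∃! α : ℂ, IsMaximalRoot (polyThree s) α) ∧
    ∀ α : ℂ, IsMaximalRoot (polyThree s) α → α.re = s * T / 2 ∧ ‖α‖ ^ 2 = T := by
  have hT0 : 0 < T := by linarith
  have hinv : T⁻¹ < 1 := inv_lt_one_of_one_lt₀ (by linarith)
  have hTc : ((T : ℂ) - 1) ^ 3 = T := by exact_mod_cast hT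
  have hTc0 : (T : ℂ) ≠ 0 := by exact_mod_cast hT0.ne'
  have hssr : (s : ℝ) ^ 2 = 1 := by rcases hs with rfl | rfl <;> norm_num
  refine existsUnique_isMaximalRoot (by rw [mul_pow, hssr]; nlinarith) (fun z hz => ?_)
    (fun z hz => ?_) fun z hz _ hn => ?_
  · rw [aeval_polyThree]
    push_cast at hz
    rcases hs with rfl | rfl <;> push_cast at hz ⊢
    · refine mul_left_cancel₀ hTc0 ?_
      linear_combination (T * z ^ 2 - T * z + 1) * (z ^ 2 + (T - 2) * z + 1) * hz +
        (z ^ 2 - z) ^ 2 * hTc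
    · refine mul_left_cancel₀ hTc0 ?_
      linear_combination (T * z ^ 2 + T * z + 1) * (z ^ 2 - (T - 2) * z + 1) * hz +
        (z ^ 2 + z) ^ 2 * hTc
  · rcases root_cases hs hT1 hT2 hT hz with ⟨-, h⟩ | ⟨-, h⟩ | ⟨-, h⟩ <;> linarith
  · rcases root_cases hs hT1 hT2 hT hz with ⟨-, h⟩ | ⟨h, -⟩ | ⟨-, h⟩
    · linarith
    · exact h
    · linarith

theorem sum_posLog_of_root {z : ℂ} (hz : aeval z (polyThree s) = 0) :
    ∑ i, log⁺ ‖(mats s).ev i z‖ = log T / 2 := by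
  have hT0 : 0 < T := by linarith
  have hlT : log⁺ T = log T := posLog_eq_log (by rw [abs_of_pos hT0]; linarith)
  have hlT' : log⁺ T⁻¹ = 0 := by
    rw [posLog_eq_zero_iff, abs_of_pos (inv_pos.2 hT0)]
    exact (inv_lt_one_of_one_lt₀ (by linarith)).le
  have hssr : (s : ℝ) * s = 1 := by exact_mod_cast sign_mul_self hs
  have h2 := sq_norm_sub_int z hs
  rw [Fin.sum_univ_three, ev_zero, ev_one, ev_two, norm_div, norm_div, norm_one, one_div,
    norm_mul_sub_one hs, norm_sub_rev (s : ℂ) z, posLog_of_sq (rfl : ‖z‖ ^ 2 = _),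
    posLog_of_sq (inv_pow ‖z - s‖ 2), posLog_of_sq (div_pow ‖z - s‖ ‖z‖ 2), h2]
  rcases root_cases hs hT1 hT2 hT hz with ⟨h, h'⟩ | ⟨h, h'⟩ | ⟨h, h'⟩ <;> rw [h, h']
  · rw [show T⁻¹ - 2 * s * (s / 2) + 1 = T⁻¹ by linear_combination -hssr, inv_inv,
      div_self (inv_ne_zero hT0.ne'), hlT, hlT', posLog_one]
    ring
  · rw [show T - 2 * s * (s * T / 2) + 1 = 1 by linear_combination -T * hssr, inv_one, one_div,
      hlT, hlT', posLog_one]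
    ring
  · rw [show 1 - 2 * s * (s * (2 - T) / 2) + 1 = T by linear_combination (T - 2) * hssr, div_one,
      hlT, hlT', posLog_one]
    ring

omit hs hT2 in
-- B makes T the critical point, and log T = 3 log(T − 1) makes the two terms with B cancel at t =
-- T.
theorem min_le {B t : ℝ} (hB : B = (T - 1) / (2 * (2 * T + 1))) (ht : 1 < t) :
    log T / 2 ≤ (1 / 2 + B) * log t - 3 * B * log (t - 1) := by
  have hG : log T / 2 = (1 / 2 + B) * log T - 3 * B * log (T - 1) := by
    have := congrArg log hT
    rw [log_pow] at this
    push_cast at this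
    linear_combination B * this
  rw [hG]
  refine le_of_deriv_sign (f := fun t => (1 / 2 + B) * log t - 3 * B * log (t - 1))
    (f' := fun t => (1 / 2 + B) * t⁻¹ - 3 * B * (t - 1)⁻¹) (a := 1) (by linarith) ht
    (fun y hy => ?_) (fun y hy hyT => ?_) (fun y hyT => ?_)
  · have d1 := hasDerivAt_log (show y ≠ 0 by linarith)
    have d2 := ((hasDerivAt_id' y).sub_const 1).log (show y - 1 ≠ 0 by linarith)
    exact ((d1.const_mul _).sub (d2.const_mul _)).congr_deriv (by simp)
  all_goals
    have hy1 : 1 < y := by linarith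
    have e : (1 / 2 + B) * y⁻¹ - 3 * B * (y - 1)⁻¹ =
        (y - T) * (3 / (2 * (2 * T + 1) * (y * (y - 1)))) := by
      rw [hB]
      have : y - 1 ≠ 0 := by linarith
      have : y ≠ 0 := by linarith
      have : 2 * T + 1 ≠ 0 := by linarith
      field_simp
      ring
    have hp : 0 ≤ 3 / (2 * (2 * T + 1) * (y * (y - 1))) := by
      have : 0 < y - 1 := by linarith
      positivity
    simp only [e]
  · exact mul_nonpos_of_nonpos_of_nonneg (by linarith) hp
  · exact mul_nonneg (by linarith) hp

omit hT2 in
theorem circle_le {B : ℝ} (hB : B = (T - 1) / (2 * (2 * T + 1))) {z : ℂ}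
    (hz : ‖z‖ = 1) (hoff : ∀ i, (mats s).den i z ≠ 0) (hN : z ^ 2 - s * z + 1 ≠ 0) :
    log T / 2 ≤ (mats s).defect ![B] ![N s] ![M s] z := by
  obtain ⟨h1, h2⟩ := (off_iff z).1 hoff
  rw [defect_eq hs hoff hN, hz, posLog_one, log_one, div_one, norm_quad_eq hs hz]
  have hQ := norm_pos_iff.2 hN
  rw [norm_quad_eq hs hz] at hQ
  have hB0 : 0 < B := by rw [hB]; exact div_pos (by linarith) (by linarith)
  have hr0 : 0 < ‖z - s‖ := by rw [norm_sub_rev]; exact norm_pos_iff.2 h1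
  set r := ‖z - s‖
  have e := posLog_add_posLog_inv r
  have el : log (r ^ 2) = 2 * log r := by rw [log_pow]; norm_num
  rcases lt_trichotomy (r ^ 2) 1 with h | h | h
  -- For x = |z − s|² < 1 the bound at t = 1/x holds with −B log x > 0 to spare, so the minimum lies
  -- on the side x > 1.
  · have h3 := min_le hT1 hT hB ((one_lt_inv₀ (by positivity)).2 h)
    have h4 : (r ^ 2)⁻¹ - 1 = (1 - r ^ 2) / r ^ 2 := by field_simp
    have h5 : log (r ^ 2) < 0 := log_neg (by positivity) h
    rw [h4, log_div (by linarith) (by positivity), log_inv] at h3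
    rw [abs_of_neg (by linarith)] at e
    rw [abs_of_pos (by linarith)]
    have := mul_pos hB0 (neg_pos.2 h5)
    rw [el] at h3 this
    linarith
  · rw [h] at hQ; norm_num at hQ
  · have h3 := min_le hT1 hT hB h
    have h5 : 0 < log (r ^ 2) := log_pos h
    rw [abs_of_pos (by linarith)] at e
    rw [abs_of_neg (by linarith), neg_sub]
    rw [el] at h3
    linarith

end

theorem parameter_bounds {T B : ℝ} (hT1 : 2.32465 < T) (hT2 : T < 2.32485)
    (hB : B = (T - 1) / (2 * (2 * T + 1))) : 0.11724 ≤ B ∧ B < 0.11725 := by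
  rw [hB, le_div_iff₀ (by linarith), div_lt_iff₀ (by linarith)]
  constructor <;> linarith

variable {s : ℤ}

theorem growth (hs : s = 1 ∨ s = -1) {B : ℝ} (hB : 0 < B) (hB' : B < 1 / 4) (D' : ℝ) :
    ∃ R : ℝ, ∀ z : ℂ, R < ‖z‖ → z ∈ MatrixSeq.regular (mats s) ![N s] →
      D' ≤ (mats s).defect ![B] ![N s] ![M s] z := by
  refine exists_radius_of_growth (δ := 1 - 2 * B) (c := 3 * B * log 3 + 2 * B * log 2) (R₀ := 2)
    (by linarith) (fun z hr hz => ?_) D'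
  have hN : z ^ 2 - s * z + 1 ≠ 0 := by simpa [aeval_N] using hr.2 0
  have hz0 : 0 < ‖z‖ := by linarith
  rw [defect_eq hs hr.1 hN, posLog_eq_log (by rw [abs_norm]; linarith)]
  have e1 : log ‖z ^ 2 - s * z + 1‖ ≤ log 3 + 2 * log ‖z‖ := by
    refine (log_le_log (norm_pos_iff.2 hN) (norm_quad_le hs (by linarith))).trans ?_
    rw [log_mul (by norm_num) (by positivity), log_pow]; norm_num
  have e2 : log ‖z‖ - log 2 ≤ log ‖z - s‖ := by
    rw [← log_div (by positivity) (by norm_num)]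
    exact log_le_log (by positivity) (half_norm_le hs hz.le)
  have e3 : 0 ≤ log⁺ ‖z - s‖⁻¹ := posLog_nonneg
  have e3' : 0 ≤ log⁺ (‖z - s‖ / ‖z‖) := posLog_nonneg
  have e4 := mul_le_mul_of_nonneg_left e1 hB.le
  have e5 := mul_le_mul_of_nonneg_left e2 hB.le
  linarith

theorem bounds (hs : s = 1 ∨ s = -1) {σ : PGL(2, ℚ)} (hrep : (mats s).Represents σ) {T B : ℝ}
    (hT1 : 2.32465 < T) (hT2 : T < 2.32485) (hT : (T - 1) ^ 3 = T)
    (hB : B = (T - 1) / (2 * (2 * T + 1))) {a : ℂ} (ha : a ^ 2 - s * a + 1 = 0) :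
    OrbitInequality σ ![{a}] ![B] (log T / 2) ∧
      IsHeightBound σ (algNumbersOffInfty σ) (log T / 2) := by
  obtain ⟨hB1, hB2⟩ := parameter_bounds hT1 hT2 hB
  refine hrep.bounds (N := ![N s]) (M := ![M s]) (fun j => ?_) (fun j => ?_)
    (fun z hz hr => circle_le hs hT1 hT hB hz hr.1 (by simpa [aeval_N] using hr.2 0))
    (fun D' _ => growth hs (by linarith) (by linarith) D') ![2] (fun j => ?_)
    (by simp; linarith) (fun j z hj => ?_)
  · fin_cases j; exact quot hs ha
  · fin_cases j; simp; linarith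
  · fin_cases j; exact nonarchBound hs
  · fin_cases j
    have h1 : z ^ 2 - s * z + 1 = 0 := by simpa [aeval_N] using hj
    exact Or.inr (pow_twelve_of_quadratic hs h1)

/-- The orbit of ∞ is {∞, 0, s}, of height 0. -/
theorem orbitHeight_of_not_off (hs : s = 1 ∨ s = -1) {σ : PGL(2, ℚ)}
    (hrep : (mats s).Represents σ) {α : ℂ} (hα : ∃ i, (mats s).den i α = 0) :
    orbitHeight (Subgroup.zpowers σ) (α : OnePoint ℂ) = 0 := by
  have h : α = s ∨ α = 0 := by
    by_contra! h
    obtain ⟨i, hi⟩ := hα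
    exact (off_iff α).2 ⟨sub_ne_zero.2 h.1.symm, h.2⟩ i hi
  refine hrep.orbitHeight_eq_zero fun i => ?_
  rcases hs with rfl | rfl <;> rcases h with rfl | rfl <;> fin_cases i <;>
    norm_num [mats, MatrixSeq.ev, MatrixSeq.num, MatrixSeq.den]

end OrderThreeOmega

theorem order_three_omega {s : ℤ} (hs : s = 1 ∨ s = -1) (σ : PGL(2, ℚ)) {hdet}
    (hσ : σ = moebius 0 1 (-1) s hdet) :
    HasOrbits σ 3 ![{omega s 1}, {omega s (-1)}] ∧ (∃! α : ℂ, IsMaximalRoot (polyThree s) α) ∧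
      ∀ α : ℂ, IsMaximalRoot (polyThree s) α → ∀ D : ℝ, D = Real.log ‖α‖ →
        0 < D ∧
        (∃ B : ℝ, 0.11724 ≤ B ∧ B < 0.11725 ∧ OrbitInequality σ ![{omega s 1}] ![B] D ∧
          OrbitInequality σ ![{omega s (-1)}] ![B] D) ∧
        IsHeightBound σ algNumbers D ∧ AttainsBound σ algNumbers D α := by
  have hrep := OrderThreeOmega.represents hs hσ
  obtain ⟨T, hT1, hT2, hT⟩ := OrderThreeOmega.exists_parameter
  obtain ⟨hu, hm⟩ := OrderThreeOmega.maximal hs hT1 hT2 hT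
  have hI := omega_quadratic (s := s) (t := 1) (sign_mul_self hs) (by norm_num)
  have hI' := omega_quadratic (s := s) (t := -1) (sign_mul_self hs) (by norm_num)
  refine ⟨hrep.hasOrbits ⟨1, ?_⟩ fun j => ?_, hu, fun α hα D hD => ?_⟩
  · rcases hs with rfl | rfl <;> simp [OrderThreeOmega.mats]
  · have key : ∀ a : ℂ, a ^ 2 - s * a + 1 = 0 → (∀ z ∈ ({a} : Set ℂ), z = 0 ∨ ‖z‖ = 1) ∧
        ∃ x : ℂ, (∀ i, (OrderThreeOmega.mats s).den i x ≠ 0) ∧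
          ({a} : Set ℂ) = Set.range fun i => (OrderThreeOmega.mats s).ev i x := fun a ha => by
      have h0 : a ≠ 0 := by rintro rfl; norm_num at ha
      have h1 : s - a ≠ 0 := fun h => by
        have : (1 : ℂ) = 0 := by linear_combination ha + a * h
        norm_num at this
      refine ⟨fun z hz => Or.inr ?_, a, (OrderThreeOmega.off_iff a).2 ⟨h1, h0⟩, ?_⟩
      · rw [Set.mem_singleton_iff.1 hz]
        exact norm_of_quadratic hs ha
      · have e1 : 1 / (s - a) = a := by rw [div_eq_iff h1]; linear_combination ha
        have e2 : (s * a - 1) / a = a := by rw [div_eq_iff h0]; linear_combination -ha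
        ext y
        simp only [Set.mem_singleton_iff, Set.mem_range, Fin.exists_fin_succ,
          OrderThreeOmega.ev_zero, Fin.succ_zero_eq_one, Fin.succ_one_eq_two,
          OrderThreeOmega.ev_one, OrderThreeOmega.ev_two, e1, e2]
        simp [eq_comm]
    fin_cases j
    · exact key _ hI
    · exact key _ hI'
  · have hD' : D = log T / 2 := by
      rw [hD, ← (hm α hα).2, log_pow]; push_cast; ring
    obtain ⟨hB1, hB2⟩ := OrderThreeOmega.parameter_bounds hT1 hT2 rfl
    have hb := OrderThreeOmega.bounds hs hrep hT1 hT2 hT rfl hI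
    have hb' := OrderThreeOmega.bounds hs hrep hT1 hT2 hT rfl hI'
    rw [← hD'] at hb hb'
    have hb2 := hrep.isHeightBound_algNumbers hb.2 fun β hβ =>
      Or.inl (OrderThreeOmega.orbitHeight_of_not_off hs hrep hβ)
    refine ⟨?_, ⟨_, hB1, hB2, hb.1, hb'.1⟩, hb2, attainsBound_of_eq
      (isAlgebraic_of_aeval_intPoly OrderThreeOmega.polyThree_monic.ne_zero hα.1) ?_ hb2⟩
    · have := log_pos (show 1 < T by linarith)
      linarith
    · rw [hD']
      exact hrep.orbitHeight_eq_of_integral OrderThreeOmega.polyThree_monic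
        (fun x hx i => OrderThreeOmega.polyThree_ev hs x hx i)
        (fun z hz => OrderThreeOmega.sum_posLog_of_root hs hT1 hT2 hT hz) hα.1

end OrbitHeight

/-! ### Order six: orbit function, finite places and the polynomial of α. -/

namespace OrbitHeight
open Polynomial Real Matrix

namespace OrderSix

/-- The powers of `z ↦ (2 z - s) / (s z + 1)`. -/
def mats (s : ℤ) : MatrixSeq 6 :=
  ⟨![1, 2, 1, 1, 0, -1], ![0, -s, -s, -2 * s, -s, -s], ![0, s, s, 2 * s, s, s],
    ![1, 1, 0, -1, -1, -2]⟩

variable {s : ℤ}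

section
variable {K : Type*} [Field K] (x : K)

@[simp] theorem num_zero : (mats s).num 0 x = x := by simp [mats, MatrixSeq.num]
@[simp] theorem den_zero : (mats s).den 0 x = 1 := by simp [mats, MatrixSeq.den]
@[simp] theorem num_one : (mats s).num 1 x = 2 * x - s := by simp [mats, MatrixSeq.num]; ring
@[simp] theorem den_one : (mats s).den 1 x = s * x + 1 := by simp [mats, MatrixSeq.den]
@[simp] theorem num_two : (mats s).num 2 x = x - s := by simp [mats, MatrixSeq.num]; ring
@[simp] theorem den_two : (mats s).den 2 x = s * x := by simp [mats, MatrixSeq.den]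
@[simp] theorem num_three : (mats s).num 3 x = x - 2 * s := by
  simp [mats, MatrixSeq.num]; ring
@[simp] theorem den_three : (mats s).den 3 x = 2 * s * x - 1 := by
  simp [mats, MatrixSeq.den]; ring
@[simp] theorem num_four : (mats s).num 4 x = -s := by simp [mats, MatrixSeq.num]
@[simp] theorem den_four : (mats s).den 4 x = s * x - 1 := by simp [mats, MatrixSeq.den]; ring
@[simp] theorem num_five : (mats s).num 5 x = -x - s := by simp [mats, MatrixSeq.num]; ring
@[simp] theorem den_five : (mats s).den 5 x = s * x - 2 := by simp [mats, MatrixSeq.den]; ring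
@[simp] theorem ev_zero : (mats s).ev 0 x = x := by simp [MatrixSeq.ev]
@[simp] theorem ev_one : (mats s).ev 1 x = (2 * x - s) / (s * x + 1) := by simp [MatrixSeq.ev]
@[simp] theorem ev_two : (mats s).ev 2 x = (x - s) / (s * x) := by simp [MatrixSeq.ev]
@[simp] theorem ev_three : (mats s).ev 3 x = (x - 2 * s) / (2 * s * x - 1) := by
  simp [MatrixSeq.ev]
@[simp] theorem ev_four : (mats s).ev 4 x = -s / (s * x - 1) := by simp [MatrixSeq.ev]
@[simp] theorem ev_five : (mats s).ev 5 x = (-x - s) / (s * x - 2) := by simp [MatrixSeq.ev]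

theorem forall_fin_six {P : Fin 6 → Prop} :
    (∀ i, P i) ↔ P 0 ∧ P 1 ∧ P 2 ∧ P 3 ∧ P 4 ∧ P 5 :=
  ⟨fun h => ⟨h 0, h 1, h 2, h 3, h 4, h 5⟩, fun ⟨h0, h1, h2, h3, h4, h5⟩ i => by
    fin_cases i <;> assumption⟩

theorem off_iff : (∀ i, (mats s).den i x ≠ 0) ↔ s * x + 1 ≠ 0 ∧ s * x ≠ 0 ∧ 2 * s * x - 1 ≠ 0 ∧
    s * x - 1 ≠ 0 ∧ s * x - 2 ≠ 0 := by
  rw [forall_fin_six, den_zero, den_one, den_two, den_three, den_four, den_five]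
  simp

end

theorem represents (hs : s = 1 ∨ s = -1) {σ : PGL(2, ℚ)} {hdet}
    (hσ : σ = moebius 2 (-s) s 1 hdet) : (mats s).Represents σ := by
  have hss := sign_mul_self hs
  have h1 : ∃ h, σ = moebius (2 : ℤ) (-s : ℤ) s (1 : ℤ) h := by
    refine ⟨by push_cast; exact hdet, ?_⟩
    rw [hσ]; norm_num
  have h1' : ∃ h, σ ^ 1 = moebius (2 : ℤ) (-s : ℤ) s (1 : ℤ) h := by rwa [pow_one]
  have h2 := exists_pow_succ_eq_moebius h1' h1 3 1 (-s) s 0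
    (by norm_num) (by linarith) (by linarith) (by linarith) (by linarith)
  have h3 := exists_pow_succ_eq_moebius h2 h1 1 1 (-2 * s) (2 * s) (-1)
    (by norm_num) (by linarith) (by linarith) (by linarith) (by linarith)
  have h4 := exists_pow_succ_eq_moebius h3 h1 3 0 (-s) s (-1)
    (by norm_num) (by linarith) (by linarith) (by linarith) (by linarith)
  have h5 := exists_pow_succ_eq_moebius h4 h1 1 (-1) (-s) s (-2)
    (by norm_num) (by linarith) (by linarith) (by linarith) (by linarith)
  have h6 := exists_pow_succ_eq_moebius h5 h1 1 (-3) 0 0 (-3)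
    (by norm_num) (by linarith) (by linarith) (by linarith) (by linarith)
  refine .of_pow (by norm_num) (fun i => ?_) _ h6 (fun i hi => ?_)
  · fin_cases i
    · exact exists_pow_zero_eq_moebius σ
    · exact h1'
    · exact h2
    · exact h3
    · exact h4
    · exact h5
  · fin_cases i <;> simp [mats] at hi ⊢

/-- The numerator and denominator of the orbit function
`(X² - sX + 1)⁶ / (X² (X² - 1)² (2sX - 1)² (X - 2s)²)`. -/
noncomputable def N (s : ℤ) : ℤ[X] := (X ^ 2 - C s * X + 1) ^ 6
noncomputable def M (s : ℤ) : ℤ[X] :=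
  (X * (X ^ 2 - 1) * (C (2 * s) * X - C 1) * (X - C (2 * s))) ^ 2

section
variable {K : Type*} [Field K] (x : K)

theorem aeval_N : aeval x (N s) = (x ^ 2 - s * x + 1) ^ 6 := by simp [N]

theorem aeval_M : aeval x (M s) = (x * (x ^ 2 - 1) * (2 * s * x - 1) * (x - 2 * s)) ^ 2 := by
  simp [M, map_ofNat]

variable (hs : s = 1 ∨ s = -1)
include hs

theorem den_prod_eq : x * (x ^ 2 - 1) * (2 * s * x - 1) * (x - 2 * s) =
    (s * x + 1) * (s * x) * (2 * s * x - 1) * (s * x - 1) * (s * x - 2) := by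
  rcases hs with rfl | rfl <;> push_cast <;> ring

/-- A non-zero value at both fixed points shows that N and M have no common zero and that the fixed
points avoid the poles of the σ^i. -/
theorem aeval_M_of_quad_eq_zero {x : K} (h : x ^ 2 - s * x + 1 = 0) : aeval x (M s) = -27 := by
  have e1 : x * (x ^ 2 - 1) = -x - s := by
    rcases hs with rfl | rfl <;> push_cast at h ⊢
    · linear_combination (x + 1) * h
    · linear_combination (x - 1) * h
  have e2 : (2 * s * x - 1) * (x - 2 * s) = -3 * x := by
    rcases hs with rfl | rfl <;> push_cast at h ⊢
    · linear_combination 2 * h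
    · linear_combination -2 * h
  rw [aeval_M, mul_assoc, e1, e2]
  rcases hs with rfl | rfl <;> push_cast at h ⊢
  · linear_combination (9 * x ^ 2 + 27 * x + 27) * h
  · linear_combination (9 * x ^ 2 - 27 * x + 27) * h

omit hs in
theorem quad_div {n d k : K} (hd : d ≠ 0) (h : n ^ 2 - s * n * d + d ^ 2 = k) :
    (n / d) ^ 2 - s * (n / d) + 1 = k / d ^ 2 := by
  rw [← h]; field_simp

end

theorem quot (hs : s = 1 ∨ s = -1) {a : ℂ} (ha : a ^ 2 - s * a + 1 = 0) :
    (mats s).Quot {a} (N s) (M s) := by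
  have h1 : (X ^ 2 - C s * X + 1 : ℤ[X]).Monic := by monicity!
  have h2 : (X ^ 2 - 1 : ℤ[X]).Monic := by monicity!
  refine ⟨(h1.pow 6).isPrimitive, IsPrimitive.pow (((monic_X.mul h2).isPrimitive.mul
    (IsPrimitive.linear isCoprime_one_left)).mul (monic_X_sub_C _).isPrimitive) 2,
    fun z h1 => ?_, fun z hz => ?_, ⟨a, rfl⟩, ?_⟩
  · rw [aeval_N, pow_eq_zero_iff (by norm_num)] at h1
    rw [aeval_M_of_quad_eq_zero hs h1]
    norm_num
  · obtain ⟨h1, h2, h3, h4, h5⟩ := (off_iff z).1 hz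
    rw [aeval_M, den_prod_eq z hs]
    exact pow_ne_zero 2 (mul_ne_zero (mul_ne_zero (mul_ne_zero (mul_ne_zero h1 h2) h3) h4) h5)
  · rintro a rfl
    refine ⟨_, minpoly_of_quadratic (k := s) (by have := sign_mul_self hs; nlinarith) ha, 27,
      by norm_num, fun z hz => ?_⟩
    obtain ⟨h1, h2, h3, h4, h5⟩ := (off_iff z).1 hz
    have hf : ∀ w : ℂ, aeval w (X ^ 2 - C s * X + 1 : ℤ[X]) = w ^ 2 - s * w + 1 := fun w => by simp
    have e1 : (2 * z - s) ^ 2 - s * (2 * z - s) * (s * z + 1) + (s * z + 1) ^ 2 =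
      3 * (z ^ 2 - s * z + 1) := by rcases hs with rfl | rfl <;> push_cast <;> ring
    have e2 : (z - s) ^ 2 - s * (z - s) * (s * z) + (s * z) ^ 2 = z ^ 2 - s * z + 1 := by
      rcases hs with rfl | rfl <;> push_cast <;> ring
    have e3 : (z - 2 * s) ^ 2 - s * (z - 2 * s) * (2 * s * z - 1) + (2 * s * z - 1) ^ 2 =
      3 * (z ^ 2 - s * z + 1) := by rcases hs with rfl | rfl <;> push_cast <;> ring
    have e4 : (-s : ℂ) ^ 2 - s * (-s) * (s * z - 1) + (s * z - 1) ^ 2 = z ^ 2 - s * z + 1 := by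
      rcases hs with rfl | rfl <;> push_cast <;> ring
    have e5 : (-z - s) ^ 2 - s * (-z - s) * (s * z - 2) + (s * z - 2) ^ 2 =
      3 * (z ^ 2 - s * z + 1) := by rcases hs with rfl | rfl <;> push_cast <;> ring
    simp only [aeval_N, aeval_M, Fin.prod_univ_six, ev_zero, ev_one, ev_two, ev_three, ev_four,
      ev_five, hf]
    rw [quad_div h1 e1, quad_div h2 e2, quad_div h3 e3, quad_div h4 e4, quad_div h5 e5,
      den_prod_eq z hs]
    obtain ⟨q, hq⟩ : ∃ q, q = z ^ 2 - s * z + 1 := ⟨_, rfl⟩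
    obtain ⟨d1, hd1⟩ : ∃ d, d = s * z + 1 := ⟨_, rfl⟩
    obtain ⟨d2, hd2⟩ : ∃ d, d = s * z := ⟨_, rfl⟩
    obtain ⟨d3, hd3⟩ : ∃ d, d = 2 * s * z - 1 := ⟨_, rfl⟩
    obtain ⟨d4, hd4⟩ : ∃ d, d = s * z - 1 := ⟨_, rfl⟩
    obtain ⟨d5, hd5⟩ : ∃ d, d = s * z - 2 := ⟨_, rfl⟩
    rw [← hd1] at h1
    rw [← hd2] at h2
    rw [← hd3] at h3
    rw [← hd4] at h4
    rw [← hd5] at h5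
    rw [← hq, ← hd1, ← hd3, ← hd4, ← hd5, ← hd2]
    push_cast
    field_simp
    ring

theorem norm_sign_mul (hs : s = 1 ∨ s = -1) (w : ℂ) : ‖(s : ℂ) * w‖ = ‖w‖ := by
  rw [norm_mul, norm_sign hs, one_mul]

section
variable (hs : s = 1 ∨ s = -1) (z : ℂ)
include hs

theorem norm_den_one : ‖(s : ℂ) * z + 1‖ = ‖z + s‖ := by
  rw [← norm_sign_mul hs (z + s)]; congr 1; rcases hs with rfl | rfl <;> push_cast <;> ring

theorem norm_den_three : ‖2 * (s : ℂ) * z - 1‖ = ‖2 * z - s‖ := by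
  rw [← norm_sign_mul hs (2 * z - s)]; congr 1; rcases hs with rfl | rfl <;> push_cast <;> ring

theorem norm_den_five : ‖(s : ℂ) * z - 2‖ = ‖z - 2 * s‖ := by
  rw [← norm_sign_mul hs (z - 2 * s)]; congr 1; rcases hs with rfl | rfl <;> push_cast <;> ring

theorem sum_posLog_eq : ∑ i, log⁺ ‖(mats s).ev i z‖ =
    log⁺ ‖z‖ + log⁺ (‖2 * z - s‖ / ‖z + s‖) + log⁺ (‖z - s‖ / ‖z‖) +
      log⁺ (‖z - 2 * s‖ / ‖2 * z - s‖) + log⁺ ‖z - s‖⁻¹ + log⁺ (‖z + s‖ / ‖z - 2 * s‖) := by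
  simp only [Fin.sum_univ_six, ev_zero, ev_one, ev_two, ev_three, ev_four, ev_five, norm_div,
    norm_den_one hs, norm_sign_mul hs, norm_den_three hs, norm_mul_sub_one hs, norm_den_five hs,
    norm_neg, norm_sign hs, one_div]
  rw [show -z - s = -(z + s) by ring, norm_neg]

variable {z}

theorem defect_eq (hz : ∀ i, (mats s).den i z ≠ 0) (hN : z ^ 2 - s * z + 1 ≠ 0) (B : ℝ) :
    (mats s).defect ![B] ![N s] ![M s] z =
      log⁺ ‖z‖ + log⁺ (‖2 * z - s‖ / ‖z + s‖) + log⁺ (‖z - s‖ / ‖z‖) +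
      log⁺ (‖z - 2 * s‖ / ‖2 * z - s‖) + log⁺ ‖z - s‖⁻¹ + log⁺ (‖z + s‖ / ‖z - 2 * s‖) -
      B * (6 * log ‖z ^ 2 - s * z + 1‖ - 2 * (log ‖z‖ + log ‖z - s‖ + log ‖z + s‖ +
        log ‖2 * z - s‖ + log ‖z - 2 * s‖)) := by
  obtain ⟨h1, h2, h3, h4, h5⟩ := (off_iff z).1 hz
  rw [← norm_ne_zero_iff] at h1 h2 h3 h4 h5
  rw [MatrixSeq.defect, sum_posLog_eq hs]
  congr 1
  simp only [Finset.univ_unique, Fin.default_eq_zero, Matrix.cons_val_fin_one,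
    Finset.sum_singleton, aeval_N, aeval_M]
  rw [den_prod_eq z hs, norm_div, norm_pow, norm_pow, norm_mul, norm_mul, norm_mul, norm_mul,
    log_div (pow_ne_zero _ (norm_ne_zero_iff.2 hN)) (pow_ne_zero _ (mul_ne_zero (mul_ne_zero
      (mul_ne_zero (mul_ne_zero h1 h2) h3) h4) h5)),
    log_pow, log_pow, log_mul (mul_ne_zero (mul_ne_zero (mul_ne_zero h1 h2) h3) h4) h5,
    log_mul (mul_ne_zero (mul_ne_zero h1 h2) h3) h4, log_mul (mul_ne_zero h1 h2) h3,
    log_mul h1 h2, norm_den_one hs, norm_sign_mul hs, norm_den_three hs, norm_mul_sub_one hs,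
    norm_den_five hs]
  push_cast
  ring

/-- The quadratic is s(num_i·den_j − den_i·num_j) for the consecutive pairs (0, 1), (2, 3), (4, 5),
since its zeros are fixed points. The square of the product of these three estimates is the claim.
-/
theorem nonarchBound : (mats s).NonarchBound (N s) (M s) 2 := by
  intro F _ v hv hv' x
  have hprod : ∀ {a b m₁ m₂ : ℝ}, 0 ≤ a → 0 ≤ b → a ≤ m₁ → b ≤ m₂ → a * b ≤ m₁ * m₂ :=
    fun ha hb h1 h2 => mul_le_mul h1 h2 hb (ha.trans h1)
  have key : ∀ d n d' n' : F, x ^ 2 - s * x + 1 = s * (n * d') - s * (d * n') →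
      v (x ^ 2 - s * x + 1) ≤ max (v d) (v n) * max (v d') (v n') := fun d n d' n' h => by
    rw [h]
    refine nonarch_sub_le hv (nonarch_int_mul_le hv' _ ?_) (nonarch_int_mul_le hv' _ ?_) <;>
      rw [map_mul]
    · exact hprod (v.nonneg _) (v.nonneg _) (le_max_right _ _) (le_max_left _ _)
    · exact hprod (v.nonneg _) (v.nonneg _) (le_max_left _ _) (le_max_right _ _)
  have h1 := key 1 x (s * x + 1) (2 * x - s) (by rcases hs with rfl | rfl <;> push_cast <;> ring)
  have h2 := key (s * x) (x - s) (2 * s * x - 1) (x - 2 * s)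
    (by rcases hs with rfl | rfl <;> push_cast <;> ring)
  have h3 := key (s * x - 1) (-s) (s * x - 2) (-x - s)
    (by rcases hs with rfl | rfl <;> push_cast <;> ring)
  simp only [Fin.prod_univ_six, num_zero, num_one, num_two, num_three, num_four, num_five,
    den_zero, den_one, den_two, den_three, den_four, den_five, aeval_N, aeval_M]
  rw [den_prod_eq x hs, map_pow, map_pow, map_mul _ _ ((s : F) * x - 2), map_mul _ _ ((s : F) * x - 1),
    map_mul _ _ (2 * (s : F) * x - 1), map_mul _ ((s : F) * x + 1) _]
  have h4 := mul_le_mul (mul_le_mul h1 h2 (v.nonneg _) (by positivity)) h3 (v.nonneg _)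
    (by positivity)
  have h5 := pow_le_pow_left₀ (by positivity) h4 2
  refine (le_of_eq ?_).trans ((mul_le_mul_of_nonneg_left h5 (sq_nonneg (v (s * x + 1) * v (s * x) *
    v (2 * s * x - 1) * v (s * x - 1) * v (s * x - 2)))).trans (le_of_eq ?_))
  · rw [map_one]; ring
  · ring

omit hs in
theorem aeval_polySix {K : Type*} [Field K] (x : K) :
    aeval x (polySix s) = (x ^ 2 - s * x + 1) ^ 6 +
      x ^ 2 * (2 * x ^ 2 - 5 * s * x + 2) ^ 2 * (x ^ 2 - 1) ^ 2 := by
  simp [polySix, map_ofNat]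

theorem aeval_polySix' {K : Type*} [Field K] (x : K) :
    aeval x (polySix s) = (x ^ 2 - s * x + 1) ^ 6 + aeval x (M s) := by
  rw [aeval_polySix, aeval_M]
  rcases hs with rfl | rfl <;> push_cast <;> ring

omit hs in
theorem polySix_monic : (polySix s).Monic := by
  unfold polySix
  monicity!

omit hs in
theorem polySix_div {K : Type*} [Field K] {n d : K} (hd : d ≠ 0)
    (h : (n ^ 2 - s * n * d + d ^ 2) ^ 6 +
      n ^ 2 * (2 * n ^ 2 - 5 * s * n * d + 2 * d ^ 2) ^ 2 * (n ^ 2 - d ^ 2) ^ 2 * d ^ 2 = 0) :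
    aeval (n / d) (polySix s) = 0 := by
  rw [aeval_polySix]
  field_simp
  linear_combination h

/-- The polynomial takes the values of (z² − sz + 1)⁶ + M, so its roots solve the G-invariant
equation φ = −1. -/
theorem polySix_ev {K : Type*} [Field K] [CharZero K] (x : K) (hx : aeval x (polySix s) = 0)
    (i : Fin 6) : (mats s).den i x ≠ 0 ∧ aeval ((mats s).ev i x) (polySix s) = 0 := by
  have h0 : x * (x ^ 2 - 1) * (2 * s * x - 1) * (x - 2 * s) ≠ 0 := fun h => by
    have h1 := hx
    rw [aeval_polySix' hs, aeval_M, h, zero_pow two_ne_zero, add_zero,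
      pow_eq_zero_iff (by norm_num)] at h1
    have h2 := aeval_M_of_quad_eq_zero hs h1
    rw [aeval_M, h] at h2
    norm_num at h2
  rw [den_prod_eq x hs] at h0
  simp only [mul_ne_zero_iff, and_assoc] at h0
  have hne : ∀ i, (mats s).den i x ≠ 0 := (off_iff x).2 <| by
    simp only [ne_eq, mul_eq_zero, not_or]; tauto
  refine ⟨hne i, ?_⟩
  rw [aeval_polySix] at hx
  rw [MatrixSeq.ev]
  refine polySix_div (hne i) ?_
  revert i
  rw [forall_fin_six]
  refine ⟨?_, ?_, ?_, ?_, ?_, ?_⟩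
  · rw [num_zero, den_zero]; linear_combination hx
  -- The odd powers of σ have matrices of determinant 3; they multiply the homogenised quadratic by
  -- 3, whence 729 = 3⁶. The even powers have determinant 1.
  · rw [num_one, den_one]
    rcases hs with rfl | rfl <;> push_cast at hx ⊢ <;> linear_combination 729 * hx
  · rw [num_two, den_two]
    rcases hs with rfl | rfl <;> push_cast at hx ⊢ <;> linear_combination hx
  · rw [num_three, den_three]
    rcases hs with rfl | rfl <;> push_cast at hx ⊢ <;> linear_combination 729 * hx
  · rw [num_four, den_four]
    rcases hs with rfl | rfl <;> push_cast at hx ⊢ <;> linear_combination hx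
  · rw [num_five, den_five]
    rcases hs with rfl | rfl <;> push_cast at hx ⊢ <;> linear_combination 729 * hx

end

end OrderSix
end OrbitHeight

/-! ### Order six: the critical parameter and the minimum on the circle. -/

namespace OrbitHeight
open Polynomial Real Matrix

namespace OrderSix

/-- T is |α|² for the maximal root α, which satisfies z² − sz = −T; substituting this into `polySix`
gives the equation. -/
theorem exists_parameter : ∃ T : ℝ, 10.2852 < T ∧ T < 10.2861 ∧
    (T - 1) ^ 6 = T ^ 2 * (T + 2) ^ 2 * (4 * T - 1) := by
  have hc : ContinuousOn (fun T : ℝ => (T - 1) ^ 6 - T ^ 2 * (T + 2) ^ 2 * (4 * T - 1))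
      (Set.Icc 10.2852 10.2861) := by
    fun_prop
  obtain ⟨T, hT, h⟩ := intermediate_value_Ioo (by norm_num) hc
    (show (0 : ℝ) ∈ Set.Ioo _ _ by constructor <;> norm_num)
  exact ⟨T, hT.1, hT.2, by simpa [sub_eq_zero] using h⟩

/-- The lower bound in terms of the parameter. -/
noncomputable def bound (T : ℝ) : ℝ := (log T + log (4 * T - 1) - log (T + 2)) / 2

section
variable {s : ℤ} (hs : s = 1 ∨ s = -1)
include hs

/-- With y = z² − sz, the subgroup of order three generated by σ² has the invariant (y + 1)³/y². The
polynomial is quadratic in it, so the roots fall into two families, each described by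
`re_and_norm_of_cubic`. -/
theorem polySix_eq_quad {K : Type*} [Field K] (x : K) :
    aeval x (polySix s) = (x ^ 2 - s * x + 1) ^ 6 +
      4 * (x ^ 2 - s * x + 1) ^ 3 * (x ^ 2 - s * x) ^ 2 - 27 * (x ^ 2 - s * x) ^ 4 := by
  rw [aeval_polySix]
  rcases hs with rfl | rfl <;> push_cast <;> ring

theorem sq_norms (z : ℂ) : ‖z - s‖ ^ 2 = ‖z‖ ^ 2 - 2 * (s * z.re) + 1 ∧
    ‖2 * z - s‖ ^ 2 = 4 * ‖z‖ ^ 2 - 4 * (s * z.re) + 1 ∧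
    ‖z + s‖ ^ 2 = ‖z‖ ^ 2 + 2 * (s * z.re) + 1 ∧
    ‖z - 2 * s‖ ^ 2 = ‖z‖ ^ 2 - 4 * (s * z.re) + 4 := by
  have hssr : (s : ℝ) ^ 2 = 1 := by rcases hs with rfl | rfl <;> norm_num
  have h2 := sq_norm_linear z 2 (-s)
  have h3 := sq_norm_linear z 1 s
  have h4 := sq_norm_linear z 1 (-(2 * s))
  push_cast at h2 h3 h4
  rw [← sub_eq_add_neg] at h2
  rw [one_mul] at h3 h4
  rw [← sub_eq_add_neg] at h4
  refine ⟨?_, ?_, ?_, ?_⟩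
  · rw [sq_norm_sub_int z hs]; ring
  · rw [h2]; linear_combination hssr
  · rw [h3]; linear_combination hssr
  · rw [h4]; linear_combination 4 * hssr

/-- The three cases are permuted by the subgroup of order three, so they give the same sum. -/
theorem sum_posLog_of_cubic {κ : ℝ} (hκ : 1 / 4 < κ) {z : ℂ}
    (hz : (z.re = s / 2 ∧ ‖z‖ ^ 2 = κ) ∨ (z.re = s / (2 * κ) ∧ ‖z‖ ^ 2 = κ⁻¹) ∨
      (z.re = s * (2 * κ - 1) / (2 * κ) ∧ ‖z‖ ^ 2 = 1)) :
    ∑ i, log⁺ ‖(mats s).ev i z‖ = (|log κ| + |log ((4 * κ - 1) / (κ + 2))|) / 2 := by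
  have hκ0 : κ ≠ 0 := by linarith
  have hκ1 : 4 * κ - 1 ≠ 0 := by linarith
  have hκ2 : κ + 2 ≠ 0 := by linarith
  have hssr : (s : ℝ) ^ 2 = 1 := by rcases hs with rfl | rfl <;> norm_num
  obtain ⟨h1, h2, h3, h4⟩ := sq_norms hs z
  rw [sum_posLog_eq hs, posLog_of_sq (rfl : ‖z‖ ^ 2 = _), posLog_of_sq (div_pow ‖2 * z - s‖ _ 2),
    posLog_of_sq (div_pow ‖z - s‖ _ 2), posLog_of_sq (div_pow ‖z - 2 * s‖ _ 2),
    posLog_of_sq (inv_pow ‖z - s‖ 2), posLog_of_sq (div_pow ‖z + s‖ _ 2), h1, h2, h3, h4,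
    ← posLog_add_posLog_inv, ← posLog_add_posLog_inv, inv_div]
  rcases hz with ⟨h, h'⟩ | ⟨h, h'⟩ | ⟨h, h'⟩
  · have e : s * z.re = 1 / 2 := by rw [h]; linear_combination hssr / 2
    rw [e, h', show κ - 2 * (1 / 2) + 1 = κ by ring, show 4 * κ - 4 * (1 / 2) + 1 = 4 * κ - 1 by ring,
      show κ + 2 * (1 / 2) + 1 = κ + 2 by ring, show κ - 4 * (1 / 2) + 4 = κ + 2 by ring,
      div_self hκ0, div_self hκ2, posLog_one]
    ring
  · have e : s * z.re = κ⁻¹ / 2 := by rw [h]; field_simp; exact hssr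
    rw [e, h', show κ⁻¹ - 2 * (κ⁻¹ / 2) + 1 = 1 by ring,
      show 4 * κ⁻¹ - 4 * (κ⁻¹ / 2) + 1 = (κ + 2) / κ by field_simp; ring,
      show κ⁻¹ + 2 * (κ⁻¹ / 2) + 1 = (κ + 2) / κ by field_simp; ring,
      show κ⁻¹ - 4 * (κ⁻¹ / 2) + 4 = (4 * κ - 1) / κ by field_simp; ring,
      div_self (div_ne_zero hκ2 hκ0), div_div_div_cancel_right₀ hκ0, div_div_div_cancel_right₀ hκ0,
      one_div, inv_inv, inv_one, posLog_one]
    ring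
  · have e : s * z.re = 1 - κ⁻¹ / 2 := by rw [h]; field_simp; linear_combination (2 * κ - 1) * hssr
    rw [e, h', show 1 - 2 * (1 - κ⁻¹ / 2) + 1 = κ⁻¹ by ring,
      show 4 * 1 - 4 * (1 - κ⁻¹ / 2) + 1 = (κ + 2) / κ by field_simp; ring,
      show 1 + 2 * (1 - κ⁻¹ / 2) + 1 = (4 * κ - 1) / κ by field_simp; ring,
      show 1 - 4 * (1 - κ⁻¹ / 2) + 4 = (κ + 2) / κ by field_simp; ring,
      div_self (div_ne_zero hκ2 hκ0), div_div_div_cancel_right₀ hκ0, div_div_div_cancel_right₀ hκ0,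
      div_one, inv_inv, posLog_one]
    ring

end

section
variable {s : ℤ} {T : ℝ} (hs : s = 1 ∨ s = -1) (hT1 : 10.2852 < T)
  (hT : (T - 1) ^ 6 = T ^ 2 * (T + 2) ^ 2 * (4 * T - 1))
include hs hT1 hT

/-- The two families are exchanged by σ³: if Re z = s/2 and |z|² = T, then |σ³z|² = (T + 2)/(4T −
1). -/
theorem root_cases {z : ℂ} (hz : aeval z (polySix s) = 0) :
    ∃ κ : ℝ, 1 / 4 < κ ∧ (κ = T ∨ κ = (T + 2) / (4 * T - 1)) ∧
      ((z.re = s / 2 ∧ ‖z‖ ^ 2 = κ) ∨ (z.re = s / (2 * κ) ∧ ‖z‖ ^ 2 = κ⁻¹) ∨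
      (z.re = s * (2 * κ - 1) / (2 * κ) ∧ ‖z‖ ^ 2 = 1)) := by
  have hTc : ((T : ℂ) - 1) ^ 6 = T ^ 2 * (T + 2) ^ 2 * (4 * T - 1) := by exact_mod_cast hT
  rw [polySix_eq_quad hs] at hz
  have h41 : 0 < 4 * T - 1 := by linarith
  have h41c : 4 * (T : ℂ) - 1 ≠ 0 := by exact_mod_cast h41.ne'
  obtain ⟨y, hy⟩ : ∃ y, y = z ^ 2 - s * z := ⟨_, rfl⟩
  have h0 : ((T : ℂ) ^ 2 * (z ^ 2 - s * z + 1) ^ 3 - (1 - T) ^ 3 * (z ^ 2 - s * z) ^ 2) *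
      ((4 * T - 1) * (T + 2) ^ 2 * (z ^ 2 - s * z + 1) ^ 3 -
        27 * (T - 1) ^ 3 * (z ^ 2 - s * z) ^ 2) = 0 := by
    rw [← hy] at hz ⊢
    linear_combination ((T : ℂ) - 1) ^ 6 * hz - (y + 1) ^ 6 * hTc
  rcases mul_eq_zero.1 h0 with h | h
  · have h4 : 1 / 4 < T := by linarith
    exact ⟨T, h4, Or.inl rfl, re_and_norm_of_cubic hs h4 (by linear_combination h)⟩
  · have h4 : 1 / 4 < (T + 2) / (4 * T - 1) := by rw [lt_div_iff₀ h41]; linarith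
    refine ⟨_, h4, Or.inr rfl, re_and_norm_of_cubic hs h4 ?_⟩
    push_cast
    obtain ⟨d, hd⟩ : ∃ d, d = 4 * (T : ℂ) - 1 := ⟨_, rfl⟩
    rw [← hd] at h41c ⊢
    field_simp
    rw [hd]
    linear_combination h

theorem maximal : (∃! α : ℂ, IsMaximalRoot (polySix s) α) ∧
    ∀ α : ℂ, IsMaximalRoot (polySix s) α → α.re = s / 2 ∧ ‖α‖ ^ 2 = T := by
  have h41 : 0 < 4 * T - 1 := by linarith
  have hinv : T⁻¹ < 1 := inv_lt_one_of_one_lt₀ (by linarith)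
  have hκ : (T + 2) / (4 * T - 1) < T := by rw [div_lt_iff₀ h41]; nlinarith
  have hκ' : ((T + 2) / (4 * T - 1))⁻¹ < T := by
    rw [inv_div, div_lt_iff₀ (by linarith)]; nlinarith
  have hTc : ((T : ℂ) - 1) ^ 6 = T ^ 2 * (T + 2) ^ 2 * (4 * T - 1) := by exact_mod_cast hT
  have hssr : (s : ℝ) ^ 2 = 1 := by rcases hs with rfl | rfl <;> norm_num
  refine existsUnique_isMaximalRoot (by rw [hssr]; linarith) (fun z hz => ?_)
    (fun z hz => ?_) fun z hz _ hn => ?_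
  · push_cast at hz
    rw [polySix_eq_quad hs, show z ^ 2 - (s : ℂ) * z = -T by linear_combination hz]
    linear_combination hTc
  · obtain ⟨κ, -, rfl | rfl, ⟨-, h⟩ | ⟨-, h⟩ | ⟨-, h⟩⟩ := root_cases hs hT1 hT hz <;> linarith
  · obtain ⟨κ, -, rfl | rfl, ⟨h', h⟩ | ⟨-, h⟩ | ⟨-, h⟩⟩ := root_cases hs hT1 hT hz <;>
      first | exact h' | linarith

theorem sum_posLog_of_root {z : ℂ} (hz : aeval z (polySix s) = 0) :
    ∑ i, log⁺ ‖(mats s).ev i z‖ = bound T := by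
  have h41 : 0 < 4 * T - 1 := by linarith
  have h2 : 0 < T + 2 := by linarith
  have hlT : 0 < log T := log_pos (by linarith)
  have hl : log (T + 2) < log (4 * T - 1) := log_lt_log h2 (by linarith)
  obtain ⟨κ, h4, h, hz'⟩ := root_cases hs hT1 hT hz
  rw [sum_posLog_of_cubic hs h4 hz', bound]
  rcases h with rfl | rfl
  · rw [abs_of_pos hlT, log_div h41.ne' h2.ne', abs_of_pos (by linarith)]
    ring
  · rw [show (4 * ((T + 2) / (4 * T - 1)) - 1) / ((T + 2) / (4 * T - 1) + 2) = T⁻¹ by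
      have : T ≠ 0 := by linarith
      have : T + 2 + 2 * (4 * T - 1) ≠ 0 := by linarith
      have := h41.ne'
      field_simp
      ring, log_inv, abs_neg, abs_of_pos hlT, log_div h2.ne' h41.ne', abs_of_neg (by linarith)]
    ring

omit hs in
-- As in the smaller orders, B makes T critical, and the logarithm of the equation for T removes B
-- from the value at T.
theorem min_le {B t : ℝ}
    (hB : B = (2 * T ^ 3 + 6 * T ^ 2 - 9 * T + 1) / (4 * T ^ 3 + 42 * T ^ 2 + 12 * T - 4))
    (ht : 1 < t) :
    bound T ≤ (1 / 2 + 2 * B) * log t + (1 / 2 + B) * log (4 * t - 1) -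
      (1 / 2 - 2 * B) * log (t + 2) - 6 * B * log (t - 1) := by
  have hG : bound T = (1 / 2 + 2 * B) * log T + (1 / 2 + B) * log (4 * T - 1) -
      (1 / 2 - 2 * B) * log (T + 2) - 6 * B * log (T - 1) := by
    have := congrArg log hT
    have h1 : T ^ 2 ≠ 0 := pow_ne_zero _ (by linarith)
    have h2 : (T + 2) ^ 2 ≠ 0 := pow_ne_zero _ (by linarith)
    rw [log_mul (mul_ne_zero h1 h2) (by linarith), log_mul h1 h2, log_pow, log_pow, log_pow] at this
    push_cast at this
    rw [bound]
    linear_combination B * this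
  rw [hG]
  have hden : 0 < 4 * T ^ 3 + 42 * T ^ 2 + 12 * T - 4 := by
    have : 0 < T := by linarith
    have : 0 < 4 * T ^ 3 + 42 * T ^ 2 := by positivity
    linarith
  refine le_of_deriv_sign
    (f := fun t => (1 / 2 + 2 * B) * log t + (1 / 2 + B) * log (4 * t - 1) -
      (1 / 2 - 2 * B) * log (t + 2) - 6 * B * log (t - 1))
    (f' := fun t => (1 / 2 + 2 * B) * t⁻¹ + (1 / 2 + B) * (4 / (4 * t - 1)) -
      (1 / 2 - 2 * B) * (t + 2)⁻¹ - 6 * B * (t - 1)⁻¹) (a := 1) (by linarith) ht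
    (fun y hy => ?_) (fun y hy hyT => ?_) (fun y hyT => ?_)
  · have d1 := hasDerivAt_log (show y ≠ 0 by linarith)
    have d2 := ((hasDerivAt_id' y).sub_const 1).log (show y - 1 ≠ 0 by linarith)
    have d3 := ((hasDerivAt_id' y).add_const 2).log (show y + 2 ≠ 0 by linarith)
    have d4 := (((hasDerivAt_id' y).const_mul 4).sub_const 1).log
      (show 4 * y - 1 ≠ 0 by linarith)
    exact ((((d1.const_mul _).add (d4.const_mul _)).sub (d3.const_mul _)).sub
      (d2.const_mul _)).congr_deriv (by simp)
  all_goals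
    have hy1 : 1 < y := by linarith
    -- The derivative is y − T times a fraction whose numerator is arranged as a sum of terms
    -- visibly positive for y, T > 1.
    have e : (1 / 2 + 2 * B) * y⁻¹ + (1 / 2 + B) * (4 / (4 * y - 1)) -
        (1 / 2 - 2 * B) * (y + 2)⁻¹ - 6 * B * (y - 1)⁻¹ =
        (y - T) * ((12 * (y ^ 2 * (T ^ 2 - 1)) + 12 * (T ^ 2 * (y ^ 2 - 1)) + 36 * y ^ 2 * T ^ 2 +
          60 * y * T * (y + T) + 306 * y * T + 66 * (y * (T - 1)) + 66 * (T * (y - 1)) + 24) /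
          ((4 * T ^ 3 + 42 * T ^ 2 + 12 * T - 4) * (y * (4 * y - 1) * (y + 2) * (y - 1)))) := by
      obtain ⟨q, hq⟩ : ∃ q, q = 4 * T ^ 3 + 42 * T ^ 2 + 12 * T - 4 := ⟨_, rfl⟩
      rw [hB, ← hq]
      have : q ≠ 0 := by rw [hq]; exact hden.ne'
      have : y - 1 ≠ 0 := by linarith
      have : y ≠ 0 := by linarith
      have : y + 2 ≠ 0 := by linarith
      obtain ⟨r, hr⟩ : ∃ r, r = 4 * y - 1 := ⟨_, rfl⟩
      have : r ≠ 0 := by rw [hr]; linarith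
      rw [← hr]
      field_simp
      rw [hq, hr]
      ring
    have hp : 0 ≤ (12 * (y ^ 2 * (T ^ 2 - 1)) + 12 * (T ^ 2 * (y ^ 2 - 1)) + 36 * y ^ 2 * T ^ 2 +
          60 * y * T * (y + T) + 306 * y * T + 66 * (y * (T - 1)) + 66 * (T * (y - 1)) + 24) /
          ((4 * T ^ 3 + 42 * T ^ 2 + 12 * T - 4) * (y * (4 * y - 1) * (y + 2) * (y - 1))) := by
      have : 0 < y - 1 := by linarith
      have : 0 < T - 1 := by linarith
      have : 0 < T := by linarith
      have : 0 < 4 * y - 1 := by linarith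
      have : 0 < y ^ 2 - 1 := by nlinarith
      have : 0 < T ^ 2 - 1 := by nlinarith
      positivity
    simp only [e]
  · exact mul_nonpos_of_nonpos_of_nonneg (by linarith) hp
  · exact mul_nonneg (by linarith) hp

theorem circle_le {B : ℝ}
    (hB : B = (2 * T ^ 3 + 6 * T ^ 2 - 9 * T + 1) / (4 * T ^ 3 + 42 * T ^ 2 + 12 * T - 4)) {z : ℂ}
    (hz : ‖z‖ = 1) (hoff : ∀ i, (mats s).den i z ≠ 0) (hN : z ^ 2 - s * z + 1 ≠ 0) :
    bound T ≤ (mats s).defect ![B] ![N s] ![M s] z := by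
  obtain ⟨h1, h2, h3, h4, h5⟩ := (off_iff z).1 hoff
  rw [← norm_pos_iff, norm_den_one hs] at h1
  rw [← norm_pos_iff, norm_den_three hs] at h3
  rw [← norm_pos_iff, norm_mul_sub_one hs] at h4
  have hQ := norm_pos_iff.2 hN
  rw [norm_quad_eq hs hz] at hQ
  obtain ⟨e1, e2, e3, e4⟩ := sq_norms hs z
  have hpw : ‖z - 2 * s‖ = ‖2 * z - s‖ := by
    rw [← pow_left_inj₀ (norm_nonneg _) (norm_nonneg _) two_ne_zero, e2, e4, hz]; ring
  rw [defect_eq hs hoff hN, hz, hpw, posLog_one, log_one, div_one, norm_quad_eq hs hz,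
    div_self h3.ne', posLog_one]
  have a1 := posLog_add_posLog_inv ‖z - s‖
  have a2 := posLog_add_posLog_inv (‖2 * z - s‖ / ‖z + s‖)
  rw [inv_div, log_div h3.ne' h1.ne'] at a2
  set x := ‖z - s‖ ^ 2 with hx
  have hp : ‖2 * z - s‖ ^ 2 = 1 + 2 * x := by rw [e2, e1, hz]; ring
  have hq : ‖z + s‖ ^ 2 = 4 - x := by rw [e3, e1, hz]; ring
  have hl : ∀ a b : ℝ, a ^ 2 = b → log a = log b / 2 := fun a b h => by
    rw [← h, log_pow]; push_cast; ring
  have hx0 : 0 < x := by positivity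
  have hx4 : 0 < 4 - x := by rw [← hq]; positivity
  rw [hl _ _ hx.symm] at a1 ⊢
  rw [hl _ _ hp, hl _ _ hq] at a2 ⊢
  rcases lt_trichotomy x 1 with h | h | h
  · have h6 := min_le hT1 hT hB ((one_lt_inv₀ hx0).2 h)
    have h7 : log x < 0 := log_neg hx0 h
    have h8 : log (1 + 2 * x) < log (4 - x) := log_lt_log (by linarith) (by linarith)
    rw [show 4 * x⁻¹ - 1 = (4 - x) / x by field_simp,
      show x⁻¹ + 2 = (1 + 2 * x) / x by field_simp, show x⁻¹ - 1 = (1 - x) / x by field_simp,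
      log_div hx4.ne' hx0.ne', log_div (by linarith) hx0.ne', log_div (by linarith) hx0.ne',
      log_inv] at h6
    rw [abs_of_neg (by linarith)] at a1 a2
    rw [abs_of_pos (by linarith)]
    linarith
  · rw [h] at hQ; norm_num at hQ
  -- The map σ³ preserves the circle and sends x = |z − s|² to (4 − x)/(1 + 2x), which exchanges the
  -- two sides of x = 1. So t is the reciprocal of the image of x, as it was 1/x on the other side.
  · have h6 := min_le hT1 hT hB (t := (1 + 2 * x) / (4 - x)) (by rw [one_lt_div hx4]; linarith)
    have h7 : 0 < log x := log_pos h
    have h8 : log (4 - x) < log (1 + 2 * x) := log_lt_log hx4 (by linarith)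
    have h9 : (9 : ℝ) = 3 ^ 2 := by norm_num
    rw [show 4 * ((1 + 2 * x) / (4 - x)) - 1 = 9 * x / (4 - x) by field_simp; ring,
      show (1 + 2 * x) / (4 - x) + 2 = 9 / (4 - x) by field_simp; ring,
      show (1 + 2 * x) / (4 - x) - 1 = 3 * (x - 1) / (4 - x) by field_simp; ring,
      log_div (by linarith) hx4.ne', log_div (by linarith) hx4.ne', log_div (by linarith) hx4.ne',
      log_div (by linarith) hx4.ne', log_mul (by norm_num) hx0.ne',
      log_mul (by norm_num) (by linarith), h9, log_pow] at h6
    rw [abs_of_pos (by linarith)] at a1 a2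
    rw [abs_of_neg (by linarith), neg_sub]
    push_cast at h6
    linarith

end

end OrderSix
end OrbitHeight

/-! ### Order six: the bounds, their sharpness and the exceptional orbit of ∞. -/

namespace OrbitHeight
open Polynomial Real Matrix

namespace OrderSix

theorem parameter_bounds {T B : ℝ} (hT1 : 10.2852 < T) (hT2 : T < 10.2861)
    (hB : B = (2 * T ^ 3 + 6 * T ^ 2 - 9 * T + 1) / (4 * T ^ 3 + 42 * T ^ 2 + 12 * T - 4)) :
    0.30503 ≤ B ∧ B < 0.30504 := by
  obtain ⟨u, rfl⟩ : ∃ u, T = 10.2852 + u := ⟨T - 10.2852, by ring⟩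
  have h0 : 0 < u := by linarith
  have h1 : u < 0.0009 := by linarith
  have h2 : u ^ 2 < 0.0009 ^ 2 := pow_lt_pow_left₀ h1 h0.le two_ne_zero
  have h3 : u ^ 3 < 0.0009 ^ 3 := pow_lt_pow_left₀ h1 h0.le three_ne_zero
  have h2' : 0 < u ^ 2 := by positivity
  have h3' : 0 < u ^ 3 := by positivity
  have hd : 0 < 4 * (10.2852 + u) ^ 3 + 42 * (10.2852 + u) ^ 2 + 12 * (10.2852 + u) - 4 := by
    ring_nf; linarith
  rw [hB, le_div_iff₀ hd, div_lt_iff₀ hd]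
  constructor <;> ring_nf <;> linarith

variable {s : ℤ}

theorem growth (hs : s = 1 ∨ s = -1) {B : ℝ} (hB : 0 < B) (hB' : B < 1 / 2) (D' : ℝ) :
    ∃ R : ℝ, ∀ z : ℂ, R < ‖z‖ → z ∈ MatrixSeq.regular (mats s) ![N s] →
      D' ≤ (mats s).defect ![B] ![N s] ![M s] z := by
  -- The orbit function has degree 12 − 10 = 2 at ∞, and the five linear factors in its denominator
  -- are each at least |z|/2 in norm for |z| > 4.
  refine exists_radius_of_growth (δ := 1 - 2 * B) (c := 6 * B * log 3 + 8 * B * log 2) (R₀ := 4)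
    (by linarith) (fun z hr hz => ?_) D'
  have hN : z ^ 2 - s * z + 1 ≠ 0 := by simpa [aeval_N] using hr.2 0
  have hz0 : 0 < ‖z‖ := by linarith
  rw [defect_eq hs hr.1 hN, posLog_eq_log (by rw [abs_norm]; linarith)]
  have e1 : log ‖z ^ 2 - s * z + 1‖ ≤ log 3 + 2 * log ‖z‖ := by
    refine (log_le_log (norm_pos_iff.2 hN) (norm_quad_le hs (by linarith))).trans ?_
    rw [log_mul (by norm_num) (by positivity), log_pow]; norm_num
  have key : ∀ r, ‖z‖ / 2 ≤ r → B * (log ‖z‖ - log 2) ≤ B * log r := fun r h => by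
    refine mul_le_mul_of_nonneg_left ?_ hB.le
    rw [← log_div (by positivity) (by norm_num)]
    exact log_le_log (by positivity) h
  have n1 : ‖(s : ℂ)‖ = 1 := norm_sign hs
  have n2 : ‖2 * (s : ℂ)‖ = 2 := by rw [norm_mul, n1]; norm_num
  have n3 : ‖2 * z‖ = 2 * ‖z‖ := by rw [norm_mul]; norm_num
  have e2 := key _ (half_norm_le hs (by linarith : 2 ≤ ‖z‖))
  have e3 := key ‖z + s‖ (by
    have := norm_sub_le (z + s) s
    rw [add_sub_cancel_right] at this; linarith)
  have e4 := key ‖2 * z - s‖ (by have := norm_sub_norm_le (2 * z) s; linarith)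
  have e5 := key ‖z - 2 * s‖ (by have := norm_sub_norm_le z (2 * s); linarith)
  have p1 : 0 ≤ log⁺ (‖2 * z - s‖ / ‖z + s‖) := posLog_nonneg
  have p2 : 0 ≤ log⁺ (‖z - s‖ / ‖z‖) := posLog_nonneg
  have p3 : 0 ≤ log⁺ (‖z - 2 * s‖ / ‖2 * z - s‖) := posLog_nonneg
  have p4 : 0 ≤ log⁺ ‖z - s‖⁻¹ := posLog_nonneg
  have p5 : 0 ≤ log⁺ (‖z + s‖ / ‖z - 2 * s‖) := posLog_nonneg
  have e6 := mul_le_mul_of_nonneg_left e1 hB.le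
  linarith

theorem bounds (hs : s = 1 ∨ s = -1) {σ : PGL(2, ℚ)} (hrep : (mats s).Represents σ) {T B : ℝ}
    (hT1 : 10.2852 < T) (hT2 : T < 10.2861)
    (hT : (T - 1) ^ 6 = T ^ 2 * (T + 2) ^ 2 * (4 * T - 1))
    (hB : B = (2 * T ^ 3 + 6 * T ^ 2 - 9 * T + 1) / (4 * T ^ 3 + 42 * T ^ 2 + 12 * T - 4))
    {a : ℂ} (ha : a ^ 2 - s * a + 1 = 0) :
    OrbitInequality σ ![{a}] ![B] (bound T) ∧
      IsHeightBound σ (algNumbersOffInfty σ) (bound T) := by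
  obtain ⟨hB1, hB2⟩ := parameter_bounds hT1 hT2 hB
  refine hrep.bounds (N := ![N s]) (M := ![M s]) (fun j => ?_) (fun j => ?_)
    (fun z hz hr => circle_le hs hT1 hT hB hz hr.1 (by simpa [aeval_N] using hr.2 0))
    (fun D' _ => growth hs (by linarith) (by linarith) D') ![2] (fun j => ?_)
    (by simp; linarith) (fun j z hj => ?_)
  · fin_cases j; exact quot hs ha
  · fin_cases j; simp; linarith
  · fin_cases j; exact nonarchBound hs
  · fin_cases j
    have h1 : z ^ 2 - s * z + 1 = 0 := by simpa [aeval_N] using hj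
    exact Or.inr (pow_twelve_of_quadratic hs h1)

/-- In the orbit of ∞, which contains 0, only 2s and s/2 have positive height, namely log 2 each. -/
theorem orbitHeight_coe_zero (hs : s = 1 ∨ s = -1) {σ : PGL(2, ℚ)}
    (hrep : (mats s).Represents σ) :
    orbitHeight (Subgroup.zpowers σ) ((0 : ℂ) : OnePoint ℂ) = log 4 := by
  have hh : ∀ z : ℂ, z = 0 ∨ z ^ 2 = 1 → weilHeight (z : OnePoint ℂ) = 0 := fun z hz =>
    absLogHeight_eq_zero two_ne_zero hz
  have h2 : ∀ (A B : ℤ) (z : ℂ), B ≠ 0 → IsCoprime A B → max |(A : ℝ)| |(B : ℝ)| = 2 → z = A / B →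
      weilHeight (z : OnePoint ℂ) = log 2 := fun A B z hB h hm hz => by
    rw [MatrixSeq.Represents.weilHeight_coe, hz, absLogHeight_ratio hB h, hm]
  rw [hrep.orbitHeight_eq, Fin.sum_univ_six]
  simp only [hrep.smul_coe, den_zero, den_one, den_two, den_three, den_four, den_five, ev_zero,
    ev_one, ev_three, ev_four, ev_five]
  rw [if_neg (by norm_num), if_neg (by norm_num), if_pos (by norm_num), if_neg (by norm_num),
    if_neg (by norm_num), if_neg (by norm_num), MatrixSeq.Represents.weilHeight_infty, hh 0 (Or.inl rfl),
    hh ((2 * 0 - s) / (s * 0 + 1)) (Or.inr (by rcases hs with rfl | rfl <;> norm_num)),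
    hh (-s / (s * 0 - 1)) (Or.inr (by rcases hs with rfl | rfl <;> norm_num)),
    h2 (2 * s) 1 ((0 - 2 * s) / (2 * s * 0 - 1)) one_ne_zero isCoprime_one_right
      (by rcases hs with rfl | rfl <;> norm_num) (by push_cast; ring),
    h2 s 2 ((-0 - s) / (s * 0 - 2)) two_ne_zero
      (by rcases hs with rfl | rfl <;> norm_num) (by rcases hs with rfl | rfl <;> norm_num)
      (by push_cast; ring),
    show (4 : ℝ) = 2 ^ 2 by norm_num, log_pow]
  push_cast
  ring

theorem orbitHeight_infty (hs : s = 1 ∨ s = -1) {σ : PGL(2, ℚ)}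
    (hrep : (mats s).Represents σ) : orbitHeight (Subgroup.zpowers σ) ∞ = log 4 := by
  have h1 := orbitHeight_smul (σ ^ 2) (pow_mem (Subgroup.mem_zpowers σ) 2) ((0 : ℂ) : OnePoint ℂ)
  have h2 := hrep.smul_coe 2 0
  rw [if_pos (by simp)] at h2
  rw [show σ ^ 2 • ((0 : ℂ) : OnePoint ℂ) = ∞ from h2] at h1
  rw [h1, orbitHeight_coe_zero hs hrep]

theorem orbitHeight_of_not_off (hs : s = 1 ∨ s = -1) {σ : PGL(2, ℚ)}
    (hrep : (mats s).Represents σ) {α : ℂ} (hα : ∃ i, (mats s).den i α = 0) :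
    orbitHeight (Subgroup.zpowers σ) (α : OnePoint ℂ) = log 4 := by
  obtain ⟨i, hi⟩ := hα
  rw [← orbitHeight_smul (σ ^ (i : ℕ)) (pow_mem (Subgroup.mem_zpowers σ) _), hrep.smul_coe,
    if_pos hi, orbitHeight_infty hs hrep]

theorem log_four_lt_bound {T : ℝ} (hT1 : 10.2852 < T) : log 4 < bound T := by
  have h1 : log (16 * (T + 2)) < log (T * (4 * T - 1)) := log_lt_log (by linarith) (by nlinarith)
  rw [log_mul (by norm_num) (by linarith), log_mul (by linarith) (by linarith),
    show (16 : ℝ) = 4 ^ 2 by norm_num, log_pow] at h1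
  push_cast at h1
  rw [bound]
  linarith

/-- On the line Re z = s/2 one has |α − s| = |α| and |α + s| = |α − 2s|. For this T only α and σα
have modulus greater than 1, and the expression is their product up to sign. -/
theorem log_norm_eq_bound (hs : s = 1 ∨ s = -1) {T : ℝ} (hT1 : 10.2852 < T) {α : ℂ}
    (hre : α.re = s / 2) (hn : ‖α‖ ^ 2 = T) :
    log ‖α * (2 * α - s) / (α + s)‖ = bound T := by
  have hssr : (s : ℝ) ^ 2 = 1 := by rcases hs with rfl | rfl <;> norm_num
  obtain ⟨-, h2, h3, -⟩ := sq_norms hs α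
  have e : s * α.re = 1 / 2 := by rw [hre]; linear_combination hssr / 2
  have h : ‖α * (2 * α - s) / (α + s)‖ ^ 2 = T * (4 * T - 1) / (T + 2) := by
    rw [norm_div, norm_mul, div_pow, mul_pow, h2, h3, hn, e]
    ring
  have h' := congrArg log h
  rw [log_pow, log_div (mul_ne_zero (by linarith) (by linarith)) (by linarith),
    log_mul (by linarith) (by linarith)] at h'
  push_cast at h'
  rw [bound]
  linarith

end OrderSix

theorem order_six {s : ℤ} (hs : s = 1 ∨ s = -1) (σ : PGL(2, ℚ)) {hdet}
    (hσ : σ = moebius 2 (-s) s 1 hdet) :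
    HasOrbits σ 6 ![{omega s 1}, {omega s (-1)}] ∧ (∃! α : ℂ, IsMaximalRoot (polySix s) α) ∧
      (∀ α : ℂ, IsMaximalRoot (polySix s) α →
        ∀ D : ℝ, D = Real.log ‖α * (2 * α - s) / (α + s)‖ →
        Real.log 4 < D ∧
        (∃ B : ℝ, 0.30503 ≤ B ∧ B < 0.30504 ∧ OrbitInequality σ ![{omega s 1}] ![B] D ∧
          OrbitInequality σ ![{omega s (-1)}] ![B] D) ∧
        IsHeightBound σ (algNumbersOffInfty σ) D ∧
        AttainsBound σ (algNumbersOffInfty σ) D α) ∧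
      (∀ τ ∈ Subgroup.zpowers σ,
        orbitHeight (Subgroup.zpowers σ) (τ • (∞ : OnePoint ℂ)) = Real.log 4) ∧
      IsOptimalConstant σ algNumbers (Real.log 4) := by
  have hrep := OrderSix.represents hs hσ
  obtain ⟨T, hT1, hT2, hT⟩ := OrderSix.exists_parameter
  obtain ⟨hu, hm⟩ := OrderSix.maximal hs hT1 hT
  have hI := omega_quadratic (s := s) (t := 1) (sign_mul_self hs) (by norm_num)
  have hI' := omega_quadratic (s := s) (t := -1) (sign_mul_self hs) (by norm_num)
  obtain ⟨hB1, hB2⟩ := OrderSix.parameter_bounds hT1 hT2 rfl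
  have hb := OrderSix.bounds hs hrep hT1 hT2 hT rfl hI
  have hb' := OrderSix.bounds hs hrep hT1 hT2 hT rfl hI'
  have hlt := OrderSix.log_four_lt_bound hT1
  refine ⟨hrep.hasOrbits ⟨1, ?_⟩ fun j => ?_, hu, fun α hα D hD => ?_, fun τ hτ => ?_,
    ⟨log_pos (by norm_num), ?_⟩, fun D' hD' => ?_⟩
  · rcases hs with rfl | rfl <;> simp [OrderSix.mats]
  · have key : ∀ a : ℂ, a ^ 2 - s * a + 1 = 0 → (∀ z ∈ ({a} : Set ℂ), z = 0 ∨ ‖z‖ = 1) ∧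
        ∃ x : ℂ, (∀ i, (OrderSix.mats s).den i x ≠ 0) ∧
          ({a} : Set ℂ) = Set.range fun i => (OrderSix.mats s).ev i x := fun a ha => by
      have hoff : ∀ i, (OrderSix.mats s).den i a ≠ 0 := (OrderSix.off_iff a).2 <| by
        have hM := OrderSix.aeval_M_of_quad_eq_zero hs ha
        rw [OrderSix.aeval_M, OrderSix.den_prod_eq a hs] at hM
        have h0 : (s * a + 1) * (s * a) * (2 * s * a - 1) * (s * a - 1) * (s * a - 2) ≠ 0 :=
          fun h => by rw [h] at hM; norm_num at hM
        simp only [mul_ne_zero_iff, and_assoc] at h0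
        simp only [ne_eq, mul_eq_zero, not_or]; tauto
      have hev : ∀ i, (OrderSix.mats s).ev i a = a := by
        rw [OrderSix.forall_fin_six]
        obtain ⟨h1, h2, h3, h4, h5⟩ := (OrderSix.off_iff a).1 hoff
        rw [OrderSix.ev_zero, OrderSix.ev_one, OrderSix.ev_two, OrderSix.ev_three,
          OrderSix.ev_four, OrderSix.ev_five, div_eq_iff h1, div_eq_iff h2, div_eq_iff h3,
          div_eq_iff h4, div_eq_iff h5]
        refine ⟨rfl, ?_, ?_, ?_, ?_, ?_⟩ <;> rcases hs with rfl | rfl <;> push_cast at ha ⊢ <;>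
          first | linear_combination ha | linear_combination -ha | linear_combination 2 * ha |
            linear_combination -2 * ha
      refine ⟨fun z hz => Or.inr ?_, a, hoff, ?_⟩
      · rw [Set.mem_singleton_iff.1 hz]
        exact norm_of_quadratic hs ha
      · simp_rw [hev]
        exact Set.range_const.symm
    fin_cases j
    · exact key _ hI
    · exact key _ hI'
  · have hD' : D = OrderSix.bound T := by
      rw [hD, OrderSix.log_norm_eq_bound hs hT1 (hm α hα).1 (hm α hα).2]
    rw [hD']
    exact ⟨hlt, ⟨_, hB1, hB2, hb.1, hb'.1⟩, hb.2, attainsBound_of_eq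
      ⟨isAlgebraic_of_aeval_intPoly OrderSix.polySix_monic.ne_zero hα.1,
        (hrep.off_infty_iff α).2 fun i => (OrderSix.polySix_ev hs α hα.1 i).1⟩
      (hrep.orbitHeight_eq_of_integral OrderSix.polySix_monic
        (fun x hx i => OrderSix.polySix_ev hs x hx i)
        (fun z hz => OrderSix.sum_posLog_of_root hs hT1 hT hz) hα.1) hb.2⟩
  · rw [orbitHeight_smul τ hτ, OrderSix.orbitHeight_infty hs hrep]
  -- Off the orbit of ∞ the larger constant D already applies; on it the height is exactly log 4,
  -- attained at 0.
  · exact hrep.isHeightBound_algNumbers (fun β hβ => (hb.2 β hβ).imp_right hlt.le.trans)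
      fun β hβ => Or.inr (OrderSix.orbitHeight_of_not_off hs hrep hβ).ge
  · have h0 := OrderSix.orbitHeight_coe_zero hs hrep
    rcases hD'.2 0 isAlgebraic_zero with h | h
    · exact absurd (h0.symm.trans h) (log_pos (by norm_num)).ne'
    · rwa [h0] at h

end OrbitHeight

open OrbitHeight in
theorem mainTheorem6 :
    -- the parametrised groups of order two: `p / q` in lowest terms, `s = ±1`
    (∀ p q s : ℤ, 0 < q → IsCoprime p q → (s = 1 ∨ s = -1) →
      -- orbit `{0}`
      (p ≠ 0 → ∀ (hdet : (1 : ℚ) * (-1) - 0 * ((p : ℚ) / q) ≠ 0) (σ : PGL(2, ℚ)) (D : ℝ),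
        σ = moebius 1 0 ((p : ℚ) / q) (-1) hdet →
        D = Real.log (max |(|(p : ℝ)| - q)| |(q : ℝ)|) →
        HasOrbits σ 2 ![{0}] ∧ OrbitInequality σ ![{0}] ![1] D ∧
        IsHeightBound σ algNumbers D ∧
        (0 < p → AttainsBound σ algNumbers D 1) ∧
        (p < 0 → AttainsBound σ algNumbers D (-1))) ∧
      -- orbit `{0, -s}`
      (∀ (hdet : (1 : ℚ) * (-1) - (s : ℚ) * ((p : ℚ) / q) ≠ 0) (σ : PGL(2, ℚ)) (D : ℝ),
        σ = moebius 1 s ((p : ℚ) / q) (-1) hdet →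
        D = Real.log (max (|(p : ℝ) - s * q| / 2) |(q : ℝ)|) →
        HasOrbits σ 2 ![{0, -(s : ℂ)}] ∧ OrbitInequality σ ![{0, -(s : ℂ)}] ![1] D ∧
        IsHeightBound σ algNumbers D ∧
        (2 ∣ p - s * q → AttainsBound σ algNumbers D s)) ∧
      -- orbit `{s}`
      (∀ (hdet : (1 : ℚ) * (-1) - ((p : ℚ) / q) * ((p : ℚ) / q + 2 * s) ≠ 0)
          (σ : PGL(2, ℚ)) (D : ℝ),
        σ = moebius 1 ((p : ℚ) / q) ((p : ℚ) / q + 2 * s) (-1) hdet →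
        D = Real.log (max (|(p : ℝ) + 3 * s * q| / 4) (|(p : ℝ) - s * q| / 4)) →
        HasOrbits σ 2 ![{(s : ℂ)}] ∧ OrbitInequality σ ![{(s : ℂ)}] ![1] D ∧
        IsHeightBound σ algNumbers D ∧
        (4 ∣ p - s * q → AttainsBound σ algNumbers D (-s))) ∧
      -- orbit `{i, -i}`
      (p ≠ 0 → ∀ (hdet : (1 : ℚ) * (-1) - ((p : ℚ) / q) * ((p : ℚ) / q) ≠ 0)
          (σ : PGL(2, ℚ)) (D : ℝ),
        σ = moebius 1 ((p : ℚ) / q) ((p : ℚ) / q) (-1) hdet →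
        D = Real.log (|(|(p : ℝ)| + q)| / 2) →
        HasOrbits σ 2 ![{Complex.I, -Complex.I}] ∧
        OrbitInequality σ ![{Complex.I, -Complex.I}] ![1 / 2] D ∧
        IsHeightBound σ algNumbers D ∧
        (2 ∣ p + q → AttainsBound σ algNumbers D 1 ∧ AttainsBound σ algNumbers D (-1))) ∧
      -- orbit of the two roots of `z² - s z + 1`
      ((p : ℚ) / q ≠ -s / 2 →
        ∀ (hdet : (1 : ℚ) * (-1) - ((p : ℚ) / q) * ((p : ℚ) / q + s) ≠ 0)
          (σ : PGL(2, ℚ)) (D : ℝ),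
        σ = moebius 1 ((p : ℚ) / q) ((p : ℚ) / q + s) (-1) hdet →
        D = Real.log (max (|(p : ℝ) + 2 * s * q| / 3) (|(p : ℝ) - s * q| / 3)) →
        HasOrbits σ 2 ![{omega s 1, omega s (-1)}] ∧
        OrbitInequality σ ![{omega s 1, omega s (-1)}] ![1 / 2] D ∧
        IsHeightBound σ algNumbers D ∧
        (3 ∣ p - s * q → AttainsBound σ algNumbers D (-s)))) ∧
    -- order three, orbit `{0, -1, 1}`
    (∀ σ : PGL(2, ℚ), σ = moebius 1 (-1) 3 1 (by norm_num) →
      HasOrbits σ 3 ![{0, -1, 1}] ∧ OrbitInequality σ ![{0, -1, 1}] ![1] (Real.log 5) ∧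
      IsHeightBound σ algNumbers (Real.log 5) ∧
      AttainsBound σ algNumbers (Real.log 5) Complex.I) ∧
    -- order four
    (∀ σ : PGL(2, ℚ), σ = moebius 1 1 (-1) 1 (by norm_num) →
      HasOrbits σ 4 ![{Complex.I}, {-Complex.I}] ∧
      (∃! α : ℂ, IsMaximalRoot polyFour α) ∧
      ∀ α : ℂ, IsMaximalRoot polyFour α → ∀ D : ℝ, D = Real.log ‖α‖ →
        0 < D ∧
        (∃ B : ℝ, 0.19408 ≤ B ∧ B < 0.19409 ∧ OrbitInequality σ ![{Complex.I}] ![B] D ∧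
          OrbitInequality σ ![{-Complex.I}] ![B] D) ∧
        IsHeightBound σ algNumbers D ∧ AttainsBound σ algNumbers D α) ∧
    -- order three and order six, orbits `{ω}` for the two roots `ω` of `z² - s z + 1`
    (∀ s : ℤ, (s = 1 ∨ s = -1) →
      (∀ σ : PGL(2, ℚ), σ = moebius 0 1 (-1) s (by norm_num) →
        HasOrbits σ 3 ![{omega s 1}, {omega s (-1)}] ∧
        (∃! α : ℂ, IsMaximalRoot (polyThree s) α) ∧
        ∀ α : ℂ, IsMaximalRoot (polyThree s) α → ∀ D : ℝ, D = Real.log ‖α‖ →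
          0 < D ∧
          (∃ B : ℝ, 0.11724 ≤ B ∧ B < 0.11725 ∧ OrbitInequality σ ![{omega s 1}] ![B] D ∧
            OrbitInequality σ ![{omega s (-1)}] ![B] D) ∧
          IsHeightBound σ algNumbers D ∧ AttainsBound σ algNumbers D α) ∧
      -- here the orbit of `∞` has height `log 4 < D`, and is exceptional
      (∀ (hdet : (2 : ℚ) * 1 - (-s) * s ≠ 0) (σ : PGL(2, ℚ)), σ = moebius 2 (-s) s 1 hdet →
        HasOrbits σ 6 ![{omega s 1}, {omega s (-1)}] ∧
        (∃! α : ℂ, IsMaximalRoot (polySix s) α) ∧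
        (∀ α : ℂ, IsMaximalRoot (polySix s) α →
          ∀ D : ℝ, D = Real.log ‖α * (2 * α - s) / (α + s)‖ →
          Real.log 4 < D ∧
          (∃ B : ℝ, 0.30503 ≤ B ∧ B < 0.30504 ∧ OrbitInequality σ ![{omega s 1}] ![B] D ∧
            OrbitInequality σ ![{omega s (-1)}] ![B] D) ∧
          IsHeightBound σ (algNumbersOffInfty σ) D ∧
          AttainsBound σ (algNumbersOffInfty σ) D α) ∧
        (∀ τ ∈ Subgroup.zpowers σ,
          orbitHeight (Subgroup.zpowers σ) (τ • (∞ : OnePoint ℂ)) = Real.log 4) ∧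
        IsOptimalConstant σ algNumbers (Real.log 4))) ∧
    -- groups of order two with two orbits
    (∀ s : ℤ, (s = 1 ∨ s = -1) →
      (∀ σ : PGL(2, ℚ), σ = moebius 1 0 s (-1) (by norm_num) →
        ∀ D : ℝ, D = Real.log (Real.sqrt ((1 + Real.sqrt 5) / 2)) →
        HasOrbits σ 2 ![{0}, {omega s 1, omega s (-1)}] ∧
        OrbitInequality σ ![{0}, {omega s 1, omega s (-1)}]
          ![1 / 2, 1 / (4 * Real.sqrt 5)] D ∧
        0 < D ∧ IsHeightBound σ algNumbers D ∧
        AttainsBound σ algNumbers D (-s * Complex.exp (2 * Real.pi * Complex.I / 5))) ∧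
      (∀ σ : PGL(2, ℚ), σ = moebius 1 0 (2 * s) (-1) (by norm_num) →
        ∀ D : ℝ, D = Real.log (Real.sqrt 3) →
        HasOrbits σ 2 ![{0}, {(s : ℂ)}] ∧
        OrbitInequality σ ![{0}, {(s : ℂ)}] ![2 / 3, 1 / 3] D ∧
        0 < D ∧ IsHeightBound σ algNumbers D ∧
        AttainsBound σ algNumbers D (omega s 1)) ∧
      (∀ σ : PGL(2, ℚ), σ = moebius 1 (-s) 0 (-1) (by norm_num) →
        ∀ D : ℝ, D = Real.log (Real.sqrt ((1 + Real.sqrt 5) / 2)) →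
        HasOrbits σ 2 ![{0, (s : ℂ)}, {omega s 1, omega s (-1)}] ∧
        OrbitInequality σ ![{0, (s : ℂ)}, {omega s 1, omega s (-1)}]
          ![(Real.sqrt 5 - 1) / (2 * Real.sqrt 5), 1 / (4 * Real.sqrt 5)] D ∧
        0 < D ∧ IsHeightBound σ algNumbers D ∧
        AttainsBound σ algNumbers D (s * Complex.exp (Real.pi * Complex.I / 5)))) := by
  refine ⟨fun p q s hq hpq hs => ⟨parametrised_zero hq hpq, parametrised_zero_neg hq hpq hs,
    parametrised_fixed hq hpq hs, parametrised_I hq hpq, parametrised_omega hq hpq hs⟩,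
    fun σ hσ => order_three_zero σ hσ, fun σ hσ => order_four σ hσ,
    fun s hs => ⟨fun σ hσ => order_three_omega hs σ hσ, fun _ σ hσ => order_six hs σ hσ⟩,
    fun s hs => ⟨fun σ hσ D hD => order_two_zero_omega hs σ hσ D hD,
      fun σ hσ D hD => order_two_zero_sign hs σ hσ D hD,
      fun σ hσ D hD => order_two_zero_sign_omega hs σ hσ D hD⟩⟩
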